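/- Let $\mathbb K$ be a field of characteristic $0$, $k\ge 0$ and $n\in\mathbb Z$. **Graphs.** A $k$-oriented graph is a connected multigraph without tadpoles with vertices $0,\dots,v-1$ ($v\ge1$), labelled edges $1,\dots,e$, an intrinsic orientation of every edge, and, for each colour $c\in\{1,\dots,k\}$, an orientation of every edge such that there is no directed cycle in the colour $c$. A vertex is *passing* if it is 2-valent and, in every colour, the head of one edge and the tail of the other. **The complex $\mathrm O_k\mathrm{GC}_n$.** It is spanned by the $k$-oriented graphs with all vertices at least 2-valent, at least one vertex at least 3-valent and no passing vertex, in degree $(v-1)n+(1-n)e$, modulo relabelling with signs: for $n$ even, permuting edges gives the sign of the permutation, while permuting vertices and reversing intrinsic orientations give no sign; for $n$ odd, permuting vertices gives the sign of the permutation and reversing an intrinsic orientation gives $-1$, while permuting edges gives no sign. The differential $\delta$, of degree $-1$, is the sum over all edges $t$ of the contraction of $t$, where $t$ and its head are first made the last edge and the last vertex (with the corresponding sign), and the head is then identified with the tail; a result that is not one of the spanning graphs is $0$. **The complex $\mathrm O_{k+1}\mathrm{sGC}_{m}$.** In $\mathrm O_{k+1}\mathrm{GC}_m$ take the orientation in the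 colour $k+1$, drawn below as an arrow, as intrinsic orientation. A 2-valent vertex is *weakly passing* if it is passing with respect to the colours $1,\dots,k$ but not in the colour $k+1$. A *skeleton edge* is a maximal path whose interior vertices are weakly passing. Put $$ (x\cdots\!\!>y):=\tfrac12\big((x\to z\leftarrow y)-(x\leftarrow z\to y)\big) $$ for the *dotted* edge, where $z$ is weakly passing, comes after all non-middle vertices, and the edge at $x$ and the edge at $y$ are consecutive, in this order, after all other edges. As a graded space $\mathrm O_{k+1}\mathrm{sGC}_m'$ is spanned by the graphs whose skeleton edges are solid (a single edge) or dotted; as a complex it is the quotient of $\mathrm O_{k+1}\mathrm{GC}_m$ by the subcomplex spanned by graphs having a skeleton edge with at least three edges or a skeleton edge $(x\to z\leftarrow y)+(x\leftarrow z\to y)$. Thus the differential contracts solid edges and maps $(x\cdots\!\!>y)\mapsto (x\to y)-(-1)^m(y\to x)$; if the contraction of a solid edge produces a weakly passing vertex $z$, then $x\to z\leftarrow y$ is read as $(x\cdots\!\!>y)$, $x\leftarrow z\to y$ as $-(x\cdots\!\!>y)$ (with the above order of vertices and edges), and the result is $0$ if one of the two skeleton edges that meet at $z$ is dotted. For $m$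 even, $\mathrm O_{k+1}\mathrm{sGC}_m:=\mathrm O_{k+1}\mathrm{sGC}_m'$. For $m$ odd, $\mathrm O_{k+1}\mathrm{sGC}_m$ is the quotient of $\mathrm O_{k+1}\mathrm{sGC}_m'$ in which graphs whose skeleton (with solid or dotted edges) has a tadpole or a multiple edge are $0$. **The map $h$.** For a graph $\Gamma$ in $\mathrm O_k\mathrm{GC}_n$, a vertex $x$ and a spanning tree $\tau$ of $\Gamma$, let $h_{x,\tau}(\Gamma)$ be obtained by making each edge of $\tau$ solid, oriented away from $x$ in the colour $k+1$, and each other edge dotted, with its intrinsic orientation; the orientations in the colours $1,\dots,k$ are kept. Labels and sign: first permute the vertices of $\Gamma$ so that $x$ becomes the vertex $0$; in $h_{x,\tau}(\Gamma)$ the vertex $x$ has label $0$, each other vertex of $\Gamma$ takes the label of the edge of $\tau$ that points to it, the middle vertex of a dotted edge takes the label of that edge, each solid edge takes the label of the vertex it points to, and the pairs of edges of the dotted edges come afterwards; finally multiply by $(-1)^{nr}$, where $r$ is the number of edges of $\tau$ whose intrinsic orientation points towards $x$. Put $$h(\Gamma)=\sum_{x}(\mathrm{val}(x)-2)\sum_{\tau}h_{x,\tau}(\Gamma),$$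 over all vertices $x$ and all spanning trees $\tau$ of $\Gamma$. **Proposition.** The above differentials are well defined and square to zero, $h$ is a well defined map of complexes of degree $0$, and $$h:\mathrm O_k\mathrm{GC}_n\longrightarrow\mathrm O_{k+1}\mathrm{sGC}_{n+1}$$ is a quasi-isomorphism. -/

import Mathlib

open CategoryTheory

universe u

namespace OrientedGC

noncomputable section

open scoped Classical

/-! ### Complexes given by generators and relations -/

/-- Generators and relations for a graded vector space (in degree `d` it is `K⟨Gen d⟩ / rel d`),
with a formula for a differential on generators. Only `bd i j` with `j + 1 = i` is used. -/
structure Presentation (K : Type u) [Field K] where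
  Gen : ℤ → Type
  rel : ∀ d, Submodule K (Gen d →₀ K)
  bd : ∀ i j, (Gen i →₀ K) →ₗ[K] (Gen j →₀ K)

namespace Presentation

variable {K : Type u} [Field K]

/-- The formula for the differential descends to the quotients and squares to zero there. -/
structure IsComplex (P : Presentation K) : Prop where
  bd_rel : ∀ i j, j + 1 = i → P.rel i ≤ (P.rel j).comap (P.bd i j)
  bd_bd : ∀ i j l, j + 1 = i → l + 1 = j → ∀ x, P.bd j l (P.bd i j x) ∈ P.rel l

/-- The presented chain complex. -/
def toComplex (P : Presentation K) (hP : P.IsComplex) : ChainComplex (ModuleCat.{u} K) ℤ where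
  X d := ModuleCat.of K ((P.Gen d →₀ K) ⧸ P.rel d)
  d i j := if h : j + 1 = i then
      ModuleCat.ofHom (Submodule.mapQ (P.rel i) (P.rel j) (P.bd i j) (hP.bd_rel i j h)) else 0
  shape i j h := dif_neg h
  d_comp_d' i j l hij hjl := by
    have hij' : j + 1 = i := hij
    have hjl' : l + 1 = j := hjl
    rw [dif_pos hij', dif_pos hjl']
    ext x
    simpa using hP.bd_bd i j l hij' hjl' (Finsupp.single x 1)

/-- A family of linear maps between the spaces of generators descends to the quotients and
commutes there with the differentials. -/
structure IsChainMap (P Q : Presentation K)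
    (f : ∀ d, (P.Gen d →₀ K) →ₗ[K] (Q.Gen d →₀ K)) : Prop where
  map_rel : ∀ d, P.rel d ≤ (Q.rel d).comap (f d)
  map_bd : ∀ i j, j + 1 = i → ∀ x, Q.bd i j (f i x) - f j (P.bd i j x) ∈ Q.rel j

/-- The induced map of chain complexes. -/
def toHom {P Q : Presentation K} (hP : P.IsComplex) (hQ : Q.IsComplex)
    {f : ∀ d, (P.Gen d →₀ K) →ₗ[K] (Q.Gen d →₀ K)} (hf : IsChainMap P Q f) :
    P.toComplex hP ⟶ Q.toComplex hQ where
  f d := ModuleCat.ofHom (Submodule.mapQ (P.rel d) (Q.rel d) (f d) (hf.map_rel d))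
  comm' i j hij := by
    have hij' : j + 1 = i := hij
    simp only [toComplex]
    rw [dif_pos hij', dif_pos hij']
    ext x
    simpa using (Submodule.Quotient.eq _).2 (hf.map_bd i j hij' (Finsupp.single x 1))

end Presentation

/-! ### Graphs -/

/-- A multigraph with vertices `0, …, v` (so `v + 1` of them), `e` labelled edges, each with an
intrinsic orientation from `ends a false` to `ends a true`, and with `k` further orientations of
every edge: in the colour `c` the edge `a` goes from `ends a (!col c a)` to `ends a (col c a)`. -/
structure Graph (k v e : ℕ) where
  ends : Fin e → Bool → Fin (v + 1)
  col : Fin k → Fin e → Bool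

/-- There is no directed cycle. -/
def Acyclic {α : Type} (arc : α → α → Prop) : Prop := ∀ x, ¬ Relation.TransGen arc x x

/-- Number of pairs of elements of `S` whose order is reversed by `g`. -/
def inversions {e m : ℕ} (S : Finset (Fin e)) (g : Fin e → Fin m) : ℕ :=
  ((S ×ˢ S).filter fun p => p.1 < p.2 ∧ g p.2 < g p.1).card

/-- Delete the vertex `b` and renumber the others monotonically (only used on `y ≠ b`). -/
def drop {v : ℕ} (b y : Fin (v + 2)) : Fin (v + 1) := (finSuccEquiv' b y).getD 0

/-- Identify the vertex `b` with the vertex `a`, delete the label `b`, and renumber. -/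
def collapse {v : ℕ} (a b y : Fin (v + 2)) : Fin (v + 1) := drop b (if y = b then a else y)

namespace Graph

variable {k v e : ℕ}

/-- The number of half-edges at `x`; a tadpole counts twice. -/
def valence (Γ : Graph k v e) (x : Fin (v + 1)) : ℕ :=
  (Finset.univ.filter fun p : Fin e × Bool => Γ.ends p.1 p.2 = x).card

/-- `x` and `y` are connected along the edges in `τ`. -/
def Linked (Γ : Graph k v e) (τ : Finset (Fin e)) : Fin (v + 1) → Fin (v + 1) → Prop :=
  Relation.EqvGen fun x y => ∃ a ∈ τ, Γ.ends a false = x ∧ Γ.ends a true = y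

/-- There is an edge going from `x` to `y` in the colour `c`. -/
def arc (Γ : Graph k v e) (c : Fin k) (x y : Fin (v + 1)) : Prop :=
  ∃ a, Γ.ends a (!Γ.col c a) = x ∧ Γ.ends a (Γ.col c a) = y

/-- A passing vertex: 2-valent, and in every colour the head of one edge and the tail of another. -/
def Passing (Γ : Graph k v e) (x : Fin (v + 1)) : Prop :=
  Γ.valence x = 2 ∧ ∀ c, (∃ y, Γ.arc c y x) ∧ ∃ y, Γ.arc c x y

/-- Connected, no directed cycle in any colour, all vertices at least 2-valent, some vertex at
least 3-valent, no passing vertex. -/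
structure Reduced (Γ : Graph k v e) : Prop where
  connected : ∀ x y, Γ.Linked Finset.univ x y
  acyclic : ∀ c, Acyclic (Γ.arc c)
  two_le : ∀ x, 2 ≤ Γ.valence x
  three_le : ∃ x, 3 ≤ Γ.valence x
  not_passing : ∀ x, ¬ Γ.Passing x

/-- The graphs spanning `O_k GC_n`. -/
structure IsGC (Γ : Graph k v e) : Prop extends Reduced Γ where
  no_tadpole : ∀ a, Γ.ends a false ≠ Γ.ends a true

/-- The action of a permutation `σ` of the vertices, a permutation `ρ` of the edges, and the
reversal of the intrinsic orientation of the edges `a` with `f a = true`. The coloured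
orientations are unchanged relative to the actual vertices. -/
def relabel (σ : Equiv.Perm (Fin (v + 1))) (ρ : Equiv.Perm (Fin e)) (f : Fin e → Bool)
    (Γ : Graph k v e) : Graph k v e where
  ends a s := σ (Γ.ends (ρ.symm a) (xor (f (ρ.symm a)) s))
  col c a := xor (f (ρ.symm a)) (Γ.col c (ρ.symm a))

/-- Remove the edge `t` and identify `b` with `a`, where `a`, `b` are the ends of `t`. -/
def contract (Γ : Graph k (v + 1) (e + 1)) (t : Fin (e + 1)) (a b : Fin (v + 2)) :
    Graph k v e where
  ends i s := collapse a b (Γ.ends (t.succAbove i) s)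
  col c i := Γ.col c (t.succAbove i)

/-- Spanning trees, as sets of edges. -/
def IsSpanningTree (Γ : Graph k v e) (τ : Finset (Fin e)) : Prop :=
  (∀ x y, Γ.Linked τ x y) ∧ τ.card = v

/-- For `a` in the spanning tree `τ`: `true` if the intrinsic orientation of `a` points away
from `x` along `τ`, and `false` if it points towards `x`. -/
def away (Γ : Graph k v e) (τ : Finset (Fin e)) (x : Fin (v + 1)) (a : Fin e) : Bool :=
  decide (Γ.Linked (τ.erase a) x (Γ.ends a false))

/-- For `a` in the spanning tree `τ`, the end of `a` that is farther from `x`. -/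
def tip (Γ : Graph k v e) (τ : Finset (Fin e)) (x : Fin (v + 1)) (a : Fin e) : Fin (v + 1) :=
  Γ.ends a (Γ.away τ x a)

end Graph

/-! ### The complex `O_k GC_n` -/

section GC

variable (K : Type u) [Field K] (k : ℕ) (n : ℤ)

/-- The labelled graphs that span `O_k GC_n` in degree `d`; a graph with `v + 1` vertices and `e`
edges has degree `v n + (1 - n) e`. -/
def GCGen (d : ℤ) : Type :=
  {Γ : Σ v e : ℕ, Graph k v e // Γ.2.2.IsGC ∧ (Γ.1 : ℤ) * n + (1 - n) * (Γ.2.1 : ℤ) = d}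

variable {k} in
/-- A labelled graph as a generator; graphs that are not admissible are `0`. -/
def gcGen (d : ℤ) {v e : ℕ} (Γ : Graph k v e) : GCGen k n d →₀ K :=
  if h : Γ.IsGC ∧ (v : ℤ) * n + (1 - n) * (e : ℤ) = d then Finsupp.single ⟨⟨v, e, Γ⟩, h⟩ 1 else 0

/-- For even `n` edges are odd; for odd `n` vertices and intrinsic orientations of edges are. -/
def gcSign {v e : ℕ} (σ : Equiv.Perm (Fin (v + 1))) (ρ : Equiv.Perm (Fin e))
    (f : Fin e → Bool) : ℤ :=
  if Even n then (Equiv.Perm.sign ρ : ℤ)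
  else (Equiv.Perm.sign σ : ℤ) * ∏ a, if f a then -1 else 1

/-- The relations that define the (signed) coinvariants. -/
def gcRel (d : ℤ) : Submodule K (GCGen k n d →₀ K) :=
  Submodule.span K {x | ∃ (v e : ℕ) (Γ : Graph k v e) (σ : Equiv.Perm (Fin (v + 1)))
    (ρ : Equiv.Perm (Fin e)) (f : Fin e → Bool),
    x = gcGen K n d (Γ.relabel σ ρ f) - gcSign n σ ρ f • gcGen K n d Γ}

variable {k} in
/-- The sum of the contractions of all edges `t`. The edge `t` and its head are first made the last
edge and the last vertex (for even `n` the former gives the sign, for odd `n` the latter), and then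
the head of `t` is identified with its tail. -/
def gcBd (d : ℤ) : (v e : ℕ) → Graph k v e → (GCGen k n d →₀ K)
  | v + 1, e + 1, Γ => ∑ t : Fin (e + 1),
      ((-1 : ℤ) ^ (if Even n then e - (t : ℕ) else v + 1 - (Γ.ends t true : ℕ))) •
        gcGen K n d (Γ.contract t (Γ.ends t false) (Γ.ends t true))
  | _, _, _ => 0

/-- The complex `O_k GC_n`. -/
def GC : Presentation K where
  Gen := GCGen k n
  rel := gcRel K k n
  bd _ j := Finsupp.linearCombination K fun Γ => gcBd K n j Γ.1.1 Γ.1.2.1 Γ.1.2.2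

end GC

/-! ### The special complex `O_{k+1} sGC_n`

A dotted edge `x ⋯> y` stands for `½ (x → z ← y) - ½ (x ← z → y)`, where the arrows show the colour
`k + 1`, which is also taken as the intrinsic orientation, `z` is a new 2-valent vertex, the first
edge is the one at `x`, and the path goes from `x` to `y`, or from `y` to `x`, in each other colour
as the dotted edge does. The conventions are: new vertices come after all other vertices, new edges
after all other edges, the two edges of a dotted edge one after the other. All signs below are
those of the complex of `k + 1`-oriented graphs under these conventions. The complex is the
quotient of `O_{k+1} GC_n` in which the sums `(x → z ← y) + (x ← z → y)` and all graphs with a longer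
path of this kind (at least 3 edges) vanish; so there `x ⋯> y` equals `x → z ← y`. -/

/-- Graphs with solid and dotted edges. The orientations in the colours `1, …, k` are those of the
underlying graph. The edge `a` is dotted if `ty a = none`, and if `ty a = some s` then `a` is solid
and goes from `ends a (!s)` to `ends a s` in the colour `k + 1`. -/
structure SGraph (k v e : ℕ) extends Graph k v e where
  ty : Fin e → Option Bool

namespace SGraph

variable {k v e : ℕ}

def solid (Γ : SGraph k v e) : Finset (Fin e) := Finset.univ.filter fun a => Γ.ty a ≠ none

def dotted (Γ : SGraph k v e) : Finset (Fin e) := Finset.univ.filter fun a => Γ.ty a = none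

/-- The odd edges: the solid ones for even `n`, the dotted ones for odd `n`. -/
def oddEdges (n : ℤ) (Γ : SGraph k v e) : Finset (Fin e) := if Even n then Γ.solid else Γ.dotted

/-- There is a solid edge going from `x` to `y` in the colour `k + 1`. -/
def sarc (Γ : SGraph k v e) (x y : Fin (v + 1)) : Prop :=
  ∃ a s, Γ.ty a = some s ∧ Γ.ends a (!s) = x ∧ Γ.ends a s = y

/-- The graphs spanning `O_{k+1} sGC_n`. For odd `n` those with tadpoles or multiple edges (of any
types) are divided out. -/
structure IsSpecial (n : ℤ) (Γ : SGraph k v e) : Prop extends Γ.toGraph.Reduced where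
  acyclic_last : Acyclic Γ.sarc
  no_tadpole : Odd n → ∀ a, Γ.ends a false ≠ Γ.ends a true
  no_multiple : Odd n → ∀ a b, a ≠ b →
    s(Γ.ends a false, Γ.ends a true) ≠ s(Γ.ends b false, Γ.ends b true)

/-- Degree in the complex of `k + 1`-oriented graphs, where each dotted edge has one vertex and two
edges. -/
def degree (n : ℤ) (Γ : SGraph k v e) : ℤ :=
  ((v : ℤ) + Γ.dotted.card) * n + (1 - n) * (Γ.solid.card + 2 * Γ.dotted.card)

def relabel (σ : Equiv.Perm (Fin (v + 1))) (ρ : Equiv.Perm (Fin e)) (f : Fin e → Bool)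
    (Γ : SGraph k v e) : SGraph k v e where
  toGraph := Γ.toGraph.relabel σ ρ f
  ty a := (Γ.ty (ρ.symm a)).map (xor (f (ρ.symm a)))

/-- For even `n` solid edges and the intrinsic orientations of dotted edges are odd; for odd `n`
vertices and dotted edges are odd. -/
def relabelSign (n : ℤ) (σ : Equiv.Perm (Fin (v + 1))) (ρ : Equiv.Perm (Fin e))
    (f : Fin e → Bool) (Γ : SGraph k v e) : ℤ :=
  (-1) ^ inversions (Γ.oddEdges n) ρ *
    if Even n then ∏ a ∈ Γ.dotted, (if f a then -1 else 1) else (Equiv.Perm.sign σ : ℤ)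

/-- Make the edge `t` solid, with the given orientation in the colour `k + 1`. -/
def makeSolid (Γ : SGraph k v e) (t : Fin e) (s : Bool) : SGraph k v e where
  toGraph := Γ.toGraph
  ty := Function.update Γ.ty t (some s)

def contract (Γ : SGraph k (v + 1) (e + 1)) (t : Fin (e + 1)) (a b : Fin (v + 2)) :
    SGraph k v e where
  toGraph := Γ.toGraph.contract t a b
  ty i := Γ.ty (t.succAbove i)

/-- Replace the edges `i`, `j` and their common vertex `w = ends i s = ends j r` by one dotted
edge, from the other end of `i` to the other end of `j`, in the place of `i`. -/
def fuse (Γ : SGraph k (v + 1) (e + 1)) (w : Fin (v + 2)) (i j : Fin (e + 1)) (s r : Bool) :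
    SGraph k v e where
  ends a p := drop w (if j.succAbove a = i then (if p then Γ.ends j (!r) else Γ.ends i (!s))
    else Γ.ends (j.succAbove a) p)
  col c a := if j.succAbove a = i then Γ.col c i == s else Γ.col c (j.succAbove a)
  ty a := if j.succAbove a = i then none else Γ.ty (j.succAbove a)

/-- The sign of moving `w` behind all other vertices and `i`, `j`, in this order, behind all other
solid edges, and then the new dotted edge to the place of `i`; for `i < j`. -/
def fuseSign (n : ℤ) (Γ : SGraph k (v + 1) (e + 1)) (w : Fin (v + 2)) (i j : Fin (e + 1)) : ℤ :=
  (-1) ^ (if Even n then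
      (Γ.solid.filter fun a => j < a).card + (Γ.solid.filter fun a => i < a ∧ a ≠ j).card
    else v + 1 - (w : ℕ) + (Γ.dotted.filter fun a => a < i).card)

end SGraph

section SGC

variable (K : Type u) [Field K] (k : ℕ) (n : ℤ)

/-- The labelled graphs that span `O_{k+1} sGC_n` in degree `d`. -/
def SGCGen (d : ℤ) : Type :=
  {Γ : Σ v e : ℕ, SGraph k v e // Γ.2.2.IsSpecial n ∧ Γ.2.2.degree n = d}

variable {k} in
/-- A labelled graph as a generator; graphs that are not admissible are `0`. -/
def sgcGen (d : ℤ) {v e : ℕ} (Γ : SGraph k v e) : SGCGen k n d →₀ K :=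
  if h : Γ.IsSpecial n ∧ Γ.degree n = d then Finsupp.single ⟨⟨v, e, Γ⟩, h⟩ 1 else 0

/-- The relations that define the (signed) coinvariants. -/
def sgcRel (d : ℤ) : Submodule K (SGCGen k n d →₀ K) :=
  Submodule.span K {x | ∃ (v e : ℕ) (Γ : SGraph k v e) (σ : Equiv.Perm (Fin (v + 1)))
    (ρ : Equiv.Perm (Fin e)) (f : Fin e → Bool),
    x = sgcGen K n d (Γ.relabel σ ρ f) - Γ.relabelSign n σ ρ f • sgcGen K n d Γ}

variable {k} in
/-- The class of a graph in which `w` is a 2-valent vertex that is passing in the colours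
`1, …, k`. It is a dotted edge if both edges at `w` are solid and point to `w` in the colour
`k + 1`, minus a dotted edge if both are solid and point away from `w`, and zero otherwise (then
either `w` is passing in all `k + 1` colours or it lies on a path of at least 3 edges). -/
def sgcFuse (d : ℤ) : (v e : ℕ) → SGraph k v e → Fin (v + 1) → (SGCGen k n d →₀ K)
  | v + 1, e + 1, Γ, w => ∑ i : Fin (e + 1), ∑ j : Fin (e + 1), ∑ s : Bool, ∑ r : Bool,
      if i < j ∧ Γ.ends i s = w ∧ Γ.ends j r = w then
        (Γ.fuseSign n w i j *
          (if Γ.ty i = some s ∧ Γ.ty j = some r then 1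
            else if Γ.ty i = some (!s) ∧ Γ.ty j = some (!r) then -1 else 0)) •
          sgcGen K n d (Γ.fuse w i j s r)
      else 0
  | _, _, _, _ => 0

variable {k} in
/-- The part of the differential that maps a dotted edge `x ⋯> y` to `(x → y) - (-1)^n (y → x)`,
after that edge has been made the last one. -/
def sgcBdDotted (d : ℤ) {v e : ℕ} (Γ : SGraph k v e) : SGCGen k n d →₀ K :=
  ∑ t ∈ Γ.dotted, ((-1 : ℤ) ^ ((Γ.oddEdges n).filter fun a => t < a).card) •
    (sgcGen K n d (Γ.makeSolid t true) -
      ((n.negOnePow : ℤˣ) : ℤ) • sgcGen K n d (Γ.makeSolid t false))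

variable {k} in
/-- The part of the differential that contracts solid edges. The edge `t` and its head in the
colour `k + 1` are first made the last edge and the last vertex (the vertices of dotted edges
included). -/
def sgcBdSolid (d : ℤ) : (v e : ℕ) → SGraph k v e → (SGCGen k n d →₀ K)
  | v + 1, e + 1, Γ => ∑ t : Fin (e + 1), match Γ.ty t with
    | none => 0
    | some s =>
      let x := Γ.ends t (!s)
      let y := Γ.ends t s
      let Γ' := Γ.contract t x y
      let w := collapse x y x
      ((-1 : ℤ) ^ (if Even n then (Γ.solid.filter fun a => t < a).card
        else v + 1 - (y : ℕ) + Γ.dotted.card)) •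
        if Γ'.Passing w then sgcFuse K n d v e Γ' w else sgcGen K n d Γ'
  | _, _, _ => 0

/-- The complex `O_{k+1} sGC_n`. -/
def SGC : Presentation K where
  Gen := SGCGen k n
  rel := sgcRel K k n
  bd _ j := Finsupp.linearCombination K fun Γ =>
    sgcBdDotted K n j Γ.1.2.2 + sgcBdSolid K n j Γ.1.1 Γ.1.2.1 Γ.1.2.2

end SGC

/-! ### The map `h` -/

section H

variable (K : Type u) [Field K] {k : ℕ} (n : ℤ)

/-- The underlying graph of `h_{x,τ}(Γ)`: edges in `τ` become solid and are oriented away from `x`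
in the colour `k + 1`, all other edges become dotted. -/
def Graph.special {v e : ℕ} (Γ : Graph k v e) (x : Fin (v + 1)) (τ : Finset (Fin e)) :
    SGraph k v e where
  toGraph := Γ
  ty a := if a ∈ τ then some (Γ.away τ x a) else none

/-- The sign of `h_{x,τ}(Γ)`.
For even `n` (vertices and dotted edges of the image are odd): in `h_{x,τ}(Γ)` the vertex `x` is
the first one; the tip of an edge in `τ`, and the middle vertex of an edge outside `τ`, take the
label of that edge. The sign compares this order with that of `Γ.special x τ`: the vertices in
their order in `Γ`, followed by the dotted edges.
For odd `n` (solid edges of the image are odd): first `x` is made the first vertex, which gives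
`(-1)^x`; then every edge in `τ` takes the label of its tip, and each edge in `τ` whose intrinsic
orientation points towards `x` gives a factor `-1`. -/
def hSign {v e : ℕ} (Γ : Graph k v e) (x : Fin (v + 1)) (τ : Finset (Fin e)) : ℤ :=
  (-1) ^ ((x : ℕ) + inversions τ (Γ.tip τ x) +
    if Even n then ((τᶜ ×ˢ τ).filter fun p => p.1 < p.2).card
    else (τ.filter fun a => Γ.away τ x a = false).card)

/-- `h(Γ) = ∑_x (v(x) - 2) ∑_τ h_{x,τ}(Γ)`, over all vertices `x` and spanning trees `τ`. -/
def hGraph (d : ℤ) {v e : ℕ} (Γ : Graph k v e) : SGCGen k (n + 1) d →₀ K :=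
  ∑ x : Fin (v + 1), ((Γ.valence x : ℤ) - 2) •
    ∑ τ ∈ Finset.univ.filter fun τ => Γ.IsSpanningTree τ,
      hSign n Γ x τ • sgcGen K (n + 1) d (Γ.special x τ)

variable (k) in
/-- The map `h : O_k GC_n → O_{k+1} sGC_{n+1}` on generators. -/
def h (d : ℤ) : ((GC K k n).Gen d →₀ K) →ₗ[K] ((SGC K k (n + 1)).Gen d →₀ K) :=
  Finsupp.linearCombination K fun Γ => hGraph K n d Γ.1.2.2

end H

end

end OrientedGC

set_option linter.unusedSectionVars false

namespace OrientedGC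

noncomputable section

open scoped Classical

open Finset (prod_product prod_insert prod_mul_distrib prod_congr prod_eq_one induction_on
  insert_erase notMem_erase mem_map mem_erase univ mem_univ prod_disjSum mem_map_equiv map_map
  prod_map mul_prod_erase mem_of_mem_erase map_erase sum_map smul_sum sum_congr erase_right_comm
  add_sum_erase mem_product sum_eq_zero mem_filter sum_product sum_add_distrib card_erase_add_one
  mem_insert card_map sum_filter ne_of_mem_erase mem_coe mem_image mem_insert_self
  mem_insert_of_mem mem_sdiff notMem_empty erase_insert sum_nbij' sum_eq_single sum_sdiff sum_comm
  prod_union mem_map_of_mem mul_sum sum_const card_univ)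
open Function (injective_id update update_comm extend update_of_ne update_eq_self update_self
  update_idem)
open Equiv (swap injective swap_apply_of_ne_of_ne sumCongr apply_symm_apply coe_toEmbedding
  symm_swap symm_apply_apply Perm)
open Equiv.Perm (sign_swap coe_one)
open Sum (inl inr map_injective map_inr)
open Fin (valEmbedding val_injective val_strictMono strictMono_succAbove)
open Bool (false_eq_true eq_not_of_ne)
open Submodule (subset_span span_le ker_mkQ mem_comap mkQ_surjective mem_sup_left mem_sup_right
  mem_sup)
open Option (ne_none_iff_exists' some_inj)
open Finsupp (linearCombination linearCombination_single supported single_mem_supported)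
open Int (cast_mul cast_smul_eq_zsmul)
open Function.Embedding (coeFn_mk trans_apply)
open LinearMap (ker mem_ker proj)
open Submodule.Quotient (mk_eq_zero)
open Sym2 (eq_iff)
open Relation (TransGen EqvGen)

section

/-! ### Signs of reorderings -/

section Signs

variable {ι κ α β γ : Type*} [DecidableEq ι] [DecidableEq κ] [LinearOrder α] [LinearOrder β] [LinearOrder γ]

/-- The sign `-1` if `P` holds and `1` otherwise. -/
def sg (P : Prop) : ℤ := if P then -1 else 1

@[simp] lemma sg_false : sg False = 1 := by simp [sg]

@[simp] lemma sg_true : sg True = -1 := by simp [sg]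

lemma sg_mul_self (P : Prop) : sg P * sg P = 1 := by unfold sg; split_ifs <;> rfl

lemma neg_one_pow_card_filter (S : Finset ι) (P : ι → Prop) [DecidablePred P] : (-1 : ℤ) ^ (S.filter
    P).card = ∏ x ∈ S, sg (P x) := by
  have h : ∀ x, sg (P x) = if P x then -1 else 1 := fun x => by unfold sg; split_ifs <;> rfl
  simp only [h, Finset.prod_ite, Finset.prod_const, one_pow, mul_one]

/-- The sign that compares two orders on `S`. -/
def kap (S : Finset ι) (F : ι → α) (G : ι → β) : ℤ :=
  (-1) ^ ((S ×ˢ S).filter fun p => F p.1 < F p.2 ∧ G p.2 < G p.1).card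

/-- The sign of moving `c` behind all elements of `S`. -/
def aft (F : ι → α) (S : Finset ι) (c : ι) : ℤ := (-1) ^ (S.filter fun d => F c < F d).card

lemma kap_eq_prod (S : Finset ι) (F : ι → α) (G : ι → β) : kap S F G = ∏ x ∈ S, ∏ y ∈ S, sg (F x < F
    y ∧ G y < G x) := by
  rw [kap, neg_one_pow_card_filter, prod_product]

lemma aft_eq_prod (F : ι → α) (S : Finset ι) (c : ι) : aft F S c = ∏ d ∈ S, sg (F c < F d) :=
    neg_one_pow_card_filter _ _

@[simp] lemma kap_empty (F : ι → α) (G : ι → β) : kap ∅ F G = 1 := by simp [kap]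

lemma aft_insert (F : ι → α) {S : Finset ι} {d : ι} (hd : d ∉ S) (c : ι) : aft F (insert d S) c = sg
    (F c < F d) * aft F S c := by
  simp only [aft_eq_prod, prod_insert hd]

lemma aft_insert_self (F : ι → α) (S : Finset ι) (c : ι) : aft F (insert c S) c = aft F S c := by
  by_cases h : c ∈ S
  · grind
  · rw [aft_insert F h]; simp [sg]

lemma kap_insert {S : Finset ι} {F : ι → α} {G : ι → β} {c : ι} (hc : c ∉ S) (hF : Set.InjOn F
    (insert c S : Finset ι)) (hG : Set.InjOn G (insert c S : Finset ι)) : kap (insert c S) F G = kap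
    S F G * (aft F S c * aft G S c) := by
  simp only [kap_eq_prod, aft_eq_prod, prod_insert hc]
  have h0 : sg (F c < F c ∧ G c < G c) = 1 := by simp [sg]
  have key : ∀ d ∈ S, sg (F c < F d ∧ G d < G c) * sg (F d < F c ∧ G c < G d) =
      sg (F c < F d) * sg (G c < G d) := by
    intro d hd
    have hne : c ≠ d := fun h => hc (h ▸ hd)
    have h1 : F c ≠ F d := fun h => hne (hF (by simp) (by simp [hd]) h)
    have h2 : G c ≠ G d := fun h => hne (hG (by simp) (by simp [hd]) h)
    rcases lt_or_gt_of_ne h1 with a | a <;> rcases lt_or_gt_of_ne h2 with b | b <;>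
      simp [sg, a, b, a.not_gt, b.not_gt]
  rw [← prod_mul_distrib (f := fun d => sg (F c < F d)), ← prod_congr rfl key]
  simp only [prod_mul_distrib, h0]
  ring

lemma aft_mul_self (F : ι → α) (S : Finset ι) (c : ι) : aft F S c * aft F S c = 1 := by
  rw [aft_eq_prod, ← prod_mul_distrib]
  exact prod_eq_one fun _ _ => sg_mul_self _

lemma kap_mul_self (S : Finset ι) (F : ι → α) (G : ι → β) : kap S F G * kap S F G = 1 := by
  rw [kap, ← mul_pow]; simp

lemma kap_comp {S : Finset ι} {F : ι → α} {G : ι → β} {H : ι → γ} (hF : Set.InjOn F S) (hG :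
    Set.InjOn G S) (hH : Set.InjOn H S) : kap S F G * kap S G H = kap S F H := by
  induction S using induction_on with
  | empty => simp
  | insert c S hc ih =>
    rw [kap_insert hc hF hG, kap_insert hc hG hH, kap_insert hc hF hH,
      ← ih (hF.mono (by simp)) (hG.mono (by simp)) (hH.mono (by simp))]
    linear_combination (kap S F G * kap S G H * aft F S c * aft H S c) * aft_mul_self G S c

lemma kap_self (S : Finset ι) (F : ι → α) : kap S F F = 1 := by
  rw [kap, Finset.filter_false_of_mem]
  · simp
  · grind

lemma kap_congr {S : Finset ι} {F F' : ι → α} {G G' : ι → β} (hF : ∀ x ∈ S, F x = F' x) (hG : ∀ x ∈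
    S, G x = G' x) : kap S F G = kap S F' G' := by
  simp only [kap_eq_prod]
  refine prod_congr rfl fun x hx => prod_congr rfl fun y hy => ?_
  rw [hF x hx, hF y hy, hG x hx, hG y hy]

/-- `kap` depends only on the order relations. -/
lemma kap_congr_lt {α' β' : Type*} [LinearOrder α'] [LinearOrder β'] {S : Finset ι} {F : ι → α} {F'
    : ι → α'} {G : ι → β} {G' : ι → β'} (hF : ∀ x ∈ S, ∀ y ∈ S, F x < F y ↔ F' x < F' y) (hG : ∀ x ∈
    S, ∀ y ∈ S, G x < G y ↔ G' x < G' y) : kap S F G = kap S F' G' := by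
  simp only [kap_eq_prod]
  refine prod_congr rfl fun x hx => prod_congr rfl fun y hy => ?_
  rw [hF x hx y hy, hG y hy x hx]

lemma kap_map (e : κ ↪ ι) (S : Finset κ) (F : ι → α) (G : ι → β) : kap (S.map e) F G = kap S (F ∘ e)
    (G ∘ e) := by
  simp [kap_eq_prod]

lemma aft_map (e : κ ↪ ι) (S : Finset κ) (F : ι → α) (c : κ) : aft F (S.map e) (e c) = aft (F ∘ e) S
    c := by
  simp [aft_eq_prod]

lemma aft_congr {α' : Type*} [LinearOrder α'] {S : Finset ι} {F : ι → α} {F' : ι → α'} {c : ι} (h :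
    ∀ d ∈ S, F c < F d ↔ F' c < F' d) : aft F S c = aft F' S c := by
  simp only [aft_eq_prod]
  exact prod_congr rfl fun x hx => by rw [h x hx]

lemma kap_erase {S : Finset ι} {F : ι → α} {G : ι → β} {c : ι} (hc : c ∈ S) (hF : Set.InjOn F S) (hG
    : Set.InjOn G S) : kap S F G = kap (S.erase c) F G * (aft F S c * aft G S c) := by
  have h := kap_insert (S := S.erase c) (F := F) (G := G) (c := c) (by simp)
    (by rwa [insert_erase hc]) (by rwa [insert_erase hc])
  rw [← aft_insert_self F, ← aft_insert_self G, insert_erase hc] at h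
  exact h

/-- Remove `c` from `O` or add it. -/
def tog (O : Finset ι) (c : ι) : Finset ι := if c ∈ O then O.erase c else insert c O

lemma mem_tog {O : Finset ι} {c d : ι} : d ∈ tog O c ↔ (d ∈ O ↔ d ≠ c) := by
  unfold tog
  split_ifs with h <;> by_cases hd : d = c
  · grind
  · simp [hd]
  · grind
  · simp [hd]

lemma tog_tog (O : Finset ι) (c : ι) : tog (tog O c) c = O := by
  ext d; simp only [mem_tog]; tauto

lemma tog_comm (O : Finset ι) (c d : ι) : tog (tog O c) d = tog (tog O d) c := by
  ext x; simp only [mem_tog]; tauto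

lemma aft_tog_self (F : ι → α) (O : Finset ι) (c : ι) : aft F (tog O c) c = aft F O c := by
  unfold tog
  split_ifs with h
  · conv_rhs => rw [← insert_erase h, aft_insert_self]
  · rw [aft_insert_self]

lemma aft_tog (F : ι → α) (O : Finset ι) (c d : ι) : aft F (tog O d) c = sg (F c < F d) * aft F O c
    := by
  unfold tog
  split_ifs with h
  · conv_rhs => rw [← insert_erase h, aft_insert F (notMem_erase _ _), ← mul_assoc, sg_mul_self,
      one_mul]
  · rw [aft_insert F h]

/-- Toggling two elements in different orders. -/
lemma aft_anticomm {F : ι → α} (hF : Function.Injective F) (O : Finset ι) {c d : ι} (h : c ≠ d) : aft F O c *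
    aft F (tog O c) d = -(aft F O d * aft F (tog O d) c) := by
  rw [aft_tog, aft_tog]
  rcases lt_or_gt_of_ne (hF.ne h) with a | a
  · simp only [sg, a, a.not_gt, if_true, if_false]; ring
  · simp only [sg, a, a.not_gt, if_true, if_false]; ring

lemma kap_tog {F : ι → α} {G : ι → β} (hF : Function.Injective F) (hG : Function.Injective G) (O : Finset ι) (c : ι) :
    kap (tog O c) F G = kap O F G * (aft F O c * aft G O c) := by
  by_cases h : c ∈ O
  · rw [kap_erase h hF.injOn hG.injOn, tog, if_pos h]
    linear_combination (-kap (O.erase c) F G * aft G O c * aft G O c) * aft_mul_self F O c -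
      kap (O.erase c) F G * aft_mul_self G O c
  · rw [tog, if_neg h, kap_insert h hF.injOn hG.injOn]

lemma tog_map (e : κ ↪ ι) (O : Finset κ) (c : κ) : (tog O c).map e = tog (O.map e) (e c) := by
  ext x
  simp only [mem_tog, mem_map]
  constructor
  · grind
  · grind

lemma kap_swap {F : ι → α} (hF : Function.Injective F) {S : Finset ι} {a b : ι} (ha : a ∈ S) (hb : b ∈ S) (h
    : a ≠ b) : kap S F (F ∘ swap a b) = -1 := by
  have hG : Function.Injective (F ∘ swap a b) := hF.comp (injective _)
  have hb' : b ∈ S.erase a := by simp [hb, h.symm]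
  rw [kap_erase ha hF.injOn hG.injOn, kap_erase hb' hF.injOn hG.injOn]
  have h1 : kap ((S.erase a).erase b) F (F ∘ swap a b) = 1 := by
    rw [← kap_self ((S.erase a).erase b) F]
    refine kap_congr (fun _ _ => rfl) fun x hx => ?_
    simp only [mem_erase] at hx
    simp [swap_apply_of_ne_of_ne hx.2.1 hx.1]
  have e1 : ∀ {β : Type _} [LinearOrder β] (H : ι → β), aft H S a =
      sg (H a < H b) * aft H ((S.erase a).erase b) a := fun H => by
    conv_lhs => rw [← insert_erase ha, aft_insert_self, ← insert_erase hb', aft_insert H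
      (notMem_erase _ _)]
  have e2 : ∀ {β : Type _} [LinearOrder β] (H : ι → β), aft H (S.erase a) b =
      aft H ((S.erase a).erase b) b := fun H => by
    conv_lhs => rw [← insert_erase hb', aft_insert_self]
  have e3 : aft (F ∘ swap a b) ((S.erase a).erase b) a =
      aft F ((S.erase a).erase b) b := by
    simp only [aft_eq_prod]
    refine prod_congr rfl fun x hx => ?_
    simp only [mem_erase] at hx
    simp [swap_apply_of_ne_of_ne hx.2.1 hx.1]
  have e4 : aft (F ∘ swap a b) ((S.erase a).erase b) b =
      aft F ((S.erase a).erase b) a := by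
    simp only [aft_eq_prod]
    refine prod_congr rfl fun x hx => ?_
    simp only [mem_erase] at hx
    simp [swap_apply_of_ne_of_ne hx.2.1 hx.1]
  rw [h1, e1, e1, e2, e2, e3, e4]
  have h5 : sg (F a < F b) * sg ((F ∘ swap a b) a < (F ∘ swap a b) b) = -1 := by
    rcases lt_or_gt_of_ne (hF.ne h) with q | q <;> simp [sg, q, q.not_gt]
  set A := aft F ((S.erase a).erase b) a
  set B := aft F ((S.erase a).erase b) b
  have hA : A * A = 1 := aft_mul_self _ _ _
  have hB : B * B = 1 := aft_mul_self _ _ _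
  linear_combination (A * A * B * B) * h5 - B * B * hA - hB

lemma kap_swap_of_notMem {F : ι → α} {S : Finset ι} {a b : ι} (ha : a ∉ S) (hb : b ∉ S) : kap S F (F
    ∘ swap a b) = 1 := by
  rw [← kap_self S F]
  refine kap_congr (fun _ _ => rfl) fun x hx => ?_
  simp [swap_apply_of_ne_of_ne (a := a) (b := b) (x := x) (by rintro rfl; exact ha hx)
    (by rintro rfl; exact hb hx)]

lemma kap_swap_tog {F : ι → α} (hF : Function.Injective F) {S : Finset ι} {a b : ι} (ha : a ∉ S) (hb : b ∉ S)
    (h : a ≠ b) : kap (tog S a) F (F ∘ swap a b) = aft F S a * aft F S b := by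
  rw [kap_tog hF (hF.comp (injective _)), kap_swap_of_notMem ha hb, one_mul]
  congr 1
  simp only [aft_eq_prod]
  refine prod_congr rfl fun x hx => ?_
  simp [swap_apply_of_ne_of_ne (a := a) (b := b) (x := x) (by rintro rfl; exact ha hx)
    (by rintro rfl; exact hb hx)]

lemma sign_eq_kap [Fintype α] (σ : Perm α) : (Perm.sign σ : ℤ) = kap univ id σ := by
  induction σ using Perm.swap_induction_on' with
  | one => simpa using (kap_self (univ : Finset α) id).symm
  | mul_swap f x y hxy ih =>
    rw [Perm.sign_mul, sign_swap hxy]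
    have h1 := kap_comp (S := univ) (F := id) (G := swap x y) (H := f * swap x y)
      injective_id.injOn (injective _).injOn (injective _).injOn
    have h2 := kap_swap (F := (id : α → α)) injective_id (mem_univ x)
      (mem_univ y) hxy
    have h3 : kap univ (swap x y) (f * swap x y) = kap univ id f := by
      have := kap_map (swap x y).toEmbedding univ (id : α → α) f
      rw [Finset.map_univ_equiv] at this
      exact this.symm
    have h2' : kap univ (id : α → α) (swap x y) = -1 := h2
    rw [← h1, h3, h2', ← ih]
    simp

lemma inversions_eq_kap {e m : ℕ} (S : Finset (Fin e)) (g : Fin e → Fin m) : (-1 : ℤ) ^ inversions S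
    g = kap S id g := rfl

/-- The order in which all vertices come before all edges. -/
def lx {α β : Type*} (x : α ⊕ β) : α ⊕ₗ β := toLex x

lemma lx_injective {α β : Type*} : Function.Injective (lx : α ⊕ β → α ⊕ₗ β) :=
  fun _ _ h => toLex.injective h

@[simp] lemma lx_inl_lt_inl {a b : α} : (lx (inl a) : α ⊕ₗ β) < lx (inl b) ↔ a < b :=
  Sum.Lex.inl_lt_inl_iff

@[simp] lemma lx_inr_lt_inr {a b : β} : (lx (inr a) : α ⊕ₗ β) < lx (inr b) ↔ a < b :=
  Sum.Lex.inr_lt_inr_iff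

@[simp] lemma lx_inl_lt_inr {a : α} {b : β} : (lx (inl a) : α ⊕ₗ β) < lx (inr b) :=
  Sum.Lex.inl_lt_inr _ _

@[simp] lemma not_lx_inr_lt_inl {a : α} {b : β} : ¬ (lx (inr b) : α ⊕ₗ β) < lx (inl a) :=
  Sum.Lex.not_inr_lt_inl

lemma kap_disjSum {α' β' : Type*} [LinearOrder α'] [LinearOrder β'] (A : Finset ι) (B : Finset κ) (F
    : ι → α) (G : κ → β) (F' : ι → α') (G' : κ → β') : kap (A.disjSum B) (lx ∘ Sum.map F G) (lx ∘
    Sum.map F' G') = kap A F F' * kap B G G' := by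
  have h : ∀ f : ι ⊕ κ → ℤ, ∏ x ∈ A.disjSum B, f x =
      (∏ a ∈ A, f (inl a)) * ∏ b ∈ B, f (inr b) := fun f => prod_disjSum _ _ _
  simp [kap_eq_prod, h]

lemma kap_lx (A : Finset α) (B : Finset β) {α' β' : Type*} [LinearOrder α'] [LinearOrder β'] (F : α
    → α') (G : β → β') : kap (A.disjSum B) lx (lx ∘ Sum.map F G) = kap A id F * kap B id G := by
  rw [← kap_disjSum]
  simp

lemma aft_lx_inl (A : Finset α) (B : Finset β) (a : α) : aft lx (A.disjSum B) (inl a) = aft id A a *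
    (-1) ^ B.card := by
  simp [aft_eq_prod, prod_disjSum]

lemma aft_lx_inr (A : Finset α) (B : Finset β) (b : β) : aft lx (A.disjSum B) (inr b) = aft id B b
    := by
  simp [aft_eq_prod, prod_disjSum]

end Signs

end

section

/-! ### Graphs labelled by natural numbers -/

/-- Graphs whose vertices and edges are natural numbers. The values of the functions on numbers
that are not edges have no meaning. -/
@[ext] structure NG (k : ℕ) where
  V : Finset ℕ
  E : Finset ℕ
  ends : ℕ → Bool → ℕ
  col : Fin k → ℕ → Bool
  ty : ℕ → Option Bool

/-- The sign `(-1) ^ m`. -/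
def eps (m : ℤ) : ℤ := if Even m then 1 else -1

lemma eps_mul_self (m : ℤ) : eps m * eps m = 1 := by unfold eps; split_ifs <;> rfl

/-- The odd one among the edge `t` and its head `b`. -/
def citem (m : ℤ) (t b : ℕ) : ℕ ⊕ ℕ := if Even m then inr t else inl b

@[simp] lemma one_symm_apply {α : Type*} (x : α) : (Equiv.symm (1 : Perm α)) x = x := rfl

namespace NG

variable {k : ℕ}
variable {X : NG k} {m : ℤ} {t : ℕ} {σ ρ : Perm ℕ} {f : ℕ → Bool} {a : ℕ} {s : Bool}

/-- Two graphs that differ only in meaningless values. -/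
structure Agree (X X' : NG k) : Prop where
  V_eq : X.V = X'.V
  E_eq : X.E = X'.E
  ends_eq : ∀ a ∈ X.E, X.ends a = X'.ends a
  col_eq : ∀ a ∈ X.E, ∀ c, X.col c a = X'.col c a
  ty_eq : ∀ a ∈ X.E, X.ty a = X'.ty a

lemma Agree.refl (X : NG k) : Agree X X :=
  ⟨rfl, rfl, fun _ _ => rfl, fun _ _ _ => rfl, fun _ _ => rfl⟩

lemma Agree.symm {X X' : NG k} (h : Agree X X') : Agree X' X :=
  ⟨h.V_eq.symm, h.E_eq.symm, fun a ha => (h.ends_eq a (h.E_eq ▸ ha)).symm, fun a ha c => (h.col_eq a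
    (h.E_eq ▸ ha) c).symm, fun a ha => (h.ty_eq a (h.E_eq ▸ ha)).symm⟩

/-- All ends of edges are vertices. -/
def Closed (X : NG k) : Prop := ∀ a ∈ X.E, ∀ s, X.ends a s ∈ X.V

def solid (X : NG k) : Finset ℕ := X.E.filter fun a => X.ty a ≠ none

def dotted (X : NG k) : Finset ℕ := X.E.filter fun a => X.ty a = none

/-- The odd vertices and edges. -/
def items (m : ℤ) (X : NG k) : Finset (ℕ ⊕ ℕ) :=
  if Even m then (∅ : Finset ℕ).disjSum X.solid else X.V.disjSum X.dotted

/-- Relabelling, with reversal of the intrinsic orientation of the edges `a` with `f a`. -/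
@[simps] def ren (σ ρ : Perm ℕ) (f : ℕ → Bool) (X : NG k) : NG k where
  V := X.V.map σ.toEmbedding
  E := X.E.map ρ.toEmbedding
  ends a s := σ (X.ends (ρ.symm a) (xor (f (ρ.symm a)) s))
  col c a := xor (f (ρ.symm a)) (X.col c (ρ.symm a))
  ty a := (X.ty (ρ.symm a)).map (xor (f (ρ.symm a)))

/-- The sign of reversing intrinsic orientations. -/
def fsgn (m : ℤ) (f : ℕ → Bool) (X : NG k) : ℤ :=
  if Even m then ∏ a ∈ X.dotted, (if f a then -1 else 1) else 1

lemma aft_lx_anticomm (O : Finset (ℕ ⊕ ℕ)) {c d : ℕ ⊕ ℕ} (h : c ≠ d) : aft lx O c * aft lx (tog O c) d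
    = -(aft lx O d * aft lx (tog O d) c) := aft_anticomm lx_injective O h

/-- The sign of a relabelling. -/
def sgn (m : ℤ) (σ ρ : Perm ℕ) (f : ℕ → Bool) (X : NG k) : ℤ :=
  kap (X.items m) lx (lx ∘ Sum.map σ ρ) * X.fsgn m f

/-- Remove the edge `t` and replace its end `b` by `a`. -/
@[simps V E ty col] def contract (X : NG k) (t a b : ℕ) : NG k where
  V := X.V.erase b
  E := X.E.erase t
  ends i s := if X.ends i s = b then a else X.ends i s
  col := X.col
  ty := X.ty

/-- Replace the end `s` of the edge `t` by the other end. -/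
notation:max "ctr(" X "," t "," s ")" => NG.contract X t (NG.ends X t !s) (NG.ends X t s)

/-- Change the type of the edge `t`. -/
@[simps V E ends col] def setTy (X : NG k) (t : ℕ) (o : Option Bool) : NG k :=
  { X with ty := update X.ty t o }

lemma mem_solid : a ∈ X.solid ↔ a ∈ X.E ∧ X.ty a ≠ none := by simp [solid]

lemma mem_dotted : a ∈ X.dotted ↔ a ∈ X.E ∧ X.ty a = none := by simp [dotted]

lemma inl_mem_items {x : ℕ} : inl x ∈ X.items m ↔ ¬ Even m ∧ x ∈ X.V := by
  unfold items; split_ifs with h <;> simp [h, -Finset.empty_disjSum]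

lemma inr_mem_items : inr a ∈ X.items m ↔ a ∈ X.E ∧ (Even m ↔ X.ty a ≠ none) := by
  unfold items; split_ifs with h <;> simp [h, mem_solid, mem_dotted, -Finset.empty_disjSum]

lemma Agree.dotted_eq {X X' : NG k} (h : Agree X X') : X.dotted = X'.dotted := by
  ext a
  simp only [mem_dotted, ← h.E_eq]
  exact and_congr_right fun ha => by rw [h.ty_eq a ha]

lemma Agree.solid_eq {X X' : NG k} (h : Agree X X') : X.solid = X'.solid := by
  ext a
  simp only [mem_solid, ← h.E_eq]
  exact and_congr_right fun ha => by rw [h.ty_eq a ha]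

lemma Agree.items_eq {X X' : NG k} (h : Agree X X') (m : ℤ) : X.items m = X'.items m := by
  simp only [items, h.dotted_eq, h.solid_eq, h.V_eq]

lemma Agree.sgn_eq {X X' : NG k} (h : Agree X X') (m : ℤ) (σ ρ : Perm ℕ) (f : ℕ → Bool) : X.sgn m σ
    ρ f = X'.sgn m σ ρ f := by
  simp only [sgn, fsgn, h.items_eq, h.dotted_eq]

lemma Agree.closed {X X' : NG k} (h : Agree X X') (hc : X'.Closed) : X.Closed := fun a ha s => by
  rw [h.ends_eq a ha, h.V_eq]; exact hc a (h.E_eq ▸ ha) s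

lemma Closed.ren (h : X.Closed) (σ ρ : Perm ℕ) (f : ℕ → Bool) : (X.ren σ ρ f).Closed := by
  intro a ha s
  simp only [NG.ren, mem_map_equiv] at ha ⊢
  simpa using h _ ha _

lemma Closed.setTy (h : X.Closed) (t : ℕ) (o : Option Bool) : (X.setTy t o).Closed := h

lemma Closed.contract (h : X.Closed) {t a b : ℕ} (ha : a ∈ X.V) (hab : a ≠ b) : (X.contract t a
    b).Closed := by
  intro i hi s
  simp only [NG.contract, mem_erase] at hi ⊢
  split_ifs with hb
  · grind
  · exact ⟨hb, h i hi.2 s⟩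

lemma items_ren (m : ℤ) (σ ρ : Perm ℕ) (f : ℕ → Bool) (X : NG k) : (X.ren σ ρ f).items m = (X.items
    m).map (sumCongr σ ρ).toEmbedding := by
  ext (x | x)
  · rw [mem_map_equiv]
    simp [inl_mem_items, ren]
  · rw [mem_map_equiv]
    simp [inr_mem_items, ren]

lemma dotted_ren (σ ρ : Perm ℕ) (f : ℕ → Bool) (X : NG k) : (X.ren σ ρ f).dotted = X.dotted.map
    ρ.toEmbedding := by
  ext x
  rw [mem_map_equiv]
  simp [mem_dotted, ren]

lemma ren_ren (σ ρ σ' ρ' : Perm ℕ) (f f' : ℕ → Bool) (X : NG k) : (X.ren σ ρ f).ren σ' ρ' f' = X.ren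
    (σ.trans σ') (ρ.trans ρ') (fun a => xor (f a) (f' (ρ a))) := by
  ext1
  · simp [ren, map_map]
  · simp [ren, map_map]
  · funext a s; simp [ren]
  · funext c a; simp [ren, Bool.xor_left_comm]
  · funext a
    simp only [ren, Option.map_map, Equiv.symm_trans_apply, apply_symm_apply]
    congr 1
    funext s
    simp [Bool.xor_left_comm]

lemma Agree.ren {X X' : NG k} (h : Agree X X') (σ ρ : Perm ℕ) (f : ℕ → Bool) : Agree (X.ren σ ρ f)
    (X'.ren σ ρ f) := by
  have key : ∀ a ∈ (X.ren σ ρ f).E, ρ.symm a ∈ X.E := fun a ha => by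
    simpa [mem_map_equiv] using ha
  refine ⟨by simp [h.V_eq], by simp [h.E_eq], fun a ha => ?_, fun a ha c => ?_,
    fun a ha => ?_⟩
  · funext s; simp [h.ends_eq _ (key a ha)]
  · simp [h.col_eq _ (key a ha)]
  · simp [h.ty_eq _ (key a ha)]

lemma fsgn_mul (m : ℤ) (σ ρ : Perm ℕ) (f f' : ℕ → Bool) (X : NG k) : (X.ren σ ρ f).fsgn m f' *
    X.fsgn m f = X.fsgn m (fun a => xor (f a) (f' (ρ a))) := by
  unfold fsgn
  split_ifs with h
  · rw [dotted_ren, prod_map, ← prod_mul_distrib]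
    refine prod_congr rfl fun a _ => ?_
    simp only [coe_toEmbedding]
    split_ifs <;> simp_all
  · rfl

lemma sgn_mul (m : ℤ) (σ ρ σ' ρ' : Perm ℕ) (f f' : ℕ → Bool) (X : NG k) : (X.ren σ ρ f).sgn m σ' ρ'
    f' * X.sgn m σ ρ f = X.sgn m (σ.trans σ') (ρ.trans ρ') (fun a => xor (f a) (f' (ρ a))) := by
  rw [sgn, sgn, sgn, ← fsgn_mul, items_ren, kap_map]
  have h := kap_comp (S := X.items m) (F := lx) (G := lx ∘ Sum.map σ ρ)
    (H := lx ∘ Sum.map (σ.trans σ') (ρ.trans ρ')) lx_injective.injOn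
    (lx_injective.comp (map_injective.2 ⟨σ.injective, ρ.injective⟩)).injOn
    (lx_injective.comp (map_injective.2 ⟨(σ.trans σ').injective, (ρ.trans ρ').injective⟩)).injOn
  rw [← h]
  have e : (lx ∘ Sum.map σ' ρ') ∘ (sumCongr σ ρ).toEmbedding =
      lx ∘ Sum.map (σ.trans σ') (ρ.trans ρ') := by
    funext x; rcases x with x | x <;> rfl
  have e' : (lx : ℕ ⊕ ℕ → _) ∘ (sumCongr σ ρ).toEmbedding = lx ∘ Sum.map σ ρ := by
    funext x; rcases x with x | x <;> rfl
  rw [e, e']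
  ring

lemma fsgn_mul_self (m : ℤ) (f : ℕ → Bool) (X : NG k) : X.fsgn m f * X.fsgn m f = 1 := by
  unfold fsgn
  split_ifs
  · rw [← prod_mul_distrib]
    exact prod_eq_one fun a _ => by split_ifs <;> rfl
  · rfl

lemma sgn_mul_self (m : ℤ) (σ ρ : Perm ℕ) (f : ℕ → Bool) (X : NG k) : X.sgn m σ ρ f * X.sgn m σ ρ f
    = 1 := by
  unfold sgn
  linear_combination (X.fsgn m f * X.fsgn m f) * kap_mul_self (X.items m) lx (lx ∘ Sum.map σ ρ) +
    fsgn_mul_self m f X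

lemma ren_one (X : NG k) : X.ren 1 1 (fun _ => false) = X := by
  ext1
  · ext x; simp [ren, mem_map_equiv]
  · ext x; simp [ren, mem_map_equiv]
  · funext a s; simp [ren]
  · funext c a; simp [ren]
  · funext a
    simp only [ren]
    have : xor false = id := by grind
    simp [this]

lemma sgn_flip (m : ℤ) (f : ℕ → Bool) (X : NG k) : X.sgn m 1 1 f = X.fsgn m f := by
  rw [sgn]
  have : (lx ∘ Sum.map (1 : Perm ℕ) (1 : Perm ℕ) : ℕ ⊕ ℕ → _) = lx := by
    funext x; rcases x with x | x <;> rfl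
  rw [this, kap_self, one_mul]

@[simp] lemma fsgn_false (m : ℤ) (X : NG k) : X.fsgn m (fun _ => false) = 1 := by simp [fsgn]

lemma sgn_one (m : ℤ) (X : NG k) : X.sgn m 1 1 (fun _ => false) = 1 := by
  rw [sgn_flip, fsgn_false]

/-! #### Items and elementary operations -/

lemma items_setTy (ht : t ∈ X.E) {o : Option Bool} (h : X.ty t = none ↔ o ≠ none) : (X.setTy t
    o).items m = tog (X.items m) (inr t) := by
  ext (x | x)
  · simp [mem_tog, inl_mem_items, setTy]
  · rw [mem_tog, inr_mem_items, inr_mem_items]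
    by_cases hx : x = t
    · subst hx; simp [setTy, ht]; tauto
    · simp [setTy, hx]

lemma items_contract (ht : t ∈ X.solid) (a : ℕ) {b : ℕ} (hb : b ∈ X.V) : (X.contract t a b).items m
    = tog (X.items m) (citem m t b) := by
  rw [mem_solid] at ht
  ext (x | x)
  · rw [mem_tog, inl_mem_items, inl_mem_items]
    by_cases hm : Even m
    · simp [contract, citem, hm]
    · by_cases hx : x = b
      · subst hx; simp [contract, citem, hm, hb]
      · simp [contract, citem, hm, hx]
  · rw [mem_tog, inr_mem_items, inr_mem_items]
    by_cases hx : x = t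
    · subst hx; by_cases hm : Even m <;> simp [contract, citem, hm, ht]
    · by_cases hm : Even m <;> simp [contract, citem, hm, hx]

lemma aft_items_ren (c : ℕ ⊕ ℕ) : aft lx ((X.ren σ ρ f).items m) (Sum.map σ ρ c) * kap (tog (X.items
    m) c) lx (lx ∘ Sum.map σ ρ) = kap (X.items m) lx (lx ∘ Sum.map σ ρ) * aft lx (X.items m) c := by
  have e' : (lx : ℕ ⊕ ℕ → _) ∘ (sumCongr σ ρ).toEmbedding = lx ∘ Sum.map σ ρ := by
    funext x; rcases x with x | x <;> rfl
  have e : (Sum.map σ ρ c) = (sumCongr σ ρ).toEmbedding c := by rcases c with x | x <;> rfl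
  rw [items_ren, e, aft_map, e', kap_tog lx_injective (lx_injective.comp (map_injective.2
    ⟨σ.injective, ρ.injective⟩))]
  linear_combination (kap (X.items m) lx (lx ∘ Sum.map σ ρ) * aft lx (X.items m) c) *
    aft_mul_self (lx ∘ Sum.map σ ρ) (X.items m) c

lemma fsgn_contract (ht : t ∈ X.solid) (a b : ℕ) (f : ℕ → Bool) : (X.contract t a b).fsgn m f =
    X.fsgn m f := by
  have : (X.contract t a b).dotted = X.dotted := by
    ext x
    rw [mem_solid] at ht
    simp only [mem_dotted, contract, mem_erase]
    constructor
    · grind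
    · grind
  simp only [fsgn, this]

lemma dotted_setTy_some (t : ℕ) (s : Bool) : (X.setTy t (some s)).dotted = X.dotted.erase t := by
  ext x
  by_cases hx : x = t
  · subst hx; simp [mem_dotted, setTy]
  · simp [mem_dotted, setTy, hx]

lemma fsgn_setTy (ht : t ∈ X.dotted) (s : Bool) (f : ℕ → Bool) : X.fsgn m f = (if f t then - eps m
    else 1) * (X.setTy t (some s)).fsgn m f := by
  simp only [fsgn, dotted_setTy_some, eps]
  by_cases hm : Even m
  · simp only [hm, if_true]
    rw [← mul_prod_erase _ _ ht]
  · simp [hm]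

lemma citem_map (m : ℤ) (σ ρ : Perm ℕ) (t b : ℕ) : Sum.map σ ρ (citem m t b) = citem m (ρ t) (σ b)
    := by
  unfold citem; split_ifs <;> rfl

lemma Agree.contract {X X' : NG k} (h : Agree X' (X.ren σ ρ f)) (t a b : ℕ) : Agree (X'.contract (ρ
    t) (σ a) (σ b)) ((X.contract t a b).ren σ ρ f) := by
  have hE : ∀ i ∈ (X'.contract (ρ t) (σ a) (σ b)).E, i ∈ X'.E := fun i hi =>
    mem_of_mem_erase hi
  refine ⟨?_, ?_, fun i hi => ?_, fun i hi c => h.col_eq i (hE i hi) c, fun i hi => h.ty_eq i (hE i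
    hi)⟩
  · simp [NG.contract, h.V_eq, map_erase]
  · simp [NG.contract, h.E_eq, map_erase]
  · funext s
    simp only [NG.contract, NG.ren, h.ends_eq i (hE i hi), EmbeddingLike.apply_eq_iff_eq]
    split_ifs <;> rfl

lemma Agree.setTy {X X' : NG k} (h : Agree X' (X.ren σ ρ f)) (t : ℕ) (o : Option Bool) : Agree
    (X'.setTy (ρ t) (o.map (xor (f t)))) ((X.setTy t o).ren σ ρ f) := by
  refine ⟨h.V_eq, h.E_eq, h.ends_eq, h.col_eq, fun i hi => ?_⟩
  have := h.ty_eq i hi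
  by_cases hi' : i = ρ t
  · subst hi'; simp [NG.setTy]
  · have : ρ.symm i ≠ t := by grind
    simp_all [NG.setTy]

end NG

/-! ### The differential on functions of graphs -/

variable {k : ℕ} {M : Type*} [AddCommGroup M]

open NG

/-- A function of graphs that changes by the sign under relabelling. -/
def Alt (m : ℤ) (ψ : NG k → M) : Prop :=
  ∀ (X X' : NG k) (σ ρ : Perm ℕ) (f : ℕ → Bool), X.Closed → Agree X' (X.ren σ ρ f) →
    ψ X' = X.sgn m σ ρ f • ψ X

/-- A function of graphs that changes by the sign under relabelling of the vertices. -/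
def VAlt (m : ℤ) (ψ : NG k → M) : Prop :=
  ∀ (X X' : NG k) (σ : Perm ℕ), X.Closed → Agree X' (X.ren σ 1 fun _ => false) →
    ψ X' = X.sgn m σ 1 (fun _ => false) • ψ X

lemma Alt.vAlt {ψ : NG k → M} (h : Alt m ψ) : VAlt m ψ :=
  fun X X' σ hc ha => h X X' σ 1 _ hc ha

lemma VAlt.congr {ψ : NG k → M} (h : VAlt m ψ) {X X' : NG k} (hc : X.Closed) (ha : Agree X' X) : ψ
    X' = ψ X := by
  have := h X X' 1 hc (by rwa [ren_one])
  rwa [sgn_one, one_smul] at this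

/-- The contribution of the edge `t` to the differential. -/
def term (m : ℤ) (ψ : NG k → M) (t : ℕ) (X : NG k) : M :=
  if t ∉ X.E then 0 else
    match X.ty t with
    | none => aft lx (X.items m) (inr t) •
        (ψ (X.setTy t (some true)) - eps m • ψ (X.setTy t (some false)))
    | some s => if X.ends t false = X.ends t true then 0 else
        aft lx (X.items m) (citem m t (X.ends t s)) •
          ψ ctr(X, t, s)

/-- The differential. -/
def del (m : ℤ) (ψ : NG k → M) (X : NG k) : M := ∑ t ∈ X.E, term m ψ t X

lemma term_of_notMem {ψ : NG k → M} (h : t ∉ X.E) : term m ψ t X = 0 := by simp [term, h]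

lemma term_none {ψ : NG k → M} (h : t ∈ X.E) (h' : X.ty t = none) : term m ψ t X = aft lx (X.items
    m) (inr t) • (ψ (X.setTy t (some true)) - eps m • ψ (X.setTy t (some false))) := by
  simp [term, h, h']

lemma term_tadpole {ψ : NG k → M} (h' : X.ty t ≠ none) (h : X.ends t false = X.ends t true) : term m
    ψ t X = 0 := by
  obtain ⟨s, hs⟩ := ne_none_iff_exists'.1 h'
  simp [term, hs, h]

lemma term_some {ψ : NG k → M} (h : t ∈ X.E) (h' : X.ty t = some s) (h'' : X.ends t false ≠ X.ends t
    true) : term m ψ t X = aft lx (X.items m) (citem m t (X.ends t s)) • ψ ctr(X, t, s) := by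
  simp [term, h, h', h'']

section

variable {X X' : NG k} {σ ρ : Perm ℕ} {f : ℕ → Bool} {a : ℕ}

lemma NG.Agree.mem_E (h : Agree X' (X.ren σ ρ f)) : ρ a ∈ X'.E ↔ a ∈ X.E := by simp [h.E_eq]

lemma NG.Agree.ends_apply (h : Agree X' (X.ren σ ρ f)) (ha : a ∈ X.E) (s : Bool) : X'.ends (ρ a) s =
    σ (X.ends a (xor (f a) s)) := by simp [h.ends_eq _ (h.mem_E.2 ha)]

lemma NG.Agree.col_apply (h : Agree X' (X.ren σ ρ f)) (ha : a ∈ X.E) (c : Fin k) : X'.col c (ρ a) =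
    xor (f a) (X.col c a) := by simp [h.col_eq _ (h.mem_E.2 ha)]

lemma NG.Agree.ty_apply (h : Agree X' (X.ren σ ρ f)) (ha : a ∈ X.E) : X'.ty (ρ a) = (X.ty a).map (xor
    (f a)) := by simp [h.ty_eq _ (h.mem_E.2 ha)]

end

lemma ends_ne_not {X : NG k} {t : ℕ} (h : X.ends t false ≠ X.ends t true) (s : Bool) : X.ends t (!s)
    ≠ X.ends t s := by cases s; exacts [h.symm, h]

lemma term_ren {m : ℤ} {ψ : NG k → M} (hψ : Alt m ψ) {X X' : NG k} {σ ρ : Perm ℕ} {f : ℕ → Bool} (hc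
    : X.Closed) (h : Agree X' (X.ren σ ρ f)) (t : ℕ) : term m ψ (ρ t) X' = X.sgn m σ ρ f • term m ψ
    t X := by
  have hE : ρ t ∈ X'.E ↔ t ∈ X.E := h.mem_E
  by_cases ht : t ∈ X.E
  swap
  · rw [term_of_notMem ht, term_of_notMem (by rwa [hE]), smul_zero]
  have ht' := hE.2 ht
  have hty := h.ty_apply ht
  have hends := h.ends_apply ht
  rcases hs : X.ty t with _ | s
  · rw [term_none ht hs, term_none ht' (by rw [hty, hs]; rfl)]
    have key : ∀ s, ψ (X'.setTy (ρ t) (some (xor (f t) s))) =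
        (X.setTy t (some s)).sgn m σ ρ f • ψ (X.setTy t (some s)) := fun s =>
      hψ _ _ σ ρ f (hc.setTy _ _) (h.setTy t (some s))
    have hd : t ∈ X.dotted := mem_dotted.2 ⟨ht, hs⟩
    have hsg : ∀ s, aft lx (X'.items m) (inr (ρ t)) * (X.setTy t (some s)).sgn m σ ρ f *
        (if f t then - eps m else 1) = X.sgn m σ ρ f * aft lx (X.items m) (inr t) := fun s => by
      rw [sgn, sgn, fsgn_setTy hd s, items_setTy ht (by simp [hs]), h.items_eq]
      have := aft_items_ren (m := m) (σ := σ) (ρ := ρ) (f := f) (X := X) (inr t)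
      simp only [map_inr] at this
      linear_combination (if f t then - eps m else 1) * (X.setTy t (some s)).fsgn m f * this
    have k1 := key true
    have k2 := key false
    have s1 := hsg true
    have s2 := hsg false
    cases hf : f t
    · simp only [hf, Bool.false_xor, mul_one, false_eq_true, if_false] at k1 k2 s1 s2
      rw [k1, k2]
      linear_combination (norm := module) s1 • ψ (X.setTy t (some true)) -
        eps m • s2 • ψ (X.setTy t (some false))
    · simp only [hf, Bool.true_xor, Bool.not_true, Bool.not_false, if_true] at k1 k2 s1 s2
      rw [k1, k2]
      have e1 : aft lx (X'.items m) (inr (ρ t)) * (X.setTy t (some false)).sgn m σ ρ f =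
          -(X.sgn m σ ρ f * aft lx (X.items m) (inr t) * eps m) := by
        linear_combination (-(eps m)) * s2 - (aft lx (X'.items m) (inr (ρ t)) * (X.setTy t (some
          false)).sgn m σ ρ f) * eps_mul_self m
      linear_combination (norm := module) s1 • ψ (X.setTy t (some true)) +
        e1 • ψ (X.setTy t (some false))
  · by_cases htad : X.ends t false = X.ends t true
    · rw [term_tadpole (by simp [hs]) htad, term_tadpole (by simp [hty, hs]), smul_zero]
      rw [hends, hends]
      cases f t <;> simp [htad]
    · have hty' : X'.ty (ρ t) = some (xor (f t) s) := by grind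
      rw [term_some ht hs htad, term_some ht' hty']
      · have e1 : X'.ends (ρ t) (xor (f t) s) = σ (X.ends t s) := by rw [hends]; simp
        have e2 : X'.ends (ρ t) (!(xor (f t) s)) = σ (X.ends t !s) := by
          rw [hends]; congr 2; cases f t <;> simp
        rw [e1, e2, hψ _ _ σ ρ f (hc.contract (hc t ht _) (ends_ne_not htad s)) (h.contract t _ _),
          smul_smul, smul_smul]
        congr 1
        have hsol : t ∈ X.solid := mem_solid.2 ⟨ht, by simp [hs]⟩
        rw [sgn, sgn, fsgn_contract hsol, items_contract hsol _ (hc t ht s), h.items_eq, ←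
          citem_map]
        linear_combination (X.fsgn m f) * aft_items_ren (m := m) (σ := σ) (ρ := ρ) (f := f)
          (X := X) (citem m t (X.ends t s))
      · rw [hends, hends]
        cases f t <;> simp <;> first | exact htad | exact fun h => htad h.symm

lemma Alt.del {ψ : NG k → M} (hψ : Alt m ψ) : Alt m (del m ψ) := by
  intro X X' σ ρ f hc h
  rw [OrientedGC.del, OrientedGC.del, h.E_eq, NG.ren, sum_map, smul_sum]
  exact sum_congr rfl fun t _ => term_ren hψ hc h t

lemma Alt.vAlt_term {ψ : NG k → M} (hψ : Alt m ψ) (t : ℕ) : VAlt m (term m ψ t) :=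
  fun _ _ _ hc h => term_ren hψ hc h t

lemma sum_map_swap_one (a b : ℕ) : (Sum.map (swap a b) (1 : Perm ℕ) : ℕ ⊕ ℕ → ℕ ⊕ ℕ) = swap (inl a)
    (inl b) := by
  funext x
  rcases x with x | x
  · grind
  · rw [swap_apply_of_ne_of_ne (by simp) (by simp)]; rfl

lemma sum_map_one_swap (a b : ℕ) : (Sum.map (1 : Perm ℕ) (swap a b) : ℕ ⊕ ℕ → ℕ ⊕ ℕ) = swap (inr a)
    (inr b) := by
  funext x
  rcases x with x | x
  · rw [swap_apply_of_ne_of_ne (by simp) (by simp)]; rfl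
  · grind

lemma agree_contract_swap {X : NG k} {t a b : ℕ} (ha : a ∈ X.V) (hb : b ∈ X.V) (hab : a ≠ b) : Agree
    (X.contract t b a) ((X.contract t a b).ren (swap a b) 1 fun _ => false) := by
  refine ⟨?_, ?_, fun i hi => ?_, fun i hi c => ?_, fun i hi => ?_⟩
  · ext x
    simp only [contract, ren, mem_erase, mem_map_equiv, symm_swap]
    rcases eq_or_ne x a with rfl | hxa
    · simp
    · grind
  · ext x; simp [contract, ren, mem_map_equiv]
  · funext s
    simp only [contract, ren, Bool.false_xor]
    rcases eq_or_ne (X.ends i s) a with h | hxa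
    · simp [h, hab]
    · rcases eq_or_ne (X.ends i s) b with h | hxb
      · simp [h, hab.symm]
      · simp [swap_apply_of_ne_of_ne hxa hxb, hxa, hxb]
  · simp [contract, ren]
  · have : xor false = id := by grind
    simp [contract, ren, this]

lemma aft_mul_sgn_swap {m : ℤ} {X : NG k} {t a b : ℕ} (ht : t ∈ X.solid) (ha : a ∈ X.V) (hb : b ∈
    X.V) (hab : a ≠ b) : aft lx (X.items m) (citem m t a) * (X.contract t a b).sgn m (swap a b) 1
    (fun _ => false) = eps m * aft lx (X.items m) (citem m t b) := by
  rw [sgn, fsgn_false, mul_one, items_contract ht _ hb, sum_map_swap_one]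
  unfold citem eps
  by_cases hm : Even m
  · simp only [hm, if_true]
    rw [kap_swap_of_notMem]
    · ring
    · simp [mem_tog, inl_mem_items, hm]
    · simp [mem_tog, inl_mem_items, hm]
  · simp only [hm, if_false]
    set O := X.items m
    have haO : inl a ∈ O := inl_mem_items.2 ⟨hm, ha⟩
    have hbO : inl b ∈ O := inl_mem_items.2 ⟨hm, hb⟩
    have h1 := kap_swap_tog (F := (lx : ℕ ⊕ ℕ → _)) lx_injective (a := inl a) (b := inl b)
      (S := tog (tog O (inl b)) (inl a))
      (by simp [mem_tog, haO, hab]) (by simp [mem_tog, hbO, hab.symm]) (by simpa using hab)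
    rw [tog_tog] at h1
    rw [h1, aft_tog_self, tog_comm, aft_tog_self]
    have h2 := aft_lx_anticomm O (c := inl a)
      (d := inl b) (by simpa using hab)
    linear_combination aft lx (tog O (inl b)) (inl a) * h2 -
      aft lx O (inl b) * aft_mul_self lx (tog O (inl b)) (inl a)

/-- Contracting an edge in the opposite direction changes the sign by `(-1) ^ m`. -/
lemma VAlt.contract_swap {m : ℤ} {χ : NG k → M} (hχ : VAlt m χ) {X : NG k} (hc : X.Closed) {t a b :
    ℕ} (ht : t ∈ X.solid) (ha : a ∈ X.V) (hb : b ∈ X.V) (hab : a ≠ b) : aft lx (X.items m) (citem m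
    t a) • χ (X.contract t b a) = eps m • aft lx (X.items m) (citem m t b) • χ (X.contract t a b) :=
    by
  rw [hχ _ _ _ (hc.contract ha hab) (agree_contract_swap ha hb hab), smul_smul, smul_smul,
    aft_mul_sgn_swap ht ha hb hab]

/-- The contribution of a solid edge, computed by contraction in either direction. -/
lemma VAlt.term_solid {m : ℤ} {χ : NG k → M} (hχ : VAlt m χ) {X : NG k} (hc : X.Closed) {t : ℕ} (ht
    : t ∈ X.E) {s : Bool} (hs : X.ty t = some s) (htad : X.ends t false ≠ X.ends t true) (u : Bool)
    : term m χ t X = (if s = u then 1 else eps m) • aft lx (X.items m) (citem m t (X.ends t u)) • χ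
    ctr(X, t, u) := by
  rw [term_some ht hs htad]
  by_cases hu : s = u
  · subst hu; simp
  · have hsu : s = !u := by cases s <;> cases u <;> simp_all
    subst hsu
    rw [if_neg hu, Bool.not_not]
    exact hχ.contract_swap hc (mem_solid.2 ⟨ht, by simp [hs]⟩) (hc t ht _) (hc t ht _)
      (ends_ne_not htad u)

end

section

open NG

variable {k : ℕ} {M : Type*} [AddCommGroup M]
variable {X : NG k} {w i j : ℕ} {t t' : ℕ}

/-! ### The differential squares to zero -/

namespace NG

@[simp] lemma setTy_ty_self (X : NG k) (t : ℕ) (o : Option Bool) : (X.setTy t o).ty t = o := by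
  simp [setTy]
lemma setTy_ty_ne (X : NG k) {t i : ℕ} (h : i ≠ t) (o : Option Bool) : (X.setTy t o).ty i = X.ty i
    := by
  simp [setTy, h]
lemma setTy_comm (X : NG k) (h : t ≠ t') (o o' : Option Bool) : (X.setTy t o).setTy t' o' = (X.setTy
    t' o').setTy t o := by
  simp only [setTy]
  rw [update_comm h]
@[simp] lemma setTy_setTy (X : NG k) (t : ℕ) (o o' : Option Bool) : (X.setTy t o).setTy t o' =
    X.setTy t o' := by
  simp [setTy]
lemma setTy_eq_self (X : NG k) {t : ℕ} {o : Option Bool} (h : X.ty t = o) : X.setTy t o = X := by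
  subst h; simp [setTy]
lemma contract_ends (X : NG k) (t a b i : ℕ) (s : Bool) : (X.contract t a b).ends i s = if X.ends i
    s = b then a else X.ends i s := rfl
lemma contract_setTy (X : NG k) (t a b i : ℕ) (o : Option Bool) : (X.setTy i o).contract t a b =
    (X.contract t a b).setTy i o := rfl

lemma contract_comm (X : NG k) {t t' a b a' b' : ℕ} (h1 : b ≠ a') (h2 : b' ≠ a) (h3 : b ≠ b') :
    (X.contract t a b).contract t' a' b' = (X.contract t' a' b').contract t a b := by
  ext1
  · exact erase_right_comm
  · exact erase_right_comm
  · funext i s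
    simp only [contract_ends]
    grind
  · rfl
  · rfl

lemma setTy_dotted_items {m : ℤ} {t : ℕ} (ht : t ∈ X.E) (h : X.ty t = none) (s : Bool) : (X.setTy t
    (some s)).items m = tog (X.items m) (inr t) :=
  items_setTy ht (by simp [h])

end NG

lemma citem_ne {m : ℤ} {t t' b b' : ℕ} (h : t ≠ t') (h' : b ≠ b') : citem m t b ≠ citem m t' b' :=
    by
  unfold citem; split_ifs <;> simpa

lemma inr_ne_citem {m : ℤ} {t t' b : ℕ} (h : t ≠ t') : inr t ≠ citem m t' b := by
  unfold citem; split_ifs <;> simp [h]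

lemma term_term_none_none {m : ℤ} (ψ : NG k → M) (ht : t ∈ X.E) (ht' : t' ∈ X.E) (hne : t ≠ t') (h :
    X.ty t = none) (h' : X.ty t' = none) : term m (term m ψ t') t X + term m (term m ψ t) t' X = 0
    := by
  have e1 : ∀ s, term m ψ t' (X.setTy t (some s)) = _ := fun s =>
    term_none (X := X.setTy t (some s)) (ψ := ψ) (m := m) (t := t') ht'
      (by rw [setTy_ty_ne _ hne.symm, h'])
  have e2 : ∀ s, term m ψ t (X.setTy t' (some s)) = _ := fun s =>
    term_none (X := X.setTy t' (some s)) (ψ := ψ) (m := m) (t := t) ht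
      (by rw [setTy_ty_ne _ hne, h])
  rw [term_none ht h, term_none ht' h', e1, e1, e2, e2]
  simp only [setTy_dotted_items ht h, setTy_dotted_items ht' h', setTy_comm X hne.symm]
  have key := aft_lx_anticomm (X.items m)
    (c := inr t) (d := inr t') (by simpa using hne)
  linear_combination (norm := module) key •
    (ψ ((X.setTy t (some true)).setTy t' (some true)) - eps m • ψ ((X.setTy t (some true)).setTy t'
     (some false)) - eps m • ψ ((X.setTy t (some false)).setTy t' (some true)) + (eps m * eps m) • ψ
     ((X.setTy t (some false)).setTy t' (some false)))

lemma term_term_none_some {m : ℤ} (ψ : NG k → M) (hc : X.Closed) (ht : t ∈ X.E) (ht' : t' ∈ X.E)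
    (hne : t ≠ t') (h : X.ty t = none) (h' : X.ty t' ≠ none) : term m (term m ψ t') t X + term m
    (term m ψ t) t' X = 0 := by
  by_cases htad : X.ends t' false = X.ends t' true
  · rw [term_tadpole h' htad, term_none ht h,
      term_tadpole (X := X.setTy t (some true)) (by rwa [setTy_ty_ne _ hne.symm]) htad,
      term_tadpole (X := X.setTy t (some false)) (by rwa [setTy_ty_ne _ hne.symm]) htad]
    simp
  obtain ⟨s, hs⟩ := ne_none_iff_exists'.1 h'
  have e1 : ∀ s', term m ψ t' (X.setTy t (some s')) = _ := fun s' =>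
    term_some (X := X.setTy t (some s')) (ψ := ψ) (m := m) (t := t') (s := s) ht'
      (by rw [setTy_ty_ne _ hne.symm, hs]) htad
  have e2 : term m ψ t ctr(X, t', s) = _ :=
    term_none (by simp [ht, hne]) (by simp [h])
  rw [term_none ht h, term_some ht' hs htad, e1, e1, e2]
  simp only [setTy_dotted_items ht h, setTy_ends, contract_setTy,
    items_contract (m := m) (mem_solid.2 ⟨ht', h'⟩) (X.ends t' !s) (hc t' ht' s)]
  have key := aft_lx_anticomm (X.items m)
    (c := inr t) (d := citem m t' (X.ends t' s)) (inr_ne_citem hne)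
  linear_combination (norm := module) key •
    (ψ (ctr(X, t', s).setTy t (some true)) - eps m • ψ (ctr(X, t', s).setTy t (some false)))

lemma exists_ends_notMem {p q : Bool → ℕ} (hp : p false ≠ p true) (hq : q false ≠ q true) (h : ¬ ((p
    false = q false ∧ p true = q true) ∨ (p false = q true ∧ p true = q false))) : ∃ u u', (∀ s, p u
    ≠ q s) ∧ ∀ s, q u' ≠ p s := by
  simp only [Bool.exists_bool, Bool.forall_bool]
  omega

lemma term_contract_tadpole {m : ℤ} (ψ : NG k → M) (h' : X.ty t' ≠ none) (htad : X.ends t false ≠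
    X.ends t true) (h : (X.ends t false = X.ends t' false ∧ X.ends t true = X.ends t' true) ∨
    (X.ends t false = X.ends t' true ∧ X.ends t true = X.ends t' false)) (s : Bool) : term m ψ t'
    ctr(X, t, s) = 0 := by
  refine term_tadpole (X := X.contract t _ _) h' ?_
  simp only [contract_ends]
  cases s <;> simp only [Bool.not_true, Bool.not_false] <;> grind

lemma term_term_some_some {m : ℤ} {ψ : NG k → M} (hψ : Alt m ψ) (hc : X.Closed) (ht : t ∈ X.E) (ht'
    : t' ∈ X.E) (hne : t ≠ t') (h : X.ty t ≠ none) (h' : X.ty t' ≠ none) : term m (term m ψ t') t X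
    + term m (term m ψ t) t' X = 0 := by
  obtain ⟨s, hs⟩ := ne_none_iff_exists'.1 h
  obtain ⟨s', hs'⟩ := ne_none_iff_exists'.1 h'
  by_cases htad : X.ends t false = X.ends t true
  · rw [term_tadpole h htad, zero_add]
    by_cases htad' : X.ends t' false = X.ends t' true
    · rw [term_tadpole h' htad']
    · rw [term_some ht' hs' htad', term_tadpole (X := X.contract t' _ _) h
        (by simp only [contract_ends, htad]), smul_zero]
  by_cases htad' : X.ends t' false = X.ends t' true
  · rw [term_tadpole h' htad', add_zero]
    rw [term_some ht hs htad, term_tadpole (X := X.contract t _ _) h'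
      (by simp only [contract_ends, htad']), smul_zero]
  by_cases hpar : ((X.ends t false = X.ends t' false ∧ X.ends t true = X.ends t' true) ∨ (X.ends t
      false = X.ends t' true ∧ X.ends t true = X.ends t' false))
  · rw [term_some ht hs htad, term_some ht' hs' htad', term_contract_tadpole ψ h' htad hpar,
      term_contract_tadpole ψ h htad' (by grind), smul_zero, smul_zero, zero_add]
  obtain ⟨u, u', hu, hu'⟩ := exists_ends_notMem htad htad' hpar
  have hsol : t ∈ X.solid := mem_solid.2 ⟨ht, h⟩
  have hsol' : t' ∈ X.solid := mem_solid.2 ⟨ht', h'⟩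
  have en : ∀ r, ctr(X, t, u).ends t' r = X.ends t' r := fun r => by
    rw [contract_ends, if_neg (hu r).symm]
  have en' : ∀ r, ctr(X, t', u').ends t r = X.ends t r := fun r => by
    rw [contract_ends, if_neg (hu' r).symm]
  rw [(hψ.vAlt_term t').term_solid hc ht hs htad u, (hψ.vAlt_term t).term_solid hc ht' hs' htad' u',
    hψ.vAlt.term_solid (hc.contract (hc t ht _) (ends_ne_not htad u)) (t := t')
      (by simp [ht', hne.symm]) hs' (by rwa [en, en]) u',
    hψ.vAlt.term_solid (hc.contract (hc t' ht' _) (ends_ne_not htad' u')) (t := t)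
      (by simp [ht, hne]) hs (by rwa [en', en']) u]
  simp only [en, en', items_contract (m := m) hsol _ (hc t ht u),
    items_contract (m := m) hsol' _ (hc t' ht' u')]
  rw [contract_comm X (hu _) (hu' _) (hu u')]
  have key := aft_lx_anticomm (X.items m)
    (c := citem m t (X.ends t u)) (d := citem m t' (X.ends t' u')) (citem_ne hne (hu u'))
  linear_combination (norm := module) key • ((if s = u then 1 else eps m) • (if s' = u' then 1 else
    eps m) • ψ (ctr(X, t', u').contract t (X.ends t !u) (X.ends t u)))

lemma term_term {m : ℤ} {ψ : NG k → M} (hψ : Alt m ψ) (hc : X.Closed) (ht : t ∈ X.E) (ht' : t' ∈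
    X.E) (hne : t ≠ t') : term m (term m ψ t') t X + term m (term m ψ t) t' X = 0 := by
  by_cases h : X.ty t = none <;> by_cases h' : X.ty t' = none
  · exact term_term_none_none ψ ht ht' hne h h'
  · exact term_term_none_some ψ hc ht ht' hne h h'
  · rw [add_comm]; exact term_term_none_some ψ hc ht' ht hne.symm h' h
  · exact term_term_some_some hψ hc ht ht' hne h h'

lemma term_term_self {m : ℤ} {ψ : NG k → M} (hψ : Alt m ψ) (hc : X.Closed) {t : ℕ} (ht : t ∈ X.E) :
    term m (term m ψ t) t X = 0 := by
  rcases h : X.ty t with _ | s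
  · rw [term_none ht h]
    by_cases htad : X.ends t false = X.ends t true
    · rw [term_tadpole (X := X.setTy t _) (by simp) htad,
        term_tadpole (X := X.setTy t _) (by simp) htad]; simp
    have e := hψ.vAlt.term_solid (X := X.setTy t (some false)) (hc.setTy _ _) ht (s := false)
      (by simp) htad true
    rw [e, term_some (X := X.setTy t _) (s := true) ht (by simp) htad]
    have e2 : ψ ((X.setTy t (some false)).contract t (X.ends t !true) (X.ends t true)) =
        ψ ((X.setTy t (some true)).contract t (X.ends t !true) (X.ends t true)) := by
      refine hψ.vAlt.congr ((hc.setTy _ _).contract (hc t ht _) (ends_ne_not htad true)) ?_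
      refine ⟨rfl, rfl, fun _ _ => rfl, fun _ _ _ => rfl, fun a ha => ?_⟩
      have : a ≠ t := (mem_erase.1 ha).1
      simp [setTy_ty_ne _ this]
    simp only [setTy_ends, setTy_dotted_items ht h] at e2 ⊢
    rw [e2]
    simp only [false_eq_true, if_false]
    have e3 := eps_mul_self m
    linear_combination (norm := module) (- aft lx (X.items m) (inr t) * aft lx (tog (X.items m) (inr
      t)) (citem m t (X.ends t true))) • e3 •
      ψ ((X.setTy t (some true)).contract t (X.ends t !true) (X.ends t true))
  · by_cases htad : X.ends t false = X.ends t true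
    · rw [term_tadpole (by simp [h]) htad]
    · rw [term_some ht h htad, term_of_notMem (by simp), smul_zero]

lemma term_sum {m : ℤ} {ι : Type*} (S : Finset ι) (ψ : ι → NG k → M) (t : ℕ) (X : NG k) : term m
    (fun X => ∑ i ∈ S, ψ i X) t X = ∑ i ∈ S, term m (ψ i) t X := by
  by_cases ht : t ∈ X.E
  · rcases h : X.ty t with _ | s
    · simp only [term_none ht h, smul_sum, ← Finset.sum_sub_distrib]
    · by_cases htad : X.ends t false = X.ends t true
      · simp [term_tadpole (X := X) (t := t) (by simp [h]) htad]
      · simp only [term_some ht h htad, smul_sum]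
  · simp [term_of_notMem ht]

lemma term_congr {m : ℤ} {ψ χ : NG k → M} {t : ℕ} (h1 : t ∈ X.E → X.ty t = none → ∀ s, ψ (X.setTy t
    (some s)) = χ (X.setTy t (some s))) (h2 : t ∈ X.E → ∀ s, X.ty t = some s → X.ends t false ≠
    X.ends t true → ψ ctr(X, t, s) = χ ctr(X, t, s)) : term m ψ t X = term m χ t X := by
  by_cases ht : t ∈ X.E
  · rcases h : X.ty t with _ | s
    · rw [term_none ht h, term_none ht h, h1 ht h, h1 ht h]
    · by_cases htad : X.ends t false = X.ends t true
      · rw [term_tadpole (by simp [h]) htad, term_tadpole (by simp [h]) htad]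
      · rw [term_some ht h htad, term_some ht h htad, h2 ht s h htad]
  · rw [term_of_notMem ht, term_of_notMem ht]

lemma term_eq_zero {m : ℤ} {ψ : NG k → M} {t : ℕ} (h1 : t ∈ X.E → X.ty t = none → ∀ s, ψ (X.setTy t
    (some s)) = 0) (h2 : t ∈ X.E → ∀ s, X.ty t = some s → X.ends t false ≠ X.ends t true → ψ ctr(X,
    t, s) = 0) : term m ψ t X = 0 := by
  rw [term_congr (χ := fun _ => 0) h1 h2]
  have := term_sum (m := m) (∅ : Finset ℕ) (fun _ => ψ) t X
  simpa using this

lemma del_del {m : ℤ} {ψ : NG k → M} (hψ : Alt m ψ) (hc : X.Closed) : del m (del m ψ) X = 0 := by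
  have h1 : ∀ t ∈ X.E, term m (del m ψ) t X = ∑ t' ∈ X.E, term m (term m ψ t') t X := by
    intro t ht
    rw [← term_sum]
    refine term_congr (fun _ _ s => rfl) fun _ s hs _ => ?_
    show ∑ t' ∈ X.E.erase t, _ = _
    rw [← add_sum_erase _ _ ht, term_of_notMem (by simp), zero_add]
  rw [del, sum_congr rfl h1, ← Finset.sum_product']
  refine Finset.sum_involution (fun p _ => (p.2, p.1)) ?_ ?_ ?_ ?_
  · rintro ⟨t, t'⟩ hp
    rw [mem_product] at hp
    by_cases hne : t = t'
    · subst hne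
      simp [term_term_self hψ hc hp.1]
    · exact term_term hψ hc hp.1 hp.2 hne
  · rintro ⟨t, t'⟩ hp h0 heq
    rw [mem_product] at hp
    have : t' = t := by grind
    subst this
    exact h0 (term_term_self hψ hc hp.1)
  · grind
  · grind

/-! ### Fusing the edges at a passing vertex -/

namespace NG

/-- The vertex `w` is 2-valent and passing in all colours, the edge `i` points to `w` and the edge
`j` points away from `w`. -/
structure FuseAt (X : NG k) (w i j : ℕ) : Prop where
  w_mem : w ∈ X.V
  i_mem : i ∈ X.E
  j_mem : j ∈ X.E
  ne : i ≠ j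
  i_true : X.ends i true = w
  j_false : X.ends j false = w
  i_false : X.ends i false ≠ w
  j_true : X.ends j true ≠ w
  other : ∀ a ∈ X.E, a ≠ i → a ≠ j → ∀ s, X.ends a s ≠ w
  col_eq : ∀ c, X.col c i = X.col c j

/-- Replace the edges `i`, `j` by one dotted edge `i`. -/
def fuse (X : NG k) (w i j : ℕ) : NG k := (X.contract j (X.ends j true) w).setTy i none

lemma fuse_setTy_self {s : Bool} (h : X.ty i = some s) : (X.fuse w i j).setTy i (some s) =
    X.contract j (X.ends j true) w := by
  rw [fuse, setTy_setTy, setTy_eq_self]; exact h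

def fuseSgn (m : ℤ) (O : Finset (ℕ ⊕ ℕ)) (w i j : ℕ) : ℤ :=
  aft lx O (citem m j w) * aft lx (tog O (citem m j w)) (inr i)

/-- The class of the path formed by `i` and `j` as a multiple of a dotted edge. -/
def coef (X : NG k) (i j : ℕ) : ℤ :=
  if X.ty i = some true ∧ X.ty j = some false then 1
  else if X.ty i = some false ∧ X.ty j = some true then -1 else 0

lemma coef_ne_zero {i j : ℕ} (h : X.coef i j ≠ 0) : X.ty i ≠ none ∧ X.ty j ≠ none := by
  unfold coef at h
  split_ifs at h with h1 h2
  · simp [h1]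
  · simp [h2]
  · grind

lemma fuseSgn_comm {m : ℤ} (O : Finset (ℕ ⊕ ℕ)) {c : ℕ ⊕ ℕ} (h1 : c ≠ citem m j w) (h2 : c ≠ inr i)
    : aft lx O c * fuseSgn m (tog O c) w i j = fuseSgn m O w i j * aft lx (tog (tog O (citem m j w))
    (inr i)) c := by
  unfold fuseSgn
  have k1 := aft_lx_anticomm O h1
  have k2 := aft_lx_anticomm (tog O (citem m j w)) h2
  rw [tog_comm O c]
  linear_combination aft lx (tog (tog O (citem m j w)) c) (inr i) * k1 -
    aft lx O (citem m j w) * k2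

lemma FuseAt.items_fuse {m : ℤ} (h : X.FuseAt w i j) (hi : X.ty i ≠ none) (hj : X.ty j ≠ none) :
    (X.fuse w i j).items m = tog (tog (X.items m) (citem m j w)) (inr i) := by
  rw [fuse, items_setTy (by simp [h.i_mem, h.ne]) (by simp [hi]),
    items_contract (mem_solid.2 ⟨h.j_mem, hj⟩) _ h.w_mem]

lemma FuseAt.closed (h : X.FuseAt w i j) (hc : X.Closed) : (X.fuse w i j).Closed :=
  (hc.contract (hc j h.j_mem _) h.j_true).setTy _ _

lemma FuseAt.setTy (h : X.FuseAt w i j) (t : ℕ) (o : Option Bool) : (X.setTy t o).FuseAt w i j :=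
  ⟨h.w_mem, h.i_mem, h.j_mem, h.ne, h.i_true, h.j_false, h.i_false, h.j_true, h.other, h.col_eq⟩

lemma FuseAt.contract (h : X.FuseAt w i j) {t a b : ℕ} (hi : t ≠ i) (hj : t ≠ j) (ha : a ≠ w) (hb :
    b ≠ w) : (X.contract t a b).FuseAt w i j := by
  refine ⟨by simp [h.w_mem, hb.symm], by simp [h.i_mem, hi.symm], by simp [h.j_mem, hj.symm],
    h.ne, ?_, ?_, ?_, ?_, fun e he hei hej s => ?_, h.col_eq⟩
  · rw [contract_ends, h.i_true, if_neg hb.symm]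
  · rw [contract_ends, h.j_false, if_neg hb.symm]
  · rw [contract_ends]; split_ifs; exacts [ha, h.i_false]
  · rw [contract_ends]; split_ifs; exacts [ha, h.j_true]
  · rw [contract_ends]; split_ifs; exacts [ha, h.other e (mem_of_mem_erase he) hei hej s]

lemma fuse_setTy (X : NG k) (w : ℕ) {i j t : ℕ} (h : t ≠ i) (o : Option Bool) : (X.setTy t o).fuse w
    i j = (X.fuse w i j).setTy t o := by
  rw [fuse, fuse, setTy_comm _ h.symm]; rfl

lemma fuse_contract (X : NG k) {w i j t a b : ℕ} (ha : a ≠ w) (hb : b ≠ w) : (X.contract t a b).fuse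
    w i j = (X.fuse w i j).contract t a b := by
  rw [fuse, fuse, contract_setTy]
  congr 1
  ext1
  · exact erase_right_comm
  · exact erase_right_comm
  · funext e s
    simp only [contract_ends]
    grind
  · rfl
  · rfl

/-- The reversal of the edges `i` and `j`. -/
def flip2 (i j : ℕ) : ℕ → Bool := fun a => decide (a = i ∨ a = j)

lemma FuseAt.flip (h : X.FuseAt w i j) : (X.ren 1 1 (flip2 i j)).FuseAt w j i := by
  refine ⟨by simpa [ren] using h.w_mem, by simpa [ren] using h.j_mem,
    by simpa [ren] using h.i_mem, h.ne.symm, by simp [ren, flip2, h.j_false],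
    by simp [ren, flip2, h.i_true], by simp [ren, flip2, h.j_true],
    by simp [ren, flip2, h.i_false], fun a ha hai haj s => ?_, fun c => ?_⟩
  · simp only [ren, one_symm_apply, coe_one, id_eq]
    exact h.other a (by simpa [ren] using ha) haj hai _
  · simp [ren, flip2, h.col_eq c]

end NG

/-- Conditions under which graphs are set to zero. -/
structure BadCond (m : ℤ) (Bad : NG k → Prop) : Prop where
  tadpole : ∀ X : NG k, ∀ a ∈ X.E, X.ends a false = X.ends a true → Bad X
  ren : ∀ (X X' : NG k) (σ ρ : Perm ℕ) (f : ℕ → Bool), Agree X' (X.ren σ ρ f) →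
    Bad X → Bad X'
  setTy : ∀ (X : NG k) (t : ℕ) (s : Bool), t ∈ X.E → X.ty t = none → Bad X →
    Bad (X.setTy t (some s))
  contract : ∀ (X : NG k) (t : ℕ) (s : Bool), X.Closed → t ∈ X.E → X.ty t ≠ none →
    X.ends t false ≠ X.ends t true → Bad X → Bad ctr(X, t, s)
  fuse : ∀ (X : NG k) (w i j : ℕ), X.Closed → X.FuseAt w i j → X.coef i j ≠ 0 → Bad X →
    Bad (X.fuse w i j)

/-- Functions of graphs that satisfy the relations. -/
structure Good (m : ℤ) (Bad : NG k → Prop) (ψ : NG k → M) : Prop where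
  alt : Alt m ψ
  bad : ∀ X : NG k, X.Closed → Bad X → ψ X = 0
  fuse : ∀ (X : NG k) (w i j : ℕ), X.Closed → X.FuseAt w i j →
    ψ X = (X.coef i j * fuseSgn m (X.items m) w i j) • ψ (X.fuse w i j)

section

variable {m : ℤ} {Bad : NG k → Prop} {ψ : NG k → M}

lemma Good.eq_zero_of_coef (h : Good m Bad ψ) (hc : X.Closed) (hf : X.FuseAt w i j) (h0 : X.coef i j
    = 0) : ψ X = 0 := by
  rw [h.fuse X w i j hc hf, h0, zero_mul, zero_smul]

lemma Good.term_other (h : Good m Bad ψ) (hc : X.Closed) {w i j t : ℕ} (hf : X.FuseAt w i j) (ht : t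
    ∈ X.E) (hi : t ≠ i) (hj : t ≠ j) : term m ψ t X = (X.coef i j * fuseSgn m (X.items m) w i j) •
    term m ψ t (X.fuse w i j) := by
  have hends : ∀ s, (X.fuse w i j).ends t s = X.ends t s := fun s => by
    rw [NG.fuse, setTy_ends, contract_ends, if_neg (hf.other t ht hi hj s)]
  have hty : (X.fuse w i j).ty t = X.ty t := by
    rw [NG.fuse, setTy_ty_ne _ hi, contract_ty]
  have htf : t ∈ (X.fuse w i j).E := by simp [NG.fuse, ht, hj]
  have hcS : ∀ s, (X.setTy t (some s)).coef i j = X.coef i j := fun s => by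
    simp only [coef, setTy_ty_ne _ hi.symm, setTy_ty_ne _ hj.symm]
  have hcC : ∀ a b, (X.contract t a b).coef i j = X.coef i j := fun _ _ => rfl
  by_cases h0 : X.coef i j = 0
  · rw [h0, zero_mul, zero_smul]
    refine term_eq_zero (fun _ _ s => ?_) fun _ s _ htad => ?_
    · exact h.eq_zero_of_coef (hc.setTy _ _) (hf.setTy t _) (by rw [hcS, h0])
    · exact h.eq_zero_of_coef (hc.contract (hc t ht _) (ends_ne_not htad s))
        (hf.contract hi hj (hf.other t ht hi hj _) (hf.other t ht hi hj _)) (by rw [hcC, h0])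
  have hit := hf.items_fuse (m := m) (coef_ne_zero h0).1 (coef_ne_zero h0).2
  rcases hs : X.ty t with _ | s
  · rw [term_none ht hs, term_none htf (by rw [hty, hs])]
    have key : ∀ s, ψ (X.setTy t (some s)) = (X.coef i j * fuseSgn m (tog (X.items m) (inr t))
        w i j) • ψ ((X.fuse w i j).setTy t (some s)) := fun s => by
      rw [h.fuse _ w i j (hc.setTy t (some s)) (hf.setTy t _), hcS, fuse_setTy _ _ hi,
        setTy_dotted_items ht hs]
    rw [key, key, hit]
    have k1 := fuseSgn_comm (m := m) (X.items m) (w := w) (i := i) (j := j) (c := inr t)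
      (inr_ne_citem hj) (by simpa using hi)
    linear_combination (norm := module) (X.coef i j • k1) • (ψ ((X.fuse w i j).setTy t (some true)) -
      eps m • ψ ((X.fuse w i j).setTy t (some false)))
  · by_cases htad : X.ends t false = X.ends t true
    · rw [term_tadpole (by simp [hs]) htad, term_tadpole (by simp [hs, hty])
        (by rwa [hends, hends]), smul_zero]
    rw [term_some ht hs htad, term_some htf (by rw [hty, hs]) (by rwa [hends, hends]),
      hends, hends, h.fuse _ w i j (hc.contract (hc t ht _) (ends_ne_not htad s))
        (hf.contract hi hj (hf.other t ht hi hj _) (hf.other t ht hi hj _)), hcC,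
      fuse_contract _ (hf.other t ht hi hj _) (hf.other t ht hi hj _), hit,
      items_contract (mem_solid.2 ⟨ht, by simp [hs]⟩) _ (hc t ht s)]
    have k1 := fuseSgn_comm (m := m) (X.items m) (w := w) (i := i) (j := j)
      (c := citem m t (X.ends t s)) (citem_ne hj (hf.other t ht hi hj s))
      (by unfold citem; split_ifs <;> simp [hi])
    linear_combination (norm := module) (X.coef i j • k1) •
      ψ ((X.fuse w i j).contract t (X.ends t !s) (X.ends t s))

/-- Contracting either of the two edges at a passing vertex. -/
lemma Alt.contract_passing (hψ : Alt m ψ) (hc : X.Closed) (hf : X.FuseAt w i j) (hi : X.ty i ≠ none)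
    (hj : X.ty j ≠ none) : aft lx (X.items m) (citem m i w) • ψ (X.contract i (X.ends i false) w) =
    -(eps m • aft lx (X.items m) (citem m j w) • ψ ((X.contract j (X.ends j true) w).setTy i (X.ty
    j))) := by
  have h : Agree (X.contract i (X.ends i false) w)
      (((X.contract j (X.ends j true) w).setTy i (X.ty j)).ren 1 (swap i j)
        fun _ => false) := by
    have hx : xor false = id := by grind
    have hsw : ∀ a ∈ X.E.erase i, a ≠ j → swap i j a = a := by grind
    refine ⟨?_, ?_, fun a ha => ?_, fun a ha c => ?_, fun a ha => ?_⟩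
    · ext x; simp [ren]
    · ext x
      simp only [contract_E, ren, setTy_E, mem_map_equiv, symm_swap, mem_erase]
      rcases eq_or_ne x i with rfl | hxi
      · simp
      · rcases eq_or_ne x j with rfl | hxj
        · simp [hf.i_mem, hf.j_mem, hf.ne, hf.ne.symm]
        · grind
    · funext s
      rcases eq_or_ne a j with rfl | haj
      · cases s <;> simp [ren, contract_ends, hf.i_true, hf.j_false, hf.i_false, hf.j_true]
      · have h1 := hf.other a (mem_of_mem_erase ha) (mem_erase.1 ha).1 haj s
        simp [ren, contract_ends, hsw a ha haj, h1]
    · rcases eq_or_ne a j with rfl | haj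
      · simp [ren, hf.col_eq]
      · simp [ren, hsw a ha haj]
    · rcases eq_or_ne a j with rfl | haj
      · simp [ren, hx]
      · simp [ren, hsw a ha haj, hx, setTy_ty_ne _ (mem_erase.1 ha).1]
  have hcj := hc.contract (t := j) (hc j hf.j_mem true) hf.j_true
  rw [hψ _ _ _ _ _ (hcj.setTy _ _) h, smul_smul, smul_smul, ← neg_smul]
  congr 1
  have hit : ((X.contract j (X.ends j true) w).setTy i (X.ty j)).items m =
      tog (X.items m) (citem m j w) := by
    rw [← items_contract (mem_solid.2 ⟨hf.j_mem, hj⟩) (X.ends j true) hf.w_mem]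
    ext (x | x)
    · simp [inl_mem_items]
    · rcases eq_or_ne x i with rfl | hx
      · simp [inr_mem_items, hi, hj]
      · simp [inr_mem_items, setTy_ty_ne _ hx]
  rw [sgn, fsgn_false, mul_one, hit, sum_map_one_swap]
  unfold citem eps
  by_cases hm : Even m
  · simp only [hm, if_true]
    set O := X.items m
    have hiO : inr i ∈ O := inr_mem_items.2 ⟨hf.i_mem, by simp [hm, hi]⟩
    have hjO : inr j ∈ O := inr_mem_items.2 ⟨hf.j_mem, by simp [hm, hj]⟩
    have h1 := kap_swap_tog (F := (lx : ℕ ⊕ ℕ → _)) lx_injective (a := inr i) (b := inr j)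
      (S := tog (tog O (inr j)) (inr i))
      (by simp [mem_tog, hiO, hf.ne]) (by simp [mem_tog, hjO, hf.ne.symm]) (by simpa using hf.ne)
    rw [tog_tog] at h1
    rw [h1, aft_tog_self, tog_comm, aft_tog_self]
    have h2 := aft_lx_anticomm O (c := inr i)
      (d := inr j) (by simpa using hf.ne)
    linear_combination aft lx (tog O (inr j)) (inr i) * h2 -
      aft lx O (inr j) * aft_mul_self lx (tog O (inr j)) (inr i)
  · simp only [hm, if_false]
    rw [kap_swap_of_notMem]
    · ring
    · simp [mem_tog, inr_mem_items, hm, hi]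
    · simp [mem_tog, inr_mem_items, hm, hj]

lemma Good.term_pair_solid (h : Good m Bad ψ) (hc : X.Closed) (hf : X.FuseAt w i j) (hi : X.ty i ≠
    none) (hj : X.ty j ≠ none) : term m ψ i X + term m ψ j X = (X.coef i j * fuseSgn m (X.items m) w
    i j) • term m ψ i (X.fuse w i j) := by
  obtain ⟨s, hs⟩ := ne_none_iff_exists'.1 hi
  obtain ⟨r, hr⟩ := ne_none_iff_exists'.1 hj
  have t1 := h.alt.vAlt.term_solid hc hf.i_mem hs (by rw [hf.i_true]; exact hf.i_false) true
  have t2 := h.alt.vAlt.term_solid hc hf.j_mem hr (by rw [hf.j_false]; exact hf.j_true.symm) false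
  have t3 := h.alt.contract_passing hc hf hi hj
  simp only [Bool.not_true, Bool.not_false, hf.i_true, hf.j_false] at t1 t2
  rw [t1, t2, t3, hr, term_none (by simp [NG.fuse, hf.i_mem, hf.ne]) (by simp [NG.fuse]),
    hf.items_fuse hi hj, aft_tog_self]
  have e0 := fuse_setTy_self (w := w) (j := j) hs
  have e1 : ∀ o, (X.fuse w i j).setTy i o = (X.contract j (X.ends j true) w).setTy i o :=
    fun o => by rw [NG.fuse, setTy_setTy]
  rw [← e0, e1, e1, e1]
  have e2 := aft_mul_self lx (tog (X.items m) (citem m j w)) (inr i)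
  have hfs : fuseSgn m (X.items m) w i j * aft lx (tog (X.items m) (citem m j w)) (inr i) =
      aft lx (X.items m) (citem m j w) := by
    unfold fuseSgn; linear_combination (aft lx (X.items m) (citem m j w)) * e2
  rw [smul_smul (X.coef i j * _), mul_assoc, hfs]
  have hcoef : X.coef i j = if s = r then 0 else if s then 1 else -1 := by
    unfold coef; rw [hs, hr]; cases s <;> cases r <;> simp
  rw [hcoef]
  have h4 := eps_mul_self m
  cases s <;> cases r <;> simp
  · linear_combination (norm := module) (- aft lx (X.items m) (citem m j w)) • h4 •
      ψ ((X.contract j (X.ends j true) w).setTy i (some false))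
  · linear_combination (norm := module) (- aft lx (X.items m) (citem m j w)) • h4 •
      ψ ((X.contract j (X.ends j true) w).setTy i (some true))
  · module

lemma Good.term_pair_dotted (h : Good m Bad ψ) (hc : X.Closed) (hf : X.FuseAt w i j) (hi : X.ty i =
    none) (hj : X.ty j ≠ none) : term m ψ i X + term m ψ j X = 0 := by
  obtain ⟨r, hr⟩ := ne_none_iff_exists'.1 hj
  have t2 := h.alt.vAlt.term_solid hc hf.j_mem hr (by rw [hf.j_false]; exact hf.j_true.symm) false
  simp only [Bool.not_false, hf.j_false] at t2
  have key : ∀ s, ψ (X.setTy i (some s)) = ((if s = r then 0 else if s then 1 else -1) *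
      fuseSgn m (tog (X.items m) (inr i)) w i j) • ψ (X.contract j (X.ends j true) w) :=
    fun s => by
    rw [h.fuse _ w i j (hc.setTy i (some s)) (hf.setTy i _), setTy_dotted_items hf.i_mem hi]
    congr 2
    · unfold coef; rw [setTy_ty_self, setTy_ty_ne _ hf.ne.symm, hr]; cases s <;> cases r <;> simp
    · rw [NG.fuse, setTy_ends, contract_setTy, setTy_setTy, setTy_eq_self]; exact hi
  rw [t2, term_none hf.i_mem hi, key, key]
  have k1 : aft lx (X.items m) (inr i) * fuseSgn m (tog (X.items m) (inr i)) w i j =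
      - aft lx (X.items m) (citem m j w) := by
    unfold fuseSgn
    rw [tog_comm, aft_tog_self]
    have h2 := aft_lx_anticomm (X.items m) (c := inr i)
      (d := citem m j w) (inr_ne_citem hf.ne)
    linear_combination aft lx (tog (X.items m) (citem m j w)) (inr i) * h2 -
      aft lx (X.items m) (citem m j w) *
        aft_mul_self lx (tog (X.items m) (citem m j w)) (inr i)
  cases r <;> simp
  · linear_combination (norm := module) k1 • ψ (X.contract j (X.ends j true) w)
  · linear_combination (norm := module) eps m • k1 • ψ (X.contract j (X.ends j true) w)

lemma Good.del (hB : BadCond m Bad) (h : Good m Bad ψ) : Good m Bad (OrientedGC.del m ψ) := by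
  have split : ∀ (X : NG k) (w i j : ℕ), X.FuseAt w i j → OrientedGC.del m ψ X = term m ψ i X + term m ψ j X +
      ∑ t ∈ (X.E.erase j).erase i, term m ψ t X := fun X w i j hf => by
    rw [OrientedGC.del, ← add_sum_erase _ _ hf.j_mem, ← add_sum_erase _ _ (mem_erase.2 ⟨hf.ne,
      hf.i_mem⟩)]
    abel
  have zero_of : ∀ (X : NG k) (w i j : ℕ), X.Closed → X.FuseAt w i j → X.coef i j = 0 →
      term m ψ i X + term m ψ j X = 0 → OrientedGC.del m ψ X = 0 := by
    intro X w i j hc hf h0 hp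
    rw [split X w i j hf, hp, zero_add]
    refine sum_eq_zero fun t ht => ?_
    simp only [mem_erase] at ht
    rw [h.term_other hc hf ht.2.2 ht.1 ht.2.1, h0, zero_mul, zero_smul]
  refine ⟨h.alt.del, fun X hc hb => sum_eq_zero fun t ht => ?_, fun X w i j hc hf => ?_⟩
  · refine term_eq_zero (fun _ h0 s => h.bad _ (hc.setTy _ _) (hB.setTy X t s ht h0 hb))
      fun _ s hs htad => h.bad _ (hc.contract (hc t ht _) (ends_ne_not htad s))
        (hB.contract X t s hc ht (by simp [hs]) htad hb)
  · by_cases hi : X.ty i = none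
    · have h0 : X.coef i j = 0 := by simp [coef, hi]
      rw [h0, zero_mul, zero_smul]
      refine zero_of X w i j hc hf h0 ?_
      by_cases hj : X.ty j = none
      · have z : ∀ s, ψ (X.setTy i (some s)) = 0 := fun s =>
          h.eq_zero_of_coef (hc.setTy _ _) (hf.setTy i _)
            (by simp [coef, setTy_ty_ne _ hf.ne.symm, hj])
        have z' : ∀ s, ψ (X.setTy j (some s)) = 0 := fun s =>
          h.eq_zero_of_coef (hc.setTy _ _) (hf.setTy j _)
            (by simp [coef, setTy_ty_ne _ hf.ne, hi])
        rw [term_none hf.i_mem hi, term_none hf.j_mem hj, z, z, z', z']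
        simp
      · exact h.term_pair_dotted hc hf hi hj
    · by_cases hj : X.ty j = none
      · have h0 : X.coef i j = 0 := by simp [coef, hj]
        rw [h0, zero_mul, zero_smul]
        set X' := X.ren 1 1 (flip2 i j) with hΓ'
        have hj' : X'.ty j = none := by simp [hΓ', hj]
        have hi' : X'.ty i ≠ none := by simp [hΓ', hi]
        have hc' : X'.Closed := hc.ren _ _ _
        have key : OrientedGC.del m ψ X' = 0 :=
          zero_of X' w j i hc' hf.flip (by simp [coef, hj'])
            (h.term_pair_dotted hc' hf.flip hj' hi')
        have h1 := h.alt.del X X' 1 1 (flip2 i j) hc (Agree.refl _)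
        rw [key] at h1
        have h2 := congrArg (fun x => X.sgn m 1 1 (flip2 i j) • x) h1
        simp only [smul_zero, smul_smul, sgn_mul_self, one_smul] at h2
        exact h2.symm
      · rw [split X w i j hf, h.term_pair_solid hc hf hi hj]
        have e : (X.fuse w i j).E = X.E.erase j := rfl
        rw [OrientedGC.del, e, ← add_sum_erase _ _ (mem_erase.2 ⟨hf.ne, hf.i_mem⟩), smul_add,
          smul_sum]
        congr 1
        refine sum_congr rfl fun t ht => ?_
        simp only [mem_erase] at ht
        exact h.term_other hc hf ht.2.2 ht.1 ht.2.1

end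

end

section

open NG

variable {k : ℕ} {M : Type*} [AddCommGroup M]
variable {σ ρ : Perm ℕ} {f : ℕ → Bool} {m : ℤ} {x : ℕ} {v e : ℕ}

/-! ### Labelled graphs as graphs labelled by numbers -/

namespace SGraph

/-- The odd vertices and edges. -/
def items (m : ℤ) (G : SGraph k v e) : Finset (Fin (v + 1) ⊕ Fin e) :=
  if Even m then (∅ : Finset (Fin (v + 1))).disjSum G.solid else univ.disjSum G.dotted

lemma relabelSign_eq (m : ℤ) (G : SGraph k v e) (σ : Perm (Fin (v + 1))) (ρ : Perm (Fin e)) (f : Fin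
    e → Bool) : G.relabelSign m σ ρ f = kap (G.items m) lx (lx ∘ Sum.map σ ρ) * if Even m then ∏ a ∈
    G.dotted, (if f a then -1 else 1) else 1 := by
  unfold relabelSign oddEdges items
  split_ifs
  · rw [kap_lx, kap_empty, one_mul, inversions_eq_kap]
  · rw [kap_lx, inversions_eq_kap, sign_eq_kap, mul_one, mul_comm]

end SGraph

/-- The graph `X` is obtained from `G` by the labels `i` of the vertices and `j` of the edges. -/
structure Lab (X : NG k) (G : SGraph k v e) (i : Fin (v + 1) → ℕ) (j : Fin e → ℕ) :
    Prop where
  i_inj : Function.Injective i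
  j_inj : Function.Injective j
  V_eq : X.V = univ.map ⟨i, i_inj⟩
  E_eq : X.E = univ.map ⟨j, j_inj⟩
  ends_eq : ∀ a s, X.ends (j a) s = i (G.ends a s)
  col_eq : ∀ c a, X.col c (j a) = G.col c a
  ty_eq : ∀ a, X.ty (j a) = G.ty a

/-- A labelled graph as a graph labelled by numbers. -/
def toNG (G : SGraph k v e) : NG k where
  V := (univ : Finset (Fin (v + 1))).map valEmbedding
  E := (univ : Finset (Fin e)).map valEmbedding
  ends a s := if h : a < e then G.ends ⟨a, h⟩ s else 0
  col c a := if h : a < e then G.col c ⟨a, h⟩ else false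
  ty a := if h : a < e then G.ty ⟨a, h⟩ else none

lemma lab_toNG (G : SGraph k v e) : Lab (toNG G) G Fin.val Fin.val :=
  ⟨val_injective, val_injective, rfl, rfl, fun a s => by simp [toNG],
    fun c a => by simp [toNG], fun a => by simp [toNG]⟩

namespace Lab

variable {X : NG k} {G : SGraph k v e} {i : Fin (v + 1) → ℕ} {j : Fin e → ℕ}

lemma closed (h : Lab X G i j) : X.Closed := by
  intro a ha s
  rw [h.E_eq] at ha
  obtain ⟨b, -, rfl⟩ := mem_map.1 ha
  rw [h.V_eq]
  exact mem_map.2 ⟨G.ends b s, mem_univ _, (h.ends_eq b s).symm⟩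

lemma i_mem (h : Lab X G i j) (x : Fin (v + 1)) : i x ∈ X.V := by
  rw [h.V_eq]; exact mem_map.2 ⟨x, mem_univ _, rfl⟩

lemma j_mem (h : Lab X G i j) (a : Fin e) : j a ∈ X.E := by
  rw [h.E_eq]; exact mem_map.2 ⟨a, mem_univ _, rfl⟩

lemma exists_i (h : Lab X G i j) (hx : x ∈ X.V) : ∃ y, i y = x := by
  rw [h.V_eq] at hx
  obtain ⟨b, -, hb⟩ := mem_map.1 hx
  exact ⟨b, hb⟩

lemma exists_j (h : Lab X G i j) (hx : x ∈ X.E) : ∃ y, j y = x := by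
  rw [h.E_eq] at hx
  obtain ⟨b, -, hb⟩ := mem_map.1 hx
  exact ⟨b, hb⟩

lemma card_V (h : Lab X G i j) : X.V.card = v + 1 := by rw [h.V_eq]; simp

lemma card_E (h : Lab X G i j) : X.E.card = e := by rw [h.E_eq]; simp

lemma dotted_eq (h : Lab X G i j) : X.dotted = G.dotted.map ⟨j, h.j_inj⟩ := by
  ext x
  simp only [mem_dotted, mem_map, SGraph.dotted, mem_filter, mem_univ, true_and, coeFn_mk]
  constructor
  · rintro ⟨hx, h0⟩
    obtain ⟨a, rfl⟩ := h.exists_j hx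
    exact ⟨a, by rwa [h.ty_eq] at h0, rfl⟩
  · rintro ⟨a, h0, rfl⟩
    exact ⟨h.j_mem a, by rwa [h.ty_eq]⟩

lemma solid_eq (h : Lab X G i j) : X.solid = G.solid.map ⟨j, h.j_inj⟩ := by
  ext x
  simp only [mem_solid, mem_map, SGraph.solid, mem_filter, mem_univ, true_and, coeFn_mk]
  constructor
  · rintro ⟨hx, h0⟩
    obtain ⟨a, rfl⟩ := h.exists_j hx
    exact ⟨a, by rwa [h.ty_eq] at h0, rfl⟩
  · rintro ⟨a, h0, rfl⟩
    exact ⟨h.j_mem a, by rwa [h.ty_eq]⟩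

lemma items_eq (h : Lab X G i j) (m : ℤ) : X.items m = (G.items m).map ⟨Sum.map i j, map_injective.2
    ⟨h.i_inj, h.j_inj⟩⟩ := by
  unfold NG.items SGraph.items
  split_ifs
  · rw [h.solid_eq]
    ext (x | x) <;> simp [-Finset.empty_disjSum]
  · rw [h.dotted_eq, h.V_eq]
    ext (x | x) <;> simp

lemma ren (h : Lab X G i j) {X' : NG k} (ha : Agree X' (X.ren σ ρ f)) : Lab X' (G.relabel 1 1 (f ∘
    j)) (σ ∘ i) (ρ ∘ j) := by
  have hE : ∀ a, ρ (j a) ∈ X'.E := fun a => by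
    rw [ha.E_eq]; simpa using h.j_mem a
  refine ⟨σ.injective.comp h.i_inj, ρ.injective.comp h.j_inj, ?_, ?_, fun a s => ?_, fun c a => ?_,
    fun a => ?_⟩
  · rw [ha.V_eq, NG.ren, h.V_eq, map_map]; rfl
  · rw [ha.E_eq, NG.ren, h.E_eq, map_map]; rfl
  · simp [ha.ends_eq _ (hE a), h.ends_eq, SGraph.relabel, Graph.relabel]
  · simp [ha.col_eq _ (hE a), h.col_eq, SGraph.relabel, Graph.relabel]
  · simp [ha.ty_eq _ (hE a), h.ty_eq, SGraph.relabel]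

lemma relabel (h : Lab X G i j) (σ : Perm (Fin (v + 1))) (ρ : Perm (Fin e)) : Lab X (G.relabel σ ρ
    fun _ => false) (i ∘ σ.symm) (j ∘ ρ.symm) := by
  refine ⟨h.i_inj.comp σ.symm.injective, h.j_inj.comp ρ.symm.injective, ?_, ?_, fun a s => ?_, fun c
    a => ?_, fun a => ?_⟩
  · rw [h.V_eq]
    ext x
    simp only [mem_map, mem_univ, true_and, coeFn_mk, Function.comp_apply]
    exact (σ.symm.exists_congr_left.trans (by simp)).symm
  · rw [h.E_eq]
    ext x
    simp only [mem_map, mem_univ, true_and, coeFn_mk, Function.comp_apply]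
    exact (ρ.symm.exists_congr_left.trans (by simp)).symm
  · simp [SGraph.relabel, Graph.relabel, h.ends_eq]
  · simp [SGraph.relabel, Graph.relabel, h.col_eq]
  · have hx : xor false = id := by funext x; simp
    simp [SGraph.relabel, h.ty_eq, hx]

lemma exists_mono (h : Lab X G i j) : ∃ (G' : SGraph k v e) (i' : Fin (v + 1) → ℕ) (j' : Fin e → ℕ),
    Lab X G' i' j' ∧ StrictMono i' ∧ StrictMono j' := by
  refine ⟨_, _, _, h.relabel (Tuple.sort i)⁻¹ (Tuple.sort j)⁻¹, ?_, ?_⟩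
  · exact (Tuple.monotone_sort i).strictMono_of_injective (h.i_inj.comp (injective _))
  · exact (Tuple.monotone_sort j).strictMono_of_injective (h.j_inj.comp (injective _))

lemma exists_perm {n : ℕ} {f g : Fin n → ℕ} (hf : Function.Injective f) (h : ∀ x, ∃ y, g y = f x) : ∃ σ :
    Perm (Fin n), g ∘ σ = f := by
  choose σ hσ using h
  have : Function.Injective σ := fun a b hab => hf (by rw [← hσ a, ← hσ b, hab])
  exact ⟨Equiv.ofBijective σ (Finite.injective_iff_bijective.1 this), funext hσ⟩

/-- Two labelled forms of the same graph differ by a relabelling. -/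
lemma exists_relabel (h : Lab X G i j) {G' : SGraph k v e} {i' : Fin (v + 1) → ℕ} {j' : Fin e → ℕ}
    (h' : Lab X G' i' j') : ∃ (σ : Perm (Fin (v + 1))) (ρ : Perm (Fin e)), i' ∘ σ = i ∧ j' ∘ ρ = j ∧
    G' = G.relabel σ ρ fun _ => false := by
  obtain ⟨σ, hσ⟩ := exists_perm h.i_inj fun x => h'.exists_i (h.i_mem x)
  obtain ⟨ρ, hρ⟩ := exists_perm h.j_inj fun x => h'.exists_j (h.j_mem x)
  refine ⟨σ, ρ, hσ, hρ, ?_⟩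
  have hi : ∀ x, i (σ.symm x) = i' x := fun x => by rw [← hσ]; simp
  have hj : ∀ x, j (ρ.symm x) = j' x := fun x => by rw [← hρ]; simp
  have hx : xor false = id := by funext x; simp
  obtain ⟨⟨en, co⟩, ty⟩ := G'
  have e1 : en = fun a s => σ (G.ends (ρ.symm a) s) := by
    funext a s
    apply h'.i_inj
    rw [← h'.ends_eq, ← hj, h.ends_eq, ← hi, symm_apply_apply]
  have e2 : co = fun c a => G.col c (ρ.symm a) := by
    funext c a
    have := h'.col_eq c a
    rw [← hj, h.col_eq] at this
    exact this.symm
  have e3 : ty = fun a => G.ty (ρ.symm a) := by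
    funext a
    have := h'.ty_eq a
    rw [← hj, h.ty_eq] at this
    exact this.symm
  subst e1 e2 e3
  simp [SGraph.relabel, Graph.relabel, hx]

end Lab

lemma exists_lab {X : NG k} (hc : X.Closed) (hV : X.V.Nonempty) : ∃ (v e : ℕ) (G : SGraph k v e) (i
    : Fin (v + 1) → ℕ) (j : Fin e → ℕ), Lab X G i j := by
  obtain ⟨v, hv⟩ : ∃ v, X.V.card = v + 1 :=
    ⟨X.V.card - 1, (Nat.succ_pred_eq_of_pos hV.card_pos).symm⟩
  let iV := X.V.orderIsoOfFin hv
  let iE := X.E.orderIsoOfFin rfl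
  refine ⟨v, X.E.card, ⟨⟨fun a s => iV.symm ⟨X.ends (iE a) s, hc _ (iE a).2 s⟩, fun c a => X.col c
    (iE a)⟩, fun a => X.ty (iE a)⟩, fun x => iV x, fun a => iE a, Subtype.val_injective.comp
    iV.injective, Subtype.val_injective.comp iE.injective, ?_, ?_,
    fun a s => by simp, fun c a => rfl, fun a => rfl⟩
  · ext x
    simp only [mem_map, mem_univ, true_and, coeFn_mk]
    exact ⟨fun hx => ⟨iV.symm ⟨x, hx⟩, by simp⟩, by rintro ⟨y, rfl⟩; exact (iV y).2⟩
  · ext x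
    simp only [mem_map, mem_univ, true_and, coeFn_mk]
    exact ⟨fun hx => ⟨iE.symm ⟨x, hx⟩, by simp⟩, by rintro ⟨y, rfl⟩; exact (iE y).2⟩

/-- A function of labelled graphs that changes by the sign under relabelling. -/
def FinAlt (m : ℤ) (φ : ∀ v e, SGraph k v e → M) : Prop :=
  ∀ (v e : ℕ) (G : SGraph k v e) (σ : Perm (Fin (v + 1))) (ρ : Perm (Fin e))
    (f : Fin e → Bool), φ v e (G.relabel σ ρ f) = G.relabelSign m σ ρ f • φ v e G

/-- The monotone labelled forms of a graph. -/
def IsForm (X : NG k) (p : Σ v e : ℕ, SGraph k v e) : Prop :=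
  ∃ i j, Lab X p.2.2 i j ∧ StrictMono i ∧ StrictMono j

/-- The value of a function of labelled graphs on a graph labelled by numbers. -/
def base (φ : ∀ v e, SGraph k v e → M) (X : NG k) : M :=
  if h : ∃ p, IsForm X p then φ _ _ h.choose.2.2 else 0

lemma base_eq {φ : ∀ v e, SGraph k v e → M} (hφ : FinAlt m φ) {X : NG k} {G : SGraph k v e} {i : Fin
    (v + 1) → ℕ} {j : Fin e → ℕ} (h : Lab X G i j) : base φ X = kap (G.items m) lx (lx ∘ Sum.map i
    j) • φ v e G := by
  have hex : ∃ p, IsForm X p := by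
    obtain ⟨G', i', j', h'⟩ := h.exists_mono
    exact ⟨⟨v, e, G'⟩, i', j', h'⟩
  rw [base, dif_pos hex]
  obtain ⟨i', j', h', mi, mj⟩ := hex.choose_spec
  generalize hex.choose = p at *
  obtain ⟨v', e', G'⟩ := p
  obtain rfl : v = v' := Nat.succ_injective (h.card_V.symm.trans h'.card_V)
  obtain rfl : e = e' := h.card_E.symm.trans h'.card_E
  obtain ⟨σ, ρ, hi, hj, rfl⟩ := h.exists_relabel h'
  simp only
  rw [hφ, SGraph.relabelSign_eq]
  congr 1
  have : (if Even m then ∏ a ∈ G.dotted, (if (false : Bool) = true then (-1 : ℤ) else 1) else 1) = 1 := by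
    simp
  rw [this, mul_one]
  refine kap_congr_lt (fun _ _ _ _ => Iff.rfl) ?_
  subst hi hj
  rintro (x | x) - (y | y) - <;> simp [mi.lt_iff_lt, mj.lt_iff_lt]

lemma base_of_mono {φ : ∀ v e, SGraph k v e → M} (hφ : FinAlt m φ) {X : NG k} {G : SGraph k v e} {i
    : Fin (v + 1) → ℕ} {j : Fin e → ℕ} (h : Lab X G i j) (hi : StrictMono i) (hj : StrictMono j) :
    base φ X = φ v e G := by
  rw [base_eq hφ h]
  have : kap (G.items m) lx (lx ∘ Sum.map i j) = 1 := by
    rw [← kap_self (G.items m) (lx : _ → Fin (v + 1) ⊕ₗ Fin e)]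
    refine kap_congr_lt (fun _ _ _ _ => Iff.rfl) ?_
    rintro (x | x) - (y | y) - <;> simp [hi.lt_iff_lt, hj.lt_iff_lt]
  rw [this, one_smul]

lemma base_of_not {φ : ∀ v e, SGraph k v e → M} {X : NG k} (h : ∀ (v e : ℕ) (G : SGraph k v e) i j,
    ¬ Lab X G i j) : base φ X = 0 :=
  dif_neg fun ⟨_, i, j, hl, _⟩ => h _ _ _ i j hl

lemma agree_symm_ren {X X' : NG k} (h : Agree X' (X.ren σ ρ f)) : Agree X (X'.ren σ.symm ρ.symm (f ∘
    ρ.symm)) := by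
  have h1 := h.ren σ.symm ρ.symm (f ∘ ρ.symm)
  rw [ren_ren] at h1
  have e1 : σ.trans σ.symm = 1 := σ.self_trans_symm
  have e2 : ρ.trans ρ.symm = 1 := ρ.self_trans_symm
  have e3 : (fun a => xor (f a) ((f ∘ ρ.symm) (ρ a))) = fun _ => false := by funext a; simp
  rw [e1, e2, e3, ren_one] at h1
  exact h1.symm

lemma alt_base {φ : ∀ v e, SGraph k v e → M} (hφ : FinAlt m φ) : Alt m (base φ) := by
  intro X X' σ ρ f _ ha
  by_cases hex : ∃ (v e : ℕ) (G : SGraph k v e) (i : Fin (v + 1) → ℕ) (j : Fin e → ℕ), Lab X G i j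
  · obtain ⟨v, e, G, i, j, h⟩ := hex
    rw [base_eq hφ h, base_eq hφ (h.ren ha), hφ, SGraph.relabelSign_eq, smul_smul, smul_smul]
    congr 1
    have hit : (G.relabel 1 1 (f ∘ j)).items m = G.items m := by
      simp [SGraph.items, SGraph.solid, SGraph.dotted, SGraph.relabel]
    have h1 : (lx ∘ Sum.map (1 : Perm (Fin (v + 1))) (1 : Perm (Fin e)) :
        Fin (v + 1) ⊕ Fin e → _) = lx := by
      funext x; rcases x with x | x <;> rfl
    have h2 : X.fsgn m f = if Even m then ∏ a ∈ G.dotted, (if (f ∘ j) a then -1 else 1) else 1 := by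
      rw [fsgn, h.dotted_eq, prod_map]; rfl
    have hi := h.i_inj
    have hj := h.j_inj
    have h3 := kap_comp (S := G.items m) (F := lx) (G := lx ∘ Sum.map i j)
      (H := lx ∘ Sum.map (σ ∘ i) (ρ ∘ j)) lx_injective.injOn
      (lx_injective.comp (map_injective.2 ⟨hi, hj⟩)).injOn
      (lx_injective.comp (map_injective.2 ⟨σ.injective.comp hi, ρ.injective.comp hj⟩)).injOn
    rw [hit, h1, kap_self, one_mul, ← h2, sgn, h.items_eq, kap_map, ← h3]
    have e : (lx ∘ Sum.map σ ρ) ∘ (⟨Sum.map i j, map_injective.2 ⟨hi, hj⟩⟩ : _ ↪ _) =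
      lx ∘ Sum.map (σ ∘ i) (ρ ∘ j) := by
      funext x; rcases x with x | x <;> rfl
    rw [e]
    simp only [coeFn_mk]
    ring
  · have h0 : ∀ (v e : ℕ) (G : SGraph k v e) i j, ¬ Lab X G i j := fun v e G i j h =>
      hex ⟨v, e, G, i, j, h⟩
    rw [base_of_not h0, smul_zero]
    exact base_of_not fun v e G i j h => h0 _ _ _ _ _ (h.ren (agree_symm_ren ha))

end

section

open NG

variable {k : ℕ} {M : Type*} [AddCommGroup M]
variable {f : ℕ → Bool} {w i j : ℕ} {X : NG k} {σ ρ : Perm ℕ}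

/-! ### Extension of alternating functions by the rule for passing vertices -/

lemma xor_xor_self (a b : Bool) : xor a (xor a b) = b := by cases a <;> simp

namespace NG

lemma FuseAt.ren {X X' : NG k} (h : X.FuseAt w i j) (hi : f i = false) (hj : f j = false) (ha :
    Agree X' (X.ren σ ρ f)) : X'.FuseAt (σ w) (ρ i) (ρ j) := by
  have ei := ha.ends_apply h.i_mem
  have ej := ha.ends_apply h.j_mem
  refine ⟨by rw [ha.V_eq]; simpa using h.w_mem, ha.mem_E.2 h.i_mem, ha.mem_E.2 h.j_mem,
    fun e => h.ne (ρ.injective e), ?_, ?_, ?_, ?_, fun a hm hai haj s => ?_, fun c => ?_⟩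
  · simp [ei, hi, h.i_true]
  · simp [ej, hj, h.j_false]
  · simp [ei, hi, h.i_false]
  · simp [ej, hj, h.j_true]
  · obtain ⟨b, rfl⟩ := ρ.surjective a
    have hb := ha.mem_E.1 hm
    rw [ha.ends_apply hb]
    simpa using h.other b hb (fun e => hai (by rw [e])) (fun e => haj (by rw [e])) _
  · rw [ha.col_apply h.i_mem, ha.col_apply h.j_mem, hi, hj, h.col_eq]

lemma FuseAt.fuse_agree {X X' : NG k} (h : X.FuseAt w i j) (hj : f j = false) (ha : Agree X' (X.ren
    σ ρ f)) : Agree (X'.fuse (σ w) (ρ i) (ρ j)) ((X.fuse w i j).ren σ ρ f) := by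
  have he : X'.ends (ρ j) true = σ (X.ends j true) := by simp [ha.ends_apply h.j_mem, hj]
  rw [fuse, he]
  exact (ha.contract j (X.ends j true) w).setTy i none

lemma coef_agree {X X' : NG k} {i j : ℕ} (him : i ∈ X.E) (hjm : j ∈ X.E) (hi : f i = false) (hj : f
    j = false) (ha : Agree X' (X.ren σ ρ f)) : X'.coef (ρ i) (ρ j) = X.coef i j := by
  have hx : xor false = id := by grind
  simp [coef, ha.ty_apply him, ha.ty_apply hjm, hi, hj, hx]

lemma FuseAt.mem_dotted (h : X.FuseAt w i j) : i ∈ (X.fuse w i j).dotted :=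
  NG.mem_dotted.2 ⟨by simp [fuse, h.i_mem, h.ne], by simp [fuse]⟩

lemma FuseAt.fsgn_fuse {m : ℤ} (h : X.FuseAt w i j) (hi : X.ty i ≠ none) (hj : X.ty j ≠ none) :
    (X.fuse w i j).fsgn m f = (if f i then - eps m else 1) * X.fsgn m f := by
  obtain ⟨s, hs⟩ := ne_none_iff_exists'.1 hi
  rw [fsgn_setTy h.mem_dotted s, fuse_setTy_self hs, fsgn_contract (mem_solid.2 ⟨h.j_mem, hj⟩)]

lemma FuseAt.sgn_fuse {m : ℤ} {X X' : NG k} (h : X.FuseAt w i j) (hi : f i = false) (hti : X.ty i ≠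
    none) (htj : X.ty j ≠ none) (ha : Agree X' (X.ren σ ρ f)) : fuseSgn m (X'.items m) (σ w) (ρ i)
    (ρ j) * (X.fuse w i j).sgn m σ ρ f = X.sgn m σ ρ f * fuseSgn m (X.items m) w i j := by
  have hsj := mem_solid.2 ⟨h.j_mem, htj⟩
  have k1 := aft_items_ren (m := m) (σ := σ) (ρ := ρ) (f := f) (X := X) (citem m j w)
  have k2 := aft_items_ren (m := m) (σ := σ) (ρ := ρ) (f := f)
    (X := X.contract j (X.ends j true) w) (inr i)
  have hf : (X.fuse w i j).fsgn m f = X.fsgn m f := by rw [h.fsgn_fuse hti htj]; simp [hi]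
  have e2 : ((X.contract j (X.ends j true) w).ren σ ρ f).items m =
      tog ((X.ren σ ρ f).items m) (Sum.map σ ρ (citem m j w)) := by
    rw [items_ren, items_ren, items_contract hsj _ h.w_mem, tog_map]
    rfl
  rw [e2, items_contract hsj _ h.w_mem, citem_map, map_inr] at k2
  rw [citem_map] at k1
  rw [sgn, sgn, hf, h.items_fuse hti htj, fuseSgn, fuseSgn, ha.items_eq]
  linear_combination (X.fsgn m f) * aft lx ((X.ren σ ρ f).items m) (citem m (ρ j) (σ w)) * k2 +
    X.fsgn m f * aft lx (tog (X.items m) (citem m j w)) (inr i) * k1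

lemma FuseAt.flip_agree (hf : X.FuseAt w i j) : Agree ((X.ren 1 1 (flip2 i j)).fuse w j i) ((X.fuse
    w i j).ren 1 (swap i j) (flip2 i j)) := by
  have hsw : ∀ a, a ≠ i → a ≠ j → swap i j a = a := by grind
  refine ⟨?_, ?_, fun a ha => ?_, fun a ha c => ?_, fun a ha => ?_⟩
  · ext x; simp [fuse]
  · ext x
    simp only [fuse, contract_E, NG.ren, setTy_E, mem_map_equiv, symm_swap, mem_erase,
      one_symm_apply]
    rcases eq_or_ne x i with rfl | hxi
    · simp
    · rcases eq_or_ne x j with rfl | hxj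
      · simp [hf.i_mem, hf.j_mem, hf.ne, hf.ne.symm]
      · grind
  all_goals
    have hai : a ≠ i := by
      simp only [fuse, contract_E, setTy_E, mem_erase] at ha; exact ha.1
    have haE : a ∈ X.E := by
      simp only [fuse, contract_E, setTy_E, mem_erase, NG.ren] at ha; simpa using ha.2
  · funext s
    rcases eq_or_ne a j with rfl | haj
    · cases s <;> simp [fuse, contract_ends, flip2, hf.i_true, hf.j_false, hf.i_false,
        hf.j_true]
    · have h1 := hf.other a haE hai haj s
      simp [fuse, contract_ends, flip2, hsw a hai haj, hai, haj, h1]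
  · rcases eq_or_ne a j with rfl | haj
    · simp [fuse, flip2, hf.col_eq]
    · simp [fuse, flip2, hsw a hai haj, hai, haj]
  · rcases eq_or_ne a j with rfl | haj
    · simp [fuse]
    · simp [fuse, hsw a hai haj, setTy_ty_ne _ haj, setTy_ty_ne _ hai]

lemma FuseAt.coef_flip {i j : ℕ} : (X.ren 1 1 (flip2 i j)).coef j i = X.coef i j := by
  simp only [coef, NG.ren, flip2]
  rcases h1 : X.ty i with _ | _ | _ <;> rcases h2 : X.ty j with _ | _ | _ <;> simp [h1, h2]

lemma FuseAt.sgn_flip {m : ℤ} (hf : X.FuseAt w i j) (hi : X.ty i ≠ none) (hj : X.ty j ≠ none) :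
    X.sgn m 1 1 (flip2 i j) * fuseSgn m ((X.ren 1 1 (flip2 i j)).items m) w j i * (X.fuse w i j).sgn
    m 1 (swap i j) (flip2 i j) = fuseSgn m (X.items m) w i j := by
  have hsj := mem_solid.2 ⟨hf.j_mem, hj⟩
  have hit : (X.ren 1 1 (flip2 i j)).items m = X.items m := by
    rw [items_ren]
    ext (x | x) <;> rw [mem_map_equiv] <;> rfl
  have hf1 : X.fsgn m (flip2 i j) = 1 := by
    unfold fsgn
    split_ifs
    · refine prod_eq_one fun a ha => if_neg ?_
      rw [NG.mem_dotted] at ha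
      simp only [flip2, decide_eq_true_eq]
      rintro (rfl | rfl)
      exacts [hi ha.2, hj ha.2]
    · rfl
  have hf2 : (X.fuse w i j).fsgn m (flip2 i j) = - eps m := by
    rw [hf.fsgn_fuse hi hj, hf1]; simp [flip2]
  rw [NG.sgn_flip, hf1, hit, sgn, hf2, hf.items_fuse hi hj, one_mul, sum_map_one_swap]
  unfold fuseSgn citem eps
  by_cases hm : Even m
  · simp only [hm, if_true]
    set O := X.items m
    have hiO : inr i ∈ O := inr_mem_items.2 ⟨hf.i_mem, by simp [hm, hi]⟩
    have hjO : inr j ∈ O := inr_mem_items.2 ⟨hf.j_mem, by simp [hm, hj]⟩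
    rw [kap_swap_of_notMem]
    · have h2 := aft_lx_anticomm O (c := inr i)
        (d := inr j) (by simpa using hf.ne)
      linear_combination - h2
    · simp [mem_tog, hiO, hf.ne]
    · simp [mem_tog, hjO, hf.ne.symm]
  · simp only [hm, if_false]
    set O := X.items m
    have hiO : inr i ∉ O := fun h => hi (by simpa [hm] using (inr_mem_items.1 h).2)
    have hjO : inr j ∉ O := fun h => hj (by simpa [hm] using (inr_mem_items.1 h).2)
    have h1 := kap_swap_tog (F := (lx : ℕ ⊕ ℕ → _)) lx_injective (a := inr i) (b := inr j)
      (S := tog O (inl w)) (by simp [mem_tog, hiO]) (by simp [mem_tog, hjO])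
      (by simpa using hf.ne)
    rw [h1]
    linear_combination (aft lx O (inl w) * aft lx (tog O (inl w)) (inr i)) *
      aft_mul_self lx (tog O (inl w)) (inr j)

lemma FuseAt.card_lt (h : X.FuseAt w i j) : (X.fuse w i j).V.card < X.V.card :=
    Finset.card_erase_lt_of_mem h.w_mem

lemma ren_ren_flip (X : NG k) (f f' : ℕ → Bool) : (X.ren 1 1 f).ren 1 1 f' = X.ren 1 1 fun a => xor
    (f a) (f' a) := by
  rw [ren_ren]; rfl

lemma ren_ren_flip_self (X : NG k) (f : ℕ → Bool) : (X.ren 1 1 f).ren 1 1 f = X := by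
  rw [ren_ren_flip]; simp [ren_one]

/-- Some passing vertex is fusable after reversal of intrinsic orientations. -/
def Fusable (X : NG k) : Prop := ∃ f w i j, (X.ren 1 1 f).FuseAt w i j

end NG

/-- The extension of a function of labelled graphs by the rule for passing vertices. -/
def ext (m : ℤ) (φ : ∀ v e, SGraph k v e → M) (X : NG k) : M :=
  if h : ∃ p : (ℕ → Bool) × ℕ × ℕ × ℕ, (X.ren 1 1 p.1).FuseAt p.2.1 p.2.2.1 p.2.2.2 then
    let p := h.choose
    let X' := X.ren 1 1 p.1
    (X.sgn m 1 1 p.1 * (X'.coef p.2.2.1 p.2.2.2 * fuseSgn m (X'.items m) p.2.1 p.2.2.1 p.2.2.2)) •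
        ext m φ (X'.fuse p.2.1 p.2.2.1 p.2.2.2)
  else base φ X
termination_by X.V.card
decreasing_by
  have := h.choose_spec.card_lt
  simpa using this

/-- The value of a function on a graph with a passing vertex according to the rule. -/
def fuseVal (m : ℤ) (ψ : NG k → M) (X : NG k) (w i j : ℕ) : M :=
  (X.coef i j * fuseSgn m (X.items m) w i j) • ψ (X.fuse w i j)

lemma ext_of_fusable {m : ℤ} {φ : ∀ v e, SGraph k v e → M} (h : X.Fusable) : ∃ f w i j, (X.ren 1 1
    f).FuseAt w i j ∧ ext m φ X = X.sgn m 1 1 f • fuseVal m (ext m φ) (X.ren 1 1 f) w i j := by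
  obtain ⟨f, w, i, j, h⟩ := h
  have h' : ∃ p : (ℕ → Bool) × ℕ × ℕ × ℕ, (X.ren 1 1 p.1).FuseAt p.2.1 p.2.2.1 p.2.2.2 :=
    ⟨(f, w, i, j), h⟩
  refine ⟨_, _, _, _, h'.choose_spec, ?_⟩
  rw [ext, dif_pos h', fuseVal, smul_smul]

lemma ext_of_not {m : ℤ} {φ : ∀ v e, SGraph k v e → M} (h : ¬ X.Fusable) : ext m φ X = base φ X :=
    by
  rw [ext, dif_neg]
  rintro ⟨p, hp⟩
  exact h ⟨_, _, _, _, hp⟩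

/-- The relations hold for graphs with less than `N` vertices. -/
structure GoodBelow (N : ℕ) (m : ℤ) (Bad : NG k → Prop) (ψ : NG k → M) : Prop where
  alt : ∀ (X X' : NG k) (σ ρ : Perm ℕ) (f : ℕ → Bool), X.V.card < N → X.Closed →
    Agree X' (X.ren σ ρ f) → ψ X' = X.sgn m σ ρ f • ψ X
  bad : ∀ X : NG k, X.V.card < N → X.Closed → Bad X → ψ X = 0
  fuse : ∀ (X : NG k) (w i j : ℕ), X.V.card < N → X.Closed → X.FuseAt w i j →
    ψ X = fuseVal m ψ X w i j

namespace GoodBelow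

variable {N : ℕ} {m : ℤ} {Bad : NG k → Prop} {ψ : NG k → M}

lemma fuseVal_ren (H : GoodBelow N m Bad ψ) {X X' : NG k} (hN : X.V.card ≤ N) (hc : X.Closed) (h :
    X.FuseAt w i j) (hi : f i = false) (hj : f j = false) (ha : Agree X' (X.ren σ ρ f)) : fuseVal m
    ψ X' (σ w) (ρ i) (ρ j) = X.sgn m σ ρ f • fuseVal m ψ X w i j := by
  unfold fuseVal
  rw [coef_agree h.i_mem h.j_mem hi hj ha, H.alt _ _ σ ρ f (h.card_lt.trans_le hN) (h.closed hc)
    (h.fuse_agree hj ha)]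
  by_cases h0 : X.coef i j = 0
  · simp [h0]
  · obtain ⟨hti, htj⟩ := coef_ne_zero h0
    have := h.sgn_fuse (m := m) hi hti htj ha
    linear_combination (norm := module) X.coef i j • this • ψ (X.fuse w i j)

lemma fuseVal_flip (H : GoodBelow N m Bad ψ) (hN : X.V.card ≤ N) (hc : X.Closed) (h : X.FuseAt w i
    j) : X.sgn m 1 1 (flip2 i j) • fuseVal m ψ (X.ren 1 1 (flip2 i j)) w j i = fuseVal m ψ X w i j
    := by
  unfold fuseVal
  rw [FuseAt.coef_flip, H.alt _ _ _ _ _ (h.card_lt.trans_le hN) (h.closed hc) h.flip_agree]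
  by_cases h0 : X.coef i j = 0
  · simp [h0]
  · obtain ⟨hti, htj⟩ := coef_ne_zero h0
    have := h.sgn_flip (m := m) hti htj
    linear_combination (norm := module) X.coef i j • this • ψ (X.fuse w i j)

lemma fuseVal_comm (H : GoodBelow N m Bad ψ) (hN : X.V.card ≤ N) (hc : X.Closed) {w i j w' i' j' :
    ℕ} (h : X.FuseAt w i j) (h' : X.FuseAt w' i' j') (hw : w ≠ w') (h1 : i ≠ i') (h2 : i ≠ j') (h3 :
    j ≠ i') (h4 : j ≠ j') : fuseVal m ψ X w i j = fuseVal m ψ X w' i' j' := by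
  have key : ∀ {w i j w' i' j' : ℕ}, X.FuseAt w i j → X.FuseAt w' i' j' → w ≠ w' → i ≠ i' →
      i ≠ j' → j ≠ i' → j ≠ j' → fuseVal m ψ X w i j = (X.coef i j * X.coef i' j' * (fuseSgn m
        (X.items m) w i j * fuseSgn m (tog (tog (X.items m) (citem m j w)) (inr i))
          w' i' j')) • ψ ((X.fuse w i j).fuse w' i' j') := by
    intro w i j w' i' j' h h' hw h1 h2 h3 h4
    have hf' : (X.fuse w i j).FuseAt w' i' j' :=
      (h'.contract h3 h4 (by
        intro e
        rcases eq_or_ne j i' with rfl | h5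
        · exact h3 rfl
        · exact h'.other j h.j_mem h3 h4 true e) hw).setTy _ _
    rw [fuseVal, H.fuse _ _ _ _ (h.card_lt.trans_le hN) (h.closed hc) hf', fuseVal]
    by_cases h0 : X.coef i j = 0
    · simp [h0]
    · obtain ⟨hti, htj⟩ := coef_ne_zero h0
      rw [h.items_fuse hti htj]
      have hco : (X.fuse w i j).coef i' j' = X.coef i' j' := by
        simp only [coef, NG.fuse, setTy_ty_ne _ h1.symm, setTy_ty_ne _ h2.symm, contract_ty]
      rw [hco, smul_smul]
      congr 1; ring
  rw [key h h' hw h1 h2 h3 h4, key h' h hw.symm h1.symm h3.symm h2.symm h4.symm]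
  have e : (X.fuse w i j).fuse w' i' j' = (X.fuse w' i' j').fuse w i j := by
    have a1 : X.ends j true ≠ w' := h'.other j h.j_mem h3 h4 true
    have a2 : X.ends j' true ≠ w := h.other j' h'.j_mem h2.symm h4.symm true
    have b1 : (X.fuse w i j).ends j' true = X.ends j' true := by
      simp [NG.fuse, contract_ends, a2]
    have b2 : (X.fuse w' i' j').ends j true = X.ends j true := by
      simp [NG.fuse, contract_ends, a1]
    rw [NG.fuse, b1, NG.fuse, NG.fuse, b2, NG.fuse, contract_setTy, contract_setTy, setTy_comm _ h1,
      contract_comm _ a2.symm a1.symm hw]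
  rw [e]
  congr 1
  have hA := fuseSgn_comm (m := m) (tog (X.items m) (citem m j w)) (w := w') (i := i') (j := j')
    (c := inr i) (inr_ne_citem h2) (by simpa using h1)
  have hB := fuseSgn_comm (m := m) (X.items m) (w := w') (i := i') (j := j')
    (c := citem m j w) (citem_ne h4 hw) (by unfold citem; split_ifs <;> simp [h3])
  unfold fuseSgn at hA hB ⊢
  have e3 : tog (tog (tog (X.items m) (citem m j w)) (citem m j' w')) (inr i') =
      tog (tog (tog (X.items m) (citem m j' w')) (inr i')) (citem m j w) := by
    rw [tog_comm _ (citem m j w), tog_comm _ (citem m j w)]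
  rw [e3] at hA
  linear_combination (X.coef i j * X.coef i' j') * (aft lx (X.items m) (citem m j w) * hA + aft lx
    (tog (tog (tog (X.items m) (citem m j' w')) (inr i')) (citem m j w)) (inr i) * hB)

lemma eq_zero_of_coef (H : GoodBelow N m Bad ψ) (hN : X.V.card < N) (hc : X.Closed) (h : (X.ren 1 1
    f).FuseAt w i j) (h0 : (X.ren 1 1 f).coef i j = 0) : ψ X = 0 := by
  have h1 := H.alt X _ 1 1 f hN hc (Agree.refl _)
  rw [H.fuse _ w i j (by simpa using hN) (hc.ren _ _ _) h, fuseVal, h0, zero_mul,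
    zero_smul] at h1
  have h2 := congrArg (fun x => X.sgn m 1 1 f • x) h1
  simp only [smul_zero, smul_smul, sgn_mul_self, one_smul] at h2
  exact h2.symm

/-- Paths with three edges are zero. -/
lemma fuseVal_eq_zero (hB : BadCond m Bad) (H : GoodBelow N m Bad ψ) (hN : X.V.card ≤ N) (hc :
    X.Closed) {w i j w' j' : ℕ} (h : X.FuseAt w i j) (h' : (X.ren 1 1 f).FuseAt w' j j') (hw : w ≠
    w') : fuseVal m ψ X w i j = 0 := by
  have hjt : X.ends j true = w' ∧ f j = false := by
    have := h'.i_true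
    rcases hfj : f j with _ | _
    · simpa [hfj] using this
    · simp [hfj, h.j_false, hw] at this
  have hN' := h.card_lt.trans_le hN
  have hc' := h.closed hc
  have hiE : i ∈ (X.fuse w i j).E := by simp [NG.fuse, h.i_mem, h.ne]
  have e1 : (X.fuse w i j).ends i true = w' := by
    simp [NG.fuse, contract_ends, h.i_true, hjt.1]
  have e2 : (X.fuse w i j).ends i false = X.ends i false := by
    simp [NG.fuse, contract_ends, h.i_false]
  by_cases htad : X.ends i false = w'
  · rw [fuseVal, H.bad _ hN' hc' (hB.tadpole _ i hiE (by rw [e1, e2, htad])), smul_zero]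
  have hj'E : j' ∈ X.E := by simpa using h'.j_mem
  have hj'e : ∀ s, (X.ren 1 1 f).ends j' s = X.ends j' (xor (f j') s) := fun s => by
    simp
  have hne : i ≠ j' := by
    rintro rfl
    have := h'.j_false
    rw [hj'e] at this
    rcases hfi : f i with _ | _
    · grind
    · rw [hfi] at this; exact hw (h.i_true.symm.trans this)
  have hj'w : ∀ s, X.ends j' s ≠ w := h.other j' hj'E hne.symm h'.ne.symm
  have key : ((X.fuse w i j).ren 1 1 fun a => decide (a = j') && f j').FuseAt w' i j' := by
    have hcol : ∀ c, X.col c i = xor (f j') (X.col c j') := fun c => by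
      rw [h.col_eq c]
      simpa [hjt.2] using h'.col_eq c
    refine ⟨?_, by simpa using hiE, ?_, hne, ?_, ?_, ?_, ?_, fun a ha hai haj s => ?_,
      fun c => ?_⟩
    · have := h'.w_mem
      simp only [NG.ren] at this ⊢
      simpa [NG.fuse, hw.symm] using this
    · simp [NG.fuse, hj'E, h'.ne.symm]
    · simp [hne, e1]
    · have := h'.j_false
      rw [hj'e] at this
      simpa [NG.fuse, contract_ends, hj'w] using this
    · simp [hne, e2, htad]
    · have := h'.j_true
      rw [hj'e] at this
      simpa [NG.fuse, contract_ends, hj'w] using this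
    · have ha' : a ∈ X.E ∧ a ≠ j := by
        simpa [NG.fuse, and_comm] using ha
      have h3 := h.other a ha'.1 hai ha'.2
      have h4 := h'.other a (by simpa using ha'.1) ha'.2 haj
      have h5 : X.ends a s ≠ w' := by
        have := h4 (xor (f a) s)
        simpa using this
      simpa [NG.fuse, contract_ends, haj, h3] using h5
    · simp [NG.fuse, hne, hcol c]
  rw [fuseVal, H.eq_zero_of_coef hN' hc' key, smul_zero]
  simp [coef, NG.fuse]

lemma fuseVal_unique (hB : BadCond m Bad) (H : GoodBelow N m Bad ψ) (hN : X.V.card ≤ N) (hc :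
    X.Closed) {w i j w' i' j' : ℕ} (h : X.FuseAt w i j) (h' : (X.ren 1 1 f).FuseAt w' i' j') : X.sgn
    m 1 1 f • fuseVal m ψ (X.ren 1 1 f) w' i' j' = fuseVal m ψ X w i j := by
  have hmul : ∀ (X : NG k) (f f' : ℕ → Bool), (X.ren 1 1 f).sgn m 1 1 f' * X.sgn m 1 1 f =
      X.sgn m 1 1 fun a => xor (f a) (f' a) := fun X f f' => sgn_mul m 1 1 1 1 f f' X
  -- reversal of the two edges of the second pair
  have hrev : ∀ {f : ℕ → Bool} {w' i' j' : ℕ}, (X.ren 1 1 f).FuseAt w' i' j' →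
      ∃ f', (X.ren 1 1 f').FuseAt w' j' i' ∧
        X.sgn m 1 1 f' • fuseVal m ψ (X.ren 1 1 f') w' j' i' =
          X.sgn m 1 1 f • fuseVal m ψ (X.ren 1 1 f) w' i' j' := by
    intro f w' i' j' h'
    have h1 := H.fuseVal_flip (X := X.ren 1 1 f) (by simpa using hN)
      (hc.ren _ _ _) h'
    refine ⟨fun a => xor (f a) (flip2 i' j' a), ?_, ?_⟩
    · rw [← ren_ren_flip]; exact h'.flip
    · rw [← h1, ← ren_ren_flip, smul_smul, ← hmul]; congr 1; ring
  -- the same pair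
  have hsame : ∀ {f : ℕ → Bool}, (X.ren 1 1 f).FuseAt w i j →
      X.sgn m 1 1 f • fuseVal m ψ (X.ren 1 1 f) w i j = fuseVal m ψ X w i j := by
    intro f h'
    have hi : f i = false := by
      rcases hf : f i with _ | _
      · rfl
      · exact absurd h'.i_true (by simpa [hf] using h.i_false)
    have hj : f j = false := by
      rcases hf : f j with _ | _
      · rfl
      · exact absurd h'.j_false (by simpa [hf] using h.j_true)
    have := H.fuseVal_ren (σ := 1) (ρ := 1) hN hc h hi hj (Agree.refl _)
    simp only [coe_one, id_eq] at this
    rw [this, smul_smul, sgn_mul_self, one_smul]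
  -- pairs with a common edge
  have hzero : ∀ {f : ℕ → Bool} {i' j' : ℕ}, (X.ren 1 1 f).FuseAt w' i' j' → w ≠ w' →
      j = i' → fuseVal m ψ X w i j = 0 ∧ X.sgn m 1 1 f • fuseVal m ψ (X.ren 1 1 f) w' i' j' = 0 := by
    rintro f i' j' h' hw rfl
    refine ⟨H.fuseVal_eq_zero hB hN hc h h' hw, ?_⟩
    obtain ⟨f1, h1, e1⟩ := hrev h'
    have h2 : ((X.ren 1 1 f1).ren 1 1 fun a => xor (f1 a) (flip2 i j a)).FuseAt w j i := by
      rw [ren_ren_flip]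
      simpa using h.flip
    rw [← e1, H.fuseVal_eq_zero hB (by simpa using hN) (hc.ren _ _ _) h1 h2 hw.symm,
      smul_zero]
  have hflip := hrev (f := fun _ => false) (w' := w) (i' := i) (j' := j) (by rwa [ren_one])
  rw [ren_one, sgn_one, one_smul] at hflip
  have hi'E : i' ∈ X.E := by simpa using h'.i_mem
  have hj'E : j' ∈ X.E := by simpa using h'.j_mem
  by_cases hw : w = w'
  · subst hw
    have hi' : i' = i ∨ i' = j := by
      by_contra hcon
      push Not at hcon
      exact h.other i' hi'E hcon.1 hcon.2 (xor (f i') true) (by simpa using h'.i_true)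
    have hj' : j' = i ∨ j' = j := by
      by_contra hcon
      push Not at hcon
      exact h.other j' hj'E hcon.1 hcon.2 (xor (f j') false) (by simpa using h'.j_false)
    have hne := h'.ne
    rcases hi' with rfl | rfl <;> rcases hj' with rfl | rfl
    · grind
    · exact hsame h'
    · grind
    · grind
  by_cases h3 : j = i'
  · grind
  by_cases h4 : j = j'
  · grind
  by_cases h12 : i = i' ∨ i = j'
  · -- reduce to the previous case by reversing the first pair
    obtain ⟨f2, h2, e2⟩ := hflip
    have aux : ∀ {f : ℕ → Bool} {i' j' : ℕ}, (X.ren 1 1 f).FuseAt w' i' j' → i = i' →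
        fuseVal m ψ X w i j = 0 ∧ X.sgn m 1 1 f • fuseVal m ψ (X.ren 1 1 f) w' i' j' = 0 := by
      rintro f i' j' h' rfl
      have h5 : ((X.ren 1 1 f2).ren 1 1 fun a => xor (f2 a) (f a)).FuseAt w' i j' := by
        rw [ren_ren_flip]; simpa using h'
      refine ⟨?_, ?_⟩
      · rw [← e2, H.fuseVal_eq_zero hB (by simpa using hN) (hc.ren _ _ _) h2 h5 hw,
          smul_zero]
      · obtain ⟨f1, h1, e1⟩ := hrev h'
        have h6 : ((X.ren 1 1 f1).ren 1 1 f1).FuseAt w i j := by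
          rwa [ren_ren_flip_self]
        rw [← e1, H.fuseVal_eq_zero hB (by simpa using hN) (hc.ren _ _ _) h1 h6
          (Ne.symm hw), smul_zero]
    rcases h12 with h12 | h12
    · grind
    · grind
  push Not at h12
  -- disjoint pairs
  set g : ℕ → Bool := fun a => decide (a = i' ∨ a = j') && f a with hg
  have hgi : g i = false := by grind
  have hgj : g j = false := by grind
  have hgi' : xor (f i') (g i') = false := by simp [hg]
  have hgj' : xor (f j') (g j') = false := by simp [hg]
  have A1 : (X.ren 1 1 g).FuseAt w i j := h.ren (σ := 1) (ρ := 1) hgi hgj (Agree.refl _)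
  have hag : Agree (X.ren 1 1 g) ((X.ren 1 1 f).ren 1 1 fun a => xor (f a) (g a)) := by
    rw [ren_ren_flip]; simpa using Agree.refl _
  have A2 : (X.ren 1 1 g).FuseAt w' i' j' := h'.ren (σ := 1) (ρ := 1) hgi' hgj' hag
  have B1 := H.fuseVal_ren (σ := 1) (ρ := 1) hN hc h hgi hgj (Agree.refl _)
  have B2 := H.fuseVal_ren (σ := 1) (ρ := 1) (X := X.ren 1 1 f) (by simpa using hN)
    (hc.ren _ _ _) h' hgi' hgj' hag
  simp only [coe_one, id_eq] at B1 B2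
  have B3 := H.fuseVal_comm (X := X.ren 1 1 g) (by simpa using hN) (hc.ren _ _ _)
    A1 A2 hw h12.1 h12.2 h3 h4
  rw [B1, B2] at B3
  have h5 := hmul X f fun a => xor (f a) (g a)
  simp only [xor_xor_self] at h5
  have h6 := sgn_mul_self m 1 1 g X
  have h7 := sgn_mul_self m 1 1 f X
  have h8 : (X.ren 1 1 f).sgn m 1 1 (fun a => xor (f a) (g a)) =
      X.sgn m 1 1 g * X.sgn m 1 1 f := by
    grind
  rw [h8] at B3
  have B4 := congrArg (fun x => X.sgn m 1 1 g • x) B3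
  simp only [smul_smul, h6, one_smul, ← mul_assoc, one_mul] at B4
  exact B4.symm

end GoodBelow

lemma fusable_ren {X X' : NG k} (ha : Agree X' (X.ren σ ρ f)) {f0 : ℕ → Bool} (h : (X.ren 1 1
    f0).FuseAt w i j) : (X'.ren 1 1 fun a => xor (f (ρ.symm a)) (f0 (ρ.symm a))).FuseAt (σ w) (ρ i)
    (ρ j) ∧ Agree (X'.ren 1 1 fun a => xor (f (ρ.symm a)) (f0 (ρ.symm a))) ((X.ren 1 1 f0).ren σ ρ
    fun _ => false) := by
  have key : Agree (X'.ren 1 1 fun a => xor (f (ρ.symm a)) (f0 (ρ.symm a)))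
      ((X.ren 1 1 f0).ren σ ρ fun _ => false) := by
    have h1 := ha.ren 1 1 fun a => xor (f (ρ.symm a)) (f0 (ρ.symm a))
    rw [ren_ren] at h1
    rw [ren_ren]
    simp only [symm_apply_apply, ← Bool.xor_assoc, Bool.xor_self, Bool.false_xor] at h1
    simp only [Bool.xor_false]
    exact h1
  exact ⟨h.ren rfl rfl key, key⟩

lemma goodBelow_ext {m : ℤ} {Bad : NG k → Prop} {φ : ∀ v e, SGraph k v e → M} (hB : BadCond m Bad)
    (hφ : FinAlt m φ) (hbad : ∀ (X : NG k) (v e : ℕ) (G : SGraph k v e) i j, Lab X G i j → Bad X → φ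
    v e G = 0) (N : ℕ) : GoodBelow N m Bad (ext m φ) := by
  induction N with
  | zero => exact ⟨fun _ _ _ _ _ h => by omega, fun _ h => by omega, fun _ _ _ _ h => by omega⟩
  | succ N H =>
    have val : ∀ (X : NG k) (f : ℕ → Bool) (w i j : ℕ), X.V.card < N + 1 → X.Closed →
        (X.ren 1 1 f).FuseAt w i j →
        ext m φ X = X.sgn m 1 1 f • fuseVal m (ext m φ) (X.ren 1 1 f) w i j := by
      intro X f w i j hN hc h
      obtain ⟨f', w', i', j', h', e⟩ := ext_of_fusable (m := m) (φ := φ) ⟨f, w, i, j, h⟩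
      rw [e, ← H.fuseVal_unique hB (by simp; omega) (hc.ren _ _ _) h
        (f := fun a => xor (f a) (f' a)) (by rw [ren_ren_flip]; simpa using h'),
        ren_ren_flip, smul_smul]
      simp only [xor_xor_self]
      congr 1
      have := sgn_mul m 1 1 1 1 f (fun a => xor (f a) (f' a)) X
      simp only [coe_one, id_eq, xor_xor_self] at this
      rw [mul_comm, this]
      rfl
    refine ⟨fun X X' σ ρ f hN hc ha => ?_, fun X hN hc hb => ?_, fun X w i j hN hc h => ?_⟩
    · by_cases hf : X.Fusable
      · obtain ⟨f0, w, i, j, h⟩ := hf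
        obtain ⟨h', hag⟩ := fusable_ren ha h
        have hc' : X'.Closed := ha.closed (hc.ren _ _ _)
        have hN' : X'.V.card = X.V.card := by rw [ha.V_eq]; simp
        rw [val X' _ _ _ _ (by omega) hc' h', val X _ _ _ _ hN hc h,
          H.fuseVal_ren (X := X.ren 1 1 f0) (by simp; omega) (hc.ren _ _ _) h
            rfl rfl hag, smul_smul, smul_smul]
        congr 1
        have s1 := sgn_mul m 1 1 σ ρ f0 (fun _ => false) X
        have s2 := sgn_mul m σ ρ 1 1 f (fun a => xor (f (ρ.symm a)) (f0 (ρ.symm a))) X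
        rw [← ha.sgn_eq] at s2
        simp only [symm_apply_apply, xor_xor_self] at s2
        simp only [Bool.xor_false] at s1
        have s3 : X.sgn m (Equiv.trans σ (1 : Perm ℕ)) (Equiv.trans ρ (1 : Perm ℕ)) f0 =
          X.sgn m (Equiv.trans (1 : Perm ℕ) σ) (Equiv.trans (1 : Perm ℕ) ρ) f0 := rfl
        rw [s3, ← s1] at s2
        linear_combination (- (X'.sgn m 1 1 fun a => xor (f (ρ.symm a)) (f0 (ρ.symm a))) * (X.ren 1
            1 f0).sgn m σ ρ fun _ => false) * sgn_mul_self m 1 1 f0 X -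
          ((X'.sgn m 1 1 fun a => xor (f (ρ.symm a)) (f0 (ρ.symm a))) * X.sgn m 1 1 f0) * s2 +
          (X.sgn m σ ρ f * X.sgn m 1 1 f0) *
            sgn_mul_self m 1 1 (fun a => xor (f (ρ.symm a)) (f0 (ρ.symm a))) X'
      · have hf' : ¬ X'.Fusable := by
          rintro ⟨f0, w, i, j, h⟩
          exact hf ⟨_, _, _, _, (fusable_ren (agree_symm_ren ha) h).1⟩
        rw [ext_of_not hf, ext_of_not hf']
        exact alt_base hφ X X' σ ρ f hc ha
    · by_cases hf : X.Fusable
      · obtain ⟨f0, w, i, j, h⟩ := hf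
        rw [val X _ _ _ _ hN hc h, fuseVal]
        by_cases h0 : (X.ren 1 1 f0).coef i j = 0
        · simp [h0]
        · have hb' : Bad (X.ren 1 1 f0) := hB.ren X _ 1 1 f0 (Agree.refl _) hb
          rw [H.bad _ (h.card_lt.trans_le (by simp; omega)) (h.closed (hc.ren _ _ _))
            (hB.fuse _ w i j (hc.ren _ _ _) h h0 hb'), smul_zero, smul_zero]
      · rw [ext_of_not hf]
        by_cases hex : ∃ (v e : ℕ) (G : SGraph k v e) (i : Fin (v + 1) → ℕ) (j : Fin e → ℕ),
            Lab X G i j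
        · obtain ⟨v, e, G, i, j, h⟩ := hex
          rw [base_eq hφ h, hbad X v e G i j h hb, smul_zero]
        · exact base_of_not fun v e G i j h => hex ⟨v, e, G, i, j, h⟩
    · have := val X (fun _ => false) w i j hN hc (by rwa [ren_one])
      rwa [ren_one, sgn_one, one_smul] at this

lemma good_ext {m : ℤ} {Bad : NG k → Prop} {φ : ∀ v e, SGraph k v e → M} (hB : BadCond m Bad) (hφ :
    FinAlt m φ) (hbad : ∀ (X : NG k) (v e : ℕ) (G : SGraph k v e) i j, Lab X G i j → Bad X → φ v e G
    = 0) : Good m Bad (ext m φ) :=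
  ⟨fun X X' σ ρ f hc ha => (goodBelow_ext hB hφ hbad _).alt X X' σ ρ f (Nat.lt_succ_self _) hc ha,
    fun X hc hb => (goodBelow_ext hB hφ hbad _).bad X (Nat.lt_succ_self _) hc hb, fun X w i j hc h
    => (goodBelow_ext hB hφ hbad _).fuse X w i j (Nat.lt_succ_self _) hc h⟩

end

section

open NG

variable {k : ℕ} {M : Type*} [AddCommGroup M]
variable {X : NG k} {T : Finset ℕ} {f : ℕ → Bool} {t : ℕ} {σ ρ : Perm ℕ} {w i j : ℕ} {x y : ℕ}

/-! ### Valences, connectedness and degrees -/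

/-- The retraction that sends `b` to `a`. -/
def retract (a b x : ℕ) : ℕ := if x = b then a else x

/-- The retraction along the edge `t` that sends its end `s` to the other end. -/
notation:max "ret(" X "," t "," s ")" => retract (NG.ends X t !s) (NG.ends X t s)

namespace NG

/-- The number of half-edges at `x`. -/
def val (X : NG k) (x : ℕ) : ℕ :=
  ((X.E ×ˢ (univ : Finset Bool)).filter fun p => X.ends p.1 p.2 = x).card

lemma val_eq_sum (X : NG k) (x : ℕ) : X.val x = ∑ a ∈ X.E, ((if X.ends a true = x then 1 else 0) +
    if X.ends a false = x then 1 else 0) := by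
  rw [val, Finset.card_filter, sum_product]
  exact sum_congr rfl fun a _ => Fintype.sum_bool _

/-- Connected along the edges in `T`. -/
def Linked (X : NG k) (T : Finset ℕ) : ℕ → ℕ → Prop :=
  EqvGen fun x y => ∃ a ∈ T, X.ends a false = x ∧ X.ends a true = y

lemma Linked.refl (x : ℕ) : X.Linked T x x := EqvGen.refl x

lemma Linked.symm (h : X.Linked T x y) : X.Linked T y x :=
  EqvGen.symm _ _ h

lemma Linked.trans {x y z : ℕ} (h : X.Linked T x y) (h' : X.Linked T y z) : X.Linked T x z :=
    EqvGen.trans _ _ _ h h'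

lemma Linked.of_mem {a : ℕ} (ha : a ∈ T) (s : Bool) : X.Linked T (X.ends a !s) (X.ends a s) := by
  have : X.Linked T (X.ends a false) (X.ends a true) := EqvGen.rel _ _ ⟨a, ha, rfl, rfl⟩
  cases s
  · exact this.symm
  · exact this

/-- A map of vertices that preserves the relation along edges. -/
lemma Linked.map {k' : ℕ} {X' : NG k'} {T T' : Finset ℕ} {p : ℕ → ℕ} (h : ∀ a ∈ T, X'.Linked T' (p
    (X.ends a false)) (p (X.ends a true))) (hl : X.Linked T x y) : X'.Linked T' (p x) (p y) := by
  induction hl with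
  | rel x y h' => obtain ⟨a, ha, rfl, rfl⟩ := h'; exact h a ha
  | refl x => exact Linked.refl _
  | symm _ _ _ ih => exact ih.symm
  | trans _ _ _ _ _ ih1 ih2 => exact ih1.trans ih2

lemma contract_ends_eq (X : NG k) (t a b i : ℕ) (s : Bool) : (X.contract t a b).ends i s = retract a
    b (X.ends i s) := rfl

lemma retract_of_ne {a b x : ℕ} (h : x ≠ b) : retract a b x = x := if_neg h

@[simp] lemma retract_self (a b : ℕ) : retract a b b = a := if_pos rfl

@[simp] lemma retract_left (a b : ℕ) : retract a b a = a := by simp [retract]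

lemma retract_ends (s r : Bool) : ret(X, t, s) (X.ends t r) = X.ends t !s :=
    by
  cases s <;> cases r <;> simp

lemma Linked.contract (t : ℕ) (s : Bool) (h : X.Linked T x y) : ctr(X, t, s).Linked (T.erase t) (ret(X, t, s) x) (ret(X, t, s) y) := by
  refine Linked.map (fun a ha => ?_) h
  by_cases hat : a = t
  · subst hat
    rw [retract_ends, retract_ends]
    exact Linked.refl _
  · exact Linked.of_mem (X := X.contract t _ _) (mem_erase.2 ⟨hat, ha⟩) true

lemma linked_retract (ht : t ∈ T) (s : Bool) (x : ℕ) : X.Linked T (ret(X, t, s) x) x := by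
  by_cases h : x = X.ends t s
  · subst h; rw [retract_self]; exact Linked.of_mem ht s
  · rw [retract_of_ne h]; exact Linked.refl _

lemma Linked.of_contract (ht : t ∈ T) (s : Bool) (h : ctr(X, t, s).Linked (T.erase t) x y) : X.Linked T x y := by
  refine Linked.map (p := id) (fun a ha => ?_) h
  have h1 := Linked.of_mem (X := X) (mem_of_mem_erase ha) true
  exact ((linked_retract ht s _).trans h1).trans (linked_retract ht s _).symm

/-- The conditions on graphs that are preserved by all operations. -/
structure WF (X : NG k) : Prop where
  closed : X.Closed
  connected : ∀ x ∈ X.V, ∀ y ∈ X.V, X.Linked X.E x y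
  two_le : ∀ x ∈ X.V, 2 ≤ X.val x
  three_le : ∃ x ∈ X.V, 3 ≤ X.val x

lemma val_contract_ne (ht : t ∈ X.E) (s : Bool) {x : ℕ} (h1 : x ≠ X.ends t !s) (h2 : x ≠ X.ends t s)
    : ctr(X, t, s).val x = X.val x := by
  rw [val_eq_sum, val_eq_sum, ← add_sum_erase _ _ ht]
  have h0 : ∀ r, X.ends t r ≠ x := fun r => by
    cases s <;> cases r <;> first | exact h1.symm | exact h2.symm
  rw [if_neg (h0 _), if_neg (h0 _), zero_add, zero_add]
  refine sum_congr rfl fun a _ => ?_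
  have : ∀ y, ret(X, t, s) y = x ↔ y = x := fun y => by
    unfold retract; split_ifs with h
    · grind
    · rfl
  simp only [contract_ends_eq, this]

lemma val_contract_eq (ht : t ∈ X.E) (htad : X.ends t false ≠ X.ends t true) (s : Bool) : ctr(X, t,
    s).val (X.ends t !s) + 2 = X.val (X.ends t !s) + X.val (X.ends t s) := by
  have h0 := ends_ne_not htad s
  rw [val_eq_sum, val_eq_sum, val_eq_sum, ← add_sum_erase _ _ ht, ← add_sum_erase X.E (fun a => _ +
    if X.ends a false = X.ends t s then 1 else 0) ht]
  have h1 : ∀ i r, (if ctr(X, t, s).ends i r = X.ends t !s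
      then 1 else 0 : ℕ) = (if X.ends i r = X.ends t !s then 1 else 0) +
        if X.ends i r = X.ends t s then 1 else 0 := fun i r => by
    rw [contract_ends_eq]
    by_cases h : X.ends i r = X.ends t s
    · rw [h]; simp [h0.symm]
    · simp [retract_of_ne h, h]
  simp only [h1, sum_add_distrib, contract_E]
  cases s <;> simp only [Bool.not_true, Bool.not_false, if_true, if_neg htad, if_neg htad.symm] <;>
    omega

lemma WF.setTy (h : X.WF) (t : ℕ) (o : Option Bool) : (X.setTy t o).WF :=
  ⟨h.1, h.2, h.3, h.4⟩

lemma WF.contract (h : X.WF) (ht : t ∈ X.E) (htad : X.ends t false ≠ X.ends t true) (s : Bool) :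
    ctr(X, t, s).WF := by
  have h1 := val_contract_eq ht htad s
  have ha := h.two_le _ (h.closed t ht !s)
  have hb := h.two_le _ (h.closed t ht s)
  have hab := ends_ne_not htad s
  refine ⟨h.closed.contract (h.closed t ht _) hab, fun x hx y hy => ?_, fun x hx => ?_, ?_⟩
  · rw [contract_V, mem_erase] at hx hy
    have := (h.connected x hx.2 y hy.2).contract t s
    rwa [retract_of_ne hx.1, retract_of_ne hy.1] at this
  · rw [contract_V, mem_erase] at hx
    by_cases hxa : x = X.ends t !s
    · grind
    · rw [val_contract_ne ht s hxa hx.1]; exact h.two_le x hx.2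
  · obtain ⟨x, hx, h3⟩ := h.three_le
    by_cases hxa : x = X.ends t !s
    · subst hxa
      exact ⟨_, mem_erase.2 ⟨hab, hx⟩, by omega⟩
    · by_cases hxb : x = X.ends t s
      · subst hxb
        exact ⟨_, mem_erase.2 ⟨hab, h.closed t ht _⟩, by omega⟩
      · exact ⟨x, mem_erase.2 ⟨hxb, hx⟩, by rwa [val_contract_ne ht s hxa hxb]⟩

lemma WF.fuse (h : X.WF) (hf : X.FuseAt w i j) : (X.fuse w i j).WF := by
  have := h.contract hf.j_mem (by rw [hf.j_false]; exact hf.j_true.symm) false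
  rw [Bool.not_false, hf.j_false] at this
  exact this.setTy _ _

lemma val_agree {X X' : NG k} (h : Agree X' (X.ren σ ρ f)) (x : ℕ) : X'.val (σ x) = X.val x :=
    by
  rw [val_eq_sum, val_eq_sum, h.E_eq, ren, sum_map]
  refine sum_congr rfl fun a ha => ?_
  simp only [coe_toEmbedding, h.ends_apply ha, EmbeddingLike.apply_eq_iff_eq]
  cases f a <;> simp [add_comm]

lemma WF.agree {X X' : NG k} (h : X.WF) (ha : Agree X' (X.ren σ ρ f)) : X'.WF := by
  have hV : ∀ x, x ∈ X'.V ↔ σ.symm x ∈ X.V := fun x => by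
    rw [ha.V_eq, ren, mem_map_equiv]
  refine ⟨ha.closed (h.closed.ren _ _ _), fun x hx y hy => ?_, fun x hx => ?_, ?_⟩
  · have := Linked.map (X' := X') (T' := X'.E) (p := σ) (fun a haE => ?_)
      (h.connected _ ((hV x).1 hx) _ ((hV y).1 hy))
    · grind
    · have h1 := Linked.of_mem (X := X') (ha.mem_E.2 haE) (!f a)
      rw [ha.ends_apply haE, ha.ends_apply haE] at h1
      simpa using h1
  · rw [← σ.apply_symm_apply x, val_agree ha]
    exact h.two_le _ ((hV x).1 hx)
  · obtain ⟨x, hx, h3⟩ := h.three_le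
    exact ⟨σ x, (hV _).2 (by simpa), by rwa [val_agree ha]⟩

/-- The degree. -/
def degree (m : ℤ) (X : NG k) : ℤ :=
  ((X.V.card : ℤ) - 1 + X.dotted.card) * m + (1 - m) * (X.solid.card + 2 * X.dotted.card)

lemma card_solid_add (X : NG k) : X.solid.card + X.dotted.card = X.E.card := by
  rw [add_comm, solid, dotted]
  exact Finset.card_filter_add_card_filter_not _

lemma degree_eq (m : ℤ) (X : NG k) : X.degree m = ((X.V.card : ℤ) - 1) * m + (1 - m) * X.E.card +
    X.dotted.card := by
  rw [degree, ← card_solid_add]; push_cast; ring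

lemma degree_setTy (m : ℤ) (ht : t ∈ X.dotted) (s : Bool) : (X.setTy t (some s)).degree m + 1 =
    X.degree m := by
  rw [degree_eq, degree_eq, dotted_setTy_some, setTy_V, setTy_E, ← card_erase_add_one ht]
  push_cast; ring

lemma dotted_contract (ht : t ∈ X.solid) (a b : ℕ) : (X.contract t a b).dotted = X.dotted := by
  rw [mem_solid] at ht
  ext x
  simp only [mem_dotted, contract_E, contract_ty, mem_erase]
  constructor
  · grind
  · grind

lemma degree_contract (m : ℤ) (ht : t ∈ X.solid) (a : ℕ) {b : ℕ} (hb : b ∈ X.V) : (X.contract t a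
    b).degree m + 1 = X.degree m := by
  rw [degree_eq, degree_eq, dotted_contract ht, contract_V, contract_E, ← card_erase_add_one
    (mem_solid.1 ht).1, ← card_erase_add_one hb]
  push_cast; ring

lemma degree_fuse (m : ℤ) (h : X.FuseAt w i j) (hi : X.ty i ≠ none) (hj : X.ty j ≠ none) : (X.fuse w
    i j).degree m = X.degree m := by
  obtain ⟨s, hs⟩ := ne_none_iff_exists'.1 hi
  rw [← degree_setTy m h.mem_dotted s, fuse_setTy_self hs, degree_contract m (mem_solid.2 ⟨h.j_mem, hj⟩) _ h.w_mem]

lemma degree_agree (m : ℤ) {X X' : NG k} (h : Agree X' (X.ren σ ρ f)) : X'.degree m = X.degree m :=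
    by
  rw [degree_eq, degree_eq, h.V_eq, h.E_eq, h.dotted_eq, dotted_ren]
  simp [ren]

/-! #### Fusable vertices -/

def FusableAt (X : NG k) (w : ℕ) : Prop := ∃ f i j, (X.ren 1 1 f).FuseAt w i j

lemma Fusable.exists_at (h : X.Fusable) : ∃ w, X.FusableAt w :=
  let ⟨f, w, i, j, h⟩ := h
  ⟨w, f, i, j, h⟩

lemma FusableAt.fusable {w : ℕ} (h : X.FusableAt w) : X.Fusable :=
  let ⟨f, i, j, h⟩ := h
  ⟨f, w, i, j, h⟩

lemma FuseAt.fusableAt (h : X.FuseAt w i j) : X.FusableAt w :=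
  ⟨fun _ => false, i, j, by rwa [ren_one]⟩

lemma FusableAt.agree {X X' : NG k} {w : ℕ} (h : X.FusableAt w) (ha : Agree X' (X.ren σ ρ f)) :
    X'.FusableAt (σ w) :=
  let ⟨_, _, _, h⟩ := h
  ⟨_, _, _, (fusable_ren ha h).1⟩

lemma FusableAt.of_flip {w : ℕ} (h : (X.ren 1 1 f).FusableAt w) : X.FusableAt w := by
  have := h.agree (σ := 1) (ρ := 1) (f := f) (X' := X)
    (by rw [ren_ren_flip_self]; exact Agree.refl _)
  exact this

lemma FusableAt.setTy_iff {w t : ℕ} {o : Option Bool} : (X.setTy t o).FusableAt w ↔ X.FusableAt w :=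
  ⟨fun ⟨f, i, j, h⟩ => ⟨f, i, j, h.1, h.2, h.3, h.4, h.5, h.6, h.7, h.8, h.9, h.10⟩, fun ⟨f, i, j,
    h⟩ => ⟨f, i, j, h.1, h.2, h.3, h.4, h.5, h.6, h.7, h.8, h.9, h.10⟩⟩

lemma FuseAt.of_contract {t u p q : ℕ} (s : Bool) (h : ctr(X, t, s).FuseAt u p q) (hu : u ≠ X.ends t !s) : X.FuseAt u p q := by
  have hub : u ≠ X.ends t s := (mem_erase.1 h.w_mem).1
  have key : ∀ y, ret(X, t, s) y = u ↔ y = u := fun y => by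
    unfold retract; split_ifs with h
    · grind
    · rfl
  refine ⟨mem_of_mem_erase h.w_mem, mem_of_mem_erase h.i_mem, mem_of_mem_erase h.j_mem, h.ne, (key
    _).1 h.i_true, (key _).1 h.j_false, fun e => h.i_false ((key _).2 e), fun e => h.j_true ((key
    _).2 e), fun a ha hap haq r e => ?_, h.col_eq⟩
  by_cases hat : a = t
  · subst hat
    cases s <;> cases r <;> first | exact hu e.symm | exact hub e.symm
  · exact h.other a (mem_erase.2 ⟨hat, ha⟩) hap haq r ((key _).2 e)

lemma FusableAt.of_contract {t u : ℕ} (s : Bool) (h : ctr(X, t, s).FusableAt u) (hu : u ≠ X.ends t !s) : X.FusableAt u := by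
  obtain ⟨f, p, q, h⟩ := h
  refine FusableAt.of_flip (f := f) (FuseAt.fusableAt (i := p) (j := q) ?_)
  set X' := X.ren 1 1 f
  have e : ∀ r, X'.ends t r = X.ends t (xor (f t) r) := fun r => rfl
  have e1 : ∀ s, X.ends t s = X'.ends t (xor (f t) s) := fun s => by rw [e, xor_xor_self]
  rw [e1 (!s)] at hu
  have e2 : xor (f t) (!s) = !(xor (f t) s) := by cases f t <;> cases s <;> rfl
  rw [e2] at hu
  refine FuseAt.of_contract (t := t) (xor (f t) s) ?_ hu
  rw [← e2, ← e1, ← e1]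
  have hag : Agree (X'.contract t (X.ends t !s) (X.ends t s))
      (ctr(X, t, s).ren 1 1 f) :=
    (Agree.refl X').contract t _ _
  exact h.ren (σ := 1) (ρ := 1) (f := fun _ => false) rfl rfl (by rwa [ren_one])

lemma FusableAt.of_fuse {w i j u : ℕ} (hf : X.FuseAt w i j) (h : (X.fuse w i j).FusableAt u) :
    X.FusableAt u := by
  have key : ∀ {X : NG k} {i j : ℕ}, X.FuseAt w i j → (X.fuse w i j).FusableAt u →
      u ≠ X.ends j true → X.FusableAt u := by
    intro X i j hf h hu
    rw [fuse, FusableAt.setTy_iff] at h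
    refine FusableAt.of_contract (t := j) false ?_ hu
    rwa [hf.j_false]
  by_cases hu : u = X.ends j true
  · have h1 := h.agree (σ := 1) hf.flip_agree
    refine FusableAt.of_flip (key hf.flip h1 ?_)
    have e : (X.ren 1 1 (flip2 i j)).ends i true = X.ends i false := by
      simp [flip2]
    rw [e, hu]
    intro htad
    obtain ⟨f, p, q, hp⟩ := h
    have h2 : ∀ s, ((X.fuse w i j).ren 1 1 f).ends i s = u := fun s => by
      have : ∀ s, (X.fuse w i j).ends i s = u := fun s => by
        cases s
        · simp [fuse, contract_ends, hf.i_false, hu, htad]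
        · simp [fuse, contract_ends, hf.i_true, hu]
      exact this _
    have h3 : i ∈ ((X.fuse w i j).ren 1 1 f).E := by
      simp [fuse, hf.i_mem, hf.ne]
    by_cases hip : i = p
    · subst hip; exact hp.i_false (h2 _)
    · by_cases hiq : i = q
      · subst hiq; exact hp.j_true (h2 _)
      · exact hp.other i h3 hip hiq true (h2 _)
  · grind

lemma FuseAt.of_ends {s r : Bool} (hw : w ∈ X.V) (hi : i ∈ X.E) (hj : j ∈ X.E) (hij : i ≠ j) (h1 :
    X.ends i s = w) (h2 : X.ends j r = w) (h3 : X.ends i (!s) ≠ w) (h4 : X.ends j (!r) ≠ w) (h5 : ∀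
    a ∈ X.E, a ≠ i → a ≠ j → ∀ s, X.ends a s ≠ w) (h6 : ∀ c, (X.col c i = s) ↔ (X.col c j ≠ r)) :
    (X.ren 1 1 fun a => if a = i then !s else if a = j then r else false).FuseAt w i j := by
  refine ⟨by simpa using hw, by simpa using hi,
    by simpa using hj, hij, ?_, ?_, ?_, ?_, fun a ha hai haj t => ?_, fun c => ?_⟩
  · simpa using h1
  · simpa [hij.symm] using h2
  · simpa using h3
  · simpa [hij.symm] using h4
  · simpa using h5 a (by simpa using ha) hai haj _
  · have := h6 c
    simp only [NG.ren, one_symm_apply, if_true, if_neg hij.symm]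
    revert this
    cases X.col c i <;> cases X.col c j <;> cases s <;> cases r <;> simp

/-! #### Cycles -/

end NG

lemma Acyclic.of_contract {α : Type} {arc arc' : α → α → Prop} {π : α → α} {p q : α} (hpq : p ≠ q)
    (hπ : π p = π q) (h : ∀ x y, arc x y → arc' (π x) (π y) ∨ (x = p ∧ y = q)) (ha : Acyclic arc') :
    Acyclic arc := by
  have key : ∀ x y, TransGen arc x y →
      TransGen arc' (π x) (π y) ∨ (x = p ∧ y = q) := by
    intro x y hxy
    induction hxy with
    | single h1 => exact (h _ _ h1).imp_left TransGen.single
    | tail _ h1 ih =>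
      rcases ih with ih | ⟨rfl, rfl⟩ <;> rcases h _ _ h1 with h2 | ⟨h2, h3⟩
      · grind
      · grind
      · grind
      · grind
  intro x hx
  rcases key x x hx with h1 | ⟨h1, h2⟩
  · exact ha _ h1
  · grind

lemma Acyclic.of_map {α β : Type} {arc : α → α → Prop} {arc' : β → β → Prop} (f : α → β) (h : ∀ x y,
    arc x y → arc' (f x) (f y)) (ha : Acyclic arc') : Acyclic arc :=
  fun x hx => ha (f x) (TransGen.lift f h x x hx)

lemma Acyclic.mono {α : Type} {arc arc' : α → α → Prop} (h : ∀ x y, arc x y → arc' x y) (ha :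
    Acyclic arc') : Acyclic arc := ha.of_map id h

/-- A sink does not lie on a directed cycle. -/
lemma Acyclic.of_sink {α : Type} {arc arc' : α → α → Prop} {w : α} (hw : ∀ y, ¬ arc w y) (h : ∀ x y,
    arc x y → y ≠ w → arc' x y) (ha : Acyclic arc') : Acyclic arc := by
  have key : ∀ x y, TransGen arc x y → y ≠ w → TransGen arc' x y := by
    intro x y hxy
    induction hxy with
    | single h1 => exact fun hy => .single (h _ _ h1 hy)
    | tail _ h1 ih => exact fun hy => (ih fun e => hw _ (e ▸ h1)).tail (h _ _ h1 hy)
  intro x hx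
  refine ha x (key x x hx ?_)
  rintro rfl
  obtain ⟨b, hb, -⟩ := TransGen.head'_iff.1 hx
  exact hw _ hb

lemma Acyclic.swap {α : Type} {arc : α → α → Prop} (ha : Acyclic arc) : Acyclic (Function.swap arc)
    := fun x hx => ha x (Relation.transGen_swap.1 hx)

namespace NG

/-- There is an edge from `x` to `y` in the colour `c`. -/
def arc (X : NG k) (c : Fin k) (x y : ℕ) : Prop :=
  ∃ a ∈ X.E, X.ends a (!X.col c a) = x ∧ X.ends a (X.col c a) = y

/-- There is a solid edge from `x` to `y`. -/
def sarc (X : NG k) (x y : ℕ) : Prop :=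
  ∃ a ∈ X.E, ∃ s, X.ty a = some s ∧ X.ends a (!s) = x ∧ X.ends a s = y

/-- There is a tadpole or a cycle. -/
def BadG (X : NG k) : Prop :=
  (∃ a ∈ X.E, X.ends a false = X.ends a true) ∨ ∃ c, ¬ Acyclic (X.arc c)

def Parallel (X : NG k) (a b : ℕ) : Prop :=
  s(X.ends a false, X.ends a true) = s(X.ends b false, X.ends b true)

def BadS (m : ℤ) (X : NG k) : Prop :=
  X.BadG ∨ ¬ Acyclic X.sarc ∨ (Odd m ∧ ∃ a ∈ X.E, ∃ b ∈ X.E, a ≠ b ∧ X.Parallel a b)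

lemma badG_ren {X X' : NG k} (ha : Agree X' (X.ren σ ρ f)) (h : X.BadG) : X'.BadG := by
  rcases h with ⟨a, haE, h⟩ | ⟨c, h⟩
  · refine Or.inl ⟨ρ a, ha.mem_E.2 haE, ?_⟩
    rw [ha.ends_apply haE, ha.ends_apply haE]
    cases f a <;> simp [h]
  · refine Or.inr ⟨c, fun hac => h ?_⟩
    refine hac.of_map σ ?_
    rintro _ _ ⟨a, haE, rfl, rfl⟩
    refine ⟨ρ a, ha.mem_E.2 haE, ?_, ?_⟩ <;>
      rw [ha.ends_apply haE, ha.col_apply haE] <;> cases f a <;> simp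

lemma badG_contract (s : Bool) (ht : t ∈ X.E) (htad : X.ends t false ≠ X.ends t true) (h : X.BadG) :
    ctr(X, t, s).BadG := by
  rcases h with ⟨a, haE, h⟩ | ⟨c, h⟩
  · refine Or.inl ⟨a, mem_erase.2 ⟨?_, haE⟩, by rw [contract_ends, contract_ends, h]⟩
    rintro rfl; exact htad h
  · refine Or.inr ⟨c, fun hac => h ?_⟩
    refine Acyclic.of_contract (π := ret(X, t, s))
      (p := X.ends t !(X.col c t)) (q := X.ends t (X.col c t)) (ends_ne_not htad _)
      (by rw [retract_ends, retract_ends]) ?_ hac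
    rintro _ _ ⟨a, haE, rfl, rfl⟩
    by_cases hat : a = t
    · grind
    · exact Or.inl ⟨a, mem_erase.2 ⟨hat, haE⟩, rfl, rfl⟩

lemma badG_fuse (hf : X.FuseAt w i j) (h : X.BadG) : (X.fuse w i j).BadG := by
  have := badG_contract false hf.j_mem (by rw [hf.j_false]; exact hf.j_true.symm) h
  rwa [Bool.not_false, hf.j_false] at this

lemma badCond_badG (m : ℤ) : BadCond m (BadG (k := k)) where
  tadpole _ a ha h := Or.inl ⟨a, ha, h⟩
  ren _ _ _ _ _ ha h := badG_ren ha h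
  setTy _ _ _ _ _ h := h
  contract _ _ s _ ht _ htad h := badG_contract s ht htad h
  fuse _ _ _ _ _ hf _ h := badG_fuse hf h

lemma badCond_badS (m : ℤ) : BadCond m (BadS (k := k) m) where
  tadpole _ a ha h := Or.inl (Or.inl ⟨a, ha, h⟩)
  ren X X' σ ρ f ha h := by
    rcases h with h | h | ⟨hm, a, haE, b, hbE, hab, h⟩
    · exact Or.inl (badG_ren ha h)
    · refine Or.inr (Or.inl fun hac => h ?_)
      refine hac.of_map σ ?_
      rintro _ _ ⟨a, haE, s, hs, rfl, rfl⟩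
      refine ⟨ρ a, ha.mem_E.2 haE, xor (f a) s, by rw [ha.ty_apply haE, hs]; rfl, ?_, ?_⟩ <;>
        rw [ha.ends_apply haE] <;> cases f a <;> simp
    · refine Or.inr (Or.inr ⟨hm, ρ a, ha.mem_E.2 haE, ρ b, ha.mem_E.2 hbE, hab ∘ (ρ.injective ·), ?_⟩)
      have key : ∀ a ∈ X.E, s(X'.ends (ρ a) false, X'.ends (ρ a) true) =
          Sym2.map σ s(X.ends a false, X.ends a true) := fun a haE => by
        rw [ha.ends_apply haE, ha.ends_apply haE]
        cases f a <;> simp [Sym2.eq_swap]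
      rw [Parallel, key a haE, key b hbE, h]
  setTy X t s ht h0 h := by
    rcases h with h | h | h
    · exact Or.inl h
    · refine Or.inr (Or.inl fun hac => h (hac.mono ?_))
      rintro _ _ ⟨a, haE, r, hr, rfl, rfl⟩
      refine ⟨a, haE, r, ?_, rfl, rfl⟩
      rw [setTy_ty_ne, hr]
      rintro rfl; rw [h0] at hr; exact absurd hr (by simp)
    · exact Or.inr (Or.inr h)
  contract X t s _ ht h0 htad h := by
    rcases h with h | h | ⟨hm, a, haE, b, hbE, hab, h⟩
    · exact Or.inl (badG_contract s ht htad h)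
    · obtain ⟨r, hr⟩ := ne_none_iff_exists'.1 h0
      refine Or.inr (Or.inl fun hac => h ?_)
      refine Acyclic.of_contract (π := ret(X, t, s))
        (p := X.ends t !r) (q := X.ends t r) (ends_ne_not htad _)
        (by rw [retract_ends, retract_ends]) ?_ hac
      rintro _ _ ⟨a, haE, s', hs', rfl, rfl⟩
      by_cases hat : a = t
      · grind
      · exact Or.inl ⟨a, mem_erase.2 ⟨hat, haE⟩, s', hs', rfl, rfl⟩
    · have key : ∀ b ∈ X.E, t ≠ b → X.Parallel t b →
          ctr(X, t, s).BadS m := by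
        intro b hbE hab h
        refine Or.inl (Or.inl ⟨b, mem_erase.2 ⟨hab.symm, hbE⟩, ?_⟩)
        rw [contract_ends_eq, contract_ends_eq]
        have h1 : ∀ r, ret(X, t, s) (X.ends b r) = X.ends t !s := fun r => by
          have : ∃ r', X.ends b r = X.ends t r' := by
            rw [Parallel, eq_iff] at h
            rcases h with ⟨h1, h2⟩ | ⟨h1, h2⟩ <;> cases r
            exacts [⟨_, h1.symm⟩, ⟨_, h2.symm⟩, ⟨_, h2.symm⟩, ⟨_, h1.symm⟩]
          obtain ⟨r', hr'⟩ := this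
          rw [hr', retract_ends]
        rw [h1, h1]
      by_cases hta : t = a
      · grind
      by_cases htb : t = b
      · subst htb; exact key a haE hta h.symm
      refine Or.inr (Or.inr ⟨hm, a, mem_erase.2 ⟨Ne.symm hta, haE⟩, b, mem_erase.2 ⟨Ne.symm htb,
        hbE⟩, hab, ?_⟩)
      simp only [Parallel, contract_ends_eq]
      exact congrArg (Sym2.map ret(X, t, s)) h
  fuse X w i j hc hf h0 h := by
    have hne : ∀ a ∈ X.E, a ≠ i → a ≠ j → ∀ s, (X.fuse w i j).ends a s = X.ends a s :=
      fun a ha hai haj s => by simp [NG.fuse, contract_ends, hf.other a ha hai haj s]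
    have hmem : ∀ a ∈ X.E, a ≠ j → a ∈ (X.fuse w i j).E := fun a ha haj => by
      simp [NG.fuse, ha, haj]
    rcases h with h | h | ⟨hm, a, haE, b, hbE, hab, h⟩
    · exact Or.inl (badG_fuse hf h)
    · refine Or.inr (Or.inl fun hac => h ?_)
      have hother : ∀ a ∈ X.E, a ≠ i → a ≠ j → ∀ s, X.ty a = some s →
          (X.fuse w i j).sarc (X.ends a !s) (X.ends a s) := fun a ha hai haj s hs =>
        ⟨a, hmem a ha haj, s, by rw [NG.fuse, setTy_ty_ne _ hai]; exact hs,
          hne a ha hai haj _, hne a ha hai haj _⟩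
      have hi := hf.i_true
      have hi' := hf.i_false
      have hj := hf.j_false
      have hj' := hf.j_true
      have hw := hf.other
      unfold coef at h0
      split_ifs at h0 with h1 h2
      · refine Acyclic.of_sink (w := w) ?_ ?_ hac
        · rintro y ⟨a, ha, s, hs, hx, -⟩
          cases s <;> grind
        · rintro _ _ ⟨a, ha, s, hs, rfl, rfl⟩ hy
          exact hother a ha (by grind) (by grind) s hs
      · refine (Acyclic.of_sink (arc := Function.swap X.sarc) (w := w) ?_ ?_ hac.swap).swap
        · rintro y ⟨a, ha, s, hs, -, hx⟩
          cases s <;> grind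
        · rintro _ _ ⟨a, ha, s, hs, rfl, rfl⟩ hy
          exact hother a ha (by grind) (by grind) s hs
      · grind
    · have hpar : ∀ a ∈ X.E, ∀ b ∈ X.E, X.Parallel a b → (∃ s, X.ends a s = w) →
          ∃ s, X.ends b s = w := by
        rintro a - b - h ⟨s, hs⟩
        rw [Parallel, eq_iff] at h
        rcases h with ⟨h1, h2⟩ | ⟨h1, h2⟩ <;> cases s
        exacts [⟨_, h1.symm.trans hs⟩, ⟨_, h2.symm.trans hs⟩, ⟨_, h1.symm.trans hs⟩, ⟨_,
          h2.symm.trans hs⟩]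
      by_cases hij : X.Parallel i j
      · refine Or.inl (Or.inl ⟨i, hmem i hf.i_mem hf.ne, ?_⟩)
        rw [Parallel, eq_iff] at hij
        simp only [NG.fuse, setTy_ends, contract_ends, hf.i_true, if_true, if_neg hf.i_false]
        rcases hij with ⟨h1, h2⟩ | ⟨h1, h2⟩
        · exact absurd (h1.trans hf.j_false) hf.i_false
        · exact h1
      · have hw : ∀ a ∈ X.E, (∃ s, X.ends a s = w) → a = i ∨ a = j := by
          rintro a ha ⟨s, hs⟩
          by_contra hcon
          push Not at hcon
          exact hf.other a ha hcon.1 hcon.2 s hs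
        have hnot : ¬ ∃ s, X.ends a s = w := by
          intro hs
          have h1 := hw a haE hs
          have h2 := hw b hbE (hpar a haE b hbE h hs)
          rcases h1 with rfl | rfl <;> rcases h2 with rfl | rfl
          exacts [hab rfl, hij h, hij h.symm, hab rfl]
        have hnot' : ¬ ∃ s, X.ends b s = w := fun hs => hnot (hpar b hbE a haE h.symm hs)
        have hai : a ≠ i := by rintro rfl; exact hnot ⟨_, hf.i_true⟩
        have haj : a ≠ j := by rintro rfl; exact hnot ⟨_, hf.j_false⟩
        have hbi : b ≠ i := by rintro rfl; exact hnot' ⟨_, hf.i_true⟩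
        have hbj : b ≠ j := by rintro rfl; exact hnot' ⟨_, hf.j_false⟩
        refine Or.inr (Or.inr ⟨hm, a, hmem a haE haj, b, hmem b hbE hbj, hab, ?_⟩)
        rw [Parallel, hne a haE hai haj, hne a haE hai haj, hne b hbE hbi hbj, hne b hbE hbi hbj]
        exact h

end NG

/-- Functions that satisfy the relations agree if they agree on graphs without fusable vertices. -/
lemma Good.eq_of {m : ℤ} {Bad : NG k → Prop} {χ χ' : NG k → M} (h : Good m Bad χ) (h' : Good m Bad
    χ') (d : ℤ) (H : ∀ X : NG k, X.WF → X.degree m = d → ¬ Bad X → ¬ X.Fusable → χ X = χ' X) (hw :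
    X.WF) (hd : X.degree m = d) : χ X = χ' X := by
  induction hN : X.V.card using Nat.strong_induction_on generalizing X with
  | _ N ih =>
    subst hN
    by_cases hb : Bad X
    · rw [h.bad X hw.closed hb, h'.bad X hw.closed hb]
    by_cases hf : X.Fusable
    swap
    · grind
    obtain ⟨f, w, i, j, hf⟩ := hf
    have e : (X.ren 1 1 f).V.card = X.V.card := by simp
    have hw' := hw.agree (Agree.refl (X.ren 1 1 f))
    have key : χ (X.ren 1 1 f) = χ' (X.ren 1 1 f) := by
      rw [h.fuse _ w i j hw'.closed hf, h'.fuse _ w i j hw'.closed hf]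
      by_cases h0 : (X.ren 1 1 f).coef i j = 0
      · simp [h0]
      · rw [ih _ (hf.card_lt.trans_eq e) (hw'.fuse hf) ?_ rfl]
        rw [degree_fuse m hf (coef_ne_zero h0).1 (coef_ne_zero h0).2, degree_agree m (Agree.refl _),
          hd]
    have h1 : Agree X ((X.ren 1 1 f).ren 1 1 f) := by
      rw [ren_ren_flip_self]; exact Agree.refl _
    rw [h.alt _ _ _ _ _ hw'.closed h1, h'.alt _ _ _ _ _ hw'.closed h1, key]

end

section

open NG

variable {k : ℕ} {M : Type*} [AddCommGroup M]
variable {f : ℕ → Bool} {m : ℤ} {w : ℕ} {s r : Bool} {x y : ℕ} {c : Fin k} {v e : ℕ}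

/-! ### Comparison of properties of labelled graphs and of graphs labelled by numbers -/

namespace NG

def Passing (X : NG k) (x : ℕ) : Prop :=
  X.val x = 2 ∧ ∀ c, (∃ y, X.arc c y x) ∧ ∃ y, X.arc c x y

structure Reduced (X : NG k) : Prop extends X.WF where
  acyclic : ∀ c, Acyclic (X.arc c)
  not_passing : ∀ x ∈ X.V, ¬ X.Passing x

structure Special (m : ℤ) (X : NG k) : Prop extends X.Reduced where
  acyclic_last : Acyclic X.sarc
  no_tadpole : Odd m → ∀ a ∈ X.E, X.ends a false ≠ X.ends a true
  no_multiple : Odd m → ∀ a ∈ X.E, ∀ b ∈ X.E, a ≠ b → ¬ X.Parallel a b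

lemma arc_flip {X : NG k} : (X.ren 1 1 f).arc c x y ↔ X.arc c x y := by
  have hE : (X.ren 1 1 f).E = X.E := by ext; simp
  unfold arc
  rw [hE]
  refine exists_congr fun a => and_congr_right fun _ => ?_
  simp only [NG.ren, one_symm_apply, coe_one, id_eq]
  cases f a <;> simp

lemma sarc_flip {X : NG k} (h : X.sarc x y) : (X.ren 1 1 f).sarc x y := by
  obtain ⟨a, ha, s, hs, hx, hy⟩ := h
  refine ⟨a, by simpa using ha, xor (f a) s, by simp [hs], ?_, ?_⟩
  · rw [← hx]; simp only [NG.ren, one_symm_apply, coe_one, id_eq]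
    cases f a <;> simp
  · rw [← hy]; simp only [NG.ren, one_symm_apply, coe_one, id_eq]
    cases f a <;> simp

lemma passing_flip {X : NG k} {x : ℕ} : (X.ren 1 1 f).Passing x ↔ X.Passing x := by
  have h := val_agree (Agree.refl (X.ren 1 1 f)) x
  unfold Passing
  simp only [coe_one, id_eq] at h
  simp only [arc_flip, h]

lemma Reduced.flip {X : NG k} (h : X.Reduced) (f : ℕ → Bool) : (X.ren 1 1 f).Reduced where
  toWF := h.toWF.agree (Agree.refl _)
  acyclic c := (h.acyclic c).mono fun _ _ => arc_flip.1
  not_passing x hx := by rw [passing_flip]; exact h.not_passing x (by simpa using hx)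

lemma Special.flip {X : NG k} (h : X.Special m) (f : ℕ → Bool) : (X.ren 1 1 f).Special m where
  toReduced := h.toReduced.flip f
  acyclic_last := h.acyclic_last.mono fun x y h1 => by
    have := sarc_flip (f := f) h1
    rwa [ren_ren_flip_self] at this
  no_tadpole hm a ha := by
    have h1 := h.no_tadpole hm a (by simpa using ha)
    simp only [NG.ren, one_symm_apply, coe_one, id_eq]
    cases f a <;> simp [h1, h1.symm]
  no_multiple hm a ha b hb hab := by
    have h1 := h.no_multiple hm a (by simpa using ha) b
      (by simpa using hb) hab
    have h2 : ∀ a, s((X.ren 1 1 f).ends a false, (X.ren 1 1 f).ends a true) =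
        s(X.ends a false, X.ends a true) := fun a => by
      simp only [NG.ren, one_symm_apply, coe_one, id_eq]
      cases f a <;> simp [Sym2.eq_swap]
    rwa [Parallel, h2, h2]

lemma half_eq {X : NG k} {w i j : ℕ} (hi : i ∈ X.E) (hj : j ∈ X.E) (h1 : X.ends i s = w) (h2 :
    X.ends j r = w) (h3 : X.ends i (!s) ≠ w) (h4 : X.ends j (!r) ≠ w) (h5 : ∀ a ∈ X.E, a ≠ i → a ≠ j
    → ∀ s, X.ends a s ≠ w) : ((X.E ×ˢ (univ : Finset Bool)).filter fun p => X.ends p.1 p.2 = w) =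
    {(i, s), (j, r)} := by
  ext ⟨a, t⟩
  simp only [mem_filter, mem_product, mem_univ, and_true, mem_insert, Finset.mem_singleton,
    Prod.mk.injEq]
  constructor
  · rintro ⟨ha, ht⟩
    by_cases hai : a = i
    · subst hai
      refine Or.inl ⟨rfl, ?_⟩
      by_contra hne
      rw [eq_not_of_ne hne] at ht; exact h3 ht
    · by_cases haj : a = j
      · subst haj
        refine Or.inr ⟨rfl, ?_⟩
        by_contra hne
        rw [eq_not_of_ne hne] at ht; exact h4 ht
      · grind
  · grind

lemma FusableAt.passing {X : NG k} (h : X.FusableAt w) : w ∈ X.V ∧ X.Passing w := by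
  obtain ⟨f, i, j, h⟩ := h
  refine ⟨by simpa using h.w_mem, (passing_flip (f := f)).1 ⟨?_, fun c => ?_⟩⟩
  · rw [val, half_eq (s := true) (r := false) h.i_mem h.j_mem h.i_true h.j_false h.i_false h.j_true
      h.other]
    exact Finset.card_pair (by simp)
  · rcases hc : (X.ren 1 1 f).col c i with _ | _
    · exact ⟨⟨_, j, h.j_mem, rfl, by rw [← h.col_eq, hc, h.j_false]⟩,
        ⟨_, i, h.i_mem, by rw [hc, Bool.not_false, h.i_true], rfl⟩⟩
    · exact ⟨⟨_, i, h.i_mem, rfl, by rw [hc, h.i_true]⟩,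
        ⟨_, j, h.j_mem, by rw [← h.col_eq, hc, Bool.not_true, h.j_false], rfl⟩⟩

/-- The two edges at a passing vertex. -/
lemma Passing.exists_ends {X : NG k} (h : X.Passing w) (htad : ∀ a ∈ X.E, X.ends a false = w →
    X.ends a true ≠ w) : ∃ i ∈ X.E, ∃ j ∈ X.E, ∃ s r, i < j ∧ X.ends i s = w ∧ X.ends j r = w ∧
    X.ends i (!s) ≠ w ∧ X.ends j (!r) ≠ w ∧ (∀ a ∈ X.E, a ≠ i → a ≠ j → ∀ s, X.ends a s ≠ w) ∧ ∀ c,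
    (X.col c i = s) ↔ (X.col c j ≠ r) := by
  obtain ⟨⟨p, s⟩, ⟨q, r⟩, hne, hpq⟩ := Finset.card_eq_two.1 h.1
  have hmem : ∀ a t, (a ∈ X.E ∧ X.ends a t = w) ↔ ((a = p ∧ t = s) ∨ (a = q ∧ t = r)) := by
    intro a t
    have : (a, t) ∈ ((X.E ×ˢ (univ : Finset Bool)).filter
      fun p => X.ends p.1 p.2 = w) ↔ (a, t) ∈ ({(p, s), (q, r)} : Finset _) := by rw [hpq]
    simpa using this
  have htad' : ∀ a ∈ X.E, ∀ t, X.ends a t = w → X.ends a (!t) ≠ w := by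
    grind
  have key : ∀ p s q r, p < q → (∀ a t, (a ∈ X.E ∧ X.ends a t = w) ↔
      ((a = p ∧ t = s) ∨ (a = q ∧ t = r))) → ∃ i ∈ X.E, ∃ j ∈ X.E, ∃ s r, i < j ∧
      X.ends i s = w ∧ X.ends j r = w ∧
      X.ends i (!s) ≠ w ∧ X.ends j (!r) ≠ w ∧
      (∀ a ∈ X.E, a ≠ i → a ≠ j → ∀ s, X.ends a s ≠ w) ∧
      ∀ c, (X.col c i = s) ↔ (X.col c j ≠ r) := by
    intro p s q r hlt hmem
    obtain ⟨hp, hps⟩ := (hmem p s).2 (Or.inl ⟨rfl, rfl⟩)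
    obtain ⟨hq, hqr⟩ := (hmem q r).2 (Or.inr ⟨rfl, rfl⟩)
    refine ⟨p, hp, q, hq, s, r, hlt, hps, hqr, htad' p hp s hps, htad' q hq r hqr, fun a ha hap haq
      t ht => ?_, fun c => ?_⟩
    · grind
    · obtain ⟨⟨y, a, ha, -, h1⟩, ⟨z, b, hb, h2, -⟩⟩ := h.2 c
      rcases (hmem a _).1 ⟨ha, h1⟩ with ⟨rfl, h3⟩ | ⟨rfl, h3⟩ <;>
        rcases (hmem b _).1 ⟨hb, h2⟩ with ⟨rfl, h4⟩ | ⟨rfl, h4⟩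
      · grind
      · grind
      · grind
      · grind
  rcases lt_trichotomy p q with hlt | rfl | hlt
  · exact key p s q r hlt hmem
  · have hsr : r = !s := by
      cases s <;> cases r <;> simp_all
    subst hsr
    obtain ⟨hp, hps⟩ := (hmem p s).2 (Or.inl ⟨rfl, rfl⟩)
    obtain ⟨hq, hqr⟩ := (hmem p !s).2 (Or.inr ⟨rfl, rfl⟩)
    exact absurd hqr (htad' p hp s hps)
  · exact key q r p s hlt fun a t => (hmem a t).trans or_comm

lemma Passing.fusableAt {X : NG k} (h : X.Passing w) (hw : w ∈ X.V) (htad : ∀ a ∈ X.E, X.ends a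
    false = w → X.ends a true ≠ w) : X.FusableAt w := by
  obtain ⟨i, hi, j, hj, s, r, hij, h1, h2, h3, h4, h5, h6⟩ := h.exists_ends htad
  exact ⟨_, i, j, FuseAt.of_ends hw hi hj hij.ne h1 h2 h3 h4 h5 h6⟩

lemma Reduced.not_fusable {X : NG k} (h : X.Reduced) : ¬ X.Fusable := fun hf =>
  let ⟨_, hw⟩ := hf.exists_at
  h.not_passing _ hw.passing.1 hw.passing.2

lemma WF.reduced {X : NG k} (h : X.WF) (hb : ¬ X.BadG) (hf : ¬ X.Fusable) : X.Reduced :=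
  ⟨h, fun c => by_contra fun hc => hb (Or.inr ⟨c, hc⟩), fun _ hx hp =>
    hf (hp.fusableAt hx fun a ha h1 h2 => hb (Or.inl ⟨a, ha, h1.trans h2.symm⟩)).fusable⟩

lemma WF.special {X : NG k} (h : X.WF) (hb : ¬ X.BadS m) (hf : ¬ X.Fusable) : X.Special m :=
  ⟨h.reduced (fun h => hb (Or.inl h)) hf, by_contra fun hc => hb (Or.inr (Or.inl hc)), fun _ a ha ht
    => hb (Or.inl (Or.inl ⟨a, ha, ht⟩)), fun hm a ha b hb' hab hp => hb (Or.inr (Or.inr ⟨hm, a, ha,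
    b, hb', hab, hp⟩))⟩

end NG

namespace Lab

variable {X : NG k} {G : SGraph k v e} {i : Fin (v + 1) → ℕ} {j : Fin e → ℕ}

lemma val_eq (h : Lab X G i j) (x : Fin (v + 1)) : X.val (i x) = G.valence x := by
  rw [val_eq_sum, h.E_eq, sum_map, Graph.valence, Finset.card_filter, Fintype.sum_prod_type]
  refine sum_congr rfl fun a _ => ?_
  rw [Fintype.sum_bool]
  simp [h.ends_eq, h.i_inj.eq_iff]

lemma linked_iff (h : Lab X G i j) (T : Finset (Fin e)) (x y : Fin (v + 1)) : X.Linked (T.map ⟨j,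
    h.j_inj⟩) (i x) (i y) ↔ G.Linked T x y := by
  constructor
  · intro hl
    have key : ∀ a b, X.Linked (T.map ⟨j, h.j_inj⟩) a b →
        a = b ∨ ∃ x y, i x = a ∧ i y = b ∧ G.Linked T x y := by
      intro a b hl
      induction hl with
      | rel a b hab =>
        obtain ⟨c, hc, rfl, rfl⟩ := hab
        obtain ⟨d, hd, rfl⟩ := mem_map.1 hc
        exact Or.inr ⟨_, _, (h.ends_eq _ _).symm, (h.ends_eq _ _).symm, EqvGen.rel _ _ ⟨d, hd, rfl,
          rfl⟩⟩
      | refl a => exact Or.inl rfl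
      | symm a b _ ih =>
        rcases ih with rfl | ⟨x, y, hx, hy, hl⟩
        exacts [Or.inl rfl, Or.inr ⟨y, x, hy, hx, EqvGen.symm _ _ hl⟩]
      | trans a b c _ _ ih1 ih2 =>
        rcases ih1 with rfl | ⟨x, y, rfl, rfl, hl⟩
        · exact ih2
        · rcases ih2 with rfl | ⟨x', y', hx', hy', hl'⟩
          · grind
          · obtain rfl := h.i_inj hx'
            exact Or.inr ⟨x, y', rfl, hy', EqvGen.trans _ _ _ hl hl'⟩
    rcases key _ _ hl with h1 | ⟨x', y', hx, hy, hl'⟩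
    · obtain rfl := h.i_inj h1
      exact EqvGen.refl _
    · obtain rfl := h.i_inj hx
      obtain rfl := h.i_inj hy
      exact hl'
  · intro hl
    induction hl with
    | rel x y hxy =>
      obtain ⟨a, ha, rfl, rfl⟩ := hxy
      exact EqvGen.rel _ _
        ⟨j a, mem_map.2 ⟨a, ha, rfl⟩, h.ends_eq _ _, h.ends_eq _ _⟩
    | refl x => exact EqvGen.refl _
    | symm _ _ _ ih => exact EqvGen.symm _ _ ih
    | trans _ _ _ _ _ ih1 ih2 => exact EqvGen.trans _ _ _ ih1 ih2

lemma arc_iff (h : Lab X G i j) {a b : ℕ} : X.arc c a b ↔ ∃ x y, i x = a ∧ i y = b ∧ G.arc c x y :=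
    by
  constructor
  · rintro ⟨p, hp, rfl, rfl⟩
    obtain ⟨q, rfl⟩ := h.exists_j hp
    rw [h.col_eq, h.ends_eq, h.ends_eq]
    exact ⟨_, _, rfl, rfl, q, rfl, rfl⟩
  · rintro ⟨x, y, rfl, rfl, q, rfl, rfl⟩
    exact ⟨j q, h.j_mem q, by rw [h.col_eq, h.ends_eq], by rw [h.col_eq, h.ends_eq]⟩

lemma sarc_iff (h : Lab X G i j) {a b : ℕ} : X.sarc a b ↔ ∃ x y, i x = a ∧ i y = b ∧ G.sarc x y :=
    by
  constructor
  · rintro ⟨p, hp, s, hs, rfl, rfl⟩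
    obtain ⟨q, rfl⟩ := h.exists_j hp
    rw [h.ends_eq, h.ends_eq]
    exact ⟨_, _, rfl, rfl, q, s, by rw [← h.ty_eq, hs], rfl, rfl⟩
  · rintro ⟨x, y, rfl, rfl, q, s, hs, rfl, rfl⟩
    exact ⟨j q, h.j_mem q, s, by rw [h.ty_eq, hs], h.ends_eq _ _, h.ends_eq _ _⟩

lemma acyclic_iff (h : Lab X G i j) {r : Fin (v + 1) → Fin (v + 1) → Prop} {r' : ℕ → ℕ → Prop} (hr :
    ∀ a b, r' a b ↔ ∃ x y, i x = a ∧ i y = b ∧ r x y) : Acyclic r' ↔ Acyclic r := by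
  constructor
  · exact fun ha => ha.of_map i fun x y hxy => (hr _ _).2 ⟨x, y, rfl, rfl, hxy⟩
  · refine fun ha => ha.of_map (Function.invFun i) fun a b hab => ?_
    obtain ⟨x, y, rfl, rfl, hxy⟩ := (hr _ _).1 hab
    rwa [Function.leftInverse_invFun h.i_inj, Function.leftInverse_invFun h.i_inj]

lemma passing_iff (h : Lab X G i j) {x : Fin (v + 1)} : X.Passing (i x) ↔ G.Passing x := by
  unfold NG.Passing Graph.Passing
  rw [h.val_eq]
  refine and_congr_right fun _ => forall_congr' fun c => and_congr ?_ ?_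
  · constructor
    · rintro ⟨y, hy⟩
      obtain ⟨a, b, rfl, hb, hab⟩ := h.arc_iff.1 hy
      obtain rfl := h.i_inj hb
      exact ⟨a, hab⟩
    · rintro ⟨y, hy⟩
      exact ⟨i y, h.arc_iff.2 ⟨y, x, rfl, rfl, hy⟩⟩
  · constructor
    · rintro ⟨y, hy⟩
      obtain ⟨a, b, ha, rfl, hab⟩ := h.arc_iff.1 hy
      obtain rfl := h.i_inj ha
      exact ⟨b, hab⟩
    · rintro ⟨y, hy⟩
      exact ⟨i y, h.arc_iff.2 ⟨x, y, rfl, rfl, hy⟩⟩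

lemma reduced_iff (h : Lab X G i j) : X.Reduced ↔ G.Reduced := by
  constructor
  · intro hr
    refine ⟨fun x y => ?_, fun c => (h.acyclic_iff fun a b => h.arc_iff).1 (hr.acyclic c), fun x =>
      ?_, ?_, fun x hx => hr.not_passing _ (h.i_mem x) (h.passing_iff.2 hx)⟩
    · rw [← h.linked_iff, ← h.E_eq]; exact hr.connected _ (h.i_mem x) _ (h.i_mem y)
    · rw [← h.val_eq]; exact hr.two_le _ (h.i_mem x)
    · obtain ⟨x, hx, h3⟩ := hr.three_le
      obtain ⟨y, rfl⟩ := h.exists_i hx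
      exact ⟨y, by rwa [← h.val_eq]⟩
  · intro hr
    refine ⟨⟨h.closed, fun x hx y hy => ?_, fun x hx => ?_, ?_⟩, fun c => (h.acyclic_iff fun a b =>
      h.arc_iff).2 (hr.acyclic c), fun x hx hp => ?_⟩
    · obtain ⟨x, rfl⟩ := h.exists_i hx
      obtain ⟨y, rfl⟩ := h.exists_i hy
      rw [h.E_eq, h.linked_iff]; exact hr.connected x y
    · obtain ⟨x, rfl⟩ := h.exists_i hx
      rw [h.val_eq]; exact hr.two_le x
    · obtain ⟨x, h3⟩ := hr.three_le
      exact ⟨i x, h.i_mem x, by rwa [h.val_eq]⟩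
    · obtain ⟨x, rfl⟩ := h.exists_i hx
      exact hr.not_passing x (h.passing_iff.1 hp)

lemma parallel_iff (h : Lab X G i j) (a b : Fin e) : X.Parallel (j a) (j b) ↔ s(G.ends a false,
    G.ends a true) = s(G.ends b false, G.ends b true) := by
  have key : ∀ a, s(X.ends (j a) false, X.ends (j a) true) =
      Sym2.map i s(G.ends a false, G.ends a true) := fun a => by
    rw [h.ends_eq, h.ends_eq]; rfl
  rw [Parallel, key, key, (Sym2.map.injective h.i_inj).eq_iff]

lemma special_iff (h : Lab X G i j) (m : ℤ) : X.Special m ↔ G.IsSpecial m := by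
  constructor
  · intro hs
    refine ⟨h.reduced_iff.1 hs.toReduced, (h.acyclic_iff fun a b => h.sarc_iff).1 hs.acyclic_last,
      fun hm a => ?_, fun hm a b hab => ?_⟩
    · have := hs.no_tadpole hm (j a) (h.j_mem a)
      rw [h.ends_eq, h.ends_eq] at this
      exact fun e => this (by rw [e])
    · rw [Ne, ← h.parallel_iff]
      exact hs.no_multiple hm _ (h.j_mem a) _ (h.j_mem b) fun e => hab (h.j_inj e)
  · intro hs
    refine ⟨h.reduced_iff.2 hs.toReduced, (h.acyclic_iff fun a b => h.sarc_iff).2 hs.acyclic_last,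
      fun hm a ha => ?_, fun hm a ha b hb hab => ?_⟩
    · obtain ⟨a, rfl⟩ := h.exists_j ha
      rw [h.ends_eq, h.ends_eq]
      exact fun e => hs.no_tadpole hm a (h.i_inj e)
    · obtain ⟨a, rfl⟩ := h.exists_j ha
      obtain ⟨b, rfl⟩ := h.exists_j hb
      rw [h.parallel_iff]
      exact hs.no_multiple hm a b fun e => hab (by rw [e])

lemma degree_eq (h : Lab X G i j) (m : ℤ) : X.degree m = G.degree m := by
  rw [NG.degree, SGraph.degree, h.card_V, h.solid_eq, h.dotted_eq, card_map, card_map]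
  push_cast; ring

end Lab

lemma SGraph.relabel_eq (G : SGraph k v e) (σ : Perm (Fin (v + 1))) (ρ : Perm (Fin e)) (f : Fin e →
    Bool) : G.relabel σ ρ f = (G.relabel 1 1 f).relabel σ ρ fun _ => false := by
  have hx : xor false = id := by grind
  simp [SGraph.relabel, Graph.relabel, hx]

/-- A relabelled graph corresponds to the reversal of intrinsic orientations. -/
lemma exists_lab_relabel (G : SGraph k v e) (σ : Perm (Fin (v + 1))) (ρ : Perm (Fin e)) (f : Fin e →
    Bool) : ∃ f' i j, Lab ((toNG G).ren 1 1 f') (G.relabel σ ρ f) i j := by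
  have h1 := (lab_toNG G).ren (Agree.refl ((toNG G).ren 1 1
    fun a => if h : a < e then f ⟨a, h⟩ else false))
  have e1 : (fun a => if h : a < e then f ⟨a, h⟩ else false) ∘ (Fin.val : Fin e → ℕ) = f := by grind
  rw [e1] at h1
  rw [SGraph.relabel_eq]
  exact ⟨_, _, _, h1.relabel σ ρ⟩

lemma SGraph.IsSpecial.relabel {G : SGraph k v e} (h : G.IsSpecial m) (σ : Perm (Fin (v + 1))) (ρ :
    Perm (Fin e)) (f : Fin e → Bool) : (G.relabel σ ρ f).IsSpecial m := by
  obtain ⟨f', i, j, hl⟩ := exists_lab_relabel G σ ρ f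
  exact (hl.special_iff m).1 ((((lab_toNG G).special_iff m).2 h).flip f')

lemma SGraph.reduced_relabel {G : SGraph k v e} (h : G.toGraph.Reduced) (σ : Perm (Fin (v + 1))) (ρ
    : Perm (Fin e)) (f : Fin e → Bool) : (G.relabel σ ρ f).toGraph.Reduced := by
  obtain ⟨f', i, j, hl⟩ := exists_lab_relabel G σ ρ f
  exact hl.reduced_iff.1 (((lab_toNG G).reduced_iff.2 h).flip f')

lemma SGraph.degree_relabel (m : ℤ) (G : SGraph k v e) (σ : Perm (Fin (v + 1))) (ρ : Perm (Fin e))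
    (f : Fin e → Bool) : (G.relabel σ ρ f).degree m = G.degree m := by
  obtain ⟨f', i, j, hl⟩ := exists_lab_relabel G σ ρ f
  rw [← hl.degree_eq, ← (lab_toNG G).degree_eq, degree_agree m (Agree.refl _)]

lemma SGraph.relabel_relabel (G : SGraph k v e) (σ σ' : Perm (Fin (v + 1))) (ρ ρ' : Perm (Fin e)) (f
    f' : Fin e → Bool) : (G.relabel σ ρ f).relabel σ' ρ' f' = G.relabel (σ.trans σ') (ρ.trans ρ')
    (fun a => xor (f a) (f' (ρ a))) := by
  simp only [SGraph.relabel, Graph.relabel, SGraph.mk.injEq, Graph.mk.injEq]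
  refine ⟨⟨?_, ?_⟩, ?_⟩
  · funext a s; simp
  · funext c a; simp [Bool.xor_left_comm]
  · funext a
    simp only [Option.map_map, Equiv.symm_trans_apply, apply_symm_apply]
    congr 1
    funext s
    simp [Bool.xor_left_comm]

lemma SGraph.relabel_one (G : SGraph k v e) : G.relabel 1 1 (fun _ => false) = G := by
  have hx : xor false = id := by grind
  simp [SGraph.relabel, Graph.relabel, hx]

lemma SGraph.relabel_inv (G : SGraph k v e) (σ : Perm (Fin (v + 1))) (ρ : Perm (Fin e)) (f : Fin e →
    Bool) : (G.relabel σ ρ f).relabel σ⁻¹ ρ⁻¹ (fun a => f (ρ⁻¹ a)) = G := by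
  rw [SGraph.relabel_relabel]
  have e1 : σ.trans σ⁻¹ = 1 := σ.self_trans_symm
  have e2 : ρ.trans ρ⁻¹ = 1 := ρ.self_trans_symm
  rw [e1, e2]
  simp [SGraph.relabel_one]

lemma SGraph.isSpecial_relabel_iff {G : SGraph k v e} (σ : Perm (Fin (v + 1))) (ρ : Perm (Fin e)) (f
    : Fin e → Bool) : (G.relabel σ ρ f).IsSpecial m ↔ G.IsSpecial m :=
  ⟨fun h => by simpa only [SGraph.relabel_inv] using h.relabel σ⁻¹ ρ⁻¹ (fun a => f (ρ⁻¹ a)),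
    fun h => h.relabel σ ρ f⟩

/-! ### Elementary operations on labelled graphs -/

lemma succAbove_drop {v : ℕ} {b y : Fin (v + 2)} (h : y ≠ b) : b.succAbove (drop b y) = y := by
  obtain ⟨z, rfl⟩ := Fin.exists_succAbove_eq h
  simp [drop]

lemma succAbove_collapse {v : ℕ} {a b : Fin (v + 2)} (h : a ≠ b) (y : Fin (v + 2)) : b.succAbove
    (collapse a b y) = if y = b then a else y := by
  unfold collapse
  split_ifs with hy
  exacts [succAbove_drop h, succAbove_drop hy]

lemma map_succAbove {n : ℕ} {i : Fin (n + 1) → ℕ} (hi : Function.Injective i) (b : Fin (n + 1)) : (univ.map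
    ⟨i, hi⟩).erase (i b) = univ.map ⟨i ∘ b.succAbove, hi.comp Fin.succAbove_right_injective⟩ := by
  ext x
  simp only [mem_erase, mem_map, mem_univ, true_and, coeFn_mk, Function.comp_apply]
  constructor
  · rintro ⟨h, y, rfl⟩
    obtain ⟨z, hz⟩ := Fin.exists_succAbove_eq (x := y) (y := b) (fun e => h (by rw [e]))
    exact ⟨z, by rw [hz]⟩
  · rintro ⟨z, rfl⟩
    exact ⟨fun e => Fin.succAbove_ne b z (hi e), _, rfl⟩

namespace Lab

lemma contract {X : NG k} {G : SGraph k (v + 1) (e + 1)} {i : Fin (v + 2) → ℕ} {j : Fin (e + 1) → ℕ}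
    (h : Lab X G i j) (t : Fin (e + 1)) {a b : Fin (v + 2)} (hab : a ≠ b) : Lab (X.contract (j t) (i
    a) (i b)) (G.contract t a b) (i ∘ b.succAbove) (j ∘ t.succAbove) := by
  refine ⟨h.i_inj.comp Fin.succAbove_right_injective, h.j_inj.comp Fin.succAbove_right_injective,
    ?_, ?_, fun c s => ?_, fun c d => ?_, fun c => ?_⟩
  · rw [contract_V, h.V_eq, map_succAbove]
  · rw [contract_E, h.E_eq, map_succAbove]
  · simp only [Function.comp_apply, contract_ends, h.ends_eq, h.i_inj.eq_iff, SGraph.contract,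
      Graph.contract, succAbove_collapse hab]
    split_ifs <;> rfl
  · exact h.col_eq _ _
  · exact h.ty_eq _

lemma makeSolid {X : NG k} {G : SGraph k v e} {i : Fin (v + 1) → ℕ} {j : Fin e → ℕ} (h : Lab X G i
    j) (t : Fin e) (s : Bool) : Lab (X.setTy (j t) (some s)) (G.makeSolid t s) i j := by
  refine ⟨h.i_inj, h.j_inj, h.V_eq, h.E_eq, h.ends_eq, h.col_eq, fun a => ?_⟩
  by_cases hat : a = t
  · subst hat; simp [SGraph.makeSolid]
  · rw [setTy_ty_ne _ fun e => hat (h.j_inj e), h.ty_eq]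
    simp [SGraph.makeSolid, hat]

lemma fuse {X : NG k} {G : SGraph k (v + 1) (e + 1)} {i : Fin (v + 2) → ℕ} {j : Fin (e + 1) → ℕ} (h
    : Lab X G i j) {w : Fin (v + 2)} {p q : Fin (e + 1)} (hpq : p ≠ q) (h1 : G.ends p s = w) (h3 :
    G.ends p (!s) ≠ w) (h4 : G.ends q (!r) ≠ w) (h5 : ∀ a, a ≠ p → a ≠ q → ∀ s, G.ends a s ≠ w) :
    Lab ((X.ren 1 1 fun a => if a = j p then !s else if a = j q then r else false).fuse (i w) (j p)
    (j q)) (G.fuse w p q s r) (i ∘ w.succAbove) (j ∘ q.succAbove) := by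
  have hjpq : j q ≠ j p := fun e => hpq (h.j_inj e.symm)
  refine ⟨h.i_inj.comp Fin.succAbove_right_injective, h.j_inj.comp Fin.succAbove_right_injective,
    ?_, ?_, fun c t => ?_, fun c d => ?_, fun c => ?_⟩
  · rw [NG.fuse, setTy_V, contract_V, ← map_succAbove h.i_inj, ← h.V_eq]
    congr 1; ext; simp
  · rw [NG.fuse, setTy_E, contract_E, ← map_succAbove h.j_inj, ← h.E_eq]
    congr 1; ext; simp
  · simp only [Function.comp_apply, NG.fuse, setTy_ends, contract_ends, NG.ren, one_symm_apply,
      coe_one, id_eq, if_true, SGraph.fuse, h.j_inj.eq_iff, h.ends_eq, h.i_inj.eq_iff]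
    by_cases hc : q.succAbove c = p
    · simp only [hc, if_true]
      cases t
      · have : ((!s) ^^ false) = !s := by simp
        rw [this, if_neg h3]
        simp [succAbove_drop h3]
      · have : ((!s) ^^ true) = s := by simp
        rw [this, if_pos h1]
        simp [succAbove_drop h4, hpq.symm]
    · have hne := h5 _ hc (Fin.succAbove_ne q c) t
      simp [hc, Fin.succAbove_ne, hne, succAbove_drop hne]
  · simp only [Function.comp_apply, NG.fuse, setTy_col, contract_col, NG.ren, one_symm_apply,
      SGraph.fuse, h.j_inj.eq_iff, h.col_eq]
    by_cases hc : q.succAbove d = p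
    · simp only [hc, if_true]
      cases s <;> cases G.col c p <;> rfl
    · simp [hc, Fin.succAbove_ne]
  · simp only [Function.comp_apply, SGraph.fuse, NG.fuse]
    by_cases hc : q.succAbove c = p
    · simp [hc]
    · have hx : xor false = id := by grind
      rw [setTy_ty_ne _ fun e => hc (h.j_inj e)]
      simp [hc, h.j_inj.eq_iff, Fin.succAbove_ne, h.ty_eq, hx]

end Lab

end

section

open NG

variable {k : ℕ} {M : Type*} [AddCommGroup M]
variable {X : NG k} {v e : ℕ} {i i' : Fin (v + 1) → ℕ} {j : Fin e → ℕ} {σ : Perm (Fin (v + 1))}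
  {f : Fin e → Bool} {ρ : Perm (Fin e)} {m : ℤ} {ψ : NG k → M} {n : ℕ} {G : SGraph k v e}

/-! ### Restriction of alternating functions to labelled graphs -/

lemma exists_perm_nat {f g : Fin n → ℕ} (hf : Function.Injective f) (hg : Function.Injective g) : ∃ σ : Perm ℕ, ∀ x, σ
    (f x) = g x := by
  obtain ⟨σ, hσ⟩ := (Perm.isMultiplyPretransitive ℕ n).exists_smul_eq ⟨f, hf⟩ ⟨g, hg⟩
  exact ⟨σ, fun x => DFunLike.congr_fun hσ x⟩

/-- Relabelled graphs correspond to relabelled graphs. -/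
lemma Lab.exists_agree {X X' : NG k} {j j' : Fin e → ℕ} (h : Lab X G i j) (h' : Lab X' (G.relabel σ
    ρ f) i' j') : ∃ (σ' ρ' : Perm ℕ) (f' : ℕ → Bool), Agree X' (X.ren σ' ρ' f') ∧ (∀ x, σ' (i x) =
    i' (σ x)) ∧ (∀ x, ρ' (j x) = j' (ρ x)) ∧ ∀ x, f' (j x) = f x := by
  obtain ⟨σ', hσ⟩ := exists_perm_nat h.i_inj (h'.i_inj.comp σ.injective)
  obtain ⟨ρ', hρ⟩ := exists_perm_nat h.j_inj (h'.j_inj.comp ρ.injective)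
  have hf : ∀ x, (extend j f fun _ => false) (j x) = f x := fun x =>
    h.j_inj.extend_apply _ _ _
  refine ⟨σ', ρ', extend j f fun _ => false, ?_, hσ, hρ, hf⟩
  have hE : X'.E = X.E.map ρ'.toEmbedding := by
    rw [h.E_eq, h'.E_eq, map_map]
    ext x
    simp only [mem_map, mem_univ, true_and, coeFn_mk, trans_apply, hρ, Function.comp_apply]
    exact ρ.surjective.exists
  have hV : X'.V = X.V.map σ'.toEmbedding := by
    rw [h.V_eq, h'.V_eq, map_map]
    ext x
    simp only [mem_map, mem_univ, true_and, coeFn_mk, trans_apply, hσ, Function.comp_apply]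
    exact σ.surjective.exists
  have hx : ∀ a ∈ X'.E, ∃ b, a = j' (ρ b) ∧ ρ'.symm a = j b := fun a ha => by
    obtain ⟨b, rfl⟩ := h'.exists_j ha
    refine ⟨ρ.symm b, by simp, ?_⟩
    grind
  refine ⟨hV, hE, fun a ha => ?_, fun a ha c => ?_, fun a ha => ?_⟩ <;>
    obtain ⟨b, rfl, hb⟩ := hx a ha
  · funext s
    simp [hb, h'.ends_eq, h.ends_eq, hf, hσ, SGraph.relabel, Graph.relabel]
  · simp [hb, h'.col_eq, h.col_eq, hf, SGraph.relabel, Graph.relabel]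
  · simp [hb, h'.ty_eq, h.ty_eq, hf, SGraph.relabel]

lemma Lab.sgn_eq {j j' : Fin e → ℕ} (h : Lab X G i j) (hi : StrictMono i) (hj : StrictMono j) (hi' :
    StrictMono i') (hj' : StrictMono j') {σ' ρ' : Perm ℕ} {f' : ℕ → Bool} (hσ : ∀ x, σ' (i x) = i'
    (σ x)) (hρ : ∀ x, ρ' (j x) = j' (ρ x)) (hf : ∀ x, f' (j x) = f x) (m : ℤ) : X.sgn m σ' ρ' f' =
    G.relabelSign m σ ρ f := by
  rw [sgn, SGraph.relabelSign_eq, h.items_eq, kap_map]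
  congr 1
  · refine kap_congr_lt ?_ ?_
    · rintro (x | x) - (y | y) - <;> simp [hi.lt_iff_lt, hj.lt_iff_lt]
    · rintro (x | x) - (y | y) - <;> simp [hσ, hρ, hi'.lt_iff_lt, hj'.lt_iff_lt]
  · rw [fsgn, h.dotted_eq, prod_map]
    simp [hf]

lemma Alt.lab (hψ : Alt m ψ) {X X' : NG k} {j j' : Fin e → ℕ} (h : Lab X G i j) (hi : StrictMono i)
    (hj : StrictMono j) (h' : Lab X' (G.relabel σ ρ f) i' j') (hi' : StrictMono i') (hj' :
    StrictMono j') : ψ X' = G.relabelSign m σ ρ f • ψ X := by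
  obtain ⟨σ', ρ', f', ha, hσ, hρ, hf⟩ := h.exists_agree h'
  rw [hψ X X' σ' ρ' f' h.closed ha, h.sgn_eq hi hj hi' hj' hσ hρ hf]

lemma Alt.finAlt (hψ : Alt m ψ) : FinAlt m fun v e (G : SGraph k v e) => ψ (toNG G) := fun _ _ G σ
    ρ f =>
  hψ.lab (lab_toNG G) val_strictMono val_strictMono (lab_toNG (G.relabel σ ρ f))
    val_strictMono val_strictMono

lemma Alt.eq_toNG (hψ : Alt m ψ) {i : Fin (v + 1) → ℕ} (h : Lab X G i j) (hi : StrictMono i) (hj :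
    StrictMono j) : ψ X = ψ (toNG G) := by
  have h1 := hψ.lab (lab_toNG G) val_strictMono val_strictMono (σ := 1) (ρ := 1)
    (f := fun _ => false) (X' := X) (i' := i) (j' := j) (by rwa [SGraph.relabel_one]) hi hj
  have h2 := hψ.lab (lab_toNG G) val_strictMono val_strictMono (σ := 1) (ρ := 1)
    (f := fun _ => false) (by rw [SGraph.relabel_one]; exact lab_toNG G)
    val_strictMono val_strictMono
  grind

/-- Comparison of functions that satisfy the relations on labelled graphs. -/
lemma Good.eq_of_fin {Bad : NG k → Prop} {χ χ' : NG k → M} (h : Good m Bad χ) (h' : Good m Bad χ')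
    (d : ℤ) (H : ∀ (v e : ℕ) (G : SGraph k v e), (toNG G).WF → G.degree m = d → ¬ Bad (toNG G) → ¬
    (toNG G).Fusable → χ (toNG G) = χ' (toNG G)) (hB : BadCond m Bad) (hw : X.WF) (hd : X.degree m =
    d) : χ X = χ' X := by
  refine h.eq_of h' d (fun X hw hd hb hf => ?_) hw hd
  obtain ⟨x, hx, -⟩ := hw.three_le
  obtain ⟨v, e, G, i, j, hl⟩ := exists_lab hw.closed ⟨x, hx⟩
  obtain ⟨G', i', j', hl, hi, hj⟩ := hl.exists_mono
  rw [h.alt.eq_toNG hl hi hj, h'.alt.eq_toNG hl hi hj]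
  obtain ⟨σ', ρ', f', ha, -⟩ := hl.exists_agree (σ := 1) (ρ := 1) (f := fun _ => false)
    (by rw [SGraph.relabel_one]; exact lab_toNG G')
  refine H v e G' (hw.agree ha) (by rw [← hl.degree_eq, hd]) (fun hb' => hb ?_) fun hf' => hf ?_
  · exact hB.ren _ _ _ _ _ (agree_symm_ren ha) hb'
  · obtain ⟨u, hu⟩ := hf'.exists_at
    exact (hu.agree (agree_symm_ren ha)).fusable

lemma del_congr {ψ χ : NG k → M} {d : ℤ} (h : ∀ X : NG k, X.WF → X.degree m = d → ψ X = χ X) (hw :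
    X.WF) (hd : X.degree m = d + 1) : del m ψ X = del m χ X := by
  refine sum_congr rfl fun t _ => term_congr (fun ht h0 s => h _ (hw.setTy _ _) ?_)
    fun ht s hs htad => h _ (hw.contract ht htad s) ?_
  · have := degree_setTy m (mem_dotted.2 ⟨ht, h0⟩) s
    omega
  · have := degree_contract m (mem_solid.2 ⟨ht, by simp [hs]⟩) (X.ends t !s)
      (hw.closed t ht s)
    omega

/-! ### Signs of labelled graphs -/

lemma Lab.aft_inr {i : Fin (v + 1) → ℕ} (h : Lab X G i j) (hj : StrictMono j) (m : ℤ) (t : Fin e) :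
    aft lx (X.items m) (inr (j t)) = (-1) ^ ((G.oddEdges m).filter fun a => t < a).card := by
  rw [h.items_eq]
  have e1 := aft_map (⟨Sum.map i j, map_injective.2 ⟨h.i_inj, h.j_inj⟩⟩ : _ ↪ ℕ ⊕ ℕ)
    (G.items m) lx (inr t)
  rw [coeFn_mk, map_inr] at e1
  rw [e1]
  have e2 : aft (lx ∘ Sum.map i j) (G.items m) (inr t) = aft lx (G.items m) (inr t) :=
    aft_congr (by rintro (x | x) - <;> simp [hj.lt_iff_lt])
  rw [e2, SGraph.items, SGraph.oddEdges]
  split_ifs <;> rw [aft_lx_inr] <;> rfl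

lemma aft_univ (y : Fin (n + 1)) : aft id univ y = (-1) ^ (n - (y : ℕ)) := by
  have : (univ.filter fun d : Fin (n + 1) => id y < id d) = Finset.Ioi y := by
    ext; simp
  rw [aft, this, Fin.card_Ioi]
  rfl

lemma Lab.aft_inl {i : Fin (v + 1) → ℕ} (h : Lab X G i j) (hi : StrictMono i) (hm : ¬ Even m) (y :
    Fin (v + 1)) : aft lx (X.items m) (inl (i y)) = (-1) ^ (v - (y : ℕ) + G.dotted.card) := by
  rw [h.items_eq]
  have e1 := aft_map (⟨Sum.map i j, map_injective.2 ⟨h.i_inj, h.j_inj⟩⟩ : _ ↪ ℕ ⊕ ℕ)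
    (G.items m) lx (inl y)
  rw [coeFn_mk, Sum.map_inl] at e1
  rw [e1]
  have e2 : aft (lx ∘ Sum.map i j) (G.items m) (inl y) = aft lx (G.items m) (inl y) :=
    aft_congr (by rintro (x | x) - <;> simp [hi.lt_iff_lt])
  rw [e2, SGraph.items, if_neg hm, aft_lx_inl, aft_univ, pow_add]

lemma Lab.aft_citem {G : SGraph k (v + 1) e} {i : Fin (v + 2) → ℕ} (h : Lab X G i j) (hi :
    StrictMono i) (hj : StrictMono j) (m : ℤ) (t : Fin e) (y : Fin (v + 2)) : aft lx (X.items m)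
    (citem m (j t) (i y)) = (-1) ^ (if Even m then (G.solid.filter fun a => t < a).card else v + 1 -
    (y : ℕ) + G.dotted.card) := by
  unfold citem
  split_ifs with hm
  · rw [h.aft_inr hj, SGraph.oddEdges, if_pos hm]
  · rw [h.aft_inl hi hm]

lemma Lab.fuseSgn_eq {G : SGraph k (v + 1) (e + 1)} {i : Fin (v + 2) → ℕ} {j : Fin (e + 1) → ℕ} (h :
    Lab X G i j) (hi : StrictMono i) (hj : StrictMono j) (m : ℤ) {p q : Fin (e + 1)} (hpq : p < q)
    (hp : G.ty p ≠ none) (hq : G.ty q ≠ none) (w : Fin (v + 2)) : fuseSgn m (X.items m) (i w) (j p)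
    (j q) = G.fuseSign m w p q := by
  have hitp : inr (j p) ∈ X.items m ↔ Even m := by
    rw [inr_mem_items, h.ty_eq]; simp [h.j_mem, hp]
  have hitq : inr (j q) ∈ X.items m ↔ Even m := by
    rw [inr_mem_items, h.ty_eq]; simp [h.j_mem, hq]
  have hlt : j p < j q := hj hpq
  rw [fuseSgn, h.aft_citem hi hj, SGraph.fuseSign, aft_tog _ _ _ _, h.aft_inr hj]
  unfold citem SGraph.oddEdges
  by_cases hm : Even m
  · simp only [hm, if_true]
    have hmem : q ∈ G.solid.filter fun a => p < a := by simp [SGraph.solid, hq, hpq]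
    have e1 : (G.solid.filter fun a => p < a ∧ a ≠ q) = (G.solid.filter fun a => p < a).erase q := by
      grind
    rw [e1, pow_add, ← card_erase_add_one hmem, pow_succ]
    simp [hlt]
  · simp only [hm, if_false]
    have e2 : (G.dotted.filter fun a => p < a).card + (G.dotted.filter fun a => a < p).card =
        G.dotted.card := by
      rw [← Finset.card_filter_add_card_filter_not (s := G.dotted) (fun a => p < a)]
      congr 2
      ext a
      simp only [mem_filter, not_lt, SGraph.dotted, mem_univ, true_and]
      refine and_congr_right fun ha => ⟨le_of_lt, fun hle => lt_of_le_of_ne hle ?_⟩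
      rintro rfl; exact hp ha
    rw [← e2]
    simp only [pow_add]
    have e3 : ((-1 : ℤ) ^ (G.dotted.filter fun a => p < a).card) *
        ((-1 : ℤ) ^ (G.dotted.filter fun a => p < a).card) = 1 := by
      rw [← mul_pow]; simp
    simp
    linear_combination ((-1 : ℤ) ^ (v + 1 - (w : ℕ)) * (-1) ^ (G.dotted.filter fun a => a < p).card)
      * e3

end

section

open NG

variable {K : Type u} [Field K] {k : ℕ} {m : ℤ} {M : Type*} [AddCommGroup M] [Module K M]
variable {v e : ℕ} {d : ℤ} {L : (SGCGen k m d →₀ K) →ₗ[K] M}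

/-! ### The special complex is a complex -/

/-- A linear map on the space of generators as a function of labelled graphs. -/
def sgcFun (d : ℤ) (L : (SGCGen k m d →₀ K) →ₗ[K] M) : ∀ v e, SGraph k v e → M :=
  fun _ _ G => L (sgcGen K m d G)

lemma finAlt_sgcFun (hL : sgcRel K k m d ≤ ker L) : FinAlt m (sgcFun d L) := by
  intro v e G σ ρ f
  have h1 : L (sgcGen K m d (G.relabel σ ρ f) - G.relabelSign m σ ρ f • sgcGen K m d G) = 0 :=
    hL (subset_span ⟨v, e, G, σ, ρ, f, rfl⟩)
  rw [map_sub, map_zsmul, sub_eq_zero] at h1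
  exact h1

lemma sgcFun_of_not {G : SGraph k v e} (h : ¬ G.IsSpecial m) : sgcFun d L v e G = 0 := by
  rw [sgcFun, sgcGen, dif_neg (fun h' => h h'.1), map_zero]

lemma eq_zero_of_eq_neg [CharZero K] {x : M} (h : x = (-1 : ℤ) • x) : x = 0 := by
  have h1 : (2 : K) • x = 0 := by
    rw [two_smul]
    nth_rewrite 1 [h]
    simp
  exact (smul_eq_zero.1 h1).resolve_left two_ne_zero

lemma not_acyclic_of_loop {α : Type} {arc : α → α → Prop} {x : α} (h : arc x x) : ¬ Acyclic arc :=
    fun ha => ha x (.single h)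

lemma sgcFun_bad [CharZero K] (hL : sgcRel K k m d ≤ ker L) (X : NG k) (v e : ℕ) (G : SGraph k v e)
    (i : Fin (v + 1) → ℕ) (j : Fin e → ℕ) (h : Lab X G i j) (hb : X.BadS m) : sgcFun d L v e G = 0
    := by
  by_cases hs : G.IsSpecial m
  swap
  · exact sgcFun_of_not hs
  have hs' := (h.special_iff m).2 hs
  rcases hb with (⟨a, ha, htad⟩ | ⟨c, hc⟩) | hc | ⟨hm, a, ha, b, hb, hab, hp⟩
  · obtain ⟨a, rfl⟩ := h.exists_j ha
    rw [h.ends_eq, h.ends_eq] at htad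
    have htad := h.i_inj htad
    have hm : Even m := by
      by_contra hm
      exact hs.no_tadpole (Int.not_even_iff_odd.1 hm) a htad
    have hk : ∀ c : Fin k, False := fun c => by
      refine not_acyclic_of_loop (x := G.ends a true) ⟨a, ?_, ?_⟩ (hs.acyclic c)
      · cases G.col c a <;> simp [htad]
      · cases G.col c a <;> simp [htad]
    have hty : G.ty a = none := by
      by_contra h0
      obtain ⟨s, hs0⟩ := ne_none_iff_exists'.1 h0
      refine not_acyclic_of_loop (x := G.ends a true) ⟨a, s, hs0, ?_, ?_⟩ hs.acyclic_last
      · cases s <;> simp [htad]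
      · cases s <;> simp [htad]
    have e1 : G.relabel 1 1 (fun b => decide (b = a)) = G := by
      obtain ⟨⟨en, co⟩, ty⟩ := G
      simp only [SGraph.relabel, Graph.relabel, SGraph.mk.injEq, Graph.mk.injEq]
      refine ⟨⟨?_, ?_⟩, ?_⟩
      · funext b s
        by_cases hba : b = a
        · subst hba; simp only at htad; cases s <;> simp [htad]
        · simp [hba]
      · funext c; exact (hk c).elim
      · funext b
        by_cases hba : b = a
        · subst hba; simp only at hty; simp [hty]
        · have hx : xor false = id := by funext x; simp
          simp [hba, hx]
    have e2 : G.relabelSign m 1 1 (fun b => decide (b = a)) = -1 := by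
      rw [SGraph.relabelSign_eq, if_pos hm]
      have : (lx ∘ Sum.map (1 : Perm (Fin (v + 1))) (1 : Perm (Fin e)) :
          Fin (v + 1) ⊕ Fin e → _) = lx := by
        funext x; rcases x with x | x <;> rfl
      rw [this, kap_self, one_mul]
      have ha : a ∈ G.dotted := by simp [SGraph.dotted, hty]
      rw [← mul_prod_erase _ _ ha, prod_eq_one]
      · simp
      · grind
    have e3 := finAlt_sgcFun hL v e G 1 1 (fun b => decide (b = a))
    rw [e1, e2] at e3
    exact eq_zero_of_eq_neg (K := K) e3
  · exact absurd (hs'.acyclic c) hc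
  · exact absurd hs'.acyclic_last hc
  · exact absurd hp (hs'.no_multiple hm a ha b hb hab)

lemma good_sgc [CharZero K] (hL : sgcRel K k m d ≤ ker L) : Good m (BadS m) (ext m (sgcFun d L)) :=
  good_ext (badCond_badS m) (finAlt_sgcFun hL) (sgcFun_bad hL)

lemma ext_lab {φ : ∀ v e, SGraph k v e → M} (hφ : FinAlt m φ) {X : NG k} {G : SGraph k v e} {i : Fin
    (v + 1) → ℕ} {j : Fin e → ℕ} (h : Lab X G i j) (hi : StrictMono i) (hj : StrictMono j) (hf : ¬
    X.Fusable) : ext m φ X = φ v e G := by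
  rw [ext_of_not hf, base_of_mono hφ h hi hj]

lemma sum4_ite {n : ℕ} {C : Fin n → Fin n → Bool → Bool → Prop} [∀ i j s r, Decidable (C i j s r)]
    {p q : Fin n} {s r : Bool} {F : Fin n → Fin n → Bool → Bool → M} (h : ∀ i j s' r', C i j s' r' ↔
    i = p ∧ j = q ∧ s' = s ∧ r' = r) : (∑ i, ∑ j, ∑ s', ∑ r', if C i j s' r' then F i j s' r' else
    0) = F p q s r := by
  simp only [h, ite_and, Finset.sum_ite_eq', mem_univ, if_true, Finset.sum_ite_irrel,
    Finset.sum_const_zero]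

lemma ext_sgcFuse [CharZero K] (hL : sgcRel K k m d ≤ ker L) {X : NG k} {G : SGraph k v e} {i : Fin
    (v + 1) → ℕ} {j : Fin e → ℕ} (h : Lab X G i j) (hi : StrictMono i) (hj : StrictMono j) {w : Fin
    (v + 1)} (hw : G.Passing w) (hu : ∀ u, X.FusableAt u → u = i w) : ext m (sgcFun d L) X = L
    (sgcFuse K m d v e G w) := by
  have hgood := good_sgc hL
  have hp := h.passing_iff.2 hw
  by_cases htad : ∃ a : Fin e, G.ends a false = w ∧ G.ends a true = w
  · obtain ⟨a, h1, h2⟩ := htad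
    rw [hgood.bad X h.closed (Or.inl (Or.inl ⟨j a, h.j_mem a, by
      rw [h.ends_eq, h.ends_eq, h1, h2]⟩))]
    have h3 : ({(a, false), (a, true)} : Finset (Fin e × Bool)) ⊆
        univ.filter fun p : Fin e × Bool => G.ends p.1 p.2 = w := by
      grind
    have h4 := Finset.eq_of_subset_of_card_le h3
      (by rw [Finset.card_pair (by simp)]; exact hw.1.le)
    have h5 : ∀ b s, G.ends b s = w → b = a := fun b s hb => by
      have : (b, s) ∈ ({(a, false), (a, true)} : Finset (Fin e × Bool)) := by
        grind
      simp only [mem_insert, Finset.mem_singleton, Prod.mk.injEq] at this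
      rcases this with h | h <;> exact h.1
    rcases v with _ | v <;> rcases e with _ | e
    · exact a.elim0
    · simp [sgcFuse]
    · exact a.elim0
    · rw [sgcFuse, eq_comm]
      convert L.map_zero
      refine sum_eq_zero fun p _ => sum_eq_zero fun q _ => sum_eq_zero
        fun s _ => sum_eq_zero fun r _ => if_neg ?_
      rintro ⟨hpq, h6, h7⟩
      rw [h5 p s h6, h5 q r h7] at hpq
      exact lt_irrefl _ hpq
  obtain ⟨p, hp, q, hq, s, r, hpq, h1, h2, h3, h4, h5, h6⟩ := hp.exists_ends fun a ha h1 h2 => by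
    obtain ⟨a, rfl⟩ := h.exists_j ha
    rw [h.ends_eq] at h1 h2
    exact htad ⟨a, h.i_inj h1, h.i_inj h2⟩
  have hF := FuseAt.of_ends (h.i_mem w) hp hq hpq.ne h1 h2 h3 h4 h5 h6
  obtain ⟨p, rfl⟩ := h.exists_j hp
  obtain ⟨q, rfl⟩ := h.exists_j hq
  have hpq' : p < q := hj.lt_iff_lt.1 hpq
  rw [h.ends_eq, h.i_inj.eq_iff] at h1 h2
  rw [h.ends_eq, Ne, h.i_inj.eq_iff] at h3 h4
  have h5' : ∀ a, a ≠ p → a ≠ q → ∀ s, G.ends a s ≠ w := fun a hap haq s e => by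
    refine h5 (j a) (h.j_mem a) (fun e => hap (h.j_inj e)) (fun e => haq (h.j_inj e)) s ?_
    rw [h.ends_eq, e]
  rcases v with _ | v
  · grind
  rcases e with _ | e
  · exact p.elim0
  have hcond : ∀ a b s' r', (a < b ∧ G.ends a s' = w ∧ G.ends b r' = w) ↔
      (a = p ∧ b = q ∧ s' = s ∧ r' = r) := by
    have haux : ∀ a s', G.ends a s' = w → (a = p ∧ s' = s) ∨ (a = q ∧ s' = r) := by
      intro a s' ha
      by_cases hap : a = p
      · subst hap
        refine Or.inl ⟨rfl, ?_⟩
        by_contra hne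
        rw [eq_not_of_ne hne] at ha; exact h3 ha
      · by_cases haq : a = q
        · subst haq
          refine Or.inr ⟨rfl, ?_⟩
          by_contra hne
          rw [eq_not_of_ne hne] at ha; exact h4 ha
        · exact absurd ha (h5' a hap haq s')
    intro a b s' r'
    constructor
    · grind
    · grind
  rw [sgcFuse, sum4_ite hcond]
  set f : ℕ → Bool := fun a => if a = j p then !s else if a = j q then r else false
  have hl := h.fuse hpq'.ne h1 h3 h4 h5'
  have halt := hgood.alt (X.ren 1 1 f) X 1 1 f (h.closed.ren 1 1 f)
    (by rw [ren_ren_flip_self]; exact Agree.refl _)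
  rw [halt, hgood.fuse _ _ _ _ (h.closed.ren _ _ _) hF, ext_lab (finAlt_sgcFun hL) hl (hi.comp
    (strictMono_succAbove w)) (hj.comp (strictMono_succAbove q))]
  · have hc : (X.ren 1 1 f).coef (j p) (j q) = if G.ty p = some s ∧ G.ty q = some r then 1
        else if G.ty p = some (!s) ∧ G.ty q = some (!r) then -1 else 0 := by
      have hne : j q ≠ j p := hpq.ne'
      simp only [coef, NG.ren, one_symm_apply, f, if_true, if_neg hne, h.ty_eq]
      rcases G.ty p with _ | _ | _ <;> rcases G.ty q with _ | _ | _ <;> cases s <;> cases r <;> rfl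
    rw [hc, map_zsmul]
    by_cases h0 : (X.ren 1 1 f).coef (j p) (j q) = 0
    · rw [← hc, h0]; simp
    · have hne := coef_ne_zero h0
      have hp0 : G.ty p ≠ none := by
        grind
      have hq0 : G.ty q ≠ none := by
        grind
      have hit : (X.ren 1 1 f).items m = X.items m := by
        rw [items_ren]
        ext (x | x) <;> rw [mem_map_equiv] <;> rfl
      have hd : (X.ren 1 1 f).fsgn m f = 1 := by
        unfold fsgn
        split_ifs
        · refine prod_eq_one fun a ha => if_neg ?_
          rw [dotted_ren, mem_map_equiv, one_symm_apply, mem_dotted] at ha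
          simp only [f]
          rw [if_neg, if_neg]
          · simp
          · rintro rfl; exact hq0 (by rw [← h.ty_eq]; exact ha.2)
          · rintro rfl; exact hp0 (by rw [← h.ty_eq]; exact ha.2)
        · rfl
      rw [NG.sgn_flip, hd, one_smul, hit, h.fuseSgn_eq hi hj m hpq' hp0 hq0, mul_comm]
      rfl
  · intro hfu
    obtain ⟨u, hfu⟩ := hfu.exists_at
    have h7 := hu u (FusableAt.of_fuse hF hfu).of_flip
    have h8 := hfu.passing.1
    rw [NG.fuse, setTy_V, contract_V, mem_erase] at h8
    exact h8.1 h7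

lemma negOnePow_eq_eps (m : ℤ) : ((m.negOnePow : ℤˣ) : ℤ) = eps m := by
  unfold eps
  split_ifs with h
  · rw [Int.negOnePow_even m h]; rfl
  · rw [Int.negOnePow_odd m (Int.not_even_iff_odd.1 h)]; rfl

lemma term_dotted_sgc [CharZero K] (hL : sgcRel K k m d ≤ ker L) {G : SGraph k v e} (hG :
    G.IsSpecial m) {t : Fin e} (ht : G.ty t = none) : term m (ext m (sgcFun d L)) (t : ℕ) (toNG G) =
    L (((-1 : ℤ) ^ ((G.oddEdges m).filter fun a => t < a).card) • (sgcGen K m d (G.makeSolid t true)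
    - ((m.negOnePow : ℤˣ) : ℤ) • sgcGen K m d (G.makeSolid t false))) := by
  have hl := lab_toNG G
  have hnf : ∀ s, ¬ ((toNG G).setTy t (some s)).Fusable := fun s hf => by
    obtain ⟨u, hu⟩ := hf.exists_at
    exact ((hl.special_iff m).2 hG).not_fusable (FusableAt.setTy_iff.1 hu).fusable
  rw [term_none (hl.j_mem t) (by rw [hl.ty_eq, ht]), hl.aft_inr val_strictMono,
    ext_lab (finAlt_sgcFun hL) (hl.makeSolid t true) val_strictMono val_strictMono (hnf _),
    ext_lab (finAlt_sgcFun hL) (hl.makeSolid t false) val_strictMono val_strictMono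
      (hnf _), negOnePow_eq_eps, map_zsmul, map_sub, map_zsmul]
  rfl

lemma term_solid_sgc [CharZero K] (hL : sgcRel K k m d ≤ ker L) {G : SGraph k (v + 1) (e + 1)} (hG :
    G.IsSpecial m) {t : Fin (e + 1)} {s : Bool} (ht : G.ty t = some s) : term m (ext m (sgcFun d L))
    (t : ℕ) (toNG G) = L (((-1 : ℤ) ^ (if Even m then (G.solid.filter fun a => t < a).card else v +
    1 - (G.ends t s : ℕ) + G.dotted.card)) • if (G.contract t (G.ends t !s) (G.ends t s)).Passing
    (collapse (G.ends t !s) (G.ends t s) (G.ends t !s)) then sgcFuse K m d v e (G.contract t (G.ends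
    t !s) (G.ends t s)) (collapse (G.ends t !s) (G.ends t s) (G.ends t !s)) else sgcGen K m d
    (G.contract t (G.ends t !s) (G.ends t s))) := by
  have hl := lab_toNG G
  have hsp := (hl.special_iff m).2 hG
  have hne : G.ends t (!s) ≠ G.ends t s := fun e => by
    refine not_acyclic_of_loop (x := G.ends t s) ⟨t, s, ht, e, rfl⟩ hG.acyclic_last
  have hends : ∀ r, (toNG G).ends t r = (G.ends t r : ℕ) := fun r => hl.ends_eq t r
  have htad : (toNG G).ends t false ≠ (toNG G).ends t true := by
    rw [hends, hends]
    intro e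
    have := val_injective e
    cases s
    exacts [hne this.symm, hne this]
  have hty : (toNG G).ty t = some s := by rw [hl.ty_eq, ht]
  have hc := hl.contract t hne
  rw [term_some (hl.j_mem t) hty htad, hends, hends, hl.aft_citem val_strictMono val_strictMono,
    map_zsmul]
  congr 1
  have m1 := val_strictMono.comp (strictMono_succAbove (G.ends t s))
  have m2 := val_strictMono.comp (strictMono_succAbove t)
  have hw : ((G.ends t s).succAbove (collapse (G.ends t !s) (G.ends t s) (G.ends t !s)) : ℕ) =
      (G.ends t !s : ℕ) := by
    rw [succAbove_collapse hne, if_neg hne]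
  have hu : ∀ u, ((toNG G).contract t (G.ends t !s : ℕ) (G.ends t s : ℕ)).FusableAt u →
      u = (G.ends t !s : ℕ) := fun u hu => by
    by_contra hcon
    rw [← hends, ← hends] at hu
    rw [← hends] at hcon
    exact hsp.not_fusable (FusableAt.of_contract s hu hcon).fusable
  split_ifs with hP
  · exact ext_sgcFuse hL hc m1 m2 hP fun u hf => (hu u hf).trans hw.symm
  · refine ext_lab (finAlt_sgcFun hL) hc m1 m2 fun hf => hP ?_
    obtain ⟨u, hf⟩ := hf.exists_at
    have h1 := hf.passing.2
    rw [(hu u hf).trans hw.symm] at h1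
    exact hc.passing_iff.1 h1

lemma sum_E_toNG (G : SGraph k v e) (F : ℕ → M) : ∑ t ∈ (toNG G).E, F t = ∑ t : Fin e, F t := by
  rw [(lab_toNG G).E_eq, sum_map]; rfl

lemma sgc_bd [CharZero K] (hL : sgcRel K k m d ≤ ker L) {G : SGraph k v e} (hG : G.IsSpecial m) : L (sgcBdDotted K m d G + sgcBdSolid K m d v e
    G) = del m (ext m (sgcFun d L)) (toNG G) := by
  have hsolid : ∀ t s, G.ty t = some s → G.ends t false ≠ G.ends t true := fun t s ht e => by
    refine not_acyclic_of_loop (x := G.ends t true) ⟨t, s, ht, ?_, ?_⟩ hG.acyclic_last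
    · cases s <;> simp [e]
    · cases s <;> simp [e]
  rw [del, sum_E_toNG, map_add, sgcBdDotted, SGraph.dotted, sum_filter, map_sum]
  rcases e with _ | e
  · cases v <;> simp [sgcBdSolid]
  rcases v with _ | v
  · have : sgcBdSolid K m d 0 (e + 1) G = 0 := rfl
    rw [this, map_zero, add_zero]
    refine sum_congr rfl fun t _ => ?_
    rcases ht : G.ty t with _ | s
    · simp only [if_true]
      exact (term_dotted_sgc hL hG ht).symm
    · grind
  · rw [sgcBdSolid, map_sum, ← sum_add_distrib]
    refine sum_congr rfl fun t _ => ?_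
    rcases ht : G.ty t with _ | s
    · simp only [if_true, map_zero, add_zero]
      exact (term_dotted_sgc hL hG ht).symm
    · simp only [reduceCtorEq, if_false, map_zero, zero_add]
      exact (term_solid_sgc hL hG ht).symm

variable (K k m) in
/-- The formula for the differential. -/
def sgcD (i j : ℤ) : (SGCGen k m i →₀ K) →ₗ[K] (SGCGen k m j →₀ K) :=
  linearCombination K fun X =>
    sgcBdDotted K m j X.1.2.2 + sgcBdSolid K m j X.1.1 X.1.2.1 X.1.2.2

lemma sgcD_single (i j : ℤ) (X : SGCGen k m i) : sgcD K k m i j (Finsupp.single X 1) = sgcBdDotted K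
    m j X.1.2.2 + sgcBdSolid K m j X.1.1 X.1.2.1 X.1.2.2 := by
  rw [sgcD, linearCombination_single, one_smul]

/-- An admissible labelled graph as a generator. -/
def sgcMk {G : SGraph k v e} (h : G.IsSpecial m ∧ G.degree m = d) : SGCGen k m d := ⟨⟨v, e, G⟩, h⟩

lemma sgcGen_of {G : SGraph k v e} (h : G.IsSpecial m ∧ G.degree m = d) : sgcGen K m d G =
    Finsupp.single (sgcMk h) 1 := dif_pos h

lemma single_sgc (a : SGCGen k m d) : (Finsupp.single a 1 : SGCGen k m d →₀ K) = sgcGen K m d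
    a.1.2.2 := (sgcGen_of a.2).symm

lemma sgc_bd_gen [CharZero K] {i j : ℤ} {L : (SGCGen k m j →₀ K) →ₗ[K] M} (hL : sgcRel K k m j ≤ ker
    L) (G : SGraph k v e) : L (sgcD K k m i j (sgcGen K m i G)) = if G.IsSpecial m ∧ G.degree m = i
    then del m (ext m (sgcFun j L)) (toNG G) else 0 := by
  split_ifs with h
  · rw [sgcGen_of h, sgcD_single]
    exact sgc_bd hL h.1
  · rw [sgcGen, dif_neg h, map_zero, map_zero]

lemma finsupp_lhom_ext {α : Type*} {f g : (α →₀ K) →ₗ[K] M} (h : ∀ a, f (Finsupp.single a 1) = g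
    (Finsupp.single a 1)) : f = g := by
  refine Finsupp.lhom_ext fun a b => ?_
  rw [← mul_one b, ← smul_eq_mul, ← Finsupp.smul_single, map_smul, map_smul, h]

lemma sgc_bd_rel [CharZero K] (i j : ℤ) : sgcRel K k m i ≤ (sgcRel K k m j).comap (sgcD K k m i j)
    := by
  refine span_le.2 ?_
  rintro _ ⟨v, e, G, σ, ρ, f, rfl⟩
  have hL : sgcRel K k m j ≤ ker (sgcRel K k m j).mkQ := (ker_mkQ _).ge
  have hA := (good_sgc hL).alt.del.finAlt v e G σ ρ f
  beta_reduce at hA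
  rw [SetLike.mem_coe, mem_comap, ← ker_mkQ (sgcRel K k m j), mem_ker, map_sub, map_zsmul, map_sub,
    map_zsmul, sgc_bd_gen hL, sgc_bd_gen hL, SGraph.isSpecial_relabel_iff, SGraph.degree_relabel,
    hA]
  split_ifs <;> simp

/-- Two functions that represent the same linear map. -/
lemma sgc_ext_eq [CharZero K] {j l : ℤ} {L : (SGCGen k m l →₀ K) →ₗ[K] M} (hL : sgcRel K k m l ≤ ker
    L) {X : NG k} (hw : X.WF) (hd : X.degree m = j) : ext m (sgcFun j (L ∘ₗ sgcD K k m j l)) X = del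
    m (ext m (sgcFun l L)) X := by
  have hL' : sgcRel K k m j ≤ ker (L ∘ₗ sgcD K k m j l) := fun x hx =>
    hL (sgc_bd_rel j l hx)
  refine (good_sgc hL').eq_of_fin ((good_sgc hL).del (badCond_badS m)) j
    (fun v e G hw hd hb hf => ?_) (badCond_badS m) hw hd
  rw [ext_lab (finAlt_sgcFun hL') (lab_toNG G) val_strictMono val_strictMono hf, sgcFun,
    LinearMap.comp_apply, sgc_bd_gen hL, if_pos ⟨((lab_toNG G).special_iff m).1 (hw.special hb hf),
    hd⟩]

lemma sgc_bd_bd [CharZero K] {i j l : ℤ} (hij : j + 1 = i) (x : SGCGen k m i →₀ K) : sgcD K k m j l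
    (sgcD K k m i j x) ∈ sgcRel K k m l := by
  have hL : sgcRel K k m l ≤ ker (sgcRel K k m l).mkQ := (ker_mkQ _).ge
  have hL' : sgcRel K k m j ≤ ker ((sgcRel K k m l).mkQ ∘ₗ sgcD K k m j l) :=
    fun x hx => hL (sgc_bd_rel j l hx)
  have key : ((sgcRel K k m l).mkQ ∘ₗ sgcD K k m j l) ∘ₗ sgcD K k m i j = 0 := by
    refine finsupp_lhom_ext fun a => ?_
    rw [single_sgc]
    obtain ⟨⟨v, e, G⟩, hG⟩ := a
    simp only at hG ⊢
    have hw : (toNG G).WF := (((lab_toNG G).special_iff m).2 hG.1).toWF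
    rw [LinearMap.zero_apply, LinearMap.comp_apply, sgc_bd_gen hL', if_pos hG,
      del_congr (d := j) (fun X hw hd => sgc_ext_eq hL hw hd) hw
      (by rw [(lab_toNG G).degree_eq]; exact hG.2.trans hij.symm),
      del_del (good_sgc hL).alt hw.closed]
  have := LinearMap.congr_fun key x
  rw [LinearMap.comp_apply, LinearMap.comp_apply, LinearMap.zero_apply] at this
  rwa [← mem_ker, ker_mkQ] at this

variable (K k m) in
lemma isComplex_SGC [CharZero K] : (SGC K k m).IsComplex where
  bd_rel i j _ := sgc_bd_rel i j
  bd_bd _ _ _ hij _ x := sgc_bd_bd hij x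

end

section

open NG

variable {K : Type u} [Field K] {k : ℕ} {n : ℤ} {M : Type*} [AddCommGroup M] [Module K M]
variable {v e : ℕ} {d : ℤ} {L : (GCGen k n d →₀ K) →ₗ[K] M}

/-! ### Functions of graphs without dotted edges -/

/-- The graph with all edges solid, oriented as their intrinsic orientation. -/
def Graph.toS (G : Graph k v e) : SGraph k v e := ⟨G, fun _ => some true⟩

lemma dotted_toS (G : Graph k v e) : G.toS.dotted = ∅ := by
  simp [SGraph.dotted, Graph.toS]

lemma solid_toS (G : Graph k v e) : G.toS.solid = univ := by
  simp [SGraph.solid, Graph.toS]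

lemma degree_toS (G : Graph k v e) (n : ℤ) : G.toS.degree n = (v : ℤ) * n + (1 - n) * (e : ℤ) := by
  simp [SGraph.degree, dotted_toS, solid_toS]

def revSgn (n : ℤ) (G : SGraph k v e) : ℤ :=
  ∏ a, if G.ty a = some false then eps n else 1

lemma revSgn_mul_self (n : ℤ) (G : SGraph k v e) : revSgn n G * revSgn n G = 1 := by
  rw [revSgn, ← prod_mul_distrib]
  exact prod_eq_one fun a _ => by split_ifs <;> simp [eps_mul_self]

lemma relabelSign_mul_revSgn {G : SGraph k v e} (hG : ∀ a, G.ty a ≠ none) (σ : Perm (Fin (v + 1)))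
    (ρ : Perm (Fin e)) (f : Fin e → Bool) : G.relabelSign n σ ρ f * revSgn n G = revSgn n (G.relabel
    σ ρ f) * gcSign n σ ρ f := by
  have hd : G.dotted = ∅ := by simp [SGraph.dotted, hG]
  have hs : G.solid = univ := by simp [SGraph.solid, hG]
  have e1 : revSgn n (G.relabel σ ρ f) =
      ∏ a, if (G.ty a).map (xor (f a)) = some false then eps n else 1 := by
    rw [revSgn, ← Equiv.prod_comp ρ]
    simp [SGraph.relabel]
  rw [e1, revSgn, SGraph.relabelSign, gcSign, SGraph.oddEdges, hd, hs]
  by_cases hn : Even n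
  · simp [hn, eps, inversions_eq_kap, sign_eq_kap]
  · have : inversions (∅ : Finset (Fin e)) ρ = 0 := by simp [inversions]
    simp only [hn, if_false, this, pow_zero, one_mul, eps]
    rw [mul_left_comm, ← prod_mul_distrib]
    congr 1
    refine prod_congr rfl fun a _ => ?_
    obtain ⟨s, hs⟩ := ne_none_iff_exists'.1 (hG a)
    rw [hs]
    cases s <;> cases f a <;> simp

lemma toNG_makeSolid (G : SGraph k v e) (t : Fin e) (s : Bool) : toNG (G.makeSolid t s) = (toNG
    G).setTy t (some s) := by
  simp only [toNG, NG.setTy, SGraph.makeSolid, NG.mk.injEq, true_and]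
  funext a
  by_cases hat : a = t
  · subst hat; simp
  · simp only [update_of_ne hat]
    split_ifs with h
    · rw [update_of_ne]
      rintro rfl; exact hat rfl
    · rfl

/-- Functions that vanish on graphs with dotted edges, and multiply by `(-1) ^ n` when the
orientation of a solid edge is reversed. -/
structure Rev (n : ℤ) (ψ : NG k → M) : Prop where
  nodot : ∀ X : NG k, X.Closed → X.dotted.Nonempty → ψ X = 0
  rev : ∀ (X : NG k) (t : ℕ), X.Closed → t ∈ X.E →
    ψ (X.setTy t (some false)) = eps n • ψ (X.setTy t (some true))

lemma Rev.eq_toS {ψ : NG k → M} (h : Rev n ψ) (G : SGraph k v e) (hG : ∀ a, G.ty a ≠ none) : ψ (toNG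
    G) = revSgn n G • ψ (toNG G.toGraph.toS) := by
  induction hN : (univ.filter fun a => G.ty a = some false).card generalizing G with
  | zero =>
    have h0 : ∀ a, G.ty a = some true := fun a => by
      have := Finset.filter_eq_empty_iff.1 (Finset.card_eq_zero.1 hN) (mem_univ a)
      obtain ⟨s, hs⟩ := ne_none_iff_exists'.1 (hG a)
      cases s
      exacts [absurd hs this, hs]
    have : G = G.toGraph.toS := by
      obtain ⟨G, ty⟩ := G
      simp only [Graph.toS, SGraph.mk.injEq, true_and]
      exact funext h0
    rw [← this, revSgn, prod_eq_one fun a _ => by simp [h0 a], one_smul]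
  | succ N ih =>
    obtain ⟨t, ht⟩ := Finset.card_pos.1 (by rw [hN]; exact N.succ_pos)
    have ht0 : G.ty t = some false := by grind
    have e1 : G.makeSolid t false = G := by
      simp only [SGraph.makeSolid, ← ht0, update_eq_self]
    have e2 : (univ.filter fun a => (G.makeSolid t true).ty a = some false) =
        (univ.filter fun a => G.ty a = some false).erase t := by
      ext a
      rw [mem_erase, mem_filter, mem_filter]
      by_cases hat : a = t <;> simp [SGraph.makeSolid, hat]
    have e3 := ih (G.makeSolid t true) (fun a => by
      by_cases hat : a = t <;> simp [SGraph.makeSolid, hat, hG]) (by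
      rw [e2, Finset.card_erase_of_mem ht, hN]; rfl)
    have e4 : revSgn n G = eps n * revSgn n (G.makeSolid t true) := by
      rw [revSgn, revSgn, ← mul_prod_erase _ _ (mem_univ t), ← mul_prod_erase _ (fun a => if
        (G.makeSolid t true).ty a = some false then eps n
          else 1) (mem_univ t), if_pos ht0, if_neg (by simp [SGraph.makeSolid]), one_mul]
      congr 1
      refine prod_congr rfl fun a ha => ?_
      simp [SGraph.makeSolid, ne_of_mem_erase ha]
    rw [← e1, toNG_makeSolid, h.rev _ _ (lab_toNG G).closed ((lab_toNG G).j_mem t), ←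
      toNG_makeSolid, e3, smul_smul, e1, e4]
    rfl

lemma Rev.relabel {ψ : NG k → M} (h : Rev n ψ) (ha : Alt n ψ) (G : Graph k v e) (σ : Perm (Fin (v +
    1))) (ρ : Perm (Fin e)) (f : Fin e → Bool) : ψ (toNG (G.relabel σ ρ f).toS) = gcSign n σ ρ f • ψ
    (toNG G.toS) := by
  have h1 := ha.finAlt v e G.toS σ ρ f
  beta_reduce at h1
  have h0 : ∀ a, G.toS.ty a ≠ none := fun a => by simp [Graph.toS]
  have h2 := h.eq_toS (G.toS.relabel σ ρ f) fun a => by simp [SGraph.relabel, Graph.toS]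
  have h3 := relabelSign_mul_revSgn (n := n) h0 σ ρ f
  have h4 : revSgn n G.toS = 1 := by simp [revSgn, Graph.toS]
  rw [h4, mul_one] at h3
  have h5 := congrArg (fun x => revSgn n (G.toS.relabel σ ρ f) • x) (h2.symm.trans h1)
  simp only [h3, smul_smul, ← mul_assoc, revSgn_mul_self, one_mul, one_smul] at h5
  exact h5

lemma Rev.del {ψ : NG k → M} (h : Rev n ψ) (ha : Alt n ψ) : Rev n (del n ψ) := by
  have h0 : ∀ X : NG k, X.Closed → X.dotted.Nonempty → OrientedGC.del n ψ X = 0 := by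
    intro X hc ⟨u, hu⟩
    have hu' := mem_dotted.1 hu
    refine sum_eq_zero fun t ht => ?_
    by_cases htu : t = u
    · subst htu
      rw [term_none ht hu'.2, h.rev X t hc ht, smul_smul, eps_mul_self, one_smul, sub_self,
        smul_zero]
    · refine term_eq_zero (fun _ _ s => h.nodot _ (hc.setTy _ _) ⟨u, ?_⟩) fun _ s hs htad =>
        h.nodot _ (hc.contract (hc t ht _) (ends_ne_not htad s)) ⟨u, ?_⟩
      · rw [dotted_setTy_some]; exact mem_erase.2 ⟨Ne.symm htu, hu⟩
      · rw [dotted_contract (mem_solid.2 ⟨ht, by simp [hs]⟩)]; exact hu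
  refine ⟨h0, fun X u hc hu => ?_⟩
  by_cases hd : ∃ b ∈ X.dotted, b ≠ u
  · obtain ⟨b, hb, hbu⟩ := hd
    rw [h0 _ (hc.setTy _ _) ⟨b, by rw [dotted_setTy_some]; exact mem_erase.2 ⟨hbu, hb⟩⟩,
      h0 _ (hc.setTy _ _) ⟨b, by rw [dotted_setTy_some]; exact mem_erase.2 ⟨hbu, hb⟩⟩,
      smul_zero]
  push Not at hd
  have hit : (X.setTy u (some false)).items n = (X.setTy u (some true)).items n := by
    simp only [items, dotted_setTy_some]
    have : ∀ s, (X.setTy u (some s)).solid = insert u X.solid := fun s => by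
      ext x
      by_cases hx : x = u
      · subst hx; simp [mem_solid, NG.setTy, hu]
      · simp [mem_solid, NG.setTy, hx]
    rw [this, this]
    rfl
  simp only [OrientedGC.del]
  rw [smul_sum]
  refine sum_congr rfl fun t ht => ?_
  have ht : t ∈ X.E := ht
  by_cases htad : X.ends t false = X.ends t true
  · have hne : ∀ s, (X.setTy u (some s)).ty t ≠ none := fun s e => by
      by_cases htu : t = u
      · subst htu; simp [NG.setTy] at e
      · simp only [NG.setTy, update_of_ne htu] at e
        exact htu (hd t (mem_dotted.2 ⟨ht, e⟩))
    rw [term_tadpole (hne _) htad, term_tadpole (hne _) htad, smul_zero]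
  by_cases htu : t = u
  · subst htu
    rw [ha.vAlt.term_solid (hc.setTy _ _) hu (s := false) (by simp [NG.setTy]) htad true,
      ha.vAlt.term_solid (hc.setTy _ _) hu (s := true) (by simp [NG.setTy]) htad true, hit]
    simp only [false_eq_true, if_false, if_true, one_smul]
    congr 2
    refine ha.vAlt.congr (hc.contract (hc t ht _) (ends_ne_not htad true)) ?_
    refine ⟨rfl, rfl, fun _ _ => rfl, fun _ _ _ => rfl, fun a ha => ?_⟩
    have : a ≠ t := ne_of_mem_erase ha
    simp [NG.contract, NG.setTy, this]
  · obtain ⟨s, hs⟩ := ne_none_iff_exists'.1 (fun e => htu (hd t (mem_dotted.2 ⟨ht, e⟩)))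
    have hs' : ∀ r, (X.setTy u (some r)).ty t = some s := fun r => by
      simp [NG.setTy, htu, hs]
    rw [term_some (X := X.setTy u (some false)) ht (hs' false) htad,
      term_some (X := X.setTy u (some true)) ht (hs' true) htad, hit, smul_comm (eps n)]
    congr 1
    exact h.rev (X.contract t _ _) u (hc.contract (hc t ht _) (ends_ne_not htad s))
      (mem_erase.2 ⟨Ne.symm htu, hu⟩)

/-! ### The complex of graphs is a complex -/

variable (K k n) in
/-- An extension of linear maps on the space of generators to graphs with edges of all types. -/
def gcFun (d : ℤ) (L : (GCGen k n d →₀ K) →ₗ[K] M) : ∀ v e, SGraph k v e → M :=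
  fun _ _ G => if ∀ a, G.ty a ≠ none then revSgn n G • L (gcGen K n d G.toGraph) else 0

lemma finAlt_gcFun (hL : gcRel K k n d ≤ ker L) : FinAlt n (gcFun K k n d L) := by
  intro v e G σ ρ f
  have hiff : (∀ a, (G.relabel σ ρ f).ty a ≠ none) ↔ ∀ a, G.ty a ≠ none := by
    simp only [SGraph.relabel, ne_eq, Option.map_eq_none_iff]
    exact (ρ.symm.surjective.forall (p := fun a => ¬ G.ty a = none)).symm
  rw [gcFun, gcFun]
  by_cases hG : ∀ a, G.ty a ≠ none
  swap
  · rw [if_neg hG, if_neg (hiff.not.2 hG), smul_zero]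
  have h1 : L (gcGen K n d (G.toGraph.relabel σ ρ f) - gcSign n σ ρ f • gcGen K n d G.toGraph) = 0 :=
    hL (subset_span ⟨v, e, G.toGraph, σ, ρ, f, rfl⟩)
  rw [map_sub, map_zsmul, sub_eq_zero] at h1
  rw [if_pos hG, if_pos (hiff.2 hG), smul_smul, relabelSign_mul_revSgn hG, mul_smul, ← h1]
  rfl

lemma gcFun_of_not {G : SGraph k v e} (h : ¬ G.toGraph.IsGC) : gcFun K k n d L v e G = 0 := by
  rw [gcFun, gcGen, dif_neg (fun h' => h h'.1), map_zero, smul_zero, ite_self]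

lemma Lab.isGC_iff {X : NG k} {G : SGraph k v e} {i : Fin (v + 1) → ℕ} {j : Fin e → ℕ} (h : Lab X G
    i j) : G.toGraph.IsGC ↔ X.WF ∧ ¬ X.BadG ∧ ¬ X.Fusable := by
  constructor
  · intro hG
    have hr := h.reduced_iff.2 hG.toReduced
    refine ⟨hr.toWF, ?_, hr.not_fusable⟩
    rintro (⟨a, ha, he⟩ | ⟨c, hc⟩)
    · obtain ⟨a, rfl⟩ := h.exists_j ha
      rw [h.ends_eq, h.ends_eq] at he
      exact hG.no_tadpole a (h.i_inj he)
    · exact hc (hr.acyclic c)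
  · rintro ⟨hw, hb, hf⟩
    refine ⟨h.reduced_iff.1 (hw.reduced hb hf), fun a he => hb (Or.inl ⟨j a, h.j_mem a, ?_⟩)⟩
    rw [h.ends_eq, h.ends_eq, he]

lemma good_gc (hL : gcRel K k n d ≤ ker L) : Good n BadG (ext n (gcFun K k n d L)) :=
  good_ext (badCond_badG n) (finAlt_gcFun hL) fun _ _ _ _ _ _ h hb =>
    gcFun_of_not fun hG => (h.isGC_iff.1 hG).2.1 hb

lemma ext_gcFun_of_dotted (hL : gcRel K k n d ≤ ker L) {X : NG k} (hc : X.Closed) (hd :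
    X.dotted.Nonempty ∨ X.Fusable) : ext n (gcFun K k n d L) X = 0 :=
    by
  induction hN : X.V.card using Nat.strong_induction_on generalizing X with
  | _ N ih =>
    by_cases hf : X.Fusable
    · obtain ⟨f, w, i, j, h, e⟩ := ext_of_fusable (m := n) (φ := gcFun K k n d L) hf
      have hV : (X.ren 1 1 f).V.card = X.V.card := by simp
      rw [e, fuseVal, ih _ (by rw [← hN, ← hV]; exact h.card_lt) (h.closed (hc.ren _ _ _))
        (Or.inl ⟨i, ?_⟩) rfl, smul_zero, smul_zero]
      rw [mem_dotted]
      exact ⟨mem_erase.2 ⟨h.ne, h.i_mem⟩, by simp [NG.fuse, NG.setTy]⟩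
    · rw [ext_of_not hf]
      by_cases hex : ∃ (v e : ℕ) (G : SGraph k v e) (i : Fin (v + 1) → ℕ) (j : Fin e → ℕ),
          Lab X G i j
      · obtain ⟨v, e, G, i, j, h⟩ := hex
        rw [base_eq (finAlt_gcFun hL) h, gcFun, if_neg, smul_zero]
        obtain ⟨u, hu⟩ := hd.resolve_right hf
        rw [mem_dotted] at hu
        obtain ⟨u, rfl⟩ := h.exists_j hu.1
        exact fun h0 => h0 u (by rw [← h.ty_eq]; exact hu.2)
      · exact base_of_not fun v e G i j h => hex ⟨v, e, G, i, j, h⟩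

lemma rev_gc (hL : gcRel K k n d ≤ ker L) : Rev n (ext n (gcFun K k n d L)) := by
  refine ⟨fun X hc hd => ext_gcFun_of_dotted hL hc (Or.inl hd), fun X t hc ht => ?_⟩
  have hfus : ∀ s, (X.setTy t (some s)).Fusable ↔ X.Fusable := fun s =>
    ⟨fun h => (FusableAt.setTy_iff.1 h.exists_at.choose_spec).fusable, fun h =>
      (FusableAt.setTy_iff.2 h.exists_at.choose_spec).fusable⟩
  by_cases hf : X.Fusable
  · rw [ext_gcFun_of_dotted hL (hc.setTy _ _) (Or.inr ((hfus _).2 hf)), ext_gcFun_of_dotted hL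
      (hc.setTy _ _) (Or.inr ((hfus _).2 hf)), smul_zero]
  obtain ⟨v, e, G, i, j, h⟩ := exists_lab hc ⟨_, hc t ht true⟩
  obtain ⟨G, i, j, h, hi, hj⟩ := h.exists_mono
  obtain ⟨t, rfl⟩ := h.exists_j ht
  rw [ext_lab (finAlt_gcFun hL) (h.makeSolid t _) hi hj ((hfus _).not.2 hf), ext_lab (finAlt_gcFun
    hL) (h.makeSolid t _) hi hj ((hfus _).not.2 hf), gcFun, gcFun]
  have e1 : ∀ s, (∀ a, (G.makeSolid t s).ty a ≠ none) ↔ ∀ a, a ≠ t → G.ty a ≠ none := fun s => by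
    refine forall_congr' fun a => ?_
    by_cases hat : a = t <;> simp [SGraph.makeSolid, hat]
  have e2 : ∀ s, revSgn n (G.makeSolid t s) = (if s = false then eps n else 1) *
      ∏ a ∈ univ.erase t, if G.ty a = some false then eps n else 1 := fun s => by
    rw [revSgn, ← mul_prod_erase _ _ (mem_univ t)]
    congr 1
    · simp [SGraph.makeSolid]
    · refine prod_congr rfl fun a ha => ?_
      simp [SGraph.makeSolid, ne_of_mem_erase ha]
  simp only [e1, e2, if_true, reduceCtorEq, if_false, one_mul, smul_ite, smul_zero, smul_smul]
  rfl

/-- Comparison of functions on graphs without dotted edges. -/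
lemma Good.eq_of_toS {χ χ' : NG k → M} (h : Good n BadG χ) (h' : Good n BadG χ') (hr : Rev n χ) (hr'
    : Rev n χ') (d : ℤ) (H : ∀ (v e : ℕ) (G : Graph k v e), G.IsGC → (v : ℤ) * n + (1 - n) * (e : ℤ)
    = d → χ (toNG G.toS) = χ' (toNG G.toS)) {X : NG k} (hw : X.WF) (hd : X.degree n = d) : χ X = χ'
    X := by
  refine h.eq_of_fin h' d (fun v e G hw hd hb hf => ?_) (badCond_badG n) hw hd
  by_cases hs : ∀ a, G.ty a ≠ none
  · rw [hr.eq_toS G hs, hr'.eq_toS G hs, H v e G.toGraph ((lab_toNG G).isGC_iff.2 ⟨hw, hb, hf⟩)]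
    rw [← hd, SGraph.degree]
    have hd : G.dotted = ∅ := by simp [SGraph.dotted, hs]
    have hs : G.solid = univ := by simp [SGraph.solid, hs]
    simp [hd, hs]
  · push Not at hs
    obtain ⟨a, ha⟩ := hs
    have hne : (toNG G).dotted.Nonempty :=
      ⟨a, mem_dotted.2 ⟨(lab_toNG G).j_mem a, by rw [(lab_toNG G).ty_eq, ha]⟩⟩
    rw [hr.nodot _ hw.closed hne, hr'.nodot _ hw.closed hne]

lemma gcFun_toS (G : Graph k v e) : gcFun K k n d L v e G.toS = L (gcGen K n d G) := by
  rw [gcFun, if_pos (by simp [Graph.toS]), revSgn, prod_eq_one (by simp [Graph.toS]),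
    one_smul]
  rfl

lemma gc_bd (hL : gcRel K k n d ≤ ker L) {G : Graph k v e} (hG : G.IsGC) : L (gcBd K n d v e G) =
    del n (ext n (gcFun K k n d L)) (toNG G.toS) := by
  rw [del, sum_E_toNG]
  rcases e with _ | e
  · cases v <;> simp [gcBd]
  rcases v with _ | v
  · exact absurd (Subsingleton.elim (α := Fin 1) _ _) (hG.no_tadpole 0)
  rw [gcBd, map_sum]
  refine sum_congr rfl fun t _ => ?_
  have hl := lab_toNG G.toS
  have hne : G.ends t false ≠ G.ends t true := hG.no_tadpole t
  have hends : ∀ r, (toNG G.toS).ends t r = (G.ends t r : ℕ) := fun r => hl.ends_eq t r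
  rw [map_zsmul, term_some (hl.j_mem t) (s := true) (by rw [hl.ty_eq]; rfl)
    (by rw [hends, hends]; exact fun e => hne (val_injective e)), hends, hends,
    hl.aft_citem val_strictMono val_strictMono]
  have hcard : (G.toS.solid.filter fun a => t < a).card = e - t := by
    have : (univ.filter fun a => t < a) = Finset.Ioi t := by ext; simp
    rw [solid_toS, this, Fin.card_Ioi]
    rfl
  rw [hcard, dotted_toS, Finset.card_empty, add_zero]
  congr 1
  have hc := hl.contract t hne
  have hc' : Lab _ (G.contract t (G.ends t false) (G.ends t true)).toS _ _ := hc
  by_cases hf : ((toNG G.toS).contract t (G.ends t false) (G.ends t true)).Fusable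
  · have hn : ¬ (G.contract t (G.ends t false) (G.ends t true)).IsGC := fun h =>
      (hc'.isGC_iff.1 h).2.2 hf
    rw [gcGen, dif_neg fun h => hn h.1, map_zero]
    exact (ext_gcFun_of_dotted hL hc.closed (Or.inr hf)).symm
  · exact ((ext_lab (finAlt_gcFun hL) hc' (val_strictMono.comp (strictMono_succAbove _))
      (val_strictMono.comp (strictMono_succAbove _)) hf).trans (gcFun_toS _)).symm

variable (K k n) in
/-- The formula for the differential. -/
def gcD (i j : ℤ) : (GCGen k n i →₀ K) →ₗ[K] (GCGen k n j →₀ K) :=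
  linearCombination K fun X => gcBd K n j X.1.1 X.1.2.1 X.1.2.2

/-- An admissible labelled graph as a generator. -/
def gcMk {G : Graph k v e} (h : G.IsGC ∧ (v : ℤ) * n + (1 - n) * (e : ℤ) = d) : GCGen k n d := ⟨⟨v,
    e, G⟩, h⟩

lemma gcGen_of {G : Graph k v e} (h : G.IsGC ∧ (v : ℤ) * n + (1 - n) * (e : ℤ) = d) : gcGen K n d G
    = Finsupp.single (gcMk h) 1 := dif_pos h

lemma single_gc (a : GCGen k n d) : (Finsupp.single a 1 : GCGen k n d →₀ K) = gcGen K n d a.1.2.2 :=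
    (gcGen_of a.2).symm

lemma gc_bd_gen {i j : ℤ} {L : (GCGen k n j →₀ K) →ₗ[K] M} (hL : gcRel K k n j ≤ ker L) (G : Graph k
    v e) : L (gcD K k n i j (gcGen K n i G)) = if G.IsGC ∧ (v : ℤ) * n + (1 - n) * (e : ℤ) = i then
    del n (ext n (gcFun K k n j L)) (toNG G.toS) else 0 := by
  split_ifs with h
  · rw [gcGen_of h, gcD, linearCombination_single, one_smul]
    exact gc_bd hL h.1
  · rw [gcGen, dif_neg h, map_zero, map_zero]

lemma Graph.IsGC.relabel {G : Graph k v e} (h : G.IsGC) (σ : Perm (Fin (v + 1))) (ρ : Perm (Fin e))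
    (f : Fin e → Bool) : (G.relabel σ ρ f).IsGC := by
  refine ⟨SGraph.reduced_relabel (G := G.toS) h.toReduced σ ρ f, fun a he => ?_⟩
  simp only [Graph.relabel, EmbeddingLike.apply_eq_iff_eq] at he
  cases hf : f (ρ.symm a) <;> rw [hf] at he
  · exact h.no_tadpole _ he
  · exact h.no_tadpole _ he.symm

lemma Graph.isGC_relabel_iff {G : Graph k v e} (σ : Perm (Fin (v + 1))) (ρ : Perm (Fin e)) (f : Fin
    e → Bool) : (G.relabel σ ρ f).IsGC ↔ G.IsGC := by
  refine ⟨fun h => ?_, fun h => h.relabel σ ρ f⟩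
  have h1 := h.relabel σ⁻¹ ρ⁻¹ (fun a => f (ρ⁻¹ a))
  have h2 := congrArg SGraph.toGraph (G.toS.relabel_inv σ ρ f)
  rw [← show _ = G from h2]
  exact h1

lemma gc_bd_rel (i j : ℤ) : gcRel K k n i ≤ (gcRel K k n j).comap (gcD K k n i j) := by
  refine span_le.2 ?_
  rintro _ ⟨v, e, G, σ, ρ, f, rfl⟩
  have hL : gcRel K k n j ≤ ker (gcRel K k n j).mkQ := (ker_mkQ _).ge
  have hA := ((rev_gc hL).del (good_gc hL).alt).relabel (good_gc hL).alt.del G σ ρ f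
  rw [SetLike.mem_coe, mem_comap, ← ker_mkQ (gcRel K k n j), mem_ker, map_sub, map_zsmul, map_sub,
    map_zsmul, gc_bd_gen hL, gc_bd_gen hL, Graph.isGC_relabel_iff, hA]
  split_ifs <;> simp

lemma gc_ext_eq {j l : ℤ} {L : (GCGen k n l →₀ K) →ₗ[K] M} (hL : gcRel K k n l ≤ ker L) {X : NG k}
    (hw : X.WF) (hd : X.degree n = j) : ext n (gcFun K k n j (L ∘ₗ gcD K k n j l)) X = del n (ext n
    (gcFun K k n l L)) X := by
  have hL' : gcRel K k n j ≤ ker (L ∘ₗ gcD K k n j l) := fun x hx =>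
    hL (gc_bd_rel j l hx)
  refine (good_gc hL').eq_of_toS ((good_gc hL).del (badCond_badG n)) (rev_gc hL')
    ((rev_gc hL).del (good_gc hL).alt) j (fun v e G hG hd => ?_) hw hd
  rw [ext_lab (finAlt_gcFun hL') (lab_toNG G.toS) val_strictMono val_strictMono ((lab_toNG
    G.toS).isGC_iff.1 hG).2.2, gcFun_toS, LinearMap.comp_apply, gc_bd_gen hL, if_pos ⟨hG, hd⟩]

lemma gc_bd_bd {i j l : ℤ} (hij : j + 1 = i) (x : GCGen k n i →₀ K) : gcD K k n j l (gcD K k n i j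
    x) ∈ gcRel K k n l := by
  have hL : gcRel K k n l ≤ ker (gcRel K k n l).mkQ := (ker_mkQ _).ge
  have hL' : gcRel K k n j ≤ ker ((gcRel K k n l).mkQ ∘ₗ gcD K k n j l) :=
    fun x hx => hL (gc_bd_rel j l hx)
  have key : ((gcRel K k n l).mkQ ∘ₗ gcD K k n j l) ∘ₗ gcD K k n i j = 0 := by
    refine finsupp_lhom_ext fun a => ?_
    rw [single_gc]
    obtain ⟨⟨v, e, G⟩, hG⟩ := a
    simp only at hG ⊢
    have hw : (toNG G.toS).WF := ((lab_toNG G.toS).isGC_iff.1 hG.1).1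
    rw [LinearMap.zero_apply, LinearMap.comp_apply, gc_bd_gen hL', if_pos hG,
      del_congr (d := j) (fun X hw hd => gc_ext_eq hL hw hd) hw
      (by rw [(lab_toNG G.toS).degree_eq, degree_toS]; exact hG.2.trans hij.symm),
      del_del (good_gc hL).alt hw.closed]
  have := LinearMap.congr_fun key x
  rw [LinearMap.comp_apply, LinearMap.comp_apply, LinearMap.zero_apply] at this
  rwa [← mem_ker, ker_mkQ] at this

variable (K k n) in
lemma isComplex_GC : (GC K k n).IsComplex where
  bd_rel i j _ := gc_bd_rel i j
  bd_bd _ _ _ hij _ x := gc_bd_bd hij x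

end

section

/-! ### Spanning trees -/

/-- A rank function for an acyclic relation on a finite set. -/
lemma Acyclic.exists_rank {arc : ℕ → ℕ → Prop} (h : Acyclic arc) (V : Finset ℕ) (hV : ∀ x y, arc x y
    → x ∈ V) : ∃ l : ℕ → ℕ, ∀ x y, arc x y → l x < l y := by
  refine ⟨fun y => (V.filter fun w => TransGen arc w y).card, fun x y hxy =>
    Finset.card_lt_card ⟨fun w hw => ?_, fun hs => ?_⟩⟩
  · grind
  · have := hs (mem_filter.2 ⟨hV x y hxy, .single hxy⟩)
    exact h x (mem_filter.1 this).2

namespace NG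

variable {k : ℕ} {X : NG k} {T : Finset ℕ} {x : ℕ} {o : ℕ → Bool}
variable {l : ℕ → ℕ} {U : Finset ℕ} {a : ℕ} {s : Bool} {t : ℕ}

structure Tree (X : NG k) (T : Finset ℕ) : Prop where
  subset : T ⊆ X.E
  linked : ∀ x ∈ X.V, ∀ y ∈ X.V, X.Linked T x y
  card : T.card + 1 = X.V.card

/-- Whether the intrinsic orientation of `a` points away from the root `x`. -/
def away (X : NG k) (T : Finset ℕ) (x a : ℕ) : Bool :=
  decide (X.Linked (T.erase a) x (X.ends a false))

/-- The orientations `o` of the edges in `T` form a tree directed away from the root `x`. -/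
structure Arb (X : NG k) (x : ℕ) (T : Finset ℕ) (o : ℕ → Bool) : Prop where
  subset : T ⊆ X.E
  root_mem : x ∈ X.V
  inj : ∀ a ∈ T, ∀ b ∈ T, X.ends a (o a) = X.ends b (o b) → a = b
  ne : ∀ a ∈ T, X.ends a (o a) ≠ x
  surj : ∀ u ∈ X.V, u ≠ x → ∃ a ∈ T, X.ends a (o a) = u
  rank : ∃ l : ℕ → ℕ, ∀ a ∈ T, l (X.ends a !(o a)) < l (X.ends a (o a))

/-- The vertices at distance at most `n` from `x`. -/
def near (X : NG k) (T : Finset ℕ) (x : ℕ) : ℕ → ℕ → Prop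
  | 0, u => u = x
  | n + 1, u => X.near T x n u ∨ ∃ a ∈ T, ∃ s, X.ends a s = u ∧ X.near T x n (X.ends a !s)

lemma exists_near {y z : ℕ} (h : X.Linked T y z) : (∃ n, X.near T x n y) ↔ ∃ n, X.near T x n z :=
    by
  induction h with
  | rel y z h =>
    obtain ⟨a, ha, rfl, rfl⟩ := h
    exact ⟨fun ⟨n, hn⟩ => ⟨n + 1, Or.inr ⟨a, ha, true, rfl, hn⟩⟩, fun ⟨n, hn⟩ => ⟨n + 1, Or.inr ⟨a,
      ha, false, rfl, hn⟩⟩⟩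
  | refl => rfl
  | symm _ _ _ ih => exact ih.symm
  | trans _ _ _ _ _ ih1 ih2 => exact ih1.trans ih2

/-- Every vertex other than the root is joined to a vertex that is closer to the root. -/
lemma exists_parent (h : ∀ u ∈ X.V, X.Linked T x u) : ∃ l : ℕ → ℕ, ∀ u ∈ X.V, u ≠ x → ∃ a ∈ T, ∃ s,
    X.ends a s = u ∧ l (X.ends a !s) < l u := by
  have hn : ∀ u ∈ X.V, ∃ n, X.near T x n u := fun u hu =>
    (exists_near (h u hu)).1 ⟨0, rfl⟩
  refine ⟨fun u => if h : ∃ n, X.near T x n u then Nat.find h else 0, fun u hu hux => ?_⟩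
  have h0 := Nat.find_spec (hn u hu)
  simp only [dif_pos (hn u hu)]
  rcases hN : Nat.find (hn u hu) with _ | N
  · rw [hN] at h0; exact absurd h0 hux
  · rw [hN] at h0
    rcases h0 with h0 | ⟨a, ha, s, hs, h0⟩
    · exact absurd h0 (Nat.find_min (hn u hu) (by omega))
    · refine ⟨a, ha, s, hs, ?_⟩
      have h1 : ∃ n, X.near T x n (X.ends a !s) := ⟨N, h0⟩
      rw [dif_pos h1]
      exact Nat.lt_succ_of_le (Nat.find_min' h1 h0)

lemma parent_inj {a u u' : ℕ} {s s' : Bool} (h : X.ends a s = u) (hl : l (X.ends a !s) < l u) (h' :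
    X.ends a s' = u') (hl' : l (X.ends a !s') < l u') : u = u' := by
  by_cases hs : s = s'
  · grind
  · rw [eq_not_of_ne hs] at h hl
    rw [Bool.not_not] at hl
    rw [h] at hl'; rw [h'] at hl
    exact absurd hl' (lt_asymm hl)

lemma card_le_of_linked (h : ∀ u ∈ X.V, X.Linked T x u) : X.V.card ≤ T.card + 1 := by
  obtain ⟨l, hl⟩ := exists_parent h
  choose! p hp s hs hlt using hl
  have : ((X.V.erase x).image p).card = (X.V.erase x).card := by
    refine Finset.card_image_of_injOn fun u hu u' hu' e => ?_
    have hu := mem_erase.1 (mem_coe.1 hu)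
    have hu' := mem_erase.1 (mem_coe.1 hu')
    exact parent_inj (l := l) (hs u hu.2 hu.1) (hlt u hu.2 hu.1) (e ▸ hs u' hu'.2 hu'.1)
      (e ▸ hlt u' hu'.2 hu'.1)
  have h2 : (X.V.erase x).image p ⊆ T := by
    grind
  have h3 := Finset.card_le_card h2
  have h4 := Finset.pred_card_le_card_erase (s := X.V) (a := x)
  omega

lemma exists_arb_of_linked {D : Finset ℕ} (hT : D ⊆ X.E) (h : ∀ u ∈ X.V, X.Linked D x u) (hx : x ∈
    X.V) : ∃ T ⊆ D, T.card + 1 = X.V.card ∧ ∃ o, X.Arb x T o := by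
  obtain ⟨l, hl⟩ := exists_parent h
  choose! p hp s hs hlt using hl
  have hinj : Set.InjOn p (X.V.erase x) := by
    intro u hu u' hu' e
    have hu := mem_erase.1 (mem_coe.1 hu)
    have hu' := mem_erase.1 (mem_coe.1 hu')
    exact parent_inj (l := l) (hs u hu.2 hu.1) (hlt u hu.2 hu.1) (e ▸ hs u' hu'.2 hu'.1)
      (e ▸ hlt u' hu'.2 hu'.1)
  set T := (X.V.erase x).image p with hτ
  have hpτ : ∀ u ∈ X.V, u ≠ x → p u ∈ T := by grind
  have ho : ∀ u ∈ X.V, u ≠ x →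
      decide (l (X.ends (p u) false) < l (X.ends (p u) true)) = s u := fun u hu hux => by
    have h2 : l (X.ends (p u) !(s u)) < l (X.ends (p u) (s u)) := by
      grind
    cases hsu : s u <;> rw [hsu] at h2
    · grind
    · grind
  have hmem : ∀ a ∈ T, ∃ u ∈ X.V, u ≠ x ∧ p u = a := by grind
  have hsub : T ⊆ D := by grind
  refine ⟨T, hsub, by rw [hτ, Finset.card_image_of_injOn hinj, card_erase_add_one hx],
    fun a => decide (l (X.ends a false) < l (X.ends a true)), hsub.trans hT, hx,
    fun a ha b hb e => ?_, fun a ha => ?_, fun u hu hux => ⟨p u, hpτ u hu hux, ?_⟩, l,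
    fun a ha => ?_⟩
  · obtain ⟨u, hu, hux, rfl⟩ := hmem a ha
    obtain ⟨w, hw, hwx, rfl⟩ := hmem b hb
    rw [ho u hu hux, ho w hw hwx, hs u hu hux, hs w hw hwx] at e
    rw [e]
  · grind
  · grind
  · obtain ⟨u, hu, hux, rfl⟩ := hmem a ha
    rw [ho u hu hux, hs u hu hux]
    exact hlt u hu hux

lemma Tree.exists_arb (h : X.Tree T) (hx : x ∈ X.V) : ∃ o, X.Arb x T o := by
  obtain ⟨T', hsub, hcard, o, ho⟩ := exists_arb_of_linked h.subset (h.linked x hx) hx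
  rw [Finset.eq_of_subset_of_card_le hsub (by have := h.card; omega)] at ho
  exact ⟨o, ho⟩

namespace Arb

lemma linked (h : X.Arb x T o) (hc : X.Closed) {u : ℕ} (hu : u ∈ X.V) : X.Linked T x u := by
  obtain ⟨l, hl⟩ := h.rank
  induction hN : l u using Nat.strong_induction_on generalizing u with
  | _ N ih =>
    by_cases hux : u = x
    · subst hux; exact Linked.refl _
    · obtain ⟨a, ha, rfl⟩ := h.surj u hu hux
      exact (ih _ (hN ▸ hl a ha) (hc a (h.subset ha) _) rfl).trans (Linked.of_mem ha _)

lemma tree (h : X.Arb x T o) (hc : X.Closed) : X.Tree T := by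
  refine ⟨h.subset, fun y hy z hz => (h.linked hc hy).symm.trans (h.linked hc hz), ?_⟩
  have h1 : T.image (fun a => X.ends a (o a)) = X.V.erase x := by
    ext u
    simp only [mem_image, mem_erase]
    constructor
    · rintro ⟨a, ha, rfl⟩; exact ⟨h.ne a ha, hc a (h.subset ha) _⟩
    · rintro ⟨hux, hu⟩; exact h.surj u hu hux
  rw [← Finset.card_image_of_injOn (f := fun a => X.ends a (o a)) (s := T) (fun a ha b hb e => h.inj
    a ha b hb e), h1, card_erase_add_one h.root_mem]

lemma linked_tail (h : X.Arb x T o) (hc : X.Closed) (ha : a ∈ T) : X.Linked (T.erase a) x (X.ends a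
    !(o a)) := by
  obtain ⟨l, hl⟩ := h.rank
  have key : ∀ N, ∀ u ∈ X.V, l u = N → l u ≤ l (X.ends a !(o a)) → X.Linked (T.erase a) x u := by
    intro N
    induction N using Nat.strong_induction_on with
    | _ N ih =>
      intro u hu hN hle
      by_cases hux : u = x
      · subst hux; exact Linked.refl _
      · obtain ⟨c, hc', rfl⟩ := h.surj u hu hux
        have hca : c ≠ a := by grind
        exact (ih _ (hN ▸ hl c hc') _ (hc c (h.subset hc') _) rfl ((hl c hc').le.trans hle)).trans
          (Linked.of_mem (mem_erase.2 ⟨hca, hc'⟩) _)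
  exact key _ _ (hc a (h.subset ha) _) rfl le_rfl

lemma not_linked_head (h : X.Arb x T o) (hc : X.Closed) (ha : a ∈ T) : ¬ X.Linked (T.erase a) x
    (X.ends a (o a)) := by
  intro hl
  have h1 : ∀ u ∈ X.V, X.Linked (T.erase a) x u := fun u hu => by
    refine Linked.map (p := id) (fun c hc' => ?_) (h.linked hc hu)
    by_cases hca : c = a
    · subst hca
      have := (h.linked_tail hc ha).symm.trans hl
      cases ho : o c <;> rw [ho] at this
      · exact this.symm
      · exact this
    · exact Linked.of_mem (mem_erase.2 ⟨hca, hc'⟩) true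
  have h2 := card_le_of_linked h1
  have h3 := (h.tree hc).card
  rw [card_erase_add_one ha] at h2
  omega

lemma away (h : X.Arb x T o) (hc : X.Closed) (ha : a ∈ T) : X.away T x a = o a := by
  have h1 := h.linked_tail hc ha
  have h2 := h.not_linked_head hc ha
  rw [NG.away]
  cases ho : o a <;> rw [ho] at h1 h2
  · grind
  · grind

lemma congr (h : X.Arb x T o) {o' : ℕ → Bool} (ho : ∀ a ∈ T, o' a = o a) : X.Arb x T o' where
  subset := h.subset
  root_mem := h.root_mem
  inj a ha b hb := by rw [ho a ha, ho b hb]; exact h.inj a ha b hb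
  ne a ha := by rw [ho a ha]; exact h.ne a ha
  surj u hu hux := by
    obtain ⟨a, ha, h'⟩ := h.surj u hu hux
    exact ⟨a, ha, by rw [ho a ha, h']⟩
  rank := by
    obtain ⟨l, hl⟩ := h.rank
    exact ⟨l, fun a ha => by rw [ho a ha]; exact hl a ha⟩

end Arb

lemma Tree.arb (h : X.Tree T) (hc : X.Closed) (hx : x ∈ X.V) : X.Arb x T (X.away T x) := by
  obtain ⟨o, ho⟩ := h.exists_arb hx
  exact ho.congr fun a ha => ho.away hc ha

/-- The graph in which the edges in `U` are solid with the orientations `o`, and all others are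
dotted. -/
def cfg (X : NG k) (U : Finset ℕ) (o : ℕ → Bool) : NG k :=
  { X with ty := fun a => if a ∈ U then some (o a) else none }

lemma cfg_congr (X : NG k) {o o' : ℕ → Bool} (h : ∀ a ∈ U, o a = o' a) : X.cfg U o = X.cfg U o' :=
    by
  simp only [cfg, NG.mk.injEq, true_and]
  funext a
  split_ifs with ha
  · rw [h a ha]
  · rfl

lemma cfg_setTy (X : NG k) (U : Finset ℕ) (o : ℕ → Bool) (t : ℕ) (s : Bool) : (X.cfg U o).setTy t
    (some s) = X.cfg (insert t U) (update o t s) := by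
  simp only [cfg, NG.setTy, NG.mk.injEq, true_and]
  funext a
  by_cases hat : a = t
  · subst hat; simp
  · simp [hat]

/-- Replacing an edge of a tree by another one with the same head. -/
lemma Arb.exchange {t t' : ℕ} (h : X.Arb x T o) (ht : t ∈ X.E) (htτ : t ∉ T) (ht' : t' ∈ T) (hs :
    X.ends t s = X.ends t' (o t')) (hl : ∀ a ∈ insert t T, l (X.ends a !(update o t s a)) < l
    (X.ends a (update o t s a))) : X.Arb x (insert t (T.erase t')) (update o t s) := by
  have hne : ∀ a ∈ T, a ≠ t := by grind
  have hmem : ∀ a ∈ insert t (T.erase t'), a = t ∨ (a ≠ t ∧ a ∈ T ∧ a ≠ t') := by grind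
  refine ⟨fun a ha => ?_, h.root_mem, fun a ha b hb e => ?_, fun a ha => ?_, fun u hu hux => ?_, l,
    fun a ha => hl a ?_⟩
  · rcases hmem a ha with rfl | ⟨-, ha, -⟩
    exacts [ht, h.subset ha]
  · rcases hmem a ha with rfl | ⟨ha0, ha1, ha'⟩ <;> rcases hmem b hb with rfl | ⟨hb0, hb1, hb'⟩
    · rfl
    · rw [update_self, update_of_ne hb0, hs] at e
      exact absurd (h.inj _ ht' _ hb1 e).symm hb'
    · rw [update_self, update_of_ne ha0, hs] at e
      exact absurd (h.inj _ ha1 _ ht' e) ha'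
    · rw [update_of_ne ha0, update_of_ne hb0] at e
      exact h.inj _ ha1 _ hb1 e
  · rcases hmem a ha with rfl | ⟨ha0, ha, ha'⟩
    · rw [update_self, hs]; exact h.ne t' ht'
    · rw [update_of_ne ha0]; exact h.ne a ha
  · obtain ⟨a, ha, hau⟩ := h.surj u hu hux
    by_cases hat : a = t'
    · subst hat
      exact ⟨t, mem_insert_self _ _, by rw [update_self, hs, hau]⟩
    · grind
  · grind

/-- There is a directed cycle if every vertex is the head of an edge. -/
lemma Arb.ne_root (h : X.Arb x T o) (hc : X.Closed) (ht : t ∈ X.E) (hτ : t ∉ T) (hl : ∀ a ∈ insert t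
    T, l (X.ends a !(update o t s a)) < l (X.ends a (update o t s a))) : X.ends t s ≠ x := by
  intro hx
  obtain ⟨u, hu, hmin⟩ := Finset.exists_min_image X.V l ⟨x, h.root_mem⟩
  by_cases hux : u = x
  · subst hux
    have := hl t (mem_insert_self _ _)
    rw [update_self, hx] at this
    exact absurd this (not_lt_of_ge (hmin _ (hc t ht _)))
  · obtain ⟨a, ha, hau⟩ := h.surj u hu hux
    have := hl a (mem_insert_of_mem ha)
    rw [update_of_ne (fun e : a = t => hτ (e ▸ ha)), hau] at this
    exact absurd this (not_lt_of_ge (hmin _ (hc a (h.subset ha) _)))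

lemma exists_rank_cfg (hc : X.Closed) (hU : U ⊆ X.E) (h : Acyclic (X.cfg U o).sarc) : ∃ l : ℕ → ℕ, ∀
    a ∈ U, l (X.ends a !(o a)) < l (X.ends a (o a)) := by
  obtain ⟨l, hl⟩ := h.exists_rank X.V fun p q ⟨a, ha, s, _, hp, _⟩ => hp ▸ hc a ha _
  exact ⟨l, fun a ha => hl _ _ ⟨a, hU ha, o a, by simp [cfg, ha], rfl, rfl⟩⟩

/-! #### Trees and contraction -/

lemma tree_contract (hc : X.Closed) (ht : t ∈ X.E) (s : Bool) (htad : X.ends t false ≠ X.ends t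
    true) (htτ : t ∈ T) : ctr(X, t, s).Tree (T.erase t) ↔ X.Tree T :=
    by
  have hV : ctr(X, t, s).V.card + 1 = X.V.card :=
    card_erase_add_one (hc t ht s)
  have hτ := card_erase_add_one htτ
  have hr : ∀ y ∈ X.V, ret(X, t, s) y ∈
      ctr(X, t, s).V := fun y hy => by
    unfold retract
    split_ifs with h
    · exact mem_erase.2 ⟨ends_ne_not htad s, hc t ht _⟩
    · exact mem_erase.2 ⟨h, hy⟩
  constructor
  · intro h
    refine ⟨fun a ha => ?_, fun y hy z hz => ?_, by have := h.card; omega⟩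
    · by_cases hat : a = t
      · grind
      · exact mem_of_mem_erase (h.subset (mem_erase.2 ⟨hat, ha⟩))
    · exact (linked_retract htτ s y).symm.trans
        ((Linked.of_contract htτ s (h.linked _ (hr y hy) _ (hr z hz))).trans (linked_retract htτ s
          z))
  · intro h
    refine ⟨Finset.erase_subset_erase _ h.subset, fun y hy z hz => ?_, by have := h.card; omega⟩
    have hy := mem_erase.1 hy
    have hz := mem_erase.1 hz
    have := (h.linked y hy.2 z hz.2).contract t s
    rwa [retract_of_ne hy.1, retract_of_ne hz.1] at this

lemma away_contract {t a : ℕ} (htτ : t ∈ T) (s : Bool) (hat : a ≠ t) : ctr(X, t, s).away (T.erase t) (ret(X, t, s) x) a = X.away T x a := by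
  have ht : t ∈ T.erase a := by grind
  rw [away, away, erase_right_comm, decide_eq_decide, contract_ends_eq]
  constructor
  · intro h
    exact (linked_retract ht s x).symm.trans ((Linked.of_contract ht s h).trans (linked_retract ht s
      _))
  · exact fun h => h.contract t s

end NG

end

section

open NG

variable {k : ℕ} {n : ℤ} {M : Type*} [AddCommGroup M]
variable {σ ρ : Perm ℕ} {f : ℕ → Bool} {X' : NG k} {t : ℕ} {a : ℕ}

lemma kap_comm {ι α β : Type*} [DecidableEq ι] [LinearOrder α] [LinearOrder β] {S : Finset ι} {F : ι
    → α} {G : ι → β} (hF : Set.InjOn F S) (hG : Set.InjOn G S) : kap S F G = kap S G F := by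
  have h := kap_comp hF hG hF
  rw [kap_self] at h
  linear_combination kap S G F * h - kap S F G * kap_mul_self S G F

lemma eps_add_one (n : ℤ) : eps (n + 1) = - eps n := by
  unfold eps
  simp only [Int.even_add_one]
  split_ifs <;> simp_all

/-! ### The sign of a rooted spanning tree -/

/-- The positions `0` for the root and `a + 1` for the edge `a`. -/
def slots (n : ℤ) (E T : Finset ℕ) : Finset ℕ :=
  insert 0 ((if Even n then E else T).map ⟨Nat.succ, Nat.succ_injective⟩)

lemma zero_mem_slots {E T : Finset ℕ} : 0 ∈ slots n E T := mem_insert_self _ _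

lemma succ_mem_slots {E T : Finset ℕ} : a + 1 ∈ slots n E T ↔ a ∈ (if Even n then E else T) := by
  simp [slots]

lemma slots_erase {E T : Finset ℕ} : (slots n E T).erase (a + 1) = slots n (E.erase a) (T.erase a)
    := by
  ext (_ | b)
  · simp [zero_mem_slots]
  · rw [mem_erase, succ_mem_slots, succ_mem_slots]
    split_ifs <;> simp

lemma aft_slots {E T : Finset ℕ} (a : ℕ) : aft id (slots n E T) (a + 1) = aft id (if Even n then E
    else T) a := by
  rw [slots, aft_insert _ (by simp)]
  simp [aft_eq_prod]

/-- The vertex or edge at each position. -/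
def NG.pos (X : NG k) (x : ℕ) (T : Finset ℕ) (o : ℕ → Bool) : ℕ → ℕ ⊕ ℕ
  | 0 => inl x
  | a + 1 => if a ∈ T then inl (X.ends a (o a)) else inr a

/-- The sign of `h` for the root `x` and the tree `T` with the orientations `o`. -/
def hs (n : ℤ) (X : NG k) (x : ℕ) (T : Finset ℕ) (o : ℕ → Bool) : ℤ :=
  kap (slots n X.E T) (lx ∘ X.pos x T o) id * ∏ a ∈ T, if o a then 1 else eps n

/-- The contribution to `h` of the root `x` and the tree `T`. -/
def hterm (n : ℤ) (ψ : NG k → M) (X : NG k) (x : ℕ) (T : Finset ℕ) : M :=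
  hs n X x T (X.away T x) • ψ (X.cfg T (X.away T x))

lemma hs_congr (n : ℤ) (X : NG k) (x : ℕ) {T : Finset ℕ} {o o' : ℕ → Bool} (h : ∀ a ∈ T, o a = o' a)
    : hs n X x T o = hs n X x T o' := by
  rw [hs, hs, prod_congr rfl fun a ha => by rw [h a ha]]
  congr 2
  funext p
  rcases p with _ | a
  · rfl
  · simp only [Function.comp_apply, pos]
    split_ifs with ha
    · rw [h a ha]
    · rfl

section

variable {X : NG k} {x : ℕ} {T : Finset ℕ} {o : ℕ → Bool}

lemma hterm_eq (h : X.Arb x T o) (hc : X.Closed) (ψ : NG k → M) : hterm n ψ X x T = hs n X x T o • ψ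
    (X.cfg T o) := by
  rw [hterm, hs_congr n X x fun a ha => h.away hc ha, cfg_congr X fun a ha => h.away hc ha]

lemma pos_injective (h : X.Arb x T o) : Function.Injective (X.pos x T o) := by
  rintro (_ | a) (_ | b) e
  · rfl
  · simp only [pos] at e
    split_ifs at e with hb
    exact absurd (inl.inj e).symm (h.ne b hb)
  · simp only [pos] at e
    split_ifs at e with ha
    exact absurd (inl.inj e) (h.ne a ha)
  · simp only [pos] at e
    split_ifs at e with ha hb hb
    · rw [h.inj a ha b hb (inl.inj e)]
    · rw [inr.inj e]

lemma lx_pos_injOn (h : X.Arb x T o) (S : Finset ℕ) : Set.InjOn (lx ∘ X.pos x T o) S :=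
  (lx_injective.comp (pos_injective h)).injOn

lemma dotted_cfg : (X.cfg T o).dotted = X.E \ T := by
  ext a; simp [mem_dotted, cfg]

lemma solid_cfg (h : T ⊆ X.E) : (X.cfg T o).solid = T := by
  ext a; simp only [mem_solid, cfg]
  exact ⟨fun ⟨_, h⟩ => by by_contra h0; simp [h0] at h, fun ha => ⟨h ha, by simp [ha]⟩⟩

lemma items_cfg_even (hn : Even n) (h : X.Arb x T o) (hc : X.Closed) : (X.cfg T o).items (n + 1) =
    (slots n X.E T).map ⟨_, pos_injective h⟩ := by
  have hm : ¬ Even (n + 1) := by rw [Int.even_add_one]; exact not_not.2 hn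
  rw [items, if_neg hm, dotted_cfg]
  ext (u | a)
  · simp only [Finset.inl_mem_disjSum, mem_map, coeFn_mk]
    constructor
    · intro hu
      by_cases hux : u = x
      · exact ⟨0, zero_mem_slots, by simp [pos, hux]⟩
      · obtain ⟨a, ha, rfl⟩ := h.surj u hu hux
        exact ⟨a + 1, succ_mem_slots.2 (by simp [hn, h.subset ha]), by simp [pos, ha]⟩
    · rintro ⟨_ | a, ha, e⟩
      · exact inl.inj e ▸ h.root_mem
      · simp only [pos] at e
        split_ifs at e with haτ
        exact inl.inj e ▸ hc a (h.subset haτ) _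
  · simp only [Finset.inr_mem_disjSum, mem_map, coeFn_mk, mem_sdiff]
    constructor
    · rintro ⟨ha, haτ⟩
      exact ⟨a + 1, succ_mem_slots.2 (by simp [hn, ha]), by simp [pos, haτ]⟩
    · rintro ⟨_ | b, hb, e⟩
      · simp [pos] at e
      · rw [succ_mem_slots, if_pos hn] at hb
        simp only [pos] at e
        split_ifs at e with hbτ
        exact inr.inj e ▸ ⟨hb, hbτ⟩

lemma slots_map_odd (hn : ¬ Even n) (h : X.Arb x T o) (hc : X.Closed) : (slots n X.E T).map ⟨_,
    pos_injective h⟩ = X.V.disjSum ∅ := by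
  ext (u | a)
  · simp only [Finset.inl_mem_disjSum, mem_map, coeFn_mk]
    constructor
    · rintro ⟨_ | a, ha, e⟩
      · exact inl.inj e ▸ h.root_mem
      · rw [succ_mem_slots, if_neg hn] at ha
        simp only [pos, if_pos ha] at e
        exact inl.inj e ▸ hc a (h.subset ha) _
    · intro hu
      by_cases hux : u = x
      · exact ⟨0, zero_mem_slots, by simp [pos, hux]⟩
      · obtain ⟨a, ha, rfl⟩ := h.surj u hu hux
        exact ⟨a + 1, succ_mem_slots.2 (by simp [hn, ha]), by simp [pos, ha]⟩
  · simp only [Finset.inr_mem_disjSum, mem_map, coeFn_mk, notMem_empty, iff_false]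
    rintro ⟨_ | b, hb, e⟩
    · simp [pos] at e
    · rw [succ_mem_slots, if_neg hn] at hb
      simp [pos, hb] at e

lemma items_cfg_odd (hn : ¬ Even n) (h : T ⊆ X.E) : (X.cfg T o).items (n + 1) = (∅ : Finset
    ℕ).disjSum T := by
  rw [items, if_pos (Int.even_add_one.2 hn), solid_cfg h]

lemma items_of_solid (h : X.dotted = ∅) : X.items n = if Even n then (∅ : Finset ℕ).disjSum X.E else
    X.V.disjSum ∅ := by
  have : X.solid = X.E := by
    ext a
    rw [mem_solid]
    exact ⟨fun h => h.1, fun ha => ⟨ha, fun e => by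
      have : a ∈ X.dotted := mem_dotted.2 ⟨ha, e⟩
      rw [h] at this; exact absurd this (notMem_empty a)⟩⟩
  rw [items, this, h]

/-- The signs of moving `t` or its head behind the other odd elements. -/
lemma aft_citem_mul (h : X.Arb x T o) (hc : X.Closed) (hd : X.dotted = ∅) (ht : t ∈ T) : aft lx
    ((X.cfg T o).items (n + 1)) (citem (n + 1) t (X.ends t (o t))) * aft lx (X.items n) (citem n t
    (X.ends t (o t))) = aft (lx ∘ X.pos x T o) (slots n X.E T) (t + 1) * aft id (slots n X.E T) (t +
    1) := by
  have hp : X.pos x T o (t + 1) = inl (X.ends t (o t)) := by simp [pos, ht]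
  have hm := aft_map ⟨_, pos_injective h⟩ (slots n X.E T) lx (t + 1)
  simp only [coeFn_mk, hp] at hm
  rw [items_of_solid hd, citem, citem, aft_slots]
  by_cases hn : Even n
  · rw [if_neg (by rw [Int.even_add_one]; exact not_not.2 hn), if_pos hn, if_pos hn, if_pos hn,
      items_cfg_even hn h hc, hm, aft_lx_inr]
  · rw [if_pos (Int.even_add_one.2 hn), if_neg hn, if_neg hn, if_neg hn, items_cfg_odd hn h.subset,
      aft_lx_inr, ← slots_map_odd hn h hc, hm, mul_comm]

lemma hs_contract (h : X.Arb x T o) (hc : X.Closed) (hd : X.dotted = ∅) (ht : t ∈ T) : hs n X x T o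
    * aft lx ((X.cfg T o).items (n + 1)) (citem (n + 1) t (X.ends t (o t))) = (if o t then 1 else
    eps n) * aft lx (X.items n) (citem n t (X.ends t (o t))) * hs n (X.contract t (X.ends t !(o t))
    (X.ends t (o t))) x (T.erase t) o := by
  have hmem : t + 1 ∈ slots n X.E T := succ_mem_slots.2 (by split_ifs; exacts [h.subset ht, ht])
  have h1 := aft_citem_mul (n := n) h hc hd ht
  have h2 := kap_erase hmem (lx_pos_injOn h _) (injective_id.injOn)
  have h3 : kap (slots n (X.contract t (X.ends t !(o t)) (X.ends t (o t))).E (T.erase t))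
      (lx ∘ (X.contract t (X.ends t !(o t)) (X.ends t (o t))).pos x (T.erase t) o) id =
      kap ((slots n X.E T).erase (t + 1)) (lx ∘ X.pos x T o) id := by
    rw [slots_erase]
    refine kap_congr (fun p hp => ?_) fun _ _ => rfl
    rcases p with _ | a
    · rfl
    · have hat : a ≠ t := by
        rintro rfl
        rw [succ_mem_slots] at hp
        split_ifs at hp <;> simp [NG.contract] at hp
      simp only [Function.comp_apply, pos, mem_erase, hat, ne_eq, not_false_eq_true, true_and]
      split_ifs with ha
      · rw [contract_ends_eq, retract_of_ne fun e => hat (h.inj a ha t ht e)]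
      · rfl
  rw [hs, hs, h3, h2, ← mul_prod_erase _ _ ht, ← h1]
  linear_combination (kap ((slots n X.E T).erase (t + 1)) (lx ∘ X.pos x T o) id * (if o t then 1
    else eps n) * (∏ a ∈ T.erase t, if o a then 1 else eps n) * aft lx (X.items n) (citem n t
    (X.ends t (o t)))) *
    aft_mul_self lx ((X.cfg T o).items (n + 1)) (citem (n + 1) t (X.ends t (o t)))

lemma kap_mul_aft (h : X.Arb x T o) (hc : X.Closed) (ht : t ∈ X.E) (htτ : t ∉ T) : kap (slots n X.E
    T) (lx ∘ X.pos x T o) id * aft lx ((X.cfg T o).items (n + 1)) (inr t) = kap (slots n (X.E.erase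
    t) T) (lx ∘ X.pos x T o) id * aft id (slots n (X.E.erase t) T) (t + 1) := by
  by_cases hn : Even n
  · have hp : X.pos x T o (t + 1) = inr t := by simp [pos, htτ]
    have hm := aft_map ⟨_, pos_injective h⟩ (slots n X.E T) lx (t + 1)
    simp only [coeFn_mk, hp] at hm
    have hmem : t + 1 ∈ slots n X.E T := succ_mem_slots.2 (by rwa [if_pos hn])
    have he : (slots n X.E T).erase (t + 1) = slots n (X.E.erase t) T := by
      rw [slots_erase, Finset.erase_eq_of_notMem htτ]
    rw [items_cfg_even hn h hc, hm, kap_erase hmem (lx_pos_injOn h _) injective_id.injOn, ←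
      aft_insert_self id (slots n (X.E.erase t) T), ← he, insert_erase hmem]
    linear_combination (kap ((slots n X.E T).erase (t + 1)) (lx ∘ X.pos x T o) id * aft id (slots n
      X.E T) (t + 1)) * aft_mul_self (lx ∘ X.pos x T o) (slots n X.E T) (t + 1)
  · have he : slots n (X.E.erase t) T = slots n X.E T := by simp [slots, hn]
    rw [items_cfg_odd hn h.subset, aft_lx_inr, he, aft_slots, if_neg hn]

/-- Exchanging two edges with the same head changes the sign. -/
lemma kap_exchange {o' : ℕ → Bool} {t t' : ℕ} (h : X.Arb x T o) (hc : X.Closed) (ht : t ∈ X.E) (htτ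
    : t ∉ T) (ht' : t' ∈ T) (h' : X.Arb x (insert t (T.erase t')) o') (ho : ∀ a ∈ T, a ≠ t' → o' a =
    o a) (hh : X.ends t (o' t) = X.ends t' (o t')) : kap (slots n X.E (insert t (T.erase t'))) (lx ∘
    X.pos x (insert t (T.erase t')) o') id * aft lx ((X.cfg (insert t (T.erase t')) o').items (n +
    1)) (inr t') = - (kap (slots n X.E T) (lx ∘ X.pos x T o) id * aft lx ((X.cfg T o).items (n + 1))
    (inr t)) := by
  have hne : t ≠ t' := fun e => htτ (e ▸ ht')
  rw [kap_mul_aft h hc ht htτ, kap_mul_aft h' hc (h.subset ht') (by simp [hne.symm])]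
  set S := slots n ((X.E.erase t).erase t') (T.erase t') with hS
  have hSt : t + 1 ∉ S := by rw [hS, succ_mem_slots]; split_ifs <;> simp [htτ]
  have hSt' : t' + 1 ∉ S := by rw [hS, succ_mem_slots]; split_ifs <;> simp
  have e1 : slots n (X.E.erase t) T = insert (t' + 1) S := by
    rw [hS, ← slots_erase, insert_erase]
    rw [succ_mem_slots]
    split_ifs
    exacts [mem_erase.2 ⟨hne.symm, h.subset ht'⟩, ht']
  have e2 : slots n (X.E.erase t') (insert t (T.erase t')) = insert (t + 1) S := by
    have : S = (slots n (X.E.erase t') (insert t (T.erase t'))).erase (t + 1) := by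
      rw [slots_erase, erase_insert (by simp [htτ]), hS, erase_right_comm]
    rw [this, insert_erase]
    rw [succ_mem_slots]
    split_ifs
    exacts [mem_erase.2 ⟨hne, ht⟩, mem_insert_self _ _]
  have hcon : ∀ p ∈ S, (lx ∘ X.pos x (insert t (T.erase t')) o') p = (lx ∘ X.pos x T o) p := by
    rintro (_ | a) hp
    · rfl
    · have hat : a ≠ t := fun e => hSt (e ▸ hp)
      have hat' : a ≠ t' := fun e => hSt' (e ▸ hp)
      simp only [Function.comp_apply, pos, mem_insert, hat, mem_erase, hat', ne_eq,
        not_false_eq_true, true_and, false_or]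
      split_ifs with ha
      · grind
      · rfl
  have hpt : (lx ∘ X.pos x (insert t (T.erase t')) o') (t + 1) = (lx ∘ X.pos x T o) (t' + 1) := by
    simp [pos, ht', hh]
  have e3 : aft (lx ∘ X.pos x (insert t (T.erase t')) o') S (t + 1) =
      aft (lx ∘ X.pos x T o) S (t' + 1) := by
    rw [aft_eq_prod, aft_eq_prod]
    exact prod_congr rfl fun p hp => by rw [hcon p hp, hpt]
  rw [e1, e2, kap_insert hSt (lx_pos_injOn h' _) injective_id.injOn, kap_insert hSt' (lx_pos_injOn h
    _) injective_id.injOn, e3, kap_congr hcon fun _ _ => rfl, aft_insert _ hSt, aft_insert _ hSt']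
  have e4 : sg (id (t' + 1) < id (t + 1)) = - sg (id (t + 1) < id (t' + 1)) := by
    simp only [id, add_lt_add_iff_right, sg]
    rcases lt_or_gt_of_ne hne with h | h <;> simp [h, h.not_gt]
  rw [e4]
  ring

/-! ### Equivariance -/

lemma NG.Arb.ren (h : X.Arb x T o) (ha : Agree X' (X.ren σ ρ f)) : X'.Arb (σ x) (T.map
    ρ.toEmbedding) (fun a => xor (f (ρ.symm a)) (o (ρ.symm a))) := by
  have hE : ∀ a ∈ T, ρ a ∈ X'.E := fun a haτ => ha.mem_E.2 (h.subset haτ)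
  have hends : ∀ a ∈ T, ∀ s, X'.ends (ρ a) (xor (f a) s) = σ (X.ends a s) := fun a haτ s => by
    simp [ha.ends_apply (h.subset haτ)]
  obtain ⟨l, hl⟩ := h.rank
  refine ⟨fun a haτ => ?_, ?_, ?_, ?_, fun u hu hux => ?_, l ∘ σ.symm, ?_⟩
  · obtain ⟨b, hb, rfl⟩ := mem_map.1 haτ; exact hE b hb
  · rw [ha.V_eq]; simpa using h.root_mem
  · simp only [mem_map, coe_toEmbedding, forall_exists_index, and_imp]
    rintro _ a haτ rfl _ b hbτ rfl e
    simp only [symm_apply_apply, hends a haτ, hends b hbτ, EmbeddingLike.apply_eq_iff_eq] at e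
    rw [h.inj a haτ b hbτ e]
  · simp only [mem_map, coe_toEmbedding, forall_exists_index, and_imp]
    rintro _ a haτ rfl e
    simp only [symm_apply_apply, hends a haτ, EmbeddingLike.apply_eq_iff_eq] at e
    exact h.ne a haτ e
  · rw [ha.V_eq, NG.ren, mem_map_equiv] at hu
    obtain ⟨a, haτ, hau⟩ := h.surj _ hu fun e => hux (by rw [← e, apply_symm_apply])
    exact ⟨ρ a, mem_map.2 ⟨a, haτ, rfl⟩, by
      simp only [symm_apply_apply, hends a haτ, hau, apply_symm_apply]⟩
  · simp only [mem_map, coe_toEmbedding, forall_exists_index, and_imp]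
    rintro _ a haτ rfl
    simp only [symm_apply_apply, ← Bool.xor_not, hends a haτ, Function.comp_apply]
    exact hl a haτ

lemma NG.Agree.cfg (ha : Agree X' (X.ren σ ρ f)) (T : Finset ℕ) (o : ℕ → Bool) : Agree (X'.cfg
    (T.map ρ.toEmbedding) fun a => xor (f (ρ.symm a)) (o (ρ.symm a))) ((X.cfg T o).ren σ ρ f) :=
    by
  refine ⟨ha.V_eq, ha.E_eq, ha.ends_eq, ha.col_eq, fun a _ => ?_⟩
  simp only [NG.cfg, NG.ren, mem_map_equiv]
  split_ifs <;> rfl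

/-- The sign of a relabelling for graphs without dotted edges. -/
def gsgn (n : ℤ) (σ ρ : Perm ℕ) (f : ℕ → Bool) (X : NG k) : ℤ :=
  (if Even n then kap X.E id ρ else kap X.V id σ) * ∏ a ∈ X.E, if f a then eps n else 1

/-- The permutation of positions. -/
def liftPerm (ρ : Perm ℕ) : ℕ → ℕ
  | 0 => 0
  | a + 1 => ρ a + 1

lemma liftPerm_injective (ρ : Perm ℕ) : Function.Injective (liftPerm ρ) := by
  rintro (_ | a) (_ | b) e <;> simp_all [liftPerm]

lemma slots_map (E T : Finset ℕ) (ρ : Perm ℕ) : (slots n E T).map ⟨_, liftPerm_injective ρ⟩ = slots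
    n (E.map ρ.toEmbedding) (T.map ρ.toEmbedding) := by
  simp only [slots, Finset.map_insert, map_map, ← apply_ite (Finset.map ρ.toEmbedding)]
  rfl

lemma kap_slots (E T : Finset ℕ) (ρ : Perm ℕ) : kap (slots n E T) id (liftPerm ρ) = kap (if Even n
    then E else T) id ρ := by
  rw [slots, kap_insert (by simp) injective_id.injOn (liftPerm_injective ρ).injOn, kap_map]
  have h1 : aft id ((if Even n then E else T).map ⟨Nat.succ, Nat.succ_injective⟩) 0 =
      aft (liftPerm ρ) ((if Even n then E else T).map ⟨Nat.succ, Nat.succ_injective⟩) 0 := by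
    refine aft_congr fun d hd => ?_
    obtain ⟨a, -, rfl⟩ := mem_map.1 hd
    simp [liftPerm]
  rw [h1, aft_mul_self, mul_one]
  exact kap_congr_lt (by simp) (by simp [liftPerm])

lemma hs_ren (hA : X.Arb x T o) (hc : X.Closed) (ha : Agree X' (X.ren σ ρ f)) : hs n X' (σ x) (T.map
    ρ.toEmbedding) (fun a => xor (f (ρ.symm a)) (o (ρ.symm a))) * (X.cfg T o).sgn (n + 1) σ ρ f =
    gsgn n σ ρ f X * hs n X x T o := by
  have hE : X'.E = X.E.map ρ.toEmbedding := ha.E_eq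
  set o' : ℕ → Bool := fun a => xor (f (ρ.symm a)) (o (ρ.symm a)) with ho'
  have hmap : Function.Injective (Sum.map σ ρ) := map_injective.2 ⟨σ.injective, ρ.injective⟩
  have hB : Function.Injective (lx ∘ Sum.map σ ρ ∘ X.pos x T o) :=
    lx_injective.comp (hmap.comp (pos_injective hA))
  have k1 : kap (slots n X'.E (T.map ρ.toEmbedding)) (lx ∘ X'.pos (σ x) (T.map ρ.toEmbedding) o')
      id = kap (slots n X.E T) (lx ∘ Sum.map σ ρ ∘ X.pos x T o) (liftPerm ρ) := by
    rw [hE, ← slots_map, kap_map]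
    refine kap_congr (fun p hp => ?_) fun _ _ => rfl
    rcases p with _ | a
    · rfl
    · simp only [Function.comp_apply, coeFn_mk, liftPerm, pos, mem_map_equiv, symm_apply_apply, ho']
      split_ifs with haτ
      · simp [ha.ends_apply (hA.subset haτ)]
      · rfl
  have k2 := kap_comp (S := slots n X.E T) hB.injOn (lx_pos_injOn hA _)
    (injective_id (α := ℕ)).injOn
  have k3 := kap_comp (S := slots n X.E T) hB.injOn (injective_id (α := ℕ)).injOn
    (liftPerm_injective ρ).injOn
  have k4 : kap (slots n X.E T) (lx ∘ Sum.map σ ρ ∘ X.pos x T o) (lx ∘ X.pos x T o) =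
      kap ((slots n X.E T).map ⟨_, pos_injective hA⟩) lx (lx ∘ Sum.map σ ρ) := by
    rw [kap_comm hB.injOn (lx_pos_injOn hA _), kap_map]
    rfl
  have p1 : (∏ a ∈ T.map ρ.toEmbedding, if o' a then 1 else eps n) =
      (∏ a ∈ T, if o a then 1 else eps n) * ∏ a ∈ T, if f a then eps n else 1 := by
    rw [prod_map, ← prod_mul_distrib]
    refine prod_congr rfl fun a _ => ?_
    simp only [ho', coe_toEmbedding, symm_apply_apply]
    cases f a <;> cases o a <;> simp [eps_mul_self]
  have p2 : (∏ a ∈ X.E, if f a then eps n else 1) =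
      (∏ a ∈ T, if f a then eps n else 1) * ∏ a ∈ X.E \ T, if f a then eps n else 1 := by
    rw [mul_comm, Finset.prod_sdiff hA.subset]
  rw [hs, hs, k1, ← k3, ← k2, k4, kap_slots, sgn, fsgn, dotted_cfg, p1, gsgn, p2]
  by_cases hn : Even n
  · have hm : ¬ Even (n + 1) := by rw [Int.even_add_one]; exact not_not.2 hn
    have he : eps n = 1 := if_pos hn
    simp only [items_cfg_even hn hA hc, if_pos hn, if_neg hm, he, ite_self, Finset.prod_const_one,
      mul_one]
    linear_combination (kap (slots n X.E T) (lx ∘ X.pos x T o) id * kap X.E id ρ) *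
      kap_mul_self ((slots n X.E T).map ⟨_, pos_injective hA⟩) lx (lx ∘ Sum.map σ ρ)
  · have he : eps n = -1 := if_neg hn
    rw [items_cfg_odd hn hA.subset, slots_map_odd hn hA hc, kap_lx, kap_lx, kap_empty, kap_empty]
    simp only [if_neg hn, if_pos (Int.even_add_one.2 hn), he]
    linear_combination (kap X.V id σ * kap (slots n X.E T) (lx ∘ X.pos x T o) id * (∏ a ∈ T, if o a
      then 1 else -1) * (∏ a ∈ T, if f a then -1 else 1) * ∏ a ∈ X.E \ T, if f a then -1 else 1) *
      kap_mul_self T id ρ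

end

lemma hterm_ren {ψ : NG k → M} (hψ : Alt (n + 1) ψ) (h : X.Tree T) (hx : x ∈ X.V) (hc : X.Closed)
    (ha : Agree X' (X.ren σ ρ f)) : hterm n ψ X' (σ x) (T.map ρ.toEmbedding) = gsgn n σ ρ f X •
    hterm n ψ X x T := by
  have hA := h.arb hc hx
  rw [hterm_eq (hA.ren ha) (ha.closed (hc.ren _ _ _)), hterm_eq hA hc, hψ (X.cfg T _) _ σ ρ f hc
    (ha.cfg T _), smul_smul, smul_smul, hs_ren hA hc ha]

end

section

open NG

variable {k : ℕ} {n : ℤ} {M : Type*} [AddCommGroup M]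
variable {ψ : NG k → M} {T : Finset ℕ} {X : NG k} {σ ρ : Perm ℕ} {f : ℕ → Bool} {x : ℕ}

/-! ### The map `h` on functions of graphs -/

/-- The sum over all roots and spanning trees. -/
def hsum (n : ℤ) (ψ : NG k → M) (X : NG k) : M :=
  ∑ x ∈ X.V, ((X.val x : ℤ) - 2) • ∑ T ∈ X.E.powerset.filter X.Tree, hterm n ψ X x T

lemma mem_trees : T ∈ X.E.powerset.filter X.Tree ↔ X.Tree T := by
  rw [mem_filter, Finset.mem_powerset]
  exact ⟨fun h => h.2, fun h => ⟨h.subset, h⟩⟩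

lemma NG.Tree.ren {X X' : NG k} (h : X.Tree T) (hx : x ∈ X.V) (hc : X.Closed) (ha : Agree X' (X.ren
    σ ρ f)) : X'.Tree (T.map ρ.toEmbedding) :=
  ((h.arb hc hx).ren ha).tree (ha.closed (hc.ren _ _ _))

lemma hsum_ren (hψ : Alt (n + 1) ψ) {X X' : NG k} (hc : X.Closed) (ha : Agree X' (X.ren σ ρ f)) :
    hsum n ψ X' = gsgn n σ ρ f X • hsum n ψ X := by
  have hV : X'.V = X.V.map σ.toEmbedding := ha.V_eq
  have hi : ∀ ρ : Perm ℕ, ∀ T : Finset ℕ,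
      (T.map ρ.toEmbedding).map ρ.symm.toEmbedding = T := fun ρ T => by
    rw [map_map]; ext; simp
  rw [hsum, hsum, hV, sum_map, smul_sum]
  refine sum_congr rfl fun x hx => ?_
  rw [smul_comm (gsgn n σ ρ f X), coe_toEmbedding, val_agree ha]
  congr 1
  rw [smul_sum]
  symm
  refine sum_nbij' (fun T => T.map ρ.toEmbedding) (fun T => T.map ρ.symm.toEmbedding)
    (fun T hτ => ?_) (fun T hτ => ?_) (fun T _ => hi ρ T) (fun T _ => hi ρ.symm T)
    fun T hτ => ?_
  · rw [mem_trees] at hτ ⊢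
    exact hτ.ren hx hc ha
  · rw [mem_trees] at hτ ⊢
    exact hτ.ren (x := σ x) (by rw [hV]; exact mem_map.2 ⟨x, hx, rfl⟩)
      (ha.closed (hc.ren _ _ _)) (agree_symm_ren ha)
  · exact (hterm_ren hψ (mem_trees.1 hτ) hx hc ha).symm

/-- The contributions of pairs of a tree and an edge outside of it, which becomes solid, cancel. -/
lemma sum_dotted_eq_zero (hbad : ∀ X : NG k, X.Closed → ¬ Acyclic X.sarc → ψ X = 0) (hc : X.Closed)
    (hx : x ∈ X.V) : ∑ T ∈ X.E.powerset.filter X.Tree, ∑ t ∈ X.E \ T, hs n X x T (X.away T x) • term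
    (n + 1) ψ t (X.cfg T (X.away T x)) = 0 := by
  set w : Finset ℕ → ℕ → Bool → M := fun T t s =>
    (kap (slots n X.E T) (lx ∘ X.pos x T (X.away T x)) id * aft lx ((X.cfg T (X.away T x)).items (n
      + 1)) (inr t) * ∏ a ∈ insert t T, if update (X.away T x) t s a then 1 else eps n) •
      ψ (X.cfg (insert t T) (update (X.away T x) t s)) with hw
  set C : Finset ℕ → ℕ → Bool → ℕ → Prop := fun T t s t' =>
    X.Tree T ∧ t ∉ T ∧ t' ∈ T ∧ X.ends t s = X.ends t' (X.away T x t') ∧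
      Acyclic (X.cfg (insert t T) (update (X.away T x) t s)).sarc with hC
  have hterm : ∀ T, X.Tree T → ∀ t ∈ X.E \ T, hs n X x T (X.away T x) •
      term (n + 1) ψ t (X.cfg T (X.away T x)) = ∑ s : Bool, w T t s := by
    intro T _ t ht
    rw [mem_sdiff] at ht
    have hp : ∀ s, (∏ a ∈ insert t T, if update (X.away T x) t s a then 1 else eps n) =
        (if s then 1 else eps n) * ∏ a ∈ T, if X.away T x a then 1 else eps n := fun s => by
      rw [prod_insert ht.2, update_self]
      congr 1
      refine prod_congr rfl fun a ha => ?_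
      rw [update_of_ne fun e : a = t => ht.2 (e ▸ ha)]
    rw [term_none (X := X.cfg T (X.away T x)) ht.1 (by simp [cfg, ht.2]), cfg_setTy, cfg_setTy, eps_add_one, Fintype.sum_bool,
      hw]
    simp only [hp, hs, if_true, false_eq_true, if_false]
    module
  have hsingle : ∀ T, X.Tree T → ∀ t ∈ X.E \ T, ∀ s,
      w T t s = ∑ t' ∈ X.E, if C T t s t' then w T t s else 0 := by
    intro T hτ t ht s
    rw [mem_sdiff] at ht
    have hA := hτ.arb hc hx
    by_cases hac : Acyclic (X.cfg (insert t T) (update (X.away T x) t s)).sarc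
    · obtain ⟨l, hl⟩ := exists_rank_cfg hc (Finset.insert_subset ht.1 hτ.subset) hac
      obtain ⟨t', ht', he⟩ := hA.surj _ (hc t ht.1 s) (hA.ne_root hc ht.1 ht.2 hl)
      rw [sum_eq_single t', if_pos ⟨hτ, ht.2, ht', he.symm, hac⟩]
      · exact fun b _ hb => if_neg fun h => hb (hA.inj _ h.2.2.1 _ ht' (h.2.2.2.1.symm.trans he.symm))
      · exact fun h => absurd (hτ.subset ht') h
    · rw [hw]
      simp only [hbad _ (show (X.cfg _ _).Closed from hc) hac, smul_zero, ite_self,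
        Finset.sum_const_zero]
  have hinv : ∀ T t s t', t ∈ X.E → C T t s t' →
      C (insert t (T.erase t')) t' (X.away T x t') t ∧
      insert t' ((insert t (T.erase t')).erase t) = T ∧
      X.away (insert t (T.erase t')) x t = s ∧
      w T t s + w (insert t (T.erase t')) t' (X.away T x t') = 0 := by
    intro T t s t' ht ⟨hτ, htτ, ht', he, hac⟩
    have hA := hτ.arb hc hx
    obtain ⟨l, hl⟩ := exists_rank_cfg hc (Finset.insert_subset ht hτ.subset) hac
    have hA' := hA.exchange ht htτ ht' he hl
    have hne : t' ≠ t := by grind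
    have haw : ∀ a ∈ insert t (T.erase t'), X.away (insert t (T.erase t')) x a =
        update (X.away T x) t s a := fun a ha => hA'.away hc ha
    have hU : insert t' (insert t (T.erase t')) = insert t T := by grind
    have hup : ∀ a ∈ insert t T,
        update (X.away (insert t (T.erase t')) x) t' (X.away T x t') a =
          update (X.away T x) t s a := by grind
    have hcfg : X.cfg (insert t' (insert t (T.erase t')))
        (update (X.away (insert t (T.erase t')) x) t' (X.away T x t')) =
        X.cfg (insert t T) (update (X.away T x) t s) := by
      rw [hU]; exact cfg_congr _ hup
    have hst : X.away (insert t (T.erase t')) x t = s := by grind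
    refine ⟨⟨hA'.tree hc, by simp [hne], mem_insert_self _ _, ?_, ?_⟩, ?_, hst, ?_⟩
    · rw [hst, he]
    · rwa [hcfg]
    · rw [erase_insert (by simp [htτ]), insert_erase ht']
    · simp only [hw]
      have hprod : (∏ a ∈ insert t T, if update (X.away (insert t (T.erase t')) x) t'
          (X.away T x t') a then (1 : ℤ) else eps n) =
          ∏ a ∈ insert t T, if update (X.away T x) t s a then 1 else eps n :=
        prod_congr rfl fun a ha => by rw [hup a ha]
      rw [hcfg, hU, hprod]
      have hx1 := kap_exchange (n := n) (o' := X.away (insert t (T.erase t')) x) hA hc ht htτ ht'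
        (hA'.congr haw) (fun a ha hat => by
          rw [haw a (mem_insert_of_mem (mem_erase.2 ⟨hat, ha⟩)),
            update_of_ne fun e : a = t => htτ (e ▸ ha)]) (by rw [hst, he])
      rw [hx1]; module
  calc _ = ∑ T ∈ X.E.powerset, ∑ t ∈ X.E, ∑ s : Bool, ∑ t' ∈ X.E,
        if C T t s t' then w T t s else 0 := by
        rw [sum_filter]
        refine sum_congr rfl fun T hτ => ?_
        split_ifs with hT
        · rw [← sum_sdiff hT.subset, eq_comm, add_eq_left.2]
          · exact sum_congr rfl fun t ht => by
              rw [hterm T hT t ht]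
              exact sum_congr rfl fun s _ => (hsingle T hT t ht s).symm
          · exact sum_eq_zero fun t ht => sum_eq_zero fun s _ =>
              sum_eq_zero fun t' _ => if_neg fun h => h.2.1 ht
        · exact (sum_eq_zero fun t _ => sum_eq_zero fun s _ =>
            sum_eq_zero fun t' _ => if_neg fun h => hT h.1).symm
    _ = ∑ p ∈ (X.E.powerset ×ˢ X.E ×ˢ (univ : Finset Bool) ×ˢ X.E).filter
        (fun p => C p.1 p.2.1 p.2.2.1 p.2.2.2), w p.1 p.2.1 p.2.2.1 := by
        rw [sum_filter, sum_product]
        refine sum_congr rfl fun T _ => ?_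
        rw [sum_product]
        refine sum_congr rfl fun t _ => ?_
        rw [sum_product]
    _ = 0 := by
        refine Finset.sum_involution (fun p _ =>
          (insert p.2.1 (p.1.erase p.2.2.2), p.2.2.2, X.away p.1 x p.2.2.2, p.2.1))
          ?_ ?_ ?_ ?_
        · rintro ⟨T, t, s, t'⟩ hp
          simp only [mem_filter, mem_product] at hp
          exact (hinv T t s t' hp.1.2.1 hp.2).2.2.2
        · rintro ⟨T, t, s, t'⟩ hp _ e
          simp only [mem_filter, mem_product] at hp
          simp only [Prod.mk.injEq] at e
          exact hp.2.2.1 (e.2.1 ▸ hp.2.2.2.1)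
        · rintro ⟨T, t, s, t'⟩ hp
          simp only [mem_filter, mem_product, Finset.mem_powerset, mem_univ, true_and] at hp ⊢
          have := (hinv T t s t' hp.1.2.1 hp.2).1
          exact ⟨⟨this.1.subset, hp.1.2.2, hp.1.2.1⟩, this⟩
        · rintro ⟨T, t, s, t'⟩ hp
          simp only [mem_filter, mem_product] at hp
          have := hinv T t s t' hp.1.2.1 hp.2
          simp only [Prod.mk.injEq]
          exact ⟨this.2.1, trivial, this.2.2.1, trivial⟩

lemma hterm_contract (hψ : Alt (n + 1) ψ) (hc : X.Closed) (hd : X.dotted = ∅) (hτ : X.Tree T) (hx :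
    x ∈ X.V) {t : ℕ} (ht : t ∈ T) (htad : X.ends t false ≠ X.ends t true) : hs n X x T (X.away T x)
    • term (n + 1) ψ t (X.cfg T (X.away T x)) = aft lx (X.items n) (citem n t (X.ends t true)) •
    hterm n ψ (X.contract t (X.ends t false) (X.ends t true)) (retract (X.ends t false) (X.ends t
    true) x) (T.erase t) := by
  have hA := hτ.arb hc hx
  have htE := hτ.subset ht
  have hsol : t ∈ X.solid := mem_solid.2 ⟨htE, fun e => by
    have : t ∈ X.dotted := mem_dotted.2 ⟨htE, e⟩
    rw [hd] at this; exact absurd this (notMem_empty t)⟩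
  set s := X.away T x t with hs0
  have hxs : x ≠ X.ends t s := fun e => hA.ne t ht e.symm
  have hcc := hc.contract (t := t) (hc t htE (!s)) (ends_ne_not htad s)
  have haw : ∀ a ∈ T.erase t, X.away T x a =
      ctr(X, t, s).away (T.erase t) x a := fun a ha => by
    rw [← away_contract (x := x) ht s (ne_of_mem_erase ha), retract_of_ne hxs]
  have h1 : ψ ((X.cfg T (X.away T x)).contract t (X.ends t !s) (X.ends t s)) =
      ψ (ctr(X, t, s).cfg (T.erase t) (X.away T x)) := by
    refine hψ.vAlt.congr hcc ⟨rfl, rfl, fun _ _ => rfl, fun _ _ _ => rfl, fun a ha => ?_⟩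
    have : a ≠ t := ne_of_mem_erase ha
    simp [NG.contract, cfg, this]
  have h2 : hs n X x T (X.away T x) • term (n + 1) ψ t (X.cfg T (X.away T x)) =
      ((if s then 1 else eps n) * aft lx (X.items n) (citem n t (X.ends t s))) •
        hterm n ψ ctr(X, t, s) x (T.erase t) := by
    rw [term_some (X := X.cfg T (X.away T x)) htE (s := s) (by simp [cfg, ht, hs0]) htad]
    change _ • _ • ψ ((X.cfg T (X.away T x)).contract t (X.ends t !s) (X.ends t s)) = _
    have h3 := hs_contract (n := n) hA hc hd ht
    rw [← hs0] at h3
    rw [h1, smul_smul]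
    change (_ * aft lx _ (citem _ t (X.ends t s))) • _ = _
    rw [h3, mul_smul, hterm, ← hs_congr n _ x haw, ← cfg_congr _ haw]
  rw [h2]
  have hb := hc t htE
  cases hst : s
  · rw [hst] at hxs
    have hsw := aft_mul_sgn_swap (m := n) hsol (hb false) (hb true) htad
    have hag := agree_contract_swap (t := t) (hb false) (hb true) htad
    have hcc' := hc.contract (t := t) (hb false) htad
    have htree := (tree_contract hc htE true htad ht).2 hτ
    have hrV : retract (X.ends t false) (X.ends t true) x ∈
        (X.contract t (X.ends t false) (X.ends t true)).V := by
      unfold retract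
      split_ifs with h
      · exact mem_erase.2 ⟨htad, hb false⟩
      · exact mem_erase.2 ⟨h, hx⟩
    have h4 := hterm_ren hψ htree hrV hcc' hag
    have h5 : swap (X.ends t false) (X.ends t true)
        (retract (X.ends t false) (X.ends t true) x) = x := by
      by_cases h : x = X.ends t true
      · rw [h, retract_self, Equiv.swap_apply_left]
      · rw [retract_of_ne h, swap_apply_of_ne_of_ne hxs h]
    have h6 : (T.erase t).map (1 : Perm ℕ).toEmbedding = T.erase t := by
      ext a; simp [mem_map_equiv]
    have h7 : gsgn n (swap (X.ends t false) (X.ends t true)) 1 (fun _ => false)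
        (X.contract t (X.ends t false) (X.ends t true)) =
        (X.contract t (X.ends t false) (X.ends t true)).sgn n
          (swap (X.ends t false) (X.ends t true)) 1 fun _ => false := by
      rw [gsgn, sgn, fsgn_false, items_of_solid (by rw [dotted_contract hsol, hd])]
      by_cases hn : Even n
      · rw [if_pos hn, if_pos hn, kap_lx]; simp
      · rw [if_neg hn, if_neg hn, kap_lx]; simp
    simp only [Bool.not_true] at h4
    rw [h5, h6] at h4
    simp only [false_eq_true, if_false, Bool.not_false]
    rw [h4, smul_smul, h7]
    congr 1
    linear_combination eps n * hsw + aft lx (X.items n) (citem n t (X.ends t true)) *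
      eps_mul_self n
  · rw [hst] at hxs
    rw [if_pos rfl, one_mul, retract_of_ne hxs]
    rfl

/-- `h` is compatible with the differentials. -/
lemma del_hsum (hψ : Alt (n + 1) ψ) (hbad : ∀ X : NG k, X.Closed → ¬ Acyclic X.sarc → ψ X = 0) (hc :
    X.Closed) (hty : ∀ a ∈ X.E, X.ty a = some true) (htad : ∀ a ∈ X.E, X.ends a false ≠ X.ends a
    true) : del n (hsum n ψ) X = hsum n (del (n + 1) ψ) X := by
  have hd : X.dotted = ∅ := by
    refine Finset.eq_empty_of_forall_notMem fun a ha => ?_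
    rw [mem_dotted] at ha
    rw [hty a ha.1] at ha; simp at ha
  set g : ℕ → ℕ → Finset ℕ → M := fun t y T =>
    hterm n ψ (X.contract t (X.ends t false) (X.ends t true)) y T with hg
  have h1 : ∀ x ∈ X.V, ∑ T ∈ X.E.powerset.filter X.Tree, hterm n (del (n + 1) ψ) X x T =
      ∑ t ∈ X.E, aft lx (X.items n) (citem n t (X.ends t true)) •
        ∑ T ∈ X.E.powerset.filter X.Tree, if t ∈ T then
          g t (retract (X.ends t false) (X.ends t true) x) (T.erase t) else 0 := by
    intro x hx
    have h2 : ∑ T ∈ X.E.powerset.filter X.Tree, hterm n (del (n + 1) ψ) X x T =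
        ∑ T ∈ X.E.powerset.filter X.Tree, ∑ t ∈ T,
          hs n X x T (X.away T x) • term (n + 1) ψ t (X.cfg T (X.away T x)) := by
      rw [← add_zero (∑ T ∈ X.E.powerset.filter X.Tree, ∑ t ∈ T, _),
        ← sum_dotted_eq_zero (n := n) hbad hc hx, ← sum_add_distrib]
      refine sum_congr rfl fun T hτ => ?_
      rw [add_comm (∑ t ∈ T, _) _, sum_sdiff (mem_trees.1 hτ).subset, hterm, del, smul_sum]
      rfl
    rw [h2]
    simp only [smul_sum]
    rw [sum_comm]
    refine sum_congr rfl fun T hτ => ?_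
    have hT := mem_trees.1 hτ
    rw [← sum_sdiff hT.subset, eq_comm, add_eq_right.2]
    · exact sum_congr rfl fun t ht => by
        rw [if_pos ht, hterm_contract hψ hc hd hT hx ht (htad t (hT.subset ht))]
    · exact sum_eq_zero fun t ht => by
        rw [if_neg (mem_sdiff.1 ht).2, smul_zero]
  rw [hsum, sum_congr rfl fun x hx => by rw [h1 x hx, smul_sum], sum_comm, del]
  refine sum_congr rfl fun t ht => ?_
  have htne := htad t ht
  rw [term_some ht (hty t ht) htne, Bool.not_true]
  simp only [smul_comm _ (aft lx (X.items n) (citem n t (X.ends t true)))]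
  rw [← smul_sum]
  congr 1
  set X' := X.contract t (X.ends t false) (X.ends t true) with hΓ'
  have h3 : ∀ y, (∑ T ∈ X.E.powerset.filter X.Tree, if t ∈ T then g t y (T.erase t) else 0) =
      ∑ T ∈ X'.E.powerset.filter X'.Tree, g t y T := fun y => by
    rw [← sum_filter]
    refine sum_nbij' (fun T => T.erase t) (fun T => insert t T) (fun T hτ => ?_)
      (fun T hτ => ?_) (fun T hτ => ?_) (fun T hτ => ?_) fun T _ => rfl
    · rw [mem_filter, mem_trees] at hτ
      exact mem_trees.2 ((tree_contract hc ht true htne hτ.2).2 hτ.1)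
    · have hT := mem_trees.1 hτ
      have htn : t ∉ T := fun h => absurd (hT.subset h) (notMem_erase t _)
      rw [mem_filter, mem_trees]
      refine ⟨(tree_contract hc ht true htne (mem_insert_self _ _)).1 ?_, mem_insert_self _ _⟩
      rwa [erase_insert htn]
    · exact insert_erase (mem_filter.1 hτ).2
    · exact erase_insert fun h =>
        absurd ((mem_trees.1 hτ).subset h) (notMem_erase t _)
  simp only [h3]
  have hb := hc t ht true
  have ha : X.ends t false ∈ X.V.erase (X.ends t true) := mem_erase.2 ⟨htne, hc t ht false⟩
  have hval := val_contract_eq ht htne true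
  simp only [Bool.not_true] at hval
  rw [hsum, ← add_sum_erase _ _ hb, ← add_sum_erase _ _ ha, retract_self, retract_left]
  rw [show X'.V = X.V.erase (X.ends t true) from rfl, eq_comm, ← add_sum_erase _ _ ha, ← add_assoc, ← add_smul]
  congr 1
  · congr 1
    rw [← hΓ'] at hval
    omega
  · refine sum_congr rfl fun y hy => ?_
    rw [mem_erase, mem_erase] at hy
    rw [retract_of_ne hy.2.1]
    have := val_contract_ne ht true (by simpa using hy.1) hy.2.1
    simp only [Bool.not_true] at this
    rw [hΓ', this]

end

section

open NG

/-! ### `h` is a map of complexes -/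

lemma kap_union {ι α β : Type*} [DecidableEq ι] [LinearOrder α] [LinearOrder β] {A B : Finset ι}
    (hAB : Disjoint A B) {F : ι → α} {G : ι → β} (h : ∀ a ∈ A, ∀ b ∈ B, F a < F b) : kap (A ∪ B) F G
    = kap A F G * kap B F G * (-1) ^ ((B ×ˢ A).filter fun p => G p.1 < G p.2).card := by
  have h1 : ∀ x ∈ A, ∏ y ∈ A ∪ B, sg (F x < F y ∧ G y < G x) =
      (∏ y ∈ A, sg (F x < F y ∧ G y < G x)) * ∏ y ∈ B, sg (G y < G x) := fun x hx => by
    rw [prod_union hAB]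
    congr 1
    exact prod_congr rfl fun y hy => by simp [h x hx y hy]
  have h2 : ∀ x ∈ B, ∏ y ∈ A ∪ B, sg (F x < F y ∧ G y < G x) =
      ∏ y ∈ B, sg (F x < F y ∧ G y < G x) := fun x hx => by
    rw [prod_union hAB, prod_eq_one, one_mul]
    intro y hy
    simp [(h y hy x hx).not_gt]
  rw [kap_eq_prod, kap_eq_prod, kap_eq_prod, prod_union hAB, prod_congr rfl h1, prod_congr rfl h2,
    prod_mul_distrib, neg_one_pow_card_filter,
    prod_product, Finset.prod_comm (s := B) (t := A)]
  ring

variable {K : Type u} [Field K] {k : ℕ} {n : ℤ} {M : Type*} [AddCommGroup M] [Module K M]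
variable {X : NG k} {v e : ℕ} {ψ : NG k → M} {d : ℤ} {L : (SGCGen k (n + 1) d →₀ K) →ₗ[K] M}

section

variable (G : SGraph k v e) (T : Finset (Fin e)) (x : Fin (v + 1))

lemma tree_toNG : (toNG G).Tree (T.map valEmbedding) ↔ G.toGraph.IsSpanningTree T := by
  have hl := lab_toNG G
  constructor
  · intro h
    refine ⟨fun x y => (hl.linked_iff T x y).1 (h.linked _ (hl.i_mem x) _ (hl.i_mem y)), ?_⟩
    have := h.card
    rwa [hl.card_V, card_map, add_left_inj] at this
  · intro h
    refine ⟨fun a ha => ?_, fun a ha b hb => ?_, ?_⟩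
    · obtain ⟨b, _, rfl⟩ := mem_map.1 ha
      exact hl.j_mem b
    · obtain ⟨x, rfl⟩ := hl.exists_i ha
      obtain ⟨y, rfl⟩ := hl.exists_i hb
      exact (hl.linked_iff T x y).2 (h.1 x y)
    · rw [hl.card_V, card_map, h.2]

lemma away_toNG (a : Fin e) : (toNG G).away (T.map valEmbedding) x a = G.toGraph.away T x a := by
  have hl := lab_toNG G
  rw [NG.away, Graph.away, decide_eq_decide, hl.ends_eq, ← hl.linked_iff, map_erase]
  rfl

lemma lab_cfg : Lab ((toNG G).cfg (T.map valEmbedding) ((toNG G).away (T.map valEmbedding) x))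
    (G.toGraph.special x T) Fin.val Fin.val := by
  have hl := lab_toNG G
  refine ⟨hl.i_inj, hl.j_inj, hl.V_eq, hl.E_eq, hl.ends_eq, hl.col_eq, fun a => ?_⟩
  have h1 : (a : ℕ) ∈ T.map valEmbedding ↔ a ∈ T := Finset.mem_map' valEmbedding
  simp only [cfg, Graph.special, h1, away_toNG]

lemma hSign_eq (hτ : G.toGraph.IsSpanningTree T) : hSign n G.toGraph x T = hs n (toNG G) x (T.map
    valEmbedding) ((toNG G).away (T.map valEmbedding) x) := by
  have hl := lab_toNG G
  have hA := ((tree_toNG G T).2 hτ).arb hl.closed (hl.i_mem x)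
  set o := (toNG G).away (T.map valEmbedding) x with ho
  set D := T.map valEmbedding with hT
  have hoa : ∀ a : Fin e, o a = G.toGraph.away T x a := fun a => away_toNG G T x a
  have htip : ∀ a : Fin e, (toNG G).ends a (o a) = G.toGraph.tip T x a := fun a => by
    rw [Graph.tip, hoa]; exact hl.ends_eq _ _
  set R : Finset ℕ := (if Even n then (toNG G).E else D).map ⟨Nat.succ, Nat.succ_injective⟩ with hR
  have hTE : D ⊆ if Even n then (toNG G).E else D := by split_ifs; exacts [hA.subset, le_rfl]
  have hR0 : (0 : ℕ) ∉ R := by simp [hR]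
  have hS : slots n (toNG G).E D = insert 0 R := rfl
  have hx : aft (lx ∘ (toNG G).pos x D o) R 0 * aft id R 0 = (-1) ^ (x : ℕ) := by
    have h1 : ∀ a : ℕ, sg ((lx ∘ (toNG G).pos x D o) 0 < (lx ∘ (toNG G).pos x D o) (a + 1)) *
        sg (id 0 < id (a + 1)) = if a ∈ D then sg ((toNG G).ends a (o a) < x) else 1 := fun a => by
      by_cases ha : a ∈ D
      · have := hA.ne a ha
        simp only [Function.comp_apply, pos, ha, if_true, lx_inl_lt_inl, id, Nat.succ_pos, sg]
        rcases lt_or_gt_of_ne this with h | h <;> simp [h, h.not_gt]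
      · simp [pos, ha]
    have h2 : ∏ a ∈ D, sg ((toNG G).ends a (o a) < x) = ∏ u ∈ (toNG G).V.erase x, sg (u < x) :=
      Finset.prod_bij (fun a _ => (toNG G).ends a (o a))
        (fun a ha => mem_erase.2 ⟨hA.ne a ha, hl.closed a (hA.subset ha) _⟩)
        (fun a ha b hb => hA.inj a ha b hb)
        (fun u hu => by
          obtain ⟨a, ha, he⟩ := hA.surj u (mem_of_mem_erase hu) (ne_of_mem_erase hu)
          exact ⟨a, ha, he⟩) fun _ _ => rfl
    have h3 : ((toNG G).V.erase x).filter (fun u => u < (x : ℕ)) = Finset.range x := by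
      ext u
      rw [mem_filter, mem_erase, Finset.mem_range, hl.V_eq]
      refine ⟨fun h => h.2, fun h => ⟨⟨h.ne, ?_⟩, h⟩⟩
      exact mem_map.2 ⟨⟨u, h.trans x.2⟩, mem_univ _, rfl⟩
    rw [aft_eq_prod, aft_eq_prod, ← prod_mul_distrib, hR, prod_map]
    simp only [coeFn_mk, Nat.succ_eq_add_one, h1]
    rw [Finset.prod_ite_mem, Finset.inter_eq_right.2 hTE, h2, ← neg_one_pow_card_filter, h3,
      Finset.card_range]
  have hT1 : kap D (fun a => (lx (inl ((toNG G).ends a (o a))) : ℕ ⊕ₗ ℕ)) id =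
      (-1) ^ inversions T (G.toGraph.tip T x) := by
    rw [inversions_eq_kap, hT, kap_map, kap_comm]
    · exact kap_congr_lt (fun _ _ _ _ => Iff.rfl) fun a _ b _ => by
        simp only [Function.comp_apply, lx_inl_lt_inl, Fin.valEmbedding_apply, htip]
        exact Iff.rfl
    · intro a ha b hb h
      have := hA.inj _ (mem_map_of_mem _ ha) _ (mem_map_of_mem _ hb)
        (Sum.inl_injective (lx_injective h))
      exact val_injective this
    · exact Function.Injective.injOn val_injective
  have hp : ∏ a ∈ D, (if o a then (1 : ℤ) else eps n) =
      if Even n then 1 else (-1) ^ (T.filter fun a => G.toGraph.away T x a = false).card := by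
    rw [neg_one_pow_card_filter, hT, prod_map]
    split_ifs with hn
    · exact prod_eq_one fun a _ => by simp [eps, hn]
    · refine prod_congr rfl fun a _ => ?_
      rw [Fin.valEmbedding_apply, hoa]
      cases G.toGraph.away T x a <;> simp [eps, hn]
  have hR1 : kap R (lx ∘ (toNG G).pos x D o) id = (-1) ^ inversions T (G.toGraph.tip T x) *
      if Even n then (-1) ^ ((Tᶜ ×ˢ T).filter fun p => p.1 < p.2).card else 1 := by
    rw [hR, kap_map, ← hT1]
    split_ifs with hn
    · have hE : (toNG G).E = D ∪ Tᶜ.map valEmbedding := by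
        rw [hT, ← Finset.map_union, Finset.union_compl]; rfl
      have hdis : Disjoint D (Tᶜ.map valEmbedding) := by
        rw [hT, Finset.disjoint_map]; exact disjoint_compl_right
      have hco : ∀ a ∈ Tᶜ.map valEmbedding, a ∉ D := fun a ha h =>
        Finset.disjoint_left.1 hdis h ha
      rw [hE, kap_union hdis, kap_congr (S := D) (F' := fun a =>
        (lx (inl ((toNG G).ends a (o a))) : ℕ ⊕ₗ ℕ)) (G' := Nat.succ), mul_assoc]
      · congr 1
        · exact kap_congr_lt (fun _ _ _ _ => Iff.rfl) fun a _ b _ => by simp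
        · rw [kap_congr_lt (S := Tᶜ.map valEmbedding) (F' := id) (G' := id), kap_self, one_mul,
            neg_one_pow_card_filter, neg_one_pow_card_filter, prod_product, prod_product, hT,
            prod_map]
          · refine prod_congr rfl fun a _ => ?_
            rw [prod_map]
            simp
          · intro a ha b hb
            simp [pos, hco a ha, hco b hb]
          · simp
      · intro a ha; simp [pos, ha]
      · simp
      · intro a ha b hb
        simp [pos, ha, hco b hb]
    · rw [mul_one]
      refine kap_congr_lt (fun a ha b hb => ?_) fun a _ b _ => by simp
      simp [pos, ha, hb]
  rw [hs, hS, kap_insert hR0 (lx_pos_injOn hA _) injective_id.injOn, hx, hR1, hp, hSign, pow_add,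
    pow_add]
  split_ifs <;> ring

end

/-! ### Comparison of `h` with `hsum` -/

lemma Lab.gsgn_eq {G : SGraph k v e} {i i' : Fin (v + 1) → ℕ} {j j' : Fin e → ℕ} (h : Lab X G i j)
    (hi : StrictMono i) (hj : StrictMono j) (hi' : StrictMono i') (hj' : StrictMono j') {σ : Perm
    (Fin (v + 1))} {ρ : Perm (Fin e)} {f : Fin e → Bool} {σ' ρ' : Perm ℕ} {f' : ℕ → Bool} (hσ : ∀ x,
    σ' (i x) = i' (σ x)) (hρ : ∀ x, ρ' (j x) = j' (ρ x)) (hf : ∀ x, f' (j x) = f x) (n : ℤ) : gsgn n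
    σ' ρ' f' X = gcSign n σ ρ f := by
  rw [gsgn, h.V_eq, h.E_eq, kap_map, kap_map, prod_map, gcSign]
  simp only [coeFn_mk, hf]
  have h1 : kap univ (id ∘ j) (ρ' ∘ j) = (Perm.sign ρ : ℤ) := by
    rw [sign_eq_kap]
    exact kap_congr_lt (fun a _ b _ => hj.lt_iff_lt) fun a _ b _ => by
      simp [hρ, hj'.lt_iff_lt]
  have h2 : kap univ (id ∘ i) (σ' ∘ i) = (Perm.sign σ : ℤ) := by
    rw [sign_eq_kap]
    exact kap_congr_lt (fun a _ b _ => hi.lt_iff_lt) fun a _ b _ => by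
      simp [hσ, hi'.lt_iff_lt]
  by_cases hn : Even n
  · simp only [hn, if_true, eps, ite_self, Finset.prod_const_one, mul_one]
    exact h1
  · simp only [hn, if_false, eps]
    rw [← h2]

lemma hsum_lab (hψ : Alt (n + 1) ψ) {X X' : NG k} {G : SGraph k v e} {i i' : Fin (v + 1) → ℕ} {j j'
    : Fin e → ℕ} {σ : Perm (Fin (v + 1))} {ρ : Perm (Fin e)} {f : Fin e → Bool} (h : Lab X G i j)
    (hi : StrictMono i) (hj : StrictMono j) (h' : Lab X' (G.relabel σ ρ f) i' j') (hi' : StrictMono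
    i') (hj' : StrictMono j') : hsum n ψ X' = gcSign n σ ρ f • hsum n ψ X := by
  obtain ⟨σ', ρ', f', ha, hσ, hρ, hf⟩ := h.exists_agree h'
  rw [hsum_ren hψ h.closed ha, h.gsgn_eq hi hj hi' hj' hσ hρ hf]

lemma hsum_eq_toNG (hψ : Alt (n + 1) ψ) {G : SGraph k v e} {i : Fin (v + 1) → ℕ} {j : Fin e → ℕ} (h
    : Lab X G i j) (hi : StrictMono i) (hj : StrictMono j) : hsum n ψ X = hsum n ψ (toNG G) := by
  rw [hsum_lab hψ (lab_toNG G) val_strictMono val_strictMono (σ := 1) (ρ := 1)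
    (f := fun _ => false) (X' := X) (i' := i) (j' := j) (by rwa [SGraph.relabel_one]) hi hj]
  simp [gcSign]

lemma hsum_eq_zero (hψ : Good (n + 1) (BadS (n + 1)) ψ) (hc : X.Closed) (h : X.BadG ∨ X.Fusable) :
    hsum n ψ X = 0 := by
  refine sum_eq_zero fun x hx => ?_
  rcases h with h | ⟨f, w, i, j, hf⟩
  · rw [sum_eq_zero, smul_zero]
    intro T _
    have hb : (X.cfg T (X.away T x)).BadS (n + 1) := Or.inl h
    rw [hterm, hψ.bad (X.cfg T (X.away T x)) hc hb, smul_zero]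
  by_cases hxw : x = w
  · have := (passing_flip (f := f)).1 hf.fusableAt.passing.2
    rw [hxw, this.1]
    simp
  rw [sum_eq_zero, smul_zero]
  intro T hτ
  have hA := (mem_trees.1 hτ).arb hc hx
  set o := X.away T x with ho
  have hf' : ((X.cfg T o).ren 1 1 f).FuseAt w i j :=
    ⟨hf.w_mem, hf.i_mem, hf.j_mem, hf.ne, hf.i_true, hf.j_false, hf.i_false, hf.j_true, hf.other,
      hf.col_eq⟩
  have hce : ((X.cfg T o).ren 1 1 f).Closed := Closed.ren (show (X.cfg T o).Closed from hc) _ _ _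
  have hwV : w ∈ X.V := by simpa using hf.w_mem
  have hty : ∀ a, ((X.cfg T o).ren 1 1 f).ty a =
      if a ∈ T then some (xor (f a) (o a)) else none := fun a => by
    simp only [NG.ren, cfg, one_symm_apply]
    split_ifs <;> rfl
  have hends : ∀ a s, (X.ren 1 1 f).ends a s = X.ends a (xor (f a) s) := fun a s => rfl
  have h0 : ((X.cfg T o).ren 1 1 f).coef i j = 0 := by
    have hi := hf.i_true
    have hj := hf.j_false
    have hi' := hf.i_false
    have hj' := hf.j_true
    rw [hends] at hi hj hi' hj'
    by_contra hne
    have hm := coef_ne_zero hne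
    rw [hty, hty] at hm
    have hiτ : i ∈ T := by by_contra h; exact hm.1 (if_neg h)
    have hjτ : j ∈ T := by by_contra h; exact hm.2 (if_neg h)
    rw [coef, hty, hty, if_pos hiτ, if_pos hjτ] at hne
    simp only [some_inj] at hne
    have hx : ∀ {a s}, xor (f a) (o a) = s → o a = xor (f a) s := fun {a s} h => by
      rw [← h, xor_xor_self]
    split_ifs at hne with h1 h2
    · refine hf.ne (hA.inj i hiτ j hjτ ?_)
      rw [hx h1.1, hx h1.2, hi, hj]
    · obtain ⟨a, ha, hea⟩ := hA.surj w hwV (Ne.symm hxw)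
      by_cases hai : a = i
      · rw [hai, hx h2.1] at hea; exact hi' hea
      by_cases haj : a = j
      · rw [haj, hx h2.2] at hea; exact hj' hea
      refine hf.other a ?_ hai haj (xor (f a) (o a)) ?_
      · simpa using hA.subset ha
      · rw [hends, xor_xor_self, hea]
    · exact hne rfl
  have := hψ.alt _ (X.cfg T o) 1 1 f hce (by rw [ren_ren_flip_self]; exact Agree.refl _)
  rw [hterm, this, hψ.eq_zero_of_coef hce hf' h0, smul_zero, smul_zero]


lemma NG.WF.cfg (h : X.WF) (T : Finset ℕ) (o : ℕ → Bool) : (X.cfg T o).WF :=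
  ⟨h.closed, h.connected, h.two_le, h.three_le⟩

lemma degree_cfg {T : Finset ℕ} (h : X.Tree T) (o : ℕ → Bool) : (X.cfg T o).degree (n + 1) =
    ((X.V.card : ℤ) - 1) * n + (1 - n) * X.E.card := by
  have h1 := card_solid_add (X.cfg T o)
  rw [solid_cfg h.subset] at h1
  have h2 : ((X.cfg T o).dotted.card : ℤ) = X.E.card - T.card := by
    have : (X.cfg T o).E = X.E := rfl
    rw [this] at h1
    omega
  have h3 : (X.V.card : ℤ) = T.card + 1 := by exact_mod_cast h.card.symm
  rw [NG.degree_eq, h2, show (X.cfg T o).V = X.V from rfl, show (X.cfg T o).E = X.E from rfl, h3]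
  ring

lemma hsum_congr {ψ χ : NG k → M} (h : ∀ X : NG k, X.WF → X.degree (n + 1) = d → ψ X = χ X) (hw :
    X.WF) (hd : ((X.V.card : ℤ) - 1) * n + (1 - n) * X.E.card = d) : hsum n ψ X = hsum n χ X := by
  refine sum_congr rfl fun x _ => ?_
  congr 1
  refine sum_congr rfl fun T hτ => ?_
  rw [hterm, hterm, h _ (hw.cfg _ _) ((degree_cfg (mem_trees.1 hτ) _).trans hd)]

variable (K k n) in
/-- The map `h` on generators. -/
def hMap (d : ℤ) : (GCGen k n d →₀ K) →ₗ[K] (SGCGen k (n + 1) d →₀ K) :=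
  linearCombination K fun X => hGraph K n d X.1.2.2

variable (K n) in
lemma hMap_gcGen {G : Graph k v e} (hG : G.IsGC) (hd : (v : ℤ) * n + (1 - n) * (e : ℤ) = d) : hMap K
    k n d (gcGen K n d G) = hGraph K n d G := by
  rw [gcGen_of ⟨hG, hd⟩]
  exact (linearCombination_single _ _ _).trans (one_smul _ _)

lemma sum_trees_toNG (G : SGraph k v e) (F : Finset ℕ → M) : ∑ D ∈ (toNG G).E.powerset.filter (toNG
    G).Tree, F D = ∑ T ∈ univ.filter fun T => G.toGraph.IsSpanningTree T, F (T.map valEmbedding) :=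
    by
  symm
  refine Finset.sum_bij (fun T _ => T.map valEmbedding) (fun T hτ => ?_) (fun T _ T' _ h =>
    Finset.map_injective _ h) (fun D hT => ?_) fun T _ => rfl
  · exact mem_trees.2 ((tree_toNG G T).2 (mem_filter.1 hτ).2)
  · have hT := mem_trees.1 hT
    obtain ⟨T, -, rfl⟩ := Finset.subset_map_iff.1 ((lab_toNG G).E_eq ▸ hT.subset)
    exact ⟨T, mem_filter.2 ⟨mem_univ _, (tree_toNG G T).1 hT⟩, rfl⟩

lemma map_hGraph (hL : sgcRel K k (n + 1) d ≤ ker L) {G : SGraph k v e} (hG : G.toGraph.Reduced) : L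
    (hGraph K n d G.toGraph) = hsum n (ext (n + 1) (sgcFun d L)) (toNG G) :=
    by
  have hl := lab_toNG G
  rw [hGraph, hsum, map_sum, hl.V_eq, sum_map]
  refine sum_congr rfl fun x _ => ?_
  rw [map_zsmul, map_sum]
  have hv : (toNG G).val (x : ℕ) = G.valence x := hl.val_eq x
  simp only [coeFn_mk]
  rw [hv]
  congr 1
  rw [sum_trees_toNG]
  refine sum_congr rfl fun T hτ => ?_
  have hlc := lab_cfg G T x
  rw [map_zsmul, hterm, hSign_eq G T x (mem_filter.1 hτ).2, ext_lab (finAlt_sgcFun hL) hlc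
    val_strictMono val_strictMono (hlc.reduced_iff.2 hG).not_fusable]
  rfl

variable [CharZero K]

lemma map_hMap_gcGen (hL : sgcRel K k (n + 1) d ≤ ker L) {G : SGraph k v e} {i : Fin (v + 1) → ℕ} {j
    : Fin e → ℕ} (hl : Lab X G i j) (hi : StrictMono i) (hj : StrictMono j) (hw : X.WF) (hd : (v :
    ℤ) * n + (1 - n) * (e : ℤ) = d) : L (hMap K k n d (gcGen K n d G.toGraph)) = hsum n (ext (n + 1)
    (sgcFun d L)) X := by
  have hψ := good_sgc hL
  by_cases hG : G.toGraph.IsGC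
  · rw [hMap_gcGen K n hG hd, map_hGraph hL hG.toReduced, hsum_eq_toNG hψ.alt hl hi hj]
  · rw [gcGen, dif_neg fun h => hG h.1, map_zero, map_zero, hsum_eq_zero hψ hl.closed]
    by_contra hb
    rw [not_or] at hb
    exact hG (hl.isGC_iff.2 ⟨hw, hb⟩)

lemma hMap_map_rel (d : ℤ) : gcRel K k n d ≤ (sgcRel K k (n + 1) d).comap (hMap K k n d) := by
  rw [gcRel, span_le]
  rintro _ ⟨v, e, G, σ, ρ, f, rfl⟩
  set L := (sgcRel K k (n + 1) d).mkQ with hLdef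
  have hL : sgcRel K k (n + 1) d ≤ ker L := (ker_mkQ _).ge
  rw [SetLike.mem_coe, mem_comap, ← ker_mkQ (sgcRel K k (n + 1) d), mem_ker, map_sub, map_sub,
    map_zsmul, map_zsmul, sub_eq_zero]
  by_cases hG : G.IsGC ∧ (v : ℤ) * n + (1 - n) * (e : ℤ) = d
  · have hl := lab_toNG G.toS
    have hl' := lab_toNG (G.toS.relabel σ ρ f)
    have hG' : (G.toS.relabel σ ρ f).toGraph.IsGC := hG.1.relabel σ ρ f
    have h1 := map_hMap_gcGen hL hl val_strictMono val_strictMono (hl.isGC_iff.1 hG.1).1 hG.2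
    have h2 := map_hMap_gcGen hL hl' val_strictMono val_strictMono (hl'.isGC_iff.1 hG').1 hG.2
    have h3 := hsum_lab (good_sgc hL).alt hl val_strictMono val_strictMono hl'
      val_strictMono val_strictMono
    exact h2.trans (h3.trans (congrArg _ h1.symm))
  · have hG' : ¬ ((G.relabel σ ρ f).IsGC ∧ (v : ℤ) * n + (1 - n) * (e : ℤ) = d) := fun h =>
      hG ⟨(Graph.isGC_relabel_iff σ ρ f).1 h.1, h.2⟩
    rw [gcGen, gcGen, dif_neg hG, dif_neg hG']
    simp

lemma hMap_map_bd {i j : ℤ} (hij : j + 1 = i) (x : GCGen k n i →₀ K) : sgcD K k (n + 1) i j (hMap K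
    k n i x) - hMap K k n j (gcD K k n i j x) ∈ sgcRel K k (n + 1) j := by
  set L := (sgcRel K k (n + 1) j).mkQ with hLdef
  have hL : sgcRel K k (n + 1) j ≤ ker L := (ker_mkQ _).ge
  rw [← ker_mkQ (sgcRel K k (n + 1) j), mem_ker, map_sub, sub_eq_zero]
  have hlin : L ∘ₗ sgcD K k (n + 1) i j ∘ₗ hMap K k n i = L ∘ₗ hMap K k n j ∘ₗ gcD K k n i j := by
    refine finsupp_lhom_ext fun a => ?_
    rw [single_gc]
    obtain ⟨⟨v, e, G⟩, hG, hd⟩ := a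
    simp only at hG hd
    have hψ := good_sgc hL
    have hl := lab_toNG G.toS
    have hw : (toNG G.toS).WF := (hl.isGC_iff.1 hG).1
    have hL' : sgcRel K k (n + 1) i ≤ ker (L ∘ₗ sgcD K k (n + 1) i j) := fun x hx => by
      rw [mem_ker]
      exact hL (sgc_bd_rel i j hx)
    change (L ∘ₗ sgcD K k (n + 1) i j) (hMap K k n i (gcGen K n i G)) =
      L (hMap K k n j (gcD K k n i j (gcGen K n i G)))
    have e1 := map_hMap_gcGen hL' hl val_strictMono val_strictMono hw hd
    have e2 := hsum_congr (n := n) (χ := del (n + 1) (ext (n + 1) (sgcFun j L))) (d := i)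
      (fun X hw hd => sgc_ext_eq hL hw hd) hw (by rw [hl.card_V, hl.card_E, ← hd]; push_cast; ring)
    have hends : ∀ t r, (toNG G.toS).ends (t : Fin e) r = (G.ends t r : ℕ) :=
      fun t r => hl.ends_eq t r
    rw [show hMap K k n i (gcGen K n i G) = hMap K k n i (gcGen K n i G.toS.toGraph) from rfl, e1, e2,
      ← del_hsum hψ.alt (fun X hc h => hψ.bad X hc (Or.inr (Or.inl h))) hw.closed]
    · rw [gcGen_of ⟨hG, hd⟩, gcD, linearCombination_single, one_smul]
      change _ = L (hMap K k n j (gcBd K n j v e G))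
      rw [del, sum_E_toNG]
      rcases e with _ | e
      · cases v <;> simp [gcBd]
      rcases v with _ | v
      · exact absurd (Subsingleton.elim (α := Fin 1) _ _) (hG.no_tadpole 0)
      rw [gcBd, map_sum, map_sum]
      refine sum_congr rfl fun t _ => ?_
      have hne : G.ends t false ≠ G.ends t true := hG.no_tadpole t
      have hne' : (toNG G.toS).ends t false ≠ (toNG G.toS).ends t true := by
        rw [hends, hends]; exact fun e => hne (val_injective e)
      have hwc := hw.contract (hl.j_mem t) hne' true
      rw [map_zsmul, map_zsmul, term_some (hl.j_mem t) (s := true) (by rw [hl.ty_eq]; rfl) hne',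
        hends, hends, hl.aft_citem val_strictMono val_strictMono]
      have hcard : (G.toS.solid.filter fun a => t < a).card = e - t := by
        have : (univ.filter fun a => t < a) = Finset.Ioi t := by ext; simp
        rw [solid_toS, this, Fin.card_Ioi]
        rfl
      rw [hcard, dotted_toS, Finset.card_empty, add_zero]
      congr 1
      rw [hends, hends] at hwc
      have hc : Lab _ (G.contract t (G.ends t false) (G.ends t true)).toS _ _ := hl.contract t hne
      refine (map_hMap_gcGen hL hc (val_strictMono.comp (strictMono_succAbove _))
        (val_strictMono.comp (strictMono_succAbove _)) hwc ?_).symm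
      push_cast at hd
      linarith
    · intro a ha
      obtain ⟨a, rfl⟩ := hl.exists_j ha
      exact hl.ty_eq a
    · intro a ha
      obtain ⟨a, rfl⟩ := hl.exists_j ha
      rw [hends, hends]
      exact fun e => hG.no_tadpole a (val_injective e)
  exact LinearMap.congr_fun hlin x

variable (K k n) in
lemma isChainMap_h : Presentation.IsChainMap (GC K k n) (SGC K k (n + 1)) (h K k n) where
  map_rel d := hMap_map_rel d
  map_bd _ _ hij x := hMap_map_bd hij x

end

section

/-! ### The differential on the types of the edges of a fixed graph -/

/-- The types of the edges. -/
abbrev Ty (e : ℕ) := Fin e → Option Bool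

variable {K : Type u} [Field K] {e : ℕ} {m : ℤ}
variable {ty : Ty e} {a : Fin e} {U : Finset (Fin e)} {o : Option Bool} {t : Fin e}

/-- The odd edges. -/
def oddT (m : ℤ) (ty : Ty e) : Finset (Fin e) := univ.filter fun a => (Even m ↔ ty a ≠ none)

/-- The coefficient of a solid edge in the differential of a dotted edge. -/
def cc (m : ℤ) : Option Bool → ℤ
  | none => 0
  | some true => 1
  | some false => - eps m

/-- The sign of moving the edge `t` to the end. -/
def aftT (m : ℤ) (ty : Ty e) (t : Fin e) : ℤ := aft id (oddT m ty) t

/-- The differential on coefficients. -/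
def bdT (m : ℤ) (z : Ty e → K) (ty : Ty e) : K :=
  ∑ t, ((aftT m ty t * cc m (ty t) : ℤ) : K) * z (update ty t none)

lemma bdT_congr {z z' : Ty e → K} (h : ∀ t, ty t ≠ none → z (update ty t none) = z' (update ty t
    none)) : bdT m z ty = bdT m z' ty := by
  refine sum_congr rfl fun t _ => ?_
  by_cases ht : ty t = none
  · simp [ht, cc]
  · rw [h t ht]

lemma bdT_add (z z' : Ty e → K) (ty : Ty e) : bdT m (fun ty => z ty + z' ty) ty = bdT m z ty + bdT m
    z' ty := by
  simp only [bdT, mul_add, sum_add_distrib]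

lemma bdT_mul (c : K) (z : Ty e → K) (ty : Ty e) : bdT m (fun ty => c * z ty) ty = c * bdT m z ty :=
    by
  simp only [bdT, mul_sum]
  exact sum_congr rfl fun t _ => by ring

lemma oddT_update (h : ty t = none ↔ o ≠ none) : oddT m (update ty t o) = tog (oddT m ty) t := by
  ext a
  rw [mem_tog]
  by_cases ha : a = t
  · subst ha
    simp only [oddT, mem_filter, mem_univ, true_and, update_self]
    rcases o with _ | o
    · grind
    · grind
  · simp [oddT, ha]

lemma aftT_update (h : ty t = none ↔ o ≠ none) (c : Fin e) : aftT m (update ty t o) c = sg (c < t) *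
    aftT m ty c := by
  rw [aftT, oddT_update h, aft_tog]; rfl

lemma aftT_update_self (h : ty t = none ↔ o ≠ none) : aftT m (update ty t o) t = aftT m ty t := by
  rw [aftT_update h]; simp

lemma aftT_mul_self (ty : Ty e) (t : Fin e) : ((aftT m ty t : ℤ) : K) * (aftT m ty t : ℤ) = 1 := by
  rw [← cast_mul, aftT, aft_mul_self, Int.cast_one]

lemma sg_lt_mul {t a : Fin e} (h : t ≠ a) : sg (t < a) = - sg (a < t) := by
  rcases lt_or_gt_of_ne h with h | h <;> simp [sg, h, h.not_gt]

lemma bdT_bdT [CharZero K] (z : Ty e → K) (ty : Ty e) : bdT m (bdT m z) ty = 0 := by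
  set F : Fin e → Fin e → K := fun t t' =>
    ((aftT m ty t * cc m (ty t) : ℤ) : K) * (((aftT m (update ty t none) t' * cc m (update ty t none
      t') : ℤ) : K) * z (update (update ty t none) t' none)) with hF
  have hanti : ∀ t t', F t t' = - F t' t := by
    intro t t'
    by_cases h : t = t'
    · subst h; simp [hF, cc]
    by_cases h1 : ty t = none
    · simp [hF, h1, update_of_ne h, cc]
    by_cases h2 : ty t' = none
    · simp [hF, h2, update_of_ne (Ne.symm h), cc]
    simp only [hF]
    rw [aftT_update (by simp [h1]), aftT_update (by simp [h2]), update_of_ne (Ne.symm h),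
      update_of_ne h, update_comm h, sg_lt_mul h]
    push_cast
    ring
  have h1 : bdT m (bdT m z) ty = ∑ t, ∑ t', F t t' := by
    rw [bdT]
    exact sum_congr rfl fun t _ => by rw [bdT, mul_sum]
  have h2 : ∑ t, ∑ t', F t t' = - ∑ t, ∑ t', F t t' := by
    conv_lhs => rw [sum_comm]
    rw [← Finset.sum_neg_distrib]
    exact sum_congr rfl fun t _ => by
      rw [← Finset.sum_neg_distrib]
      exact sum_congr rfl fun t' _ => hanti t' t
  rw [h1]
  exact self_eq_neg.1 h2

lemma bdT_split (z : Ty e → K) {ρ : Ty e} (ha : ρ a = none) (s : Bool) : (aftT m ρ a : ℤ) * bdT m z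
    (update ρ a (some s)) = (cc m (some s) : ℤ) * z ρ - bdT m (fun ρ' => (aftT m ρ' a : ℤ) * z
    (update ρ' a (some s))) ρ := by
  rw [bdT, bdT, ← add_sum_erase _ _ (mem_univ a), ← add_sum_erase (univ : Finset (Fin e)) (fun t =>
    _ * _) (mem_univ a), mul_add, mul_sum]
  have h1 : update (update ρ a (some s)) a none = ρ := by
    grind
  rw [h1, aftT_update_self (by simp [ha]), update_self, ha, cc.eq_1]
  have h2 : ∀ t ∈ univ.erase a, (aftT m ρ a : K) *
      (((aftT m (update ρ a (some s)) t * cc m (update ρ a (some s) t) : ℤ) : K) * z (update (update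
        ρ a (some s)) t none)) =
      - (((aftT m ρ t * cc m (ρ t) : ℤ) : K) * (((aftT m (update ρ t none) a : ℤ) : K) *
        z (update (update ρ t none) a (some s)))) := by
    intro t ht
    have hta := ne_of_mem_erase ht
    rw [update_of_ne hta, update_comm hta.symm]
    by_cases h : ρ t = none
    · simp [h, cc]
    rw [aftT_update (by simp [ha]), aftT_update (by simp [h]), sg_lt_mul hta]
    push_cast
    ring
  rw [sum_congr rfl h2, Finset.sum_neg_distrib]
  have h3 := aftT_mul_self (K := K) (m := m) ρ a
  push_cast
  linear_combination ((cc m (some s) : ℤ) : K) * z ρ * h3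

/-! ### Ranks -/

variable {v : ℕ} {ends : Fin e → Bool → Fin (v + 1)} {T D : Finset (Fin e)}

/-- There is a function on the vertices which is constant along the edges of `D` and increases along
the other solid edges. -/
def Ranked (ends : Fin e → Bool → Fin (v + 1)) (D : Finset (Fin e)) (ty : Ty e) : Prop :=
  ∃ l : Fin (v + 1) → ℕ, (∀ a ∈ D, l (ends a false) = l (ends a true)) ∧
    ∀ a ∉ D, ∀ s, ty a = some s → l (ends a !s) < l (ends a s)

lemma Ranked.update_none (h : Ranked ends D ty) (t : Fin e) : Ranked ends D (update ty t none) :=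
    by
  obtain ⟨l, h1, h2⟩ := h
  refine ⟨l, h1, fun a ha s hs => h2 a ha s ?_⟩
  by_cases hat : a = t
  · grind
  · grind

/-- The edge `a` is separated by a function that is constant along the edges of `D`. -/
def Separated (ends : Fin e → Bool → Fin (v + 1)) (D : Finset (Fin e)) (a : Fin e) : Prop :=
  ∃ χ : Fin (v + 1) → ℕ, (∀ x, χ x ≤ 1) ∧ (∀ b ∈ D, χ (ends b false) = χ (ends b true)) ∧
    χ (ends a false) ≠ χ (ends a true)

lemma Separated.exists_lt (h : Separated ends D a) (s : Bool) : ∃ χ : Fin (v + 1) → ℕ, (∀ x, χ x ≤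
    1) ∧ (∀ b ∈ D, χ (ends b false) = χ (ends b true)) ∧ χ (ends a !s) < χ (ends a s) := by
  obtain ⟨χ, h1, h2, h3⟩ := h
  have h4 : χ (ends a s) ≠ χ (ends a !s) := by cases s; exacts [h3, h3.symm]
  rcases lt_or_gt_of_ne h4 with h | h
  · refine ⟨fun x => 1 - χ x, fun x => Nat.sub_le _ _, fun b hb => by simp only [h2 b hb], ?_⟩
    have := h1 (ends a !s)
    simp only
    omega
  · exact ⟨χ, h1, h2, h⟩

lemma Ranked.update_some (hsep : Separated ends D a) {s : Bool} {l : Fin (v + 1) → ℕ} (h1 : ∀ a ∈ D,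
    l (ends a false) = l (ends a true)) (h2 : ∀ b ∉ D, b ≠ a → ∀ s, ty b = some s → l (ends b !s) <
    l (ends b s)) (h3 : l (ends a !s) ≤ l (ends a s)) : Ranked ends D (update ty a (some s)) := by
  obtain ⟨χ, c1, c2, c3⟩ := hsep.exists_lt s
  refine ⟨fun x => 2 * l x + χ x, fun b hb => by simp only [h1 b hb, c2 b hb], fun b hb r hr => ?_⟩
  simp only
  by_cases hba : b = a
  · grind
  · grind

lemma ranked_or (hsep : Separated ends D a) (h : Ranked ends D ty) : Ranked ends D (update ty a
    (some true)) ∨ Ranked ends D (update ty a (some false)) := by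
  obtain ⟨l, h1, h2⟩ := h
  rcases le_total (l (ends a false)) (l (ends a true)) with h | h
  · exact Or.inl (Ranked.update_some hsep h1 (fun b hb _ => h2 b hb) h)
  · exact Or.inr (Ranked.update_some hsep h1 (fun b hb _ => h2 b hb) h)

lemma Ranked.of_insert (hsep : Separated ends D a) (h : Ranked ends (insert a D) ty) (s : Bool) :
    Ranked ends D (update ty a (some s)) := by
  obtain ⟨l, h1, h2⟩ := h
  have h3 := h1 a (mem_insert_self _ _)
  refine Ranked.update_some hsep (l := l) (fun b hb => h1 b (mem_insert_of_mem hb))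
    (fun b hb hba => h2 b (by simp [hb, hba])) ?_
  cases s
  exacts [h3.ge, h3.le]

lemma Ranked.insert (haT : a ∉ D) (h : Ranked ends D (update ty a (some true))) (h' : Ranked ends D
    (update ty a (some false))) : Ranked ends (insert a D) ty := by
  obtain ⟨l, h1, h2⟩ := h
  obtain ⟨l', h1', h2'⟩ := h'
  have h3 := h2 a haT true (update_self _ _ _)
  have h3' := h2' a haT false (update_self _ _ _)
  simp only [Bool.not_true, Bool.not_false] at h3 h3'
  obtain ⟨c, hc⟩ := Nat.exists_eq_add_of_lt h3
  obtain ⟨c', hc'⟩ := Nat.exists_eq_add_of_lt h3'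
  refine ⟨fun x => (c' + 1) * l x + (c + 1) * l' x, fun b hb => ?_, fun b hb s hs => ?_⟩
  · grind
  · rw [mem_insert, not_or] at hb
    have e1 := h2 b hb.2 s (by rw [update_of_ne hb.1, hs])
    have e2 := h2' b hb.2 s (by rw [update_of_ne hb.1, hs])
    simp only
    gcongr

/-! ### Exactness -/

/-- The product of the signs of the reversed edges. -/
def revT (m : ℤ) (ty : Ty e) : ℤ := ∏ a, if ty a = some false then eps m else 1

/-- The functional that detects the homology: the sum over all orientations of the edges in `U`. -/
def epsT (m : ℤ) (U : Finset (Fin e)) (z : Ty e → K) : K :=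
  ∑ ty : Ty e with (∀ a, ty a ≠ none ↔ a ∈ U), (revT m ty : K) * z ty

lemma revT_update (ty : Ty e) (ha : ty a = none) (s : Bool) : revT m (update ty a (some s)) = (if s
    = false then eps m else 1) * revT m ty := by
  rw [revT, revT, ← mul_prod_erase _ _ (mem_univ a), ← mul_prod_erase (univ : Finset (Fin e)) (fun b
    => if ty b = some false then _ else _) (mem_univ a), update_self, ha]
  simp only [some_inj, reduceCtorEq, if_false, one_mul]
  congr 1
  exact prod_congr rfl fun b hb => by rw [update_of_ne (ne_of_mem_erase hb)]

lemma sum_update {M : Type*} [AddCommMonoid M] (a : Fin e) (F : Ty e → M) (hF : ∀ ty, ty a = none →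
    F ty = 0) : ∑ ty, F ty = ∑ ρ : Ty e with ρ a = none, ∑ s : Bool, F (update ρ a (some s)) := by
  rw [← Finset.sum_filter_add_sum_filter_not univ (fun ty : Ty e => ty a = none),
    sum_eq_zero (s := univ.filter _) fun ty hty => hF ty (mem_filter.1 hty).2,
    zero_add, ← Finset.sum_product']
  symm
  refine Finset.sum_bij' (fun p _ => update p.1 a (some p.2))
    (fun ty _ => (update ty a none, (ty a).getD false)) ?_ ?_ ?_ ?_ fun _ _ => rfl
  · grind
  · grind
  · rintro ⟨ρ, s⟩ h
    have : ρ a = none := by grind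
    simp only [update_idem, update_self, Option.getD_some, Prod.mk.injEq, and_true]
    rw [← this, update_eq_self]
  · intro ty h
    have : ty a ≠ none := by grind
    obtain ⟨s, hs⟩ := ne_none_iff_exists'.1 this
    simp only [update_idem, hs, Option.getD_some]
    rw [← hs, update_eq_self]

lemma epsT_insert (ha : a ∉ U) (z : Ty e → K) : epsT m (insert a U) z = epsT m U fun ρ => z (update
    ρ a (some true)) + (eps m : ℤ) * z (update ρ a (some false)) := by
  rw [epsT, sum_filter, sum_update a, epsT, sum_filter, sum_filter]
  · refine sum_congr rfl fun ρ _ => ?_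
    by_cases hρ : ρ a = none
    · have h1 : ∀ s, (∀ b, update ρ a (some s) b ≠ none ↔ b ∈ insert a U) ↔
          ∀ b, ρ b ≠ none ↔ b ∈ U := fun s => by
        refine forall_congr' fun b => ?_
        by_cases hb : b = a
        · subst hb; simp [hρ, ha]
        · rw [update_of_ne hb, mem_insert, or_iff_right hb]
      simp only [hρ, if_true, h1, Fintype.sum_bool, revT_update ρ hρ, reduceCtorEq, if_false]
      split_ifs
      · push_cast; ring
      · simp
    · grind
  · grind

variable (K m ends) in
/-- Cycles on which `epsT` vanishes are boundaries if the edges in `D` are contracted. -/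
def ExactOn (D U : Finset (Fin e)) : Prop :=
  ∀ z : Ty e → K, (∀ ty, (∀ b ∈ D, ty b = none) → Ranked ends D ty → bdT m z ty = 0) →
    epsT m U z = 0 → ∃ w, ∀ ty, (∀ b ∈ D, ty b = none) → Ranked ends D ty → z ty = bdT m w ty

lemma ExactOn.step [CharZero K] (haT : a ∉ D) (haU : a ∉ U) (hsep : Separated ends D a) (ih :
    ExactOn K m ends (insert a D) U) : ExactOn K m ends D (insert a U) := by
  intro z hz hε
  have hee : ((eps m : ℤ) : K) * (eps m : ℤ) = 1 := by
    rw [← cast_mul, eps_mul_self, Int.cast_one]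
  set zz : Bool → Ty e → K := fun s ρ => (aftT m ρ a : ℤ) * z (update ρ a (some s)) with hzz
  have hzs : ∀ (ρ : Ty e), (∀ b ∈ insert a D, ρ b = none) → ∀ s,
      Ranked ends D (update ρ a (some s)) →
      bdT m (zz s) ρ = (cc m (some s) : ℤ) * z ρ := fun ρ h s hr => by
    have h1 := bdT_split (m := m) z (h a (mem_insert_self _ _)) s
    rw [hz _ (by grind) hr, mul_zero] at h1
    exact (sub_eq_zero.1 h1.symm).symm
  obtain ⟨ω, hω⟩ := ih (fun ρ => zz true ρ + (eps m : ℤ) * zz false ρ) (fun ρ h hr => by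
    rw [bdT_add, bdT_mul, hzs ρ h _ (hr.of_insert hsep _), hzs ρ h _ (hr.of_insert hsep _)]
    simp only [cc]
    push_cast
    linear_combination - z ρ * hee) (by
    set c : ℤ := aft id (univ.filter fun b => (Even m ↔ b ∈ U)) a with hc
    rw [epsT_insert haU, epsT] at hε
    rw [epsT, ← mul_zero (c : K), ← hε, mul_sum]
    refine sum_congr rfl fun ρ hρ => ?_
    have h1 : aftT m ρ a = c := by
      rw [aftT, hc, oddT]
      simp only [(mem_filter.1 hρ).2]
    simp only [hzz, h1]
    ring)
  set w0 : Ty e → K := fun ρ => if Ranked ends D (update ρ a (some true)) then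
    zz true ρ - bdT m ω ρ else - (eps m : ℤ) * zz false ρ with hw0
  have hw0f : ∀ (ρ : Ty e), (∀ b ∈ insert a D, ρ b = none) →
      Ranked ends D (update ρ a (some false)) → w0 ρ = - (eps m : ℤ) * zz false ρ :=
    fun ρ h hr => by
      simp only [hw0]
      split_ifs with h1
      · rw [← hω ρ h (h1.insert haT hr)]; ring
      · rfl
  set w : Ty e → K := fun ty => match ty a with
    | none => w0 ty
    | some true => - (aftT m (update ty a none) a : ℤ) * ω (update ty a none)
    | some false => 0 with hw
  have hwn : ∀ ρ : Ty e, ρ a = none → w ρ = w0 ρ := by grind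
  have hupd : ∀ ρ : Ty e, ρ a = none → ∀ s, update (update ρ a (some s)) a none = ρ := by grind
  have hrn : ∀ (ρ : Ty e) (t : Fin e) (s : Bool), ρ a = none → ρ t ≠ none →
      Ranked ends D (update ρ a (some s)) → Ranked ends D (update (update ρ t none) a (some s)) :=
    fun ρ t s h ht hr => by
      rw [update_comm fun e : t = a => ht (e ▸ h)]
      exact hr.update_none t
  have hwt : ∀ ρ : Ty e, ρ a = none →
      w (update ρ a (some true)) = - (aftT m ρ a : ℤ) * ω ρ := by grind
  have hwf : ∀ ρ : Ty e, w (update ρ a (some false)) = 0 := by grind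
  refine ⟨w, fun ty hty hr => ?_⟩
  set ρ := update ty a none with hρ
  have hρa : ρ a = none := by simp [hρ]
  have hρT : ∀ b ∈ insert a D, ρ b = none := by grind
  have hη := aftT_mul_self (K := K) (m := m) ρ a
  rcases hta : ty a with _ | s
  · have hty' : ty = ρ := by grind
    rw [hty'] at hr ⊢
    by_cases h1 : Ranked ends D (update ρ a (some true))
    · rw [bdT_congr (z' := fun ρ => zz true ρ + (-1) * bdT m ω ρ) fun t ht => by
        rw [hwn _ (by grind)]
        simp only [hw0]
        rw [if_pos (hrn ρ t _ hρa ht h1)]; ring, bdT_add, bdT_mul, bdT_bdT, hzs ρ hρT _ h1]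
      simp [cc]
    · have h2 := (ranked_or hsep hr).resolve_left h1
      rw [bdT_congr (z' := fun ρ => - (eps m : ℤ) * zz false ρ) fun t ht => by
        rw [hwn _ (by grind), hw0f _ (by grind) (hrn ρ t _ hρa ht h2)], bdT_mul,
        hzs ρ hρT _ h2]
      simp only [cc]
      push_cast
      linear_combination (- z ρ) * hee
  · have hty' : ty = update ρ a (some s) := by
      rw [hρ, update_idem, ← hta, update_eq_self]
    rw [hty'] at hr ⊢
    have h1 := bdT_split (m := m) w hρa s
    cases s
    · have h2 : bdT m (fun ρ' => (aftT m ρ' a : ℤ) * w (update ρ' a (some false))) ρ =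
          bdT m (fun _ => (0 : K) * 0) ρ := by grind
      rw [h2, bdT_mul, hwn _ hρa, hw0f ρ hρT hr] at h1
      simp only [cc, hzz] at h1
      push_cast at h1
      linear_combination (-(aftT m ρ a : ℤ) : K) * h1 + (bdT m w (update ρ a (some false)) - ((eps m
        : ℤ) : K) ^ 2 * z (update ρ a (some false))) * hη -
          z (update ρ a (some false)) * hee
    · have h2 : bdT m (fun ρ' => (aftT m ρ' a : ℤ) * w (update ρ' a (some true))) ρ =
          bdT m (fun ρ => (-1 : K) * ω ρ) ρ := bdT_congr fun t _ => by
        rw [hwt _ (by grind)]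
        linear_combination (- ω (update ρ t none)) *
          aftT_mul_self (K := K) (m := m) (update ρ t none) a
      rw [h2, bdT_mul, hwn _ hρa] at h1
      simp only [hw0, if_pos hr, cc, hzz] at h1
      push_cast at h1
      linear_combination (-(aftT m ρ a : ℤ) : K) * h1 + (bdT m w (update ρ a (some true)) - z
        (update ρ a (some true))) * hη

lemma Separated.mono (h : Separated ends T a) (hD : D ⊆ T) : Separated ends D a :=
  let ⟨χ, h1, h2, h3⟩ := h
  ⟨χ, h1, fun b hb => h2 b (hD hb), h3⟩

lemma exactOn_of_subset [CharZero K] (hconn : ∀ l : Fin (v + 1) → ℕ, (∀ a ∈ T, l (ends a false) = l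
    (ends a true)) → ∀ x y, l x = l y) (hsep : ∀ a ∈ T, Separated ends (T.erase a) a) (hU : U ⊆ T) :
    ExactOn K m ends (T \ U) U := by
  induction U using induction_on with
  | empty =>
    intro z _ hε
    rw [Finset.sdiff_empty]
    refine ⟨0, fun ty h ⟨l, h1, h2⟩ => ?_⟩
    have hty : ∀ a, ty a = none := fun a => by
      by_cases ha : a ∈ T
      · exact h a ha
      by_contra hne
      obtain ⟨s, hs⟩ := ne_none_iff_exists'.1 hne
      exact (h2 a ha s hs).ne (hconn l h1 _ _)
    rw [epsT, sum_eq_single ty] at hε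
    · have : revT m ty = 1 := prod_eq_one fun a _ => by simp [hty a]
      rw [this, Int.cast_one, one_mul] at hε
      rw [hε]
      simp [bdT]
    · intro b hb hne
      refine absurd (funext fun a => ?_) hne
      have := (mem_filter.1 hb).2 a
      simp only [notMem_empty, iff_false, not_not] at this
      rw [this, hty]
    · intro hn
      exact absurd (mem_filter.2 ⟨mem_univ _, by simp [hty]⟩) hn
  | insert a U ha ih =>
    have haτ : a ∈ T := by grind
    refine .step (by simp) ha ((hsep a haτ).mono (by grind)) ?_
    rw [show insert a (T \ insert a U) = T \ U by grind]
    exact ih ((Finset.subset_insert a U).trans hU)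

/-- The functional `epsT` for a spanning tree detects the homology modulo the graphs with directed
cycles. -/
lemma exists_eq_bdT [CharZero K] (hconn : ∀ l : Fin (v + 1) → ℕ, (∀ a ∈ T, l (ends a false) = l
    (ends a true)) → ∀ x y, l x = l y) (hsep : ∀ a ∈ T, Separated ends (T.erase a) a) (z : Ty e → K)
    (hz : ∀ ty, Ranked ends ∅ ty → bdT m z ty = 0) (hε : epsT m T z = 0) : ∃ w, ∀ ty, Ranked ends ∅
    ty → z ty = bdT m w ty := by
  simpa [hε] using exactOn_of_subset (m := m) hconn hsep le_rfl z (by simpa using hz)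

lemma ranked_of_tree (hsep : ∀ a ∈ T, Separated ends (T.erase a) a) (hty : ∀ a, ty a ≠ none → a ∈ T)
    : Ranked ends ∅ ty := by
  suffices H : ∀ U ⊆ T, ∀ ty : Ty e, (∀ a, ty a ≠ none → a ∈ U) → Ranked ends (T \ U) ty by
    have := H T le_rfl ty hty
    rwa [Finset.sdiff_self] at this
  intro U
  induction U using induction_on with
  | empty =>
    intro _ ty h
    exact ⟨fun _ => 0, fun _ _ => rfl, fun a _ s hs => absurd (h a (by simp [hs])) (by simp)⟩
  | insert a U ha ih =>
    intro hU ty h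
    have haτ : a ∈ T := by grind
    have hT : insert a (T \ insert a U) = T \ U := by grind
    have hs : Separated ends (T \ insert a U) a := (hsep a haτ).mono (by grind)
    have h1 := ih ((Finset.subset_insert a U).trans hU) (update ty a none) fun b hb => by
      grind
    rw [← hT] at h1
    have h2 : ∀ o, ty a = o → update (update ty a none) a o = ty := by grind
    rcases hta : ty a with _ | s
    · have h3 := (h1.of_insert hs true).update_none a
      rwa [update_idem, update_idem, ← hta, update_eq_self] at h3
    · have h3 := h1.of_insert hs s
      rwa [h2 _ hta] at h3

/-- The adjoint of `bdT`: the differential of a dotted edge. -/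
def cobT {M : Type*} [AddCommGroup M] (m : ℤ) (g : Ty e → M) (ty : Ty e) : M :=
  ∑ t, if ty t = none then aftT m ty t •
    (g (update ty t (some true)) - eps m • g (update ty t (some false))) else 0

lemma sum_bdT_smul {M : Type*} [AddCommGroup M] [Module K M] (z : Ty e → K) (g : Ty e → M) : ∑ ty,
    bdT m z ty • g ty = ∑ ty, z ty • cobT m g ty := by
  simp only [bdT, cobT, Finset.sum_smul, smul_sum]
  rw [sum_comm, sum_comm (s := (univ : Finset (Ty e)))]
  refine sum_congr rfl fun t _ => ?_
  rw [sum_update t _ fun ty hty => by simp [hty, cc], sum_filter]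
  refine sum_congr rfl fun ρ _ => ?_
  by_cases hρ : ρ t = none
  · have h1 : ∀ s, update (update ρ t (some s)) t none = ρ := by grind
    rw [if_pos hρ, if_pos hρ, Fintype.sum_bool, h1, h1, aftT_update_self (by simp [hρ]),
      aftT_update_self (by simp [hρ]), update_self, update_self]
    simp only [cc]
    rw [← cast_smul_eq_zsmul K, ← cast_smul_eq_zsmul K (eps m)]
    push_cast
    module
  · rw [if_neg hρ, if_neg hρ, smul_zero]

lemma epsT_bdT (U : Finset (Fin e)) (z : Ty e → K) : epsT m U (bdT m z) = 0 := by
  set g : Ty e → K := fun ty => if (∀ a, ty a ≠ none ↔ a ∈ U) then (revT m ty : K) else 0 with hg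
  have h1 : epsT m U (bdT m z) = ∑ ty, bdT m z ty • g ty := by
    rw [epsT, sum_filter]
    refine sum_congr rfl fun ty _ => ?_
    simp only [hg, smul_eq_mul]
    split_ifs
    · ring
    · ring
  rw [h1, sum_bdT_smul]
  refine sum_eq_zero fun ty _ => ?_
  rw [cobT, sum_eq_zero, smul_zero]
  intro t _
  split_ifs with ht
  · have h2 : ∀ s, (∀ b, update ty t (some s) b ≠ none ↔ b ∈ U) ↔
        t ∈ U ∧ ∀ b, b ≠ t → (ty b ≠ none ↔ b ∈ U) := by grind
    simp only [hg, h2, revT_update ty ht, if_true, reduceCtorEq, if_false]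
    split_ifs
    · rw [← cast_smul_eq_zsmul K (eps m), smul_eq_mul, ← cast_mul, ← mul_assoc, eps_mul_self]
      simp
    · simp
  · rfl

end

section

open NG

/-! ### Averaging -/

/-- The data of a relabelling. -/
abbrev Rel (v e : ℕ) := Perm (Fin (v + 1)) × Perm (Fin e) × (Fin e → Bool)

variable {K : Type u} [Field K] {k v e : ℕ} {m n : ℤ}
variable {G : SGraph k v e} {X : Graph k v e}

def Rel.trans (g g' : Rel v e) : Rel v e :=
  (g.1.trans g'.1, g.2.1.trans g'.2.1, fun a => xor (g.2.2 a) (g'.2.2 (g.2.1 a)))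

lemma Rel.trans_bijective (g : Rel v e) : Function.Bijective g.trans := by
  refine Finite.injective_iff_bijective.1 fun g₁ g₂ h => ?_
  simp only [Rel.trans, Prod.mk.injEq] at h
  have h1 : g₁.1 = g₂.1 := Equiv.ext fun x => by
    simpa using congrArg (fun σ : Perm _ => σ (g.1.symm x)) h.1
  have h2 : g₁.2.1 = g₂.2.1 := Equiv.ext fun x => by
    simpa using congrArg (fun σ : Perm _ => σ (g.2.1.symm x)) h.2.1
  have h3 : g₁.2.2 = g₂.2.2 := funext fun x => by
    simpa using congrFun h.2.2 (g.2.1.symm x)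
  exact Prod.ext h1 (Prod.ext h2 h3)

/-- The relabelled graph. -/
abbrev SGraph.act (g : Rel v e) (G : SGraph k v e) : SGraph k v e := G.relabel g.1 g.2.1 g.2.2

abbrev SGraph.asgn (m : ℤ) (g : Rel v e) (G : SGraph k v e) : ℤ := G.relabelSign m g.1 g.2.1 g.2.2

lemma exists_sgn (m : ℤ) (G : SGraph k v e) (g : Rel v e) : ∃ (σ' ρ' : Perm ℕ) (f' : ℕ → Bool),
    Agree (toNG (G.act g)) ((toNG G).ren σ' ρ' f') ∧ (∀ x : Fin (v + 1), σ' x = g.1 x) ∧ (∀ x : Fin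
    e, ρ' x = g.2.1 x) ∧ (∀ x : Fin e, f' x = g.2.2 x) ∧ (toNG G).sgn m σ' ρ' f' = G.asgn m g :=
    by
  obtain ⟨σ', ρ', f', ha, hσ, hρ, hf⟩ := (lab_toNG G).exists_agree (lab_toNG (G.act g))
  exact ⟨σ', ρ', f', ha, hσ, hρ, hf, (lab_toNG G).sgn_eq val_strictMono val_strictMono
    val_strictMono val_strictMono hσ hρ hf m⟩

lemma asgn_trans (m : ℤ) (G : SGraph k v e) (g g' : Rel v e) : (G.act g).asgn m g' * G.asgn m g =
    G.asgn m (g.trans g') := by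
  obtain ⟨σ, ρ, f, ha, hσ, hρ, hf, hs⟩ := exists_sgn m G g
  obtain ⟨σ', ρ', f', ha', hσ', hρ', hf', hs'⟩ := exists_sgn m (G.act g) g'
  rw [← hs, ← hs', ha.sgn_eq, sgn_mul]
  refine (lab_toNG G).sgn_eq val_strictMono val_strictMono
    val_strictMono val_strictMono (fun x => ?_) (fun x => ?_) (fun x => ?_) m
  · simp [hσ, hσ', Rel.trans]
  · simp [hρ, hρ', Rel.trans]
  · simp [hρ, hf, hf', Rel.trans]

lemma asgn_mul_self (m : ℤ) (G : SGraph k v e) (g : Rel v e) : G.asgn m g * G.asgn m g = 1 := by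
  obtain ⟨σ, ρ, f, -, -, -, -, hs⟩ := exists_sgn m G g
  rw [← hs, sgn_mul_self]

variable (φ : ∀ v e, SGraph k v e → K)

/-- A function of labelled graphs after a relabelling. -/
def tw (m : ℤ) (g : Rel v e) (G : SGraph k v e) : K := (G.asgn m g : K) * φ v e (G.act g)

/-- The alternating part of a function of labelled graphs. -/
def avg (m : ℤ) : ∀ v e, SGraph k v e → K := fun v e G =>
  (Fintype.card (Rel v e) : K)⁻¹ * ∑ g : Rel v e, tw φ m g G

lemma finAlt_avg : FinAlt m (avg φ m) := by
  intro v e G σ ρ f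
  have h : ∀ g, tw φ m g (G.act (σ, ρ, f)) =
      (G.asgn m (σ, ρ, f) : K) * tw φ m (Rel.trans (σ, ρ, f) g) G := fun g => by
    have h1 := asgn_trans m G (σ, ρ, f) g
    have h2 := asgn_mul_self m G (σ, ρ, f)
    have h3 : (G.act (σ, ρ, f)).act g = G.act (Rel.trans (σ, ρ, f) g) :=
      SGraph.relabel_relabel G σ g.1 ρ g.2.1 f g.2.2
    rw [tw, tw, ← h1, h3]
    push_cast
    linear_combination (-((G.act (σ, ρ, f)).asgn m g : K) *
      φ v e (G.act (Rel.trans (σ, ρ, f) g))) * (by exact_mod_cast congrArg (Int.cast : ℤ → K) h2 :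
        (G.asgn m (σ, ρ, f) : K) * (G.asgn m (σ, ρ, f) : K) = 1)
  rw [← cast_smul_eq_zsmul K, smul_eq_mul, avg, avg, sum_congr rfl fun g _ => h g, ← mul_sum,
    (Rel.trans_bijective (σ, ρ, f)).sum_comp fun g => tw φ m g G]
  ring

lemma avg_eq [CharZero K] {c : K} (h : ∀ g, tw φ m g G = c) : avg φ m v e G = c := by
  rw [avg, sum_congr rfl fun g _ => h g, sum_const, card_univ, nsmul_eq_mul, inv_mul_cancel_left₀
    (Nat.cast_ne_zero.2 Fintype.card_ne_zero)]

/-- The dual of the part of the differential that acts on dotted edges. -/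
def cob (m : ℤ) : ∀ v e, SGraph k v e → K := fun v e G =>
  cobT m (fun ty => φ v e ⟨G.toGraph, ty⟩) G.ty

lemma oddEdges_eq (G : SGraph k v e) : G.oddEdges m = oddT m G.ty := by
  ext a
  unfold SGraph.oddEdges SGraph.solid SGraph.dotted oddT
  split_ifs with h <;> simp [h]

lemma aftT_mul_asgn {t : Fin e} (ht : G.ty t = none) (s : Bool) (g : Rel v e) : aftT m G.ty t *
    (G.makeSolid t s).asgn m g = (if g.2.2 t then - eps m else 1) * G.asgn m g * aftT m (G.act g).ty
    (g.2.1 t) := by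
  obtain ⟨σ, ρ, f⟩ := g
  have h1 : (G.makeSolid t s).oddEdges m = tog (oddT m G.ty) t := by
    rw [oddEdges_eq]; exact oddT_update (by simp [ht])
  have h2 : oddT m (G.act (σ, ρ, f)).ty = (oddT m G.ty).map ρ.toEmbedding := by
    ext a
    rw [mem_map_equiv]
    simp [oddT, SGraph.relabel]
  have h3 : (if Even m then ∏ a ∈ G.dotted, (if f a then (-1 : ℤ) else 1) else
      (Perm.sign σ : ℤ)) = (if f t then - eps m else 1) *
      if Even m then ∏ a ∈ (G.makeSolid t s).dotted, (if f a then (-1 : ℤ) else 1) else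
        (Perm.sign σ : ℤ) := by
    have hm : ∀ (H : SGraph k v e) a, a ∈ H.dotted ↔ H.ty a = none := fun H a => by
      simp [SGraph.dotted]
    have hd : G.dotted = insert t (G.makeSolid t s).dotted := by
      ext a
      by_cases hat : a = t <;> simp [hm, SGraph.makeSolid, hat, ht]
    have hn : t ∉ (G.makeSolid t s).dotted := by simp [hm, SGraph.makeSolid]
    rw [hd, prod_insert hn]
    by_cases hm : Even m <;> cases f t <;> simp [hm, eps]
  have h4 : aftT m (G.act (σ, ρ, f)).ty (ρ t) = aft ρ (oddT m G.ty) t := by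
    rw [aftT, h2]; exact aft_map ρ.toEmbedding _ _ t
  have h5 : (if f t then - eps m else 1) * (if f t then - eps m else 1) = (1 : ℤ) := by
    split_ifs <;> simp [eps_mul_self]
  simp only [SGraph.asgn, SGraph.relabelSign, inversions_eq_kap]
  rw [h3, h4, h1, oddEdges_eq, kap_tog injective_id ρ.injective, aftT]
  set B := if Even m then ∏ a ∈ (G.makeSolid t s).dotted, (if f a then (-1 : ℤ) else 1) else
        (Perm.sign σ : ℤ)
  set C : ℤ := if f t then - eps m else 1
  have h6 := aft_mul_self id (oddT m G.ty) t
  linear_combination (kap (oddT m G.ty) id ρ * aft ρ (oddT m G.ty) t * B) * (h6 - h5)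

lemma cob_tw (g : Rel v e) (G : SGraph k v e) : cobT m (fun ty => tw φ m g ⟨G.toGraph, ty⟩) G.ty =
    (G.asgn m g : K) * cob φ m v e (G.act g) := by
  rw [cob, cobT, cobT, mul_sum]
  refine (sum_congr rfl fun t _ => ?_).trans (Equiv.sum_comp g.2.1 _)
  by_cases ht : G.ty t = none
  · have ht' : (G.act g).ty (g.2.1 t) = none := by simp [SGraph.relabel, ht]
    have h1 : ∀ s, (⟨(G.act g).toGraph, update (G.act g).ty (g.2.1 t) (some s)⟩ :
        SGraph k v e) = (G.makeSolid t (xor (g.2.2 t) s)).act g := fun s => by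
      refine congrArg (SGraph.mk _) (funext fun a => ?_)
      by_cases ha : a = g.2.1 t
      · subst ha; simp [SGraph.makeSolid]
      · have : g.2.1.symm a ≠ t := fun h => ha (by simp [← h])
        simp [SGraph.relabel, SGraph.makeSolid, update_of_ne ha, update_of_ne this]
    have h2 := fun s => congrArg (Int.cast : ℤ → K) (aftT_mul_asgn (m := m) ht s g)
    have h3 : ((eps m : ℤ) : K) * (eps m : ℤ) = 1 := by
      exact_mod_cast congrArg (Int.cast : ℤ → K) (eps_mul_self m)
    rw [if_pos ht, if_pos ht', h1, h1]
    simp only [← cast_smul_eq_zsmul K, smul_eq_mul, tw]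
    change _ * (((G.makeSolid t true).asgn m g : K) * φ v e ((G.makeSolid t true).act g) - _ *
      (((G.makeSolid t false).asgn m g : K) * φ v e ((G.makeSolid t false).act g))) = _
    have h4 := h2 true
    have h5 := h2 false
    cases hf : g.2.2 t <;> simp only [hf] at h4 h5 <;> push_cast at h4 h5 <;>
      simp only [Bool.xor_true, Bool.xor_false, Bool.not_true, Bool.not_false] at h4 h5 ⊢
    · linear_combination φ v e ((G.makeSolid t true).act g) * h4 -
        (eps m : K) * φ v e ((G.makeSolid t false).act g) * h5
    · linear_combination φ v e ((G.makeSolid t true).act g) * h4 -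
        (eps m : K) * φ v e ((G.makeSolid t false).act g) * h5 +
        (G.asgn m g : K) * (aftT m (G.act g).ty (g.2.1 t)) *
          φ v e ((G.makeSolid t false).act g) * h3
  · rw [if_neg ht, if_neg (by simpa [SGraph.relabel] using ht), mul_zero]

lemma cobT_sum {ι : Type*} (S : Finset ι) (c : K) (z : ι → Ty e → K) (ty : Ty e) : cobT m (fun ty =>
    c * ∑ i ∈ S, z i ty) ty = c * ∑ i ∈ S, cobT m (z i) ty := by
  simp only [cobT, ← cast_smul_eq_zsmul K, smul_eq_mul]
  rw [sum_comm, mul_sum]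
  refine sum_congr rfl fun t _ => ?_
  split_ifs
  · simp only [← mul_sum, Finset.sum_sub_distrib]
    ring
  · simp

lemma cob_avg [CharZero K] {g : ∀ v e, SGraph k v e → K} (hg : FinAlt m g) (h : ∀ r, cob φ m v e
    (G.act r) = g v e (G.act r)) : cob (avg φ m) m v e G = g v e G := by
  have h1 : ∀ r : Rel v e, (G.asgn m r : K) * cob φ m v e (G.act r) = g v e G := fun r => by
    rw [h, SGraph.act, hg, ← cast_smul_eq_zsmul K, smul_eq_mul]
    have h2 := congrArg (Int.cast : ℤ → K) (asgn_mul_self m G r)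
    push_cast at h2
    linear_combination g v e G * h2
  have h2 : cob (avg φ m) m v e G = (Fintype.card (Rel v e) : K)⁻¹ *
      ∑ r : Rel v e, (G.asgn m r : K) * cob φ m v e (G.act r) := by
    simp only [← cob_tw]
    exact cobT_sum _ _ _ _
  rw [h2, sum_congr rfl fun g _ => h1 g, sum_const, card_univ, nsmul_eq_mul, inv_mul_cancel_left₀
    (Nat.cast_ne_zero.2 Fintype.card_ne_zero)]

/-! ### The pairing with `h` -/

lemma special_relabel {x : Fin (v + 1)} {T : Finset (Fin e)} (hτ : X.IsSpanningTree T) (g : Rel v e)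
    : (X.relabel g.1 g.2.1 g.2.2).IsSpanningTree (T.map g.2.1.toEmbedding) ∧ (X.special x T).act g =
    (X.relabel g.1 g.2.1 g.2.2).special (g.1 x) (T.map g.2.1.toEmbedding) ∧ hSign n (X.relabel g.1
    g.2.1 g.2.2) (g.1 x) (T.map g.2.1.toEmbedding) * (X.special x T).asgn (n + 1) g = gcSign n g.1
    g.2.1 g.2.2 * hSign n X x T := by
  obtain ⟨σ', ρ', f', ha, hσ, hρ, hf, -⟩ := exists_sgn n X.toS g
  have hl := lab_toNG X.toS
  have hl' := lab_toNG (X.toS.act g)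
  have hA := ((tree_toNG X.toS T).2 hτ).arb hl.closed (hl.i_mem x)
  have hA' := hA.ren ha
  have hmap : (T.map valEmbedding).map ρ'.toEmbedding =
      (T.map g.2.1.toEmbedding).map valEmbedding := by
    rw [map_map, map_map]
    congr 1
    ext a
    exact hρ a
  rw [hmap, hσ] at hA'
  have hτ' : (X.relabel g.1 g.2.1 g.2.2).IsSpanningTree (T.map g.2.1.toEmbedding) :=
    (tree_toNG (X.toS.act g) _).1 (hA'.tree hl'.closed)
  have haw := fun (a : ℕ) h => hA'.away hl'.closed (a := a) h
  refine ⟨hτ', congrArg (SGraph.mk _) (funext fun a => ?_), ?_⟩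
  · obtain ⟨b, rfl⟩ := g.2.1.surjective a
    by_cases hb : b ∈ T
    · have h1 := haw (g.2.1 b : Fin e)
        (mem_map_of_mem _ (mem_map_of_mem _ hb))
      rw [away_toNG (X.toS.act g), ← hρ, symm_apply_apply, hf, away_toNG X.toS] at h1
      have h2 : g.2.1 b ∈ T.map g.2.1.toEmbedding := by simpa using hb
      have h3 : ((X.relabel g.1 g.2.1 g.2.2).away (T.map g.2.1.toEmbedding) (g.1 x) (g.2.1 b)) =
        xor (g.2.2 b) (X.away T x b) := h1
      simp only [Graph.special, symm_apply_apply, if_pos hb, if_pos h2, h3, Option.map_some]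
    · have h2 : g.2.1 b ∉ T.map g.2.1.toEmbedding := by simpa using hb
      simp only [Graph.special, symm_apply_apply, if_neg hb, if_neg h2, Option.map_none]
  · have h1 := hs_ren (n := n) hA hl.closed ha
    have h2 : hSign n (X.relabel g.1 g.2.1 g.2.2) (g.1 x) (T.map g.2.1.toEmbedding) = _ :=
      hSign_eq (n := n) (X.toS.act g) _ (g.1 x) hτ'
    have h3 : hSign n X x T = _ := hSign_eq (n := n) X.toS T x hτ
    rw [h2, h3, hs_congr n _ _ haw, ← hl.gsgn_eq val_strictMono val_strictMono val_strictMono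
      val_strictMono hσ hρ hf n, ← h1, hmap, hσ]
    congr 1
    exact ((lab_cfg X.toS T x).sgn_eq val_strictMono val_strictMono val_strictMono val_strictMono hσ
      hρ hf (n + 1)).symm

lemma valence_relabel (X : Graph k v e) (g : Rel v e) (x : Fin (v + 1)) : (X.relabel g.1 g.2.1
    g.2.2).valence (g.1 x) = X.valence x := by
  obtain ⟨σ', ρ', f', ha, hσ, -⟩ := exists_sgn 0 X.toS g
  have h1 : (toNG (X.toS.act g)).val (g.1 x : Fin (v + 1)) =
      (X.relabel g.1 g.2.1 g.2.2).valence (g.1 x) := (lab_toNG (X.toS.act g)).val_eq (g.1 x)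
  rw [← h1, ← hσ, val_agree ha]
  exact (lab_toNG X.toS).val_eq x

/-- The value of a function of special graphs on `h(X)`. -/
def pair (n : ℤ) (c : SGraph k v e → K) (X : Graph k v e) : K :=
  ∑ x, (((X.valence x : ℤ) - 2 : ℤ) : K) *
    ∑ T ∈ univ.filter fun T => X.IsSpanningTree T, (hSign n X x T : K) * c (X.special x T)

lemma gcSign_mul_self (n : ℤ) (g : Rel v e) : gcSign n g.1 g.2.1 g.2.2 * gcSign n g.1 g.2.1 g.2.2 =
    1 := by
  unfold gcSign
  split_ifs
  · norm_cast; simp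
  · rw [mul_mul_mul_comm, ← prod_mul_distrib]
    norm_cast
    simp only [Int.units_mul_self, Units.val_one, one_mul]
    exact prod_eq_one fun a _ => by split_ifs <;> simp

lemma pair_tw (g : Rel v e) (X : Graph k v e) : pair n (tw φ (n + 1) g) X = (gcSign n g.1 g.2.1
    g.2.2 : K) * pair n (φ v e) (X.relabel g.1 g.2.1 g.2.2) := by
  have hinv : (X.relabel g.1 g.2.1 g.2.2).relabel g.1⁻¹ g.2.1⁻¹ (fun a => g.2.2 (g.2.1⁻¹ a)) = X :=
    congrArg SGraph.toGraph (SGraph.relabel_inv X.toS g.1 g.2.1 g.2.2)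
  rw [pair, pair, mul_sum]
  refine (sum_congr rfl fun x _ => ?_).trans (Equiv.sum_comp g.1 _)
  rw [valence_relabel, mul_left_comm]
  refine congrArg _ ?_
  rw [mul_sum]
  refine sum_nbij' (fun T : Finset (Fin e) => T.map g.2.1.toEmbedding)
    (fun T : Finset (Fin e) => T.map g.2.1.symm.toEmbedding) (fun T hτ => ?_) (fun T hτ => ?_)
    (fun T _ => ?_) (fun T _ => ?_) fun T hτ => ?_
  · exact mem_filter.2 ⟨mem_univ _,
      (special_relabel (n := n) (x := x) (mem_filter.1 hτ).2 g).1⟩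
  · have := (special_relabel (n := n) (x := x) (mem_filter.1 hτ).2
      (g.1⁻¹, g.2.1⁻¹, fun a => g.2.2 (g.2.1⁻¹ a))).1
    rw [hinv] at this
    exact mem_filter.2 ⟨mem_univ _, this⟩
  · rw [map_map]; ext; simp
  · rw [map_map]; ext; simp
  · obtain ⟨-, h2, h3⟩ := special_relabel (n := n) (x := x) (mem_filter.1 hτ).2 g
    have h4 := asgn_mul_self (n + 1) (X.special x T) g
    have h5 : hSign n (X.relabel g.1 g.2.1 g.2.2) (g.1 x) (T.map g.2.1.toEmbedding) *
        gcSign n g.1 g.2.1 g.2.2 = hSign n X x T * (X.special x T).asgn (n + 1) g := by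
      have h6 := gcSign_mul_self n g
      linear_combination (gcSign n g.1 g.2.1 g.2.2 * (X.special x T).asgn (n + 1) g) * h3 +
        (hSign n X x T * (X.special x T).asgn (n + 1) g) * h6 -
        (hSign n (X.relabel g.1 g.2.1 g.2.2) (g.1 x) (T.map g.2.1.toEmbedding) * gcSign n g.1 g.2.1
        g.2.2) * h4
    have h7 := congrArg (Int.cast : ℤ → K) h5
    push_cast at h7
    rw [tw, h2]
    linear_combination (-(φ v e ((X.relabel g.1 g.2.1 g.2.2).special (g.1 x) (T.map
      g.2.1.toEmbedding)))) * h7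

lemma pair_avg [CharZero K] {c : ∀ v e, Graph k v e → K} (hc : ∀ v e (X : Graph k v e) (g : Rel v
    e), (gcSign n g.1 g.2.1 g.2.2 : K) * c v e (X.relabel g.1 g.2.1 g.2.2) = c v e X) (h : ∀ g : Rel
    v e, pair n (φ v e) (X.relabel g.1 g.2.1 g.2.2) = c v e (X.relabel g.1 g.2.1 g.2.2)) : pair n
    (avg φ (n + 1) v e) X = c v e X := by
  have h1 : pair n (avg φ (n + 1) v e) X = (Fintype.card (Rel v e) : K)⁻¹ *
      ∑ g : Rel v e, pair n (tw φ (n + 1) g) X := by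
    simp only [pair, avg]
    rw [sum_comm, mul_sum]
    refine sum_congr rfl fun x _ => ?_
    rw [← mul_sum, mul_left_comm, sum_comm]
    refine congrArg _ ?_
    rw [mul_sum]
    refine sum_congr rfl fun T _ => ?_
    rw [← mul_sum]
    ring
  have h2 : ∀ g, pair n (tw φ (n + 1) g) X = c v e X := fun g => by rw [pair_tw, h, hc]
  rw [h1, sum_congr rfl fun g _ => h2 g, sum_const, card_univ, nsmul_eq_mul, inv_mul_cancel_left₀
    (Nat.cast_ne_zero.2 Fintype.card_ne_zero)]

end

section

variable {b : ℕ}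

open NG

/-! ### Change of the root -/

section Root

variable {k : ℕ} {n : ℤ} {X : NG k} {x : ℕ} {T : Finset ℕ} {o : ℕ → Bool}

lemma NG.Arb.change_root (h : X.Arb x T o) (hc : X.Closed) (hb : b ∈ T) (hx : X.ends b (!o b) = x) :
    X.Arb (X.ends b (o b)) T (update o b (!o b)) := by
  have ho : ∀ a ≠ b, update o b (!o b) a = o a := fun a ha =>
    update_of_ne ha _ _
  obtain ⟨l, hl⟩ := h.rank
  refine ⟨h.subset, hc _ (h.subset hb) _, fun a ha c hc' e => ?_, fun a ha => ?_, fun u hu hux =>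
    ?_, fun u => if X.Linked (T.erase b) x u then l u + l (X.ends b (o b)) + 1 else l u, fun a ha =>
    ?_⟩
  · by_cases hab : a = b <;> by_cases hcb : c = b
    · rw [hab, hcb]
    · rw [hab, update_self, ho c hcb, hx] at e
      exact absurd e.symm (h.ne c hc')
    · rw [hcb, update_self, ho a hab, hx] at e
      exact absurd e (h.ne a ha)
    · rw [ho a hab, ho c hcb] at e
      exact h.inj a ha c hc' e
  · by_cases hab : a = b
    · rw [hab, update_self, hx]
      exact (h.ne b hb).symm
    · rw [ho a hab]
      exact fun e => hab (h.inj a ha b hb e)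
  · by_cases hu' : u = x
    · exact ⟨b, hb, by rw [update_self, hx, hu']⟩
    · obtain ⟨a, ha, rfl⟩ := h.surj u hu hu'
      have hab : a ≠ b := fun e => hux (by rw [e])
      exact ⟨a, ha, by rw [ho a hab]⟩
  · by_cases hab : a = b
    · subst hab
      beta_reduce
      rw [update_self, Bool.not_not, if_neg (h.not_linked_head hc hb), hx, if_pos (Linked.refl x)]
      omega
    · rw [ho a hab]
      have h1 := Linked.of_mem (X := X) (mem_erase.2 ⟨hab, ha⟩) (o a)
      have h2 := hl a ha
      beta_reduce
      by_cases h3 : X.Linked (T.erase b) x (X.ends a !(o a))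
      · rw [if_pos h3, if_pos (h3.trans h1)]
        omega
      · rw [if_neg h3, if_neg fun h4 => h3 (h4.trans h1.symm)]
        exact h2

lemma hs_change_root (h : X.Arb x T o) (hc : X.Closed) (hb : b ∈ T) (hx : X.ends b (!o b) = x) : hs
    n X (X.ends b (o b)) T (update o b (!o b)) * ∏ a ∈ T, (if update o b (!o b) a then 1 else eps (n
    + 1)) = hs n X x T o * ∏ a ∈ T, if o a then 1 else eps (n + 1) := by
  have h' := h.change_root hc hb hx
  set o' := update o b (!o b) with ho'
  have hpos : X.pos (X.ends b (o b)) T o' = X.pos x T o ∘ swap 0 (b + 1) := by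
    funext c
    rcases c with _ | a
    · simp [NG.pos, hb]
    · by_cases hab : a = b
      · subst hab
        simp [NG.pos, hb, ho', hx]
      · rw [Function.comp_apply, swap_apply_of_ne_of_ne (Nat.succ_ne_zero a) (by simpa)]
        simp [NG.pos, ho', update_of_ne hab]
  have hbs : b + 1 ∈ slots n X.E T := by
    rw [succ_mem_slots]
    split_ifs
    exacts [h.subset hb, hb]
  have hk : kap (slots n X.E T) (lx ∘ X.pos (X.ends b (o b)) T o') id =
      - kap (slots n X.E T) (lx ∘ X.pos x T o) id := by
    have hF : Function.Injective (lx ∘ X.pos x T o) := lx_injective.comp (pos_injective h)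
    have hF' := lx_pos_injOn h' (slots n X.E T)
    rw [← kap_comp hF' hF.injOn injective_id.injOn, kap_comm hF' hF.injOn, hpos, ←
      Function.comp_assoc, kap_swap hF zero_mem_slots hbs (Nat.succ_ne_zero b).symm]
    ring
  have hp : ∀ o : ℕ → Bool, (∏ a ∈ T, if o a then (1 : ℤ) else eps n) *
      (∏ a ∈ T, if o a then 1 else eps (n + 1)) =
      (if o b then 1 else -1) * ∏ a ∈ T.erase b, if o a then 1 else -1 := fun o => by
    rw [← prod_mul_distrib, mul_prod_erase T (fun a => if o a then (1 : ℤ) else -1) hb]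
    refine prod_congr rfl fun a _ => ?_
    have := eps_mul_self n
    rw [eps_add_one]
    split_ifs <;> linarith
  have hq : (∏ a ∈ T.erase b, if o' a then (1 : ℤ) else -1) =
      ∏ a ∈ T.erase b, if o a then 1 else -1 :=
    prod_congr rfl fun a ha => by
      rw [ho', update_of_ne (ne_of_mem_erase ha)]
  rw [hs, hs, mul_assoc, mul_assoc, hp, hp, hq, hk, ho', update_self]
  cases o b <;> simp

end Root

/-! ### The types of the edges over a fixed graph -/

variable {K : Type u} [Field K] {k v e : ℕ} {m n : ℤ}

def bdL (m : ℤ) : (Ty e → K) →ₗ[K] (Ty e → K) where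
  toFun := bdT m
  map_add' z z' := funext (bdT_add z z')
  map_smul' c z := funext (bdT_mul c z)

def epsL (m : ℤ) (U : Finset (Fin e)) : (Ty e → K) →ₗ[K] K where
  toFun := epsT m U
  map_add' z z' := by simp [epsT, mul_add, sum_add_distrib]
  map_smul' c z := by simp [epsT, mul_sum, mul_left_comm]

variable (K n) in
/-- `h(X)` as a function of the types of the edges. -/
def hvec (X : Graph k v e) : Ty e → K :=
  ∑ x, (((X.valence x : ℤ) - 2 : ℤ) : K) •
    ∑ T ∈ univ.filter fun T => X.IsSpanningTree T,
      (hSign n X x T : K) • Pi.single (X.special x T).ty 1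

lemma map_hvec (F : (Ty e → K) →ₗ[K] K) (X : Graph k v e) : F (hvec K n X) = pair n (fun G => F
    (Pi.single G.ty 1)) X := by
  simp [hvec, pair]

lemma ranked_iff {X : Graph k v e} {ty : Ty e} : Ranked X.ends ∅ ty ↔ Acyclic (SGraph.mk X ty).sarc
    := by
  have hl := lab_toNG (SGraph.mk X ty)
  refine ⟨fun ⟨l, _, hl⟩ => ?_, fun h => ?_⟩
  · refine Acyclic.of_map (arc' := fun x y : ℕ => x < y) l (fun x y ⟨a, s, h1, h2, h3⟩ =>
      h2 ▸ h3 ▸ hl a (notMem_empty a) s h1) fun x hx => ?_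
    rw [Relation.transGen_eq_self] at hx
    exact lt_irrefl x hx
  · obtain ⟨l, hl'⟩ := ((hl.acyclic_iff fun _ _ => hl.sarc_iff).2 h).exists_rank (toNG _).V
      fun p q ⟨a, ha, s, _, hp, _⟩ => hp ▸ hl.closed a ha _
    exact ⟨fun x => l x, fun a ha => absurd ha (notMem_empty a), fun a _ s hs =>
      hl' _ _ (hl.sarc_iff.2 ⟨_, _, rfl, rfl, a, s, hs, rfl, rfl⟩)⟩

/-- The graphs over which there are special graphs. -/
def Nice (m : ℤ) (X : Graph k v e) : Prop :=
  X.IsGC ∧ (Odd m → ∀ a b, a ≠ b → s(X.ends a false, X.ends a true) ≠ s(X.ends b false, X.ends b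
    true))

lemma Nice.special_iff {X : Graph k v e} (h : Nice m X) {ty : Ty e} : (SGraph.mk X ty).IsSpecial m ↔
    Ranked X.ends ∅ ty :=
  ⟨fun hs => ranked_iff.2 hs.acyclic_last, fun hr =>
    ⟨h.1.toReduced, ranked_iff.1 hr, fun _ => h.1.no_tadpole, h.2⟩⟩

lemma bdT_hvec (X : Graph k v e) {ty₀ : Ty e} (h0 : Ranked X.ends ∅ ty₀) : bdT (n + 1) (hvec K n X)
    ty₀ = 0 := by
  set δ : Ty e → K := Pi.single ty₀ 1 with hδ
  have h1 : ∀ ty, bdT (n + 1) (Pi.single ty 1) ty₀ = cobT (n + 1) δ ty := fun ty => by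
    have := sum_bdT_smul (m := n + 1) (Pi.single ty (1 : K)) δ
    rw [sum_eq_single ty₀ (fun b _ hb => by simp [hδ, hb]) (by simp),
      sum_eq_single ty (fun b _ hb => by simp [hb]) (by simp)] at this
    simpa [hδ] using this
  have h2 := map_hvec (n := n) ((proj ty₀).comp (bdL (K := K) (n + 1))) X
  change bdT (n + 1) (hvec K n X) ty₀ = pair n (fun G => bdT (n + 1) (Pi.single G.ty 1) ty₀) X at h2
  rw [h2]
  simp only [h1]
  refine sum_eq_zero fun x _ => ?_
  set ψ : NG k → K := fun X' => if (∀ a : Fin e, X'.ty a = ty₀ a) ∧ Acyclic X'.sarc then 1 else 0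
    with hψ
  have h3 := sum_dotted_eq_zero (n := n) (ψ := ψ) (X := toNG X.toS) (x := x)
    (fun X' _ h => if_neg fun h' => h h'.2) (lab_toNG X.toS).closed ((lab_toNG X.toS).i_mem x)
  rw [sum_trees_toNG] at h3
  refine (congrArg _ ((sum_congr rfl fun T hτ => ?_).trans h3)).trans (mul_zero _)
  have hlc := lab_cfg X.toS T x
  have hfil : univ.filter (fun t => (X.special x T).ty t = none) = univ \ T := by
    ext t; simp [Graph.special]
  have hE : (toNG X.toS).E \ T.map valEmbedding =
      (univ \ T).map valEmbedding := (Finset.map_sdiff _ _).symm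
  have h5 : hSign n X x T = _ := hSign_eq (n := n) X.toS T x (mem_filter.1 hτ).2
  change _ * cobT (n + 1) δ (X.special x T).ty = _
  rw [h5, ← smul_sum, ← cast_smul_eq_zsmul K, smul_eq_mul, cobT, ← sum_filter, hfil, hE, sum_map]
  refine congrArg _ (sum_congr rfl fun t ht => ?_)
  have htτ : t ∉ T := (mem_sdiff.1 ht).2
  have ht0 : (X.special x T).ty t = none := by simp [Graph.special, htτ]
  have h4 : ∀ s, ψ (((toNG X.toS).cfg (T.map valEmbedding)
      ((toNG X.toS).away (T.map valEmbedding) x)).setTy t (some s)) =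
      δ (update (X.special x T).ty t (some s)) := fun s => by
    have hls := hlc.makeSolid t s
    rw [hψ, hδ, Pi.single_apply]
    by_cases h : update (X.special x T).ty t (some s) = ty₀
    · rw [if_pos h]
      refine if_pos ⟨fun a => (hls.ty_eq a).trans (congrFun h a), ?_⟩
      refine (hls.acyclic_iff fun _ _ => hls.sarc_iff).2 ?_
      rw [← h] at h0
      exact ranked_iff.1 h0
    · rw [if_neg h]
      exact if_neg fun h' => h (funext fun a => (hls.ty_eq a).symm.trans (h'.1 a))
  refine Eq.trans ?_ (term_none (hlc.j_mem t) ((hlc.ty_eq t).trans ht0)).symm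
  rw [h4, h4, hlc.aft_inr val_strictMono, oddEdges_eq]
  rfl

/-! ### Spanning trees -/

lemma linked_const {α : Type*} {X : Graph k v e} {T : Finset (Fin e)} {f : Fin (v + 1) → α} (hf : ∀
    a ∈ T, f (X.ends a false) = f (X.ends a true)) {x y : Fin (v + 1)} (h : X.Linked T x y) : f x =
    f y := by
  induction h with
  | rel x y h => obtain ⟨a, ha, rfl, rfl⟩ := h; exact hf a ha
  | refl => rfl
  | symm _ _ _ ih => exact ih.symm
  | trans _ _ _ _ _ ih ih' => exact ih.trans ih'

lemma exists_spanningTree {X : Graph k v e} (h : ∀ x y, X.Linked univ x y) : ∃ T, X.IsSpanningTree T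
    := by
  have hl := lab_toNG X.toS
  obtain ⟨D, hT, -, o, ho⟩ := exists_arb_of_linked (x := (0 : Fin (v + 1))) (X := toNG X.toS)
    subset_rfl (fun u hu => by
      obtain ⟨y, rfl⟩ := hl.exists_i hu
      rw [hl.E_eq]
      exact (hl.linked_iff _ _ _).2 (h 0 y)) (hl.i_mem 0)
  obtain ⟨T, -, rfl⟩ := Finset.subset_map_iff.1 (hl.E_eq ▸ hT)
  exact ⟨T, (tree_toNG X.toS T).1 (ho.tree hl.closed)⟩

variable {X : Graph k v e} {T : Finset (Fin e)}

lemma Graph.IsSpanningTree.arb (hτ : X.IsSpanningTree T) (x : Fin (v + 1)) : (toNG X.toS).Arb x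
    (T.map valEmbedding) ((toNG X.toS).away (T.map valEmbedding) x) :=
  ((tree_toNG X.toS T).2 hτ).arb (lab_toNG X.toS).closed ((lab_toNG X.toS).i_mem x)

lemma Graph.IsSpanningTree.separated (hτ : X.IsSpanningTree T) {a : Fin e} (ha : a ∈ T) : Separated
    X.ends (T.erase a) a := by
  have hl := lab_toNG X.toS
  have hA := hτ.arb 0
  have ha' : (a : ℕ) ∈ T.map valEmbedding := mem_map_of_mem _ ha
  have h1 := hA.linked_tail hl.closed ha'
  have h2 := hA.not_linked_head hl.closed ha'
  rw [hl.ends_eq] at h1 h2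
  refine ⟨fun y => if (toNG X.toS).Linked ((T.map valEmbedding).erase a)
    ((0 : Fin (v + 1)) : ℕ) (y : ℕ) then 1 else 0, fun y => by beta_reduce; split_ifs <;> simp,
    fun b hb => ?_, ?_⟩
  · have hb := mem_erase.1 hb
    have h3 := Linked.of_mem (X := toNG X.toS) (T := (T.map valEmbedding).erase a) (a := b)
      (mem_erase.2 ⟨fun h => hb.1 (Fin.ext h), mem_map_of_mem _ hb.2⟩) true
    rw [hl.ends_eq, hl.ends_eq] at h3
    exact if_congr ⟨fun h => h.trans h3, fun h => h.trans h3.symm⟩ rfl rfl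
  · beta_reduce
    cases ho : (toNG X.toS).away (T.map valEmbedding) ((0 : Fin (v + 1)) : ℕ) a <;>
      rw [ho] at h1 h2
    · exact fun h => zero_ne_one ((if_neg h2).symm.trans (h.trans (if_pos h1)))
    · exact fun h => zero_ne_one ((if_neg h2).symm.trans (h.symm.trans (if_pos h1)))

/-- The coefficient of `hvec` at a spanning tree, up to the sign of the orientation. -/
def rootSign (n : ℤ) (X : Graph k v e) (T : Finset (Fin e)) (x : Fin (v + 1)) : ℤ :=
  hSign n X x T * revT (n + 1) (X.special x T).ty

lemma rootSign_eq (hτ : X.IsSpanningTree T) (x : Fin (v + 1)) {o : ℕ → Bool} (ho : ∀ a ∈ T.map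
    valEmbedding, (toNG X.toS).away (T.map valEmbedding) x a = o a) : rootSign n X T x = hs n (toNG
    X.toS) x (T.map valEmbedding) o * ∏ a ∈ T.map valEmbedding, if o a then 1 else eps (n + 1) := by
  have h5 : hSign n X x T = _ := hSign_eq (n := n) X.toS T x hτ
  rw [rootSign, h5, hs_congr n _ _ ho, prod_map, revT,
    ← Finset.prod_subset (Finset.subset_univ T) fun a _ ha => by simp [Graph.special, ha]]
  refine congrArg _ (prod_congr rfl fun a ha => ?_)
  have h6 : X.away T x a = o a := (away_toNG X.toS T x a).symm.trans
    (ho a (mem_map_of_mem _ ha))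
  simp only [Graph.special, if_pos ha, h6, Fin.valEmbedding_apply, Option.some.injEq]
  cases o a <;> simp

lemma rootSign_const (hτ : X.IsSpanningTree T) (x y : Fin (v + 1)) : rootSign n X T x = rootSign n X
    T y := by
  refine linked_const (fun b hb => ?_) (hτ.1 x y)
  have hl := lab_toNG X.toS
  have hA := hτ.arb (X.ends b false)
  have hb' : (b : ℕ) ∈ T.map valEmbedding := mem_map_of_mem _ hb
  have hob : (toNG X.toS).away (T.map valEmbedding) (X.ends b false) b = true :=
    decide_eq_true (by rw [hl.ends_eq]; exact Linked.refl _)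
  have hx : (toNG X.toS).ends b (!((toNG X.toS).away (T.map valEmbedding)
      (X.ends b false) b)) = X.ends b false := by rw [hob, hl.ends_eq]; rfl
  have h1 := hs_change_root (n := n) hA hl.closed hb' hx
  have h2 := hA.change_root hl.closed hb' hx
  rw [rootSign_eq hτ _ fun _ _ => rfl, ← h1]
  rw [hob, hl.ends_eq] at h2 ⊢
  exact (rootSign_eq hτ (X.ends b true) fun a ha => h2.away hl.closed ha).symm

lemma epsT_single (m : ℤ) (T : Finset (Fin e)) (ty : Ty e) : epsT m T (Pi.single ty (1 : K)) = if ∀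
    a, ty a ≠ none ↔ a ∈ T then (revT m ty : K) else 0 := by
  rw [epsT, sum_filter, sum_eq_single ty (fun b _ hb => by simp [hb]) (by simp),
    Pi.single_eq_same, mul_one]

lemma epsT_hvec_ne_zero [CharZero K] (hΓ : X.Reduced) (hτ : X.IsSpanningTree T) : epsT (n + 1) T
    (hvec K n X) ≠ 0 := by
  have h1 : epsT (n + 1) T (hvec K n X) =
      pair n (fun G => epsT (n + 1) T (Pi.single G.ty 1)) X := map_hvec (epsL (n + 1) T) X
  have h2 : ∀ x, ∑ T' ∈ univ.filter fun T' => X.IsSpanningTree T', (hSign n X x T' : K) *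
      epsT (n + 1) T (Pi.single (X.special x T').ty 1) = (rootSign n X T 0 : K) := fun x => by
    have h3 : ∀ T', (∀ a, (X.special x T').ty a ≠ none ↔ a ∈ T) ↔ T' = T := fun T' => by
      simp [Graph.special, Finset.ext_iff]
    simp only [epsT_single, h3]
    rw [sum_eq_single T (fun b _ hb => by simp [hb])
      fun h => absurd (mem_filter.2 ⟨mem_univ _, hτ⟩) h, if_pos rfl,
      ← cast_mul, rootSign_const hτ 0 x, rootSign]
  have h3 : rootSign n X T 0 ≠ 0 := mul_ne_zero (pow_ne_zero _ (by norm_num))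
    (Finset.prod_ne_zero_iff.2 fun a _ => by unfold eps; split_ifs <;> norm_num)
  rw [h1, pair, sum_congr rfl fun x _ => congrArg _ (h2 x), ← Finset.sum_mul, ← Int.cast_sum, ←
    cast_mul, Int.cast_ne_zero]
  refine mul_ne_zero (ne_of_gt ?_) h3
  obtain ⟨x, hx⟩ := hΓ.three_le
  exact Finset.sum_pos' (fun y _ => by have := hΓ.two_le y; omega)
    ⟨x, mem_univ x, by omega⟩

/-! ### Duality -/

lemma exists_cobT_eq [CharZero K] (hΓ : Nice (n + 1) X) (g : Ty e → K) (hg : ∀ ty, ¬ Ranked X.ends ∅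
    ty → g ty = 0) (hc : ∀ ty, cobT (n + 1) g ty = 0) (hp : pair n (fun G => g G.ty) X = 0) (c : K)
    : ∃ g' : Ty e → K, (∀ ty, ¬ Ranked X.ends ∅ ty → g' ty = 0) ∧ (∀ ty, cobT (n + 1) g' ty = g ty)
    ∧ pair n (fun G => g' G.ty) X = c := by
  obtain ⟨T, hτ⟩ := exists_spanningTree hΓ.1.connected
  have hsep := fun a (ha : a ∈ T) => hτ.separated ha
  have hε := epsT_hvec_ne_zero (K := K) (n := n) hΓ.1.toReduced hτ
  set E : (Ty e → K) →ₗ[K] K := epsL (n + 1) T with hE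
  let π : (Ty e → K) →ₗ[K] (Ty e → K) :=
    LinearMap.pi fun ty => if Ranked X.ends ∅ ty then proj ty else 0
  have hπ : ∀ z ty, π z ty = if Ranked X.ends ∅ ty then z ty else 0 := fun z ty => by
    simp only [π, LinearMap.pi_apply]; split_ifs <;> rfl
  have hEπ : ∀ z, E (π z) = E z := fun z => sum_congr rfl fun ty hty => by
    rw [hπ, if_pos (ranked_of_tree hsep fun a ha => ((mem_filter.1 hty).2 a).1 ha)]
  set γ := Fintype.linearCombination K g with hγ
  have hγs : ∀ ty, γ (Pi.single ty 1) = g ty := fun ty => by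
    simp [hγ, Fintype.linearCombination_apply_single]
  set A := (π.comp (bdL (n + 1))).prod E with hA
  have hker : γ ∈ (ker A).dualAnnihilator := by
    rw [Submodule.mem_dualAnnihilator]
    intro z hz
    have hz1 : π (bdT (n + 1) z) = 0 := congrArg Prod.fst hz
    have hz2 : epsT (n + 1) T z = 0 := congrArg Prod.snd hz
    obtain ⟨w, hw⟩ := exists_eq_bdT (fun l hl x y => linked_const hl (hτ.1 x y)) hsep z
      (fun ty hty => by simpa [hπ, hty] using congrFun hz1 ty) hz2
    have h1 : γ z = ∑ ty, bdT (n + 1) w ty • g ty := sum_congr rfl fun ty _ => by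
      by_cases h : Ranked X.ends ∅ ty
      · rw [hw ty h]
      · rw [hg ty h, smul_zero, smul_zero]
    rw [h1, sum_bdT_smul]
    simp [hc]
  rw [← LinearMap.range_dualMap_eq_dualAnnihilator_ker] at hker
  obtain ⟨ν, hν⟩ := hker
  have hν : ∀ z, γ z = ν (π (bdT (n + 1) z), E z) := fun z => (LinearMap.congr_fun hν z).symm
  have h0 : ν (0, 1) = 0 := by
    have h1 : γ (hvec K n X) = 0 := by rw [map_hvec]; simpa only [hγs] using hp
    have h2 : π (bdT (n + 1) (hvec K n X)) = 0 := funext fun ty => by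
      rw [hπ]
      split_ifs with h
      exacts [bdT_hvec X h, rfl]
    rw [hν, h2] at h1
    have h3 : ((0 : Ty e → K), E (hvec K n X)) = E (hvec K n X) • (0, 1) := by simp
    rw [h3, map_smul, smul_eq_mul] at h1
    exact (mul_eq_zero.1 h1).resolve_left hε
  have hν0 : ∀ z : Ty e → K, ∀ t : K, ν (z, t) = ν (z, 0) := fun z t => by
    have h3 : (z, t) = (z, 0) + t • ((0 : Ty e → K), (1 : K)) := by simp
    rw [h3, map_add, map_smul, h0, smul_zero, add_zero]
  set t : K := (c - ν (π (hvec K n X), 0)) / E (hvec K n X) with ht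
  set F : (Ty e → K) →ₗ[K] K := (ν.comp (LinearMap.inl K _ _)).comp π + t • E with hF
  have hF' : ∀ z, F z = ν (π z, 0) + t * E z := fun z => rfl
  have hsum : ∀ z, ∑ ty, z ty • F (Pi.single ty 1) = F z := fun z => by
    rw [LinearMap.pi_apply_eq_sum_univ F z]
    refine sum_congr rfl fun ty _ => congrArg _ (congrArg F (funext fun j => ?_))
    simp [Pi.single_apply, eq_comm]
  refine ⟨fun ty => F (Pi.single ty 1), fun ty hty => ?_, fun ty => ?_, ?_⟩
  · have h1 : π (Pi.single ty 1) = 0 := funext fun ty' => by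
      rw [hπ, Pi.single_apply]
      split_ifs with h h' <;> first | rfl | exact absurd (h' ▸ h) hty
    change F (Pi.single ty 1) = 0
    rw [hF', ← hEπ, h1, map_zero, mul_zero, add_zero]
    exact map_zero ν
  · have h1 := sum_bdT_smul (m := n + 1) (Pi.single ty (1 : K)) fun ty => F (Pi.single ty 1)
    rw [hsum, sum_eq_single ty (fun b _ hb => by simp [hb]) (by simp), Pi.single_eq_same,
      one_smul] at h1
    have h2 : E (bdT (n + 1) (Pi.single ty 1)) = 0 := epsT_bdT T _
    rw [← h1, hF', h2, mul_zero, add_zero, ← hν0 _ (E (Pi.single ty 1)), ← hν, hγs]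
  · rw [← map_hvec, hF', ht, div_mul_cancel₀ _ (show E (hvec K n X) ≠ 0 from hε)]
    ring

end

section

variable {v e p : ℕ} {d : ℤ}

open NG

/-! ### Quasi-isomorphisms of complexes of modules -/

section Homology

variable {K : Type u} [Field K]

lemma quasiIso_of_elements {S T : ShortComplex (ModuleCat.{u} K)} (φ : S ⟶ T) (hinj : ∀ z : S.X₂,
    S.g z = 0 → ∀ w, φ.τ₂ z = T.f w → ∃ z', S.f z' = z) (hsurj : ∀ y : T.X₂, T.g y = 0 → ∃ z w, S.g
    z = 0 ∧ y = φ.τ₂ z + T.f w) : ShortComplex.QuasiIso φ := by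
  let γ : ShortComplex.LeftHomologyMapData φ S.moduleCatLeftHomologyData
    T.moduleCatLeftHomologyData := default
  rw [γ.quasiIso_iff, ConcreteCategory.isIso_iff_bijective]
  have hi : ∀ z, (γ.φK z).1 = φ.τ₂ z.1 := fun z => ConcreteCategory.congr_hom γ.commi z
  have hπ : ∀ z, γ.φH (S.moduleCatLeftHomologyData.π z) = T.moduleCatLeftHomologyData.π (γ.φK z) :=
    fun z => ConcreteCategory.congr_hom γ.commπ z
  refine ⟨(injective_iff_map_eq_zero γ.φH.hom).2 fun z hz => ?_, fun y => ?_⟩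
  · obtain ⟨z, rfl⟩ := mkQ_surjective _ z
    have h1 : T.moduleCatLeftHomologyData.π (γ.φK z) = 0 := (hπ z).symm.trans hz
    obtain ⟨w, hw⟩ := (mk_eq_zero _).1 h1
    obtain ⟨z', hz'⟩ := hinj z.1 z.2 w ((hi z).symm.trans (congrArg Subtype.val hw).symm)
    exact (mk_eq_zero _).2 ⟨z', Subtype.ext hz'⟩
  · obtain ⟨y, rfl⟩ := mkQ_surjective _ y
    obtain ⟨z, w, hz, hy⟩ := hsurj y.1 y.2
    refine ⟨S.moduleCatLeftHomologyData.π ⟨z, hz⟩, (hπ _).trans ?_⟩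
    refine ((Submodule.Quotient.eq _).2 ⟨-w, Subtype.ext ?_⟩)
    have h2 : φ.τ₂ z - y.1 = T.f (-w) := by rw [hy, map_neg]; abel
    exact h2.symm.trans (congrArg (· - y.1) (hi ⟨z, hz⟩).symm)

end Homology

/-! ### Filtration by the number of vertices -/

variable {K : Type u} [Field K] {k : ℕ} {m n : ℤ}

variable (K k m) in
def sgcLt (p : ℕ) (d : ℤ) : Submodule K (SGCGen k m d →₀ K) :=
  supported K K {a | a.1.1 < p}

variable (K k n) in
def gcLt (p : ℕ) (d : ℤ) : Submodule K (GCGen k n d →₀ K) :=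
  supported K K {a | a.1.1 < p}

lemma eq_of_supported {α : Type*} {M : Type*} [AddCommGroup M] [Module K M] {s : Set α} {T T' : (α
    →₀ K) →ₗ[K] M} (h : ∀ a ∈ s, T (Finsupp.single a 1) = T' (Finsupp.single a 1)) {y : α →₀ K} (hy
    : y ∈ supported K K s) : T y = T' y := by
  rw [Finsupp.supported_eq_span_single] at hy
  refine LinearMap.eqOn_span' (f := T) (g := T') ?_ hy
  rintro _ ⟨a, ha, rfl⟩
  exact h a ha

lemma mem_of_supported {α : Type*} {M : Type*} [AddCommGroup M] [Module K M] {s : Set α} {T : (α →₀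
    K) →ₗ[K] M} {N : Submodule K M} (h : ∀ a ∈ s, T (Finsupp.single a 1) ∈ N) {y : α →₀ K} (hy : y ∈
    supported K K s) : T y ∈ N := by
  rw [← ker_mkQ N, mem_ker]
  refine (eq_of_supported (T := N.mkQ.comp T) (T' := 0) (fun a ha => ?_) hy)
  exact (mk_eq_zero N).2 (h a ha)

lemma exists_mem_supported {α : Type*} (f : α → ℕ) (y : α →₀ K) : ∃ p, y ∈ supported K K {a | f a <
    p} :=
  ⟨y.support.sup f + 1, (Finsupp.mem_supported K y).2 fun _ ha =>
    Nat.lt_succ_of_le (Finset.le_sup (f := f) ha)⟩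

lemma sgcGen_mem (h : v < p) (d : ℤ) (G : SGraph k v e) : sgcGen K m d G ∈ sgcLt K k m p d := by
  rw [sgcGen]
  split_ifs
  exacts [single_mem_supported K 1 h, zero_mem _]

lemma gcGen_mem (h : v < p) (d : ℤ) (G : Graph k v e) : gcGen K n d G ∈ gcLt K k n p d := by
  rw [gcGen]
  split_ifs
  exacts [single_mem_supported K 1 h, zero_mem _]

lemma sgcFuse_mem (h : v < p) (d : ℤ) (G : SGraph k v e) (w : Fin (v + 1)) : sgcFuse K m d v e G w ∈
    sgcLt K k m p d := by
  rcases v with _ | v <;> rcases e with _ | e <;> try exact zero_mem _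
  refine sum_mem fun i _ => sum_mem fun j _ => sum_mem fun s _ => sum_mem fun r _ => ?_
  split_ifs <;> first | exact zero_mem _ | exact zsmul_mem (sgcGen_mem (by omega) _ _) _

lemma sgcBdSolid_mem (h : v ≤ p) (d : ℤ) (G : SGraph k v e) : sgcBdSolid K m d v e G ∈ sgcLt K k m p
    d := by
  rcases v with _ | v <;> rcases e with _ | e <;> try exact zero_mem _
  refine sum_mem fun t _ => ?_
  split
  · exact zero_mem _
  · refine zsmul_mem ?_ _
    split_ifs
    exacts [sgcFuse_mem h _ _ _, sgcGen_mem h _ _]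

lemma sgcBdDotted_mem (h : v < p) (d : ℤ) (G : SGraph k v e) : sgcBdDotted K m d G ∈ sgcLt K k m p d
    :=
  sum_mem fun _ _ => zsmul_mem (sub_mem (sgcGen_mem h _ _) (zsmul_mem (sgcGen_mem h _ _) _)) _

lemma hGraph_mem (h : v < p) (d : ℤ) (G : Graph k v e) : hGraph K n d G ∈ sgcLt K k (n + 1) p d :=
  sum_mem fun _ _ => zsmul_mem (sum_mem fun _ _ => zsmul_mem (sgcGen_mem h _ _) _) _

lemma hMap_single (d : ℤ) (X : GCGen k n d) : hMap K k n d (Finsupp.single X 1) = hGraph K n d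
    X.1.2.2 := by
  rw [hMap, linearCombination_single, one_smul]

lemma gcD_mem {p : ℕ} {i j : ℤ} {x : GCGen k n i →₀ K} (hx : x ∈ gcLt K k n (p + 1) i) : gcD K k n i
    j x ∈ gcLt K k n p j := by
  refine mem_of_supported (fun a ha => ?_) hx
  rw [gcD, linearCombination_single, one_smul]
  obtain ⟨⟨v, e, G⟩, h⟩ := a
  have hv : v < p + 1 := ha
  rcases v with _ | v <;> rcases e with _ | e <;> try exact zero_mem _
  exact sum_mem fun t _ => zsmul_mem (gcGen_mem (by omega) _ _) _

/-! ### Dual of the part of the differential that preserves the number of vertices -/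

lemma degree_makeSolid {v e : ℕ} {G : SGraph k v e} {t : Fin e} (ht : G.ty t = none) (s : Bool) :
    (G.makeSolid t s).degree m + 1 = G.degree m := by
  have hl := lab_toNG G
  have ht' : (t : ℕ) ∈ (toNG G).dotted := by
    rw [hl.dotted_eq]
    exact mem_map_of_mem _ (mem_filter.2 ⟨mem_univ _, ht⟩)
  rw [← hl.degree_eq, ← degree_setTy m ht' s, (hl.makeSolid t s).degree_eq]

lemma sgcBdDotted_eq_zero {v e : ℕ} {G : SGraph k v e} (h : ¬ (G.IsSpecial m ∧ G.degree m = d + 1))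
    : sgcBdDotted K m d G = 0 := by
  refine sum_eq_zero fun t ht => ?_
  have h1 : ∀ s, sgcGen K m d (G.makeSolid t s) = 0 := fun s => by
    refine dif_neg fun h' => h ⟨⟨h'.1.toReduced, ?_, h'.1.no_tadpole, h'.1.no_multiple⟩, ?_⟩
    · refine h'.1.acyclic_last.mono fun x y ⟨a, r, h1, h2⟩ => ⟨a, r, ?_, h2⟩
      have : a ≠ t := fun e => by
        rw [e, (mem_filter.1 ht).2] at h1
        exact Option.some_ne_none _ h1.symm
      exact (update_of_ne this _ _).trans h1
    · rw [← h'.2, degree_makeSolid (mem_filter.1 ht).2]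
  rw [h1, h1, smul_zero, sub_zero, smul_zero]

lemma cob_eq (L : (SGCGen k m d →₀ K) →ₗ[K] K) {v e : ℕ} (G : SGraph k v e) : cob (sgcFun d L) m v e
    G = L (sgcBdDotted K m d G) := by
  rw [sgcBdDotted, map_sum, SGraph.dotted, sum_filter, cob, cobT]
  refine sum_congr rfl fun t _ => ?_
  split_ifs
  · rw [map_zsmul, map_sub, map_zsmul, negOnePow_eq_eps, oddEdges_eq]
    rfl
  · rfl

lemma pair_eq (L : (SGCGen k (n + 1) d →₀ K) →ₗ[K] K) {v e : ℕ} (X : Graph k v e) : pair n (sgcFun d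
    L v e) X = L (hGraph K n d X) := by
  rw [hGraph, map_sum, pair]
  refine sum_congr rfl fun x _ => ?_
  rw [map_zsmul, map_sum, ← cast_smul_eq_zsmul K, smul_eq_mul]
  refine congrArg _ (sum_congr rfl fun T _ => ?_)
  rw [map_zsmul, ← cast_smul_eq_zsmul K, smul_eq_mul]
  rfl

lemma degree_special {v e : ℕ} {X : Graph k v e} {τ : Finset (Fin e)} (hτ : X.IsSpanningTree τ) (x :
    Fin (v + 1)) : (X.special x τ).degree (n + 1) = (v : ℤ) * n + (1 - n) * (e : ℤ) := by
  have hl := lab_toNG X.toS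
  have h1 : _ = (X.special x τ).degree (n + 1) := (lab_cfg X.toS τ x).degree_eq (n + 1)
  rw [← h1, degree_cfg ((tree_toNG X.toS τ).2 hτ), hl.card_V, hl.card_E]
  push_cast
  ring

lemma gcGen_relabel {L : (GCGen k n d →₀ K) →ₗ[K] K} (hL : gcRel K k n d ≤ ker L) {v e : ℕ} (X :
    Graph k v e) (g : Rel v e) : L (gcGen K n d (X.relabel g.1 g.2.1 g.2.2)) = gcSign n g.1 g.2.1
    g.2.2 • L (gcGen K n d X) := by
  have h1 : L (gcGen K n d (X.relabel g.1 g.2.1 g.2.2) - gcSign n g.1 g.2.1 g.2.2 •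
      gcGen K n d X) = 0 := hL (subset_span ⟨v, e, X, g.1, g.2.1, g.2.2, rfl⟩)
  rwa [map_sub, map_zsmul, sub_eq_zero] at h1

/-- Graphs with a double edge vanish if edges are odd. -/
lemma gcGen_eq_zero [CharZero K] {L : (GCGen k n d →₀ K) →ₗ[K] K} (hL : gcRel K k n d ≤ ker L) {v e
    : ℕ} {X : Graph k v e} (hΓ : ¬ Nice (n + 1) X) : L (gcGen K n d X) = 0 := by
  by_cases hG : X.IsGC
  swap
  · rw [gcGen, dif_neg fun h => hG h.1, map_zero]
  simp only [Nice, hG, true_and, not_forall, not_not] at hΓ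
  obtain ⟨hn, a, b, hab, h⟩ := hΓ
  have hn' : Even n := by
    by_contra h'
    exact Int.not_even_iff_odd.2 hn (Int.not_even_iff_odd.1 h').add_one
  obtain ⟨q, hq⟩ : ∃ q, ∀ s, X.ends b s = X.ends a (xor q s) := by
    rcases eq_iff.1 h with ⟨h1, h2⟩ | ⟨h1, h2⟩
    exacts [⟨false, fun s => by cases s <;> simp [h1, h2]⟩,
      ⟨true, fun s => by cases s <;> simp [h1, h2]⟩]
  have hcol : ∀ c, X.col c b = xor q (X.col c a) := fun c => by
    by_contra h'
    have h2 : X.col c b = xor q (!X.col c a) := by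
      revert h'; cases X.col c b <;> cases X.col c a <;> cases q <;> simp
    refine hG.acyclic c (X.ends a (X.col c a)) (.tail (.single ⟨b, ?_, rfl⟩) ⟨a, ?_, rfl⟩) <;>
      rw [hq, h2] <;> cases X.col c a <;> cases q <;> rfl
  have h3 := gcGen_relabel hL X (1, swap a b, fun x => q && decide (x = a ∨ x = b))
  have h4 : X.relabel 1 (swap a b) (fun x => q && decide (x = a ∨ x = b)) = X := by
    have h5 : ∀ x, (∀ s, X.ends (swap a b x) (xor (q && decide (swap a b x = a ∨
        swap a b x = b)) s) = X.ends x s) ∧ ∀ c, xor (q && decide (swap a b x = a ∨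
        swap a b x = b)) (X.col c (swap a b x)) = X.col c x := fun x => by
      by_cases hxa : x = a
      · subst hxa; simp [hq, hcol]
      · by_cases hxb : x = b
        · subst hxb; simp [hq, hcol]
        · simp [swap_apply_of_ne_of_ne hxa hxb, hxa, hxb]
    exact congrArg₂ Graph.mk (funext fun x => funext fun s => (h5 x).1 s)
      (funext fun c => funext fun x => (h5 x).2 c)
  rw [h4] at h3
  refine eq_zero_of_eq_neg (K := K) (h3.trans ?_)
  simp [gcSign, hn', sign_swap hab]

lemma exists_dual [CharZero K] {g : ∀ v e, SGraph k v e → K} {c : ∀ v e, Graph k v e → K} (hgA :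
    FinAlt (n + 1) g) (hg : ∀ v e (G : SGraph k v e), ¬ (Nice (n + 1) G.toGraph ∧ G.IsSpecial (n +
    1)) → g v e G = 0) (hcA : ∀ v e (X : Graph k v e) (r : Rel v e), (gcSign n r.1 r.2.1 r.2.2 : K)
    * c v e (X.relabel r.1 r.2.1 r.2.2) = c v e X) (hc : ∀ v e (X : Graph k v e), ¬ Nice (n + 1) X →
    c v e X = 0) (hgc : ∀ v e (G : SGraph k v e), cob g (n + 1) v e G = 0) (hgp : ∀ v e (X : Graph k
    v e), Nice (n + 1) X → pair n (g v e) X = 0) : ∃ g' : ∀ v e, SGraph k v e → K, FinAlt (n + 1) g'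
    ∧ (∀ v e (G : SGraph k v e), ¬ G.IsSpecial (n + 1) → g' v e G = 0) ∧ (∀ v e (G : SGraph k v e),
    cob g' (n + 1) v e G = g v e G) ∧ ∀ v e (X : Graph k v e), pair n (g' v e) X = c v e X := by
  have key : ∀ v e (X : Graph k v e), ∃ f : Ty e → K,
      (∀ ty, ¬ (SGraph.mk X ty).IsSpecial (n + 1) → f ty = 0) ∧
      (∀ ty, cobT (n + 1) f ty = g v e ⟨X, ty⟩) ∧ pair n (fun G => f G.ty) X = c v e X := by
    intro v e X
    by_cases hΓ : Nice (n + 1) X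
    · simp only [hΓ.special_iff]
      exact exists_cobT_eq hΓ (fun ty => g v e ⟨X, ty⟩)
        (fun ty hty => hg v e _ fun h => hty (hΓ.special_iff.1 h.2)) (fun ty => hgc v e ⟨X, ty⟩)
        (hgp v e X hΓ) _
    · refine ⟨fun _ => 0, fun _ _ => rfl, fun ty => ?_, ?_⟩
      · rw [hg v e _ fun h => hΓ h.1]
        simp [cobT]
      · rw [hc v e X hΓ]
        simp [pair]
  choose f hf1 hf2 hf3 using key
  set φ : ∀ v e, SGraph k v e → K := fun v e G => f v e G.toGraph G.ty with hφ
  exact ⟨avg φ (n + 1), finAlt_avg φ, fun v e G hG => avg_eq φ fun r => by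
      rw [tw, hφ]
      exact (congrArg _ (hf1 v e _ _ fun h => hG ((SGraph.isSpecial_relabel_iff _ _ _).1 h))).trans
        (mul_zero _),
    fun v e G => cob_avg φ hgA fun r => hf2 v e _ _,
    fun v e X => pair_avg φ hcA fun r => hf3 v e _⟩

end

section

open NG

/-! ### Acyclicity of the cone of `h` -/

variable {K : Type u} [Field K] [CharZero K] {k : ℕ} {m n : ℤ}
variable {i j : ℤ} {v e : ℕ} {p : ℕ} {d : ℤ} {X : Graph k v e}

lemma hGraph_eq_zero (h : (v : ℤ) * n + (1 - n) * (e : ℤ) ≠ d) : hGraph K n d X = 0 := by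
  refine sum_eq_zero fun x _ => ?_
  rw [sum_eq_zero, smul_zero]
  intro T hτ
  rw [sgcGen, dif_neg, smul_zero]
  rintro ⟨-, h'⟩
  exact h ((degree_special (mem_filter.1 hτ).2 x).symm.trans h')

lemma sgcD_sgcMk (i j : ℤ) {G : SGraph k v e} (h : G.IsSpecial m ∧ G.degree m = i) : sgcD K k m i j
    (Finsupp.single (sgcMk h) 1) = sgcBdDotted K m j G + sgcBdSolid K m j v e G :=
  sgcD_single i j _

lemma hMap_gcMk (h : X.IsGC ∧ (v : ℤ) * n + (1 - n) * (e : ℤ) = d) : hMap K k n d (Finsupp.single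
    (gcMk h) 1) = hGraph K n d X :=
  hMap_single d _

lemma exists_functional (hij : j + 1 = i) {Lg : (SGCGen k (n + 1) i →₀ K) →ₗ[K] K} (hgr : sgcRel K k
    (n + 1) i ≤ ker Lg) (hgp : ∀ y ∈ sgcLt K k (n + 1) p i, Lg y = 0) (hgd : ∀ y ∈ sgcLt K k (n + 1)
    (p + 1) (i + 1), Lg (sgcD K k (n + 1) (i + 1) i y) = 0) (hgh : ∀ x ∈ gcLt K k n (p + 1) i, Lg
    (hMap K k n i x) = 0) {Lc : (GCGen k n j →₀ K) →ₗ[K] K} (hcr : gcRel K k n j ≤ ker Lc) (hcp : ∀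
    x ∈ gcLt K k n p j, Lc x = 0) : ∃ L : (SGCGen k (n + 1) j →₀ K) →ₗ[K] K, sgcRel K k (n + 1) j ≤
    ker L ∧ (∀ y ∈ sgcLt K k (n + 1) (p + 1) i, L (sgcD K k (n + 1) i j y) = Lg y) ∧ ∀ x ∈ gcLt K k
    n (p + 1) j, L (hMap K k n j x) = Lc x := by
  obtain ⟨g', hA, hns, hcob, hpair⟩ := exists_dual (K := K) (k := k) (n := n)
    (g := fun v e G => if v = p then sgcFun i Lg v e G else 0)
    (c := fun v e X => if v = p then Lc (gcGen K n j X) else 0)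
    (fun v e G σ ρ f => by
      change (if v = p then _ else _) = _ • (if v = p then _ else _)
      split_ifs
      exacts [finAlt_sgcFun hgr v e G σ ρ f, (smul_zero _).symm])
    (fun v e G hG => by
      split_ifs
      swap
      · rfl
      by_cases hs : G.IsSpecial (n + 1)
      · have h1 : ∃ a, G.ends a false = G.ends a true := by
          by_contra! h'
          exact hG ⟨⟨⟨hs.toReduced, h'⟩, hs.no_multiple⟩, hs⟩
        obtain ⟨a, ha⟩ := h1
        refine sgcFun_bad hgr (toNG G) v e G _ _ (lab_toNG G) (.inl (.inl ⟨a, ?_, ?_⟩))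
        · rw [(lab_toNG G).E_eq]; exact mem_map_of_mem _ (mem_univ _)
        · rw [(lab_toNG G).ends_eq, (lab_toNG G).ends_eq, ha]
      · exact sgcFun_of_not hs)
    (fun v e X r => by
      split_ifs
      swap
      · exact mul_zero _
      rw [gcGen_relabel hcr, ← cast_smul_eq_zsmul K, smul_eq_mul, ← mul_assoc, ← cast_mul,
        gcSign_mul_self, Int.cast_one, one_mul])
    (fun v e X hΓ => by
      split_ifs
      exacts [gcGen_eq_zero hcr hΓ, rfl])
    (fun v e G => by
      by_cases hv : v = p
      swap
      · simp [cob, cobT, hv]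
      subst hv
      refine Eq.trans (b := cob (sgcFun i Lg) (n + 1) v e G) (by simp [cob]) ?_
      rw [cob_eq]
      by_cases hG : G.IsSpecial (n + 1) ∧ G.degree (n + 1) = i + 1
      · have h1 := hgd (Finsupp.single (sgcMk hG) 1)
          (single_mem_supported K 1 (Nat.lt_succ_self v))
        rw [sgcD_sgcMk, map_add, hgp _ (sgcBdSolid_mem le_rfl _ _), add_zero] at h1
        exact h1
      · rw [sgcBdDotted_eq_zero hG, map_zero])
    (fun v e X hΓ => by
      by_cases hv : v = p
      swap
      · simp [pair, hv]
      subst hv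
      refine Eq.trans (b := pair n (sgcFun i Lg v e) X) (by simp) ?_
      rw [pair_eq]
      by_cases hd : (v : ℤ) * n + (1 - n) * (e : ℤ) = i
      · rw [← hMap_gcGen K n hΓ.1 hd]
        exact hgh _ (gcGen_mem (Nat.lt_succ_self v) _ _)
      · rw [hGraph_eq_zero hd, map_zero])
  set L : (SGCGen k (n + 1) j →₀ K) →ₗ[K] K := linearCombination K fun a =>
    if a.1.1 = p then g' a.1.1 a.1.2.1 a.1.2.2 else 0 with hL
  have hs : ∀ a, L (Finsupp.single a 1) = if a.1.1 = p then g' a.1.1 a.1.2.1 a.1.2.2 else 0 :=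
    fun a => by rw [hL, linearCombination_single, one_smul]
  have hLG : ∀ v e (G : SGraph k v e), L (sgcGen K (n + 1) j G) =
      if v = p ∧ G.degree (n + 1) = j then g' v e G else 0 := fun v e G => by
    by_cases hG : G.IsSpecial (n + 1) ∧ G.degree (n + 1) = j
    · rw [sgcGen_of hG, hs]
      exact if_congr (and_iff_left hG.2).symm rfl rfl
    · rw [sgcGen, dif_neg hG, map_zero]
      split_ifs with h
      exacts [(hns v e G fun h' => hG ⟨h', h.2⟩).symm, rfl]
  have hLp : ∀ y ∈ sgcLt K k (n + 1) p j, L y = 0 := fun y hy =>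
    eq_of_supported (T' := 0) (fun a ha => (hs a).trans (if_neg (ne_of_lt ha))) hy
  refine ⟨L, span_le.2 ?_, fun y hy => ?_, fun x hx => ?_⟩
  · rintro _ ⟨v, e, G, σ, ρ, f, rfl⟩
    rw [SetLike.mem_coe, mem_ker, map_sub, map_zsmul, hLG, hLG, SGraph.degree_relabel, sub_eq_zero]
    split_ifs
    exacts [hA v e G σ ρ f, (smul_zero _).symm]
  · refine eq_of_supported (T := L ∘ₗ sgcD K k (n + 1) i j) (fun a ha => ?_) hy
    obtain ⟨v, e, G, hG, rfl⟩ : ∃ v e, ∃ G : SGraph k v e,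
        ∃ hG : G.IsSpecial (n + 1) ∧ G.degree (n + 1) = i, a = sgcMk hG :=
      ⟨_, _, _, a.2, rfl⟩
    have hv : v < p + 1 := ha
    rw [LinearMap.comp_apply, sgcD_sgcMk, map_add,  hLp _ (sgcBdSolid_mem (Nat.lt_succ_iff.1 hv) j
      G), add_zero]
    rcases Nat.lt_succ_iff_lt_or_eq.1 hv with hv | rfl
    · rw [hLp _ (sgcBdDotted_mem hv j G), hgp _ (single_mem_supported K 1 hv)]
    · have h1 := hcob v e G
      rw [if_pos rfl, sgcFun, sgcGen_of hG] at h1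
      refine Eq.trans ?_ h1
      rw [← cob_eq, cob, cob, cobT, cobT]
      refine sum_congr rfl fun t _ => ?_
      split_ifs with ht
      · have h2 : ∀ s, sgcFun j L v e (G.makeSolid t s) = g' v e (G.makeSolid t s) := fun s => by
          have h3 := degree_makeSolid (m := n + 1) ht s
          have h4 : G.degree (n + 1) = i := hG.2
          rw [sgcFun, hLG, if_pos ⟨rfl, by omega⟩]
        exact congrArg _ (congrArg₂ (fun a b => a - eps (n + 1) • b) (h2 true) (h2 false))
      · rfl
  · refine eq_of_supported (T := L ∘ₗ hMap K k n j) (fun a ha => ?_) hx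
    obtain ⟨v, e, X, hΓ, rfl⟩ : ∃ v e, ∃ X : Graph k v e,
        ∃ hΓ : X.IsGC ∧ (v : ℤ) * n + (1 - n) * (e : ℤ) = j, a = gcMk hΓ :=
      ⟨_, _, _, a.2, rfl⟩
    have hv : v < p + 1 := ha
    rw [LinearMap.comp_apply, hMap_gcMk]
    rcases Nat.lt_succ_iff_lt_or_eq.1 hv with hv | rfl
    · rw [hLp _ (hGraph_mem hv j X), hcp _ (single_mem_supported K 1 hv)]
    · have h1 := hpair v e X
      rw [if_pos rfl, gcGen_of hΓ] at h1
      refine Eq.trans ?_ h1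
      rw [← pair_eq, pair, pair]
      refine sum_congr rfl fun x _ => congrArg _ (sum_congr rfl fun T hτ => ?_)
      rw [sgcFun, hLG, if_pos ⟨rfl, (degree_special (mem_filter.1 hτ).2 x).trans hΓ.2⟩]

/-- A pair in the cone whose differential vanishes on graphs with `p + 1` vertices. -/
lemma mem_of_cycle (hij : j + 1 = i) {x : GCGen k n j →₀ K} (hx : x ∈ gcLt K k n (p + 1) j) {y :
    SGCGen k (n + 1) i →₀ K} (hy : y ∈ sgcLt K k (n + 1) (p + 1) i) (h : sgcD K k (n + 1) i j y -
    hMap K k n j x ∈ sgcRel K k (n + 1) j) : x ∈ gcLt K k n p j ⊔ gcRel K k n j ∧ y ∈ sgcLt K k (n +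
    1) p i ⊔ sgcRel K k (n + 1) i ⊔ ((gcLt K k n (p + 1) i).map (hMap K k n i) ⊔ (sgcLt K k (n + 1)
    (p + 1) (i + 1)).map (sgcD K k (n + 1) (i + 1) i)) := by
  constructor
  · by_contra hx'
    obtain ⟨Lc, h1, h2⟩ := Submodule.exists_le_ker_of_notMem hx'
    obtain ⟨L, hr, hd, hh⟩ := exists_functional hij (p := p) (n := n) (k := k) (Lg := 0)
      (fun _ _ => rfl) (fun _ _ => rfl) (fun _ _ => rfl) (fun _ _ => rfl)
      (le_sup_right.trans h2) (fun x hx => h2 (mem_sup_left hx))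
    have h3 : L (_ - _) = 0 := hr h
    simp_all
  · by_contra hy'
    obtain ⟨Lg, h1, h2⟩ := Submodule.exists_le_ker_of_notMem hy'
    obtain ⟨L, hr, hd, hh⟩ := exists_functional hij (p := p) (n := n) (k := k) (Lc := 0) (Lg := Lg)
      ((le_sup_right.trans le_sup_left).trans h2)
      (fun y hy => h2 (mem_sup_left (mem_sup_left hy)))
      (fun y hy => h2 (mem_sup_right (mem_sup_right ⟨y, hy, rfl⟩)))
      (fun x hx => h2 (mem_sup_right (mem_sup_left ⟨x, hx, rfl⟩)))
      (fun _ _ => rfl) (fun _ _ => rfl)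
    have h3 : L (_ - _) = 0 := hr h
    rw [map_sub, hd y hy, hh x hx, LinearMap.zero_apply, sub_zero] at h3
    exact h1 h3

/-- The cone of `h` is acyclic. -/
lemma exists_cone_boundary (hij : j + 1 = i) (p : ℕ) : ∀ x ∈ gcLt K k n p j, ∀ y ∈ sgcLt K k (n + 1)
    p i, sgcD K k (n + 1) i j y - hMap K k n j x ∈ sgcRel K k (n + 1) j → ∃ x' y', x - gcD K k n i j
    x' ∈ gcRel K k n j ∧ y - hMap K k n i x' - sgcD K k (n + 1) (i + 1) i y' ∈ sgcRel K k (n + 1) i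
    := by
  induction p with
  | zero =>
    intro x hx y hy _
    have hx0 : x = 0 := by simpa [gcLt] using hx
    have hy0 : y = 0 := by simpa [sgcLt] using hy
    exact ⟨0, 0, by simp [hx0], by simp [hy0]⟩
  | succ p ih =>
    intro x hx y hy h
    obtain ⟨h1, h2⟩ := mem_of_cycle hij hx hy h
    obtain ⟨x₀, hx₀, r, hr, rfl⟩ := mem_sup.1 h1
    obtain ⟨u, hu, w, hw, rfl⟩ := mem_sup.1 h2
    obtain ⟨y₀, hy₀, s, hs, rfl⟩ := mem_sup.1 hu
    obtain ⟨_, ⟨x₁, hx₁, rfl⟩, _, ⟨y₁, -, rfl⟩, rfl⟩ := mem_sup.1 hw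
    obtain ⟨x', y', h3, h4⟩ := ih (x₀ - gcD K k n i j x₁) (sub_mem hx₀ (gcD_mem hx₁)) y₀ hy₀ (by
      have e1 : sgcD K k (n + 1) i j s ∈ sgcRel K k (n + 1) j := sgc_bd_rel i j hs
      have e2 : hMap K k n j r ∈ sgcRel K k (n + 1) j := hMap_map_rel j hr
      have e3 := hMap_map_bd hij x₁
      have e4 := sgc_bd_bd (l := j) (m := n + 1) (i := i + 1) (j := i) rfl y₁
      have := add_mem (sub_mem (sub_mem (sub_mem h e1) e4) e3) e2
      simp only [map_add, map_sub] at this ⊢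
      convert this using 1
      abel)
    refine ⟨x₁ + x', y₁ + y', ?_, ?_⟩
    · have := add_mem h3 hr
      rw [map_add]
      convert this using 1
      abel
    · have := add_mem h4 hs
      rw [map_add, map_add]
      convert this using 1
      abel

lemma exists_cone_boundary' (hij : j + 1 = i) (x : GCGen k n j →₀ K) (y : SGCGen k (n + 1) i →₀ K)
    (h : sgcD K k (n + 1) i j y - hMap K k n j x ∈ sgcRel K k (n + 1) j) : ∃ x' y', x - gcD K k n i
    j x' ∈ gcRel K k n j ∧ y - hMap K k n i x' - sgcD K k (n + 1) (i + 1) i y' ∈ sgcRel K k (n + 1)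
    i := by
  obtain ⟨p, hp⟩ := exists_mem_supported (fun a : GCGen k n j => a.1.1) x
  obtain ⟨q, hq⟩ := exists_mem_supported (fun a : SGCGen k (n + 1) i => a.1.1) y
  exact exists_cone_boundary hij (max p q) x
    (Finsupp.supported_mono (fun a ha => lt_of_lt_of_le ha (le_max_left p q)) hp) y
    (Finsupp.supported_mono (fun a ha => lt_of_lt_of_le ha (le_max_right p q)) hq) h

end

section

open NG

variable {K : Type u} [Field K]

lemma Presentation.d_mk {P : Presentation K} (hP : P.IsComplex) {i j : ℤ} (hij : j + 1 = i) (x :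
    P.Gen i →₀ K) : (P.toComplex hP).d i j (Submodule.Quotient.mk x : (P.Gen i →₀ K) ⧸ P.rel i) =
    (Submodule.Quotient.mk (P.bd i j x) : (P.Gen j →₀ K) ⧸ P.rel j) := by
  simp only [toComplex, dif_pos hij]
  rfl

variable (K) [CharZero K] (k : ℕ) (n : ℤ)

lemma quasiIso_h : QuasiIso (Presentation.toHom (isComplex_GC K k n) (isComplex_SGC K k (n + 1))
    (isChainMap_h K k n)) := by
  refine ⟨fun i => ?_⟩
  rw [quasiIsoAt_iff' _ (i + 1) i (i - 1) (by simp) (by simp)]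
  have hi : i - 1 + 1 = i := by omega
  refine quasiIso_of_elements _ (fun z hz w hw => ?_) (fun y hy => ?_)
  · obtain ⟨x, rfl⟩ := mkQ_surjective _ z
    obtain ⟨y, rfl⟩ := mkQ_surjective _ w
    have h1 := hw.trans (Presentation.d_mk (isComplex_SGC K k (n + 1)) rfl y)
    obtain ⟨x', y', h2, -⟩ := exists_cone_boundary' (i := i + 1) rfl x y
      ((Submodule.Quotient.eq _).1 h1.symm)
    refine ⟨Submodule.Quotient.mk x', (Presentation.d_mk (isComplex_GC K k n) rfl x').trans ?_⟩
    exact ((Submodule.Quotient.eq _).2 h2).symm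
  · obtain ⟨y, rfl⟩ := mkQ_surjective _ y
    have h1 := (Presentation.d_mk (isComplex_SGC K k (n + 1)) hi y).symm.trans hy
    obtain ⟨x', y', h2, h3⟩ := exists_cone_boundary' hi (0 : GCGen k n (i - 1) →₀ K) y (by
      rw [map_zero, sub_zero]
      exact (mk_eq_zero _).1 h1)
    refine ⟨Submodule.Quotient.mk x', Submodule.Quotient.mk y', (Presentation.d_mk (isComplex_GC K k
      n) hi x').trans ((mk_eq_zero _).2 ?_), ?_⟩
    · aesop
    · refine Eq.trans ?_ (congrArg _ (Presentation.d_mk (isComplex_SGC K k (n + 1)) rfl y').symm)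
      refine (Submodule.Quotient.eq _).2 ?_
      rw [← sub_sub]
      exact h3

end

end

end OrientedGC

theorem mainTheorem3 (K : Type u) [Field K] [CharZero K] (k : ℕ) (n : ℤ) :
    ∃ (hC : (OrientedGC.GC K k n).IsComplex) (hD : (OrientedGC.SGC K k (n + 1)).IsComplex)
      (hh : OrientedGC.Presentation.IsChainMap (OrientedGC.GC K k n)
        (OrientedGC.SGC K k (n + 1)) (OrientedGC.h K k n)),
      QuasiIso (OrientedGC.Presentation.toHom hC hD hh) :=
  ⟨OrientedGC.isComplex_GC K k n, OrientedGC.isComplex_SGC K k (n + 1),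
    OrientedGC.isChainMap_h K k n, OrientedGC.quasiIso_h K k n⟩
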